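/- Let $k$ be a field of characteristic $0$, $K$ a finite-dimensional semisimple $k$-algebra, and $\mathcal P=\mathcal P(K,E,R)$ a quadratic $k$-linear operad: $\mathcal P(1)=K$; $E=\mathcal P(2)$ is a finite-dimensional $(K,K\otimes_k K)$-bimodule with a compatible action of $\Sigma_2$; and $\mathcal P=F(E)/(R)$ is the quotient of the free operad $F(E)$ by the ideal generated by a $\Sigma_3$-stable $(K,K^{\otimes 3})$-sub-bimodule $R\subset F(E)(3)=\mathrm{Ind}_{\Sigma_2}^{\Sigma_3}(E\otimes_K E)$. Let $\mathcal P^!=\mathcal P(K^{op},E^\vee,R^\perp)$ be its quadratic dual, where $E^\vee=\mathrm{Hom}_K(E,K)$ with the transposed action of $\Sigma_2$ twisted by sign. Let $\mathbf D(\mathcal P)$ be the dual dg operad. For $n\ge 2$ the complex $\mathbf D(\mathcal P)(n)$ has in degree $-j$ the space $\bigoplus_T \mathcal P(T)^\vee\otimes\mathrm{Det}(T)$, summed over the isomorphism classes of reduced $n$-trees $T$ (every vertex has at least two inputs) with $n-2-j$ internal edges. Here $\mathcal P(T)$ is the tensor product over $K$, along $T$, of the spaces $\mathcal P(\mathrm{In}(v))$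 for the vertices $v$ of $T$, $\mathcal P(T)^\vee=\mathrm{Hom}_K(\mathcal P(T),K)$, and $\mathrm{Det}(T)$ is the top exterior power of the $k$-space spanned by the edges of $T$ other than the output edge. The differential is the sum, over the internal edges $e$, of the transposes of the compositions $\mathcal P(T)\to\mathcal P(T/e)$, tensored with $e\wedge(-)\colon\mathrm{Det}(T/e)\to\mathrm{Det}(T)$. The degree-$0$ part is $F(E^\vee)(n)$, and the canonical morphism $\gamma_{\mathcal P}\colon\mathbf D(\mathcal P)\to\mathcal P^!$ is the projection $F(E^\vee)(n)\to\mathcal P^!(n)$ in degree $0$ and zero in the other degrees. The operad $\mathcal P$ is called *Koszul* if $\gamma_{\mathcal P}$ is a quasi-isomorphism, i.e. if for every $n$ it induces an isomorphism on the cohomology of the complexes $\mathbf D(\mathcal P)(n)\to\mathcal P^!(n)$ (for $n=1$ it is the identity of $K^{op}$). The $n$-th *Koszul complex* $\mathcal P((\mathcal P^!)^\vee)(n)$ has the terms $$\mathcal P((\mathcal P^!)^\vee)(n)^m=\bigoplus_{f\colon[n]\to[m]}\Bigl[\mathcal P(m)\otimes_{K^{\otimes m}}\bigotimes_{i=1}^m\mathcal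 P^!(f^{-1}(i))^\vee\Bigr]_{\Sigma_m}$$ ($f$ runs over the surjections, and $(\,\cdot\,)_{\Sigma_m}$ denotes the coinvariants of the sum), where $\mathcal P^!(b)^\vee=\mathrm{Hom}_{K^{op}}(\mathcal P^!(b),K^{op})$ and $\Sigma_m$ permutes these factors with the Koszul sign rule, $\mathcal P^!(b)^\vee$ being twisted by sign and having degree $|b|-1$. Write $\mathrm{Id}_E=\sum_i X_i\otimes\Xi_i$ with $X_i\in E$, $\Xi_i\in E^\vee$. The differential $d$, from the $m$-th to the $(m+1)$-st term, is the sum, over the ways to split one of the $m$ blocks into two, and over $i$, of the composition with $X_i$ in $\mathcal P$ tensored with the transpose of the composition with $\Xi_i$ in $\mathcal P^!$, with the same sign rule. Then the following conditions are equivalent: (i) $\mathcal P$ is Koszul; (ii) the Koszul complexes $\mathcal P((\mathcal P^!)^\vee)(n)$ are exact for all $n\ge 2$. -/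

import Mathlib

open scoped TensorProduct
open MulOpposite (op unop op_add op_smul)

noncomputable section

namespace QuadOp

universe u v w

section Data

variable (k : Type u) (K : Type v) [Field k] [Ring K] [Algebra k K]

/-- The data presenting a quadratic operad P(K, E, R), where P(1) = K.
The space `E = P(2)` of binary operations is a left K-module (action on the output) with two
commuting right K-actions `r₁`, `r₂` (actions on the two inputs) and the transposition `σ`, which is
left K-linear and exchanges `r₁` and `r₂`.
The space of ternary operations of the free operad on E is the Σ₃-module induced from
E ⊗_K E, that is, three copies of E ⊗_K E: for i in ℤ/3 the element e ⊗ e' in the i-th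
copy is the composite `e(e'(x_{i+1}, x_{i+2}), x_i)`, so that e ⊗ e' is balanced via the first
input of e. A Σ₃-stable K-submodule of it is given here by its full inverse
image `R` in (E ⊗_k E)³. -/
structure QuadraticData where
  E : Type w
  [addCommGroup : AddCommGroup E]
  [moduleBase : Module k E]
  [module : Module K E]
  [tower : IsScalarTower k K E]
  /-- The right action on the first input. -/
  r₁ : Kᵐᵒᵖ →ₐ[k] Module.End K E
  /-- The right action on the second input. -/
  r₂ : Kᵐᵒᵖ →ₐ[k] Module.End K E
  r_comm : ∀ a b e, r₁ a (r₂ b e) = r₂ b (r₁ a e)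
  /-- The transposition of the two inputs. -/
  σ : E →ₗ[K] E
  σ_σ : ∀ e, σ (σ e) = e
  σ_r₁ : ∀ a e, σ (r₁ a e) = r₂ a (σ e)
  /-- The space of quadratic relations, as a subspace of (E ⊗_k E)³. -/
  R : Submodule k (Fin 3 → E ⊗[k] E)
  /-- `R` contains the relations that define E ⊗_K E as a quotient of E ⊗_k E. -/
  R_bal : ∀ (i : Fin 3) (a : K) (e e' : E),
    Pi.single i (r₁ (op a) e ⊗ₜ[k] e' - e ⊗ₜ[k] (a • e')) ∈ R
  /-- `R` is stable under the left action of K on the output. -/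
  R_left : ∀ (a : K), ∀ r ∈ R,
    (fun i => (DistribSMul.toLinearMap k E a).rTensor E (r i)) ∈ R
  /-- `R` is stable under the three right actions of K on the inputs: in the i-th copy the
input x_i is the second input of the outer operation, and x_{i+1}, x_{i+2} are the two inputs of the
inner operation. -/
  R_right : ∀ (a : Kᵐᵒᵖ) (j : Fin 3), ∀ r ∈ R,
    (fun i =>
      if j = i then ((r₂ a).restrictScalars k).rTensor E (r i)
      else if j = i + 1 then ((r₁ a).restrictScalars k).lTensor E (r i)
      else ((r₂ a).restrictScalars k).lTensor E (r i)) ∈ R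
  /-- `R` is stable under Σ₃: a permutation of {x_0, x_1, x_2} permutes the copies, and an odd one
also interchanges the two inputs of the inner operation. -/
  R_perm : ∀ (s : Equiv.Perm (Fin 3)), ∀ r ∈ R,
    (fun i => if Equiv.Perm.sign s = 1 then r (s⁻¹ i)
      else (σ.restrictScalars k).lTensor E (r (s⁻¹ i))) ∈ R

end Data

attribute [instance] QuadraticData.addCommGroup QuadraticData.moduleBase
  QuadraticData.module QuadraticData.tower

namespace QuadraticData

variable {k : Type u} {K : Type v} [Field k] [Ring K] [Algebra k K]
variable (Q : QuadraticData.{u, v, w} k K)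

theorem σ_r₂ (a : Kᵐᵒᵖ) (e : Q.E) : Q.σ (Q.r₂ a e) = Q.r₁ a (Q.σ e) := by
  have h := Q.σ_r₁ a (Q.σ e)
  rw [Q.σ_σ] at h
  rw [← h, Q.σ_σ]

/-- The dual E^∨ = Hom_K(E, K), a left module over the opposite ring K^op. -/
abbrev EDual : Type (max w v) := Q.E →ₗ[K] K

/-- The right action of K^op on E^∨ that is dual to a right action of K on E. -/
def rDual (r : Kᵐᵒᵖ →ₐ[k] Module.End K Q.E) :
    (Kᵐᵒᵖ)ᵐᵒᵖ →ₐ[k] Module.End Kᵐᵒᵖ Q.EDual where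
  toFun a :=
    { toFun := fun φ => φ ∘ₗ r (unop a)
      map_add' := fun _ _ => rfl
      map_smul' := fun _ _ => rfl }
  map_one' := by ext; simp
  map_mul' a b := by ext; simp
  map_zero' := by ext; simp
  map_add' a b := by ext; simp
  commutes' c := by
    ext φ e
    simp [Algebra.algebraMap_eq_smul_one]

/-- The transposition of E^∨: the transpose of `σ`, twisted by the sign character of Σ₂. -/
def σDual : Q.EDual →ₗ[Kᵐᵒᵖ] Q.EDual where
  toFun φ := -(φ ∘ₗ Q.σ)
  map_add' φ ψ := by ext; simp; abel
  map_smul' a φ := by ext; simp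

/-- The functional on E ⊗ E defined by φ ⊗ ψ in E^∨ ⊗ E^∨. -/
def pairAux (φ ψ : Q.EDual) : Q.E ⊗[k] Q.E →ₗ[k] K :=
  TensorProduct.lift <| LinearMap.mk₂ k (fun e e' => φ (Q.r₁ (op (ψ e')) e))
    (by intros; simp) (by intro c m n; rw [LinearMap.map_smul_of_tower, LinearMap.map_smul_of_tower])
    (by intros; simp) (by intros; simp [LinearMap.map_smul_of_tower])

/-- The pairing of E^∨ ⊗ E^∨ with E ⊗ E given by ⟨φ ⊗ ψ, e ⊗ e'⟩ = φ(e · ψ(e')). -/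
def pairing : Q.EDual ⊗[k] Q.EDual →ₗ[k] Q.E ⊗[k] Q.E →ₗ[k] K :=
  TensorProduct.lift <| LinearMap.mk₂ k Q.pairAux
    (by intros; ext; simp [pairAux]) (by intros; ext; simp [pairAux])
    (by intros; ext; simp [pairAux]) (by intros; ext; simp [pairAux])

@[simp] theorem pairing_tmul (φ ψ : Q.EDual) (e e' : Q.E) :
    Q.pairing (φ ⊗ₜ ψ) (e ⊗ₜ e') = φ (Q.r₁ (op (ψ e')) e) := rfl

/-- The orthogonal complement of R. An odd permutation acts on the three copies of E^∨ ⊗ E^∨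
through `σDual`, which has the sign twist, so this copywise pairing identifies
the ternary part of the free operad on E^∨ with the sign-twisted dual of that of the free
operad on E. -/
def RPerp : Submodule k (Fin 3 → Q.EDual ⊗[k] Q.EDual) where
  carrier := {x | ∀ r ∈ Q.R, ∑ i, Q.pairing (x i) (r i) = 0}
  add_mem' hx hy r hr := by
    simp [Finset.sum_add_distrib, hx r hr, hy r hr]
  zero_mem' r _ := by simp
  smul_mem' c x hx r hr := by
    simp [← Finset.smul_sum, hx r hr]

theorem pairing_lTensor (f : Q.EDual →ₗ[k] Q.EDual) (g : Q.E →ₗ[k] Q.E)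
    (h : ∀ φ e, f φ e = φ (g e)) (x y) :
    Q.pairing (f.lTensor _ x) y = Q.pairing x (g.lTensor _ y) := by
  induction x with
  | zero => simp
  | add x x' hx hx' => simp [hx, hx']
  | tmul φ ψ =>
    induction y with
    | zero => simp
    | add y y' hy hy' => rw [map_add, hy, hy', map_add, map_add]
    | tmul e e' => simp [h]

theorem pairing_rTensor (f : Q.EDual →ₗ[k] Q.EDual) (g : Q.E →ₗ[k] Q.E)
    (h : ∀ φ e, f φ e = φ (g e)) (hg : ∀ a e, g (Q.r₁ a e) = Q.r₁ a (g e)) (x y) :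
    Q.pairing (f.rTensor _ x) y = Q.pairing x (g.rTensor _ y) := by
  induction x with
  | zero => simp
  | add x x' hx hx' => simp [hx, hx']
  | tmul φ ψ =>
    induction y with
    | zero => simp
    | add y y' hy hy' => rw [map_add, hy, hy', map_add, map_add]
    | tmul e e' => simp [h, hg]

/-- The quadratic dual P^! = P(K^op, E^∨, R^⊥), with E^∨ twisted by the sign character. -/
def dual : QuadraticData.{u, v, max w v} k Kᵐᵒᵖ where
  E := Q.EDual
  r₁ := Q.rDual Q.r₁
  r₂ := Q.rDual Q.r₂
  r_comm a b φ := by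
    ext e
    simp [rDual, Q.r_comm]
  σ := Q.σDual
  σ_σ φ := by ext e; simp [σDual, Q.σ_σ]
  σ_r₁ a φ := by ext e; simp [σDual, rDual, Q.σ_r₂]
  R := Q.RPerp
  R_bal i a φ ψ := by
    intro r _
    rw [Finset.sum_eq_single i (fun j _ hj => by simp [Pi.single_eq_of_ne hj]) (by simp)]
    rw [Pi.single_eq_same]
    generalize r i = y
    induction y with
    | zero => simp
    | add y y' hy hy' => rw [map_add, hy, hy', add_zero]
    | tmul e e' => simp [rDual, ← Module.End.mul_apply, ← map_mul]
  R_left a x hx := by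
    intro r hr
    have key : ∀ x y, Q.pairing ((DistribSMul.toLinearMap k Q.EDual a).rTensor _ x) y
        = Q.pairing x y * unop a := by
      intro x y
      induction x with
      | zero => simp
      | add x x' hx hx' => simp only [map_add, LinearMap.add_apply, hx, hx', add_mul]
      | tmul φ ψ =>
        induction y with
        | zero => simp
        | add y y' hy hy' => rw [map_add, hy, hy', map_add, add_mul]
        | tmul e e' => simp
    simp only [key, ← Finset.sum_mul, hx r hr, zero_mul]
  R_right a j x hx := by
    intro r hr
    rw [← hx _ (Q.R_right (unop a) j r hr)]
    refine Finset.sum_congr rfl fun i _ => ?_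
    dsimp only
    split_ifs
    · exact Q.pairing_rTensor ((Q.rDual Q.r₂ a).restrictScalars k) ((Q.r₂ (unop a)).restrictScalars k) (fun _ _ => rfl)
        (fun b e => (Q.r_comm b _ e).symm) _ _
    · exact Q.pairing_lTensor ((Q.rDual Q.r₁ a).restrictScalars k) ((Q.r₁ (unop a)).restrictScalars k) (fun _ _ => rfl) _ _
    · exact Q.pairing_lTensor ((Q.rDual Q.r₂ a).restrictScalars k) ((Q.r₂ (unop a)).restrictScalars k) (fun _ _ => rfl) _ _
  R_perm s x hx := by
    intro r hr
    have h := hx _ (Q.R_perm s⁻¹ r hr)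
    rw [← Equiv.sum_comp s]
    by_cases hs : Equiv.Perm.sign s = 1
    · simpa [hs] using h
    · simp only [Equiv.Perm.sign_inv, hs, if_false, inv_inv] at h
      simp only [hs, if_false]
      rw [← neg_eq_zero, ← h, ← Finset.sum_neg_distrib]
      refine Finset.sum_congr rfl fun i _ => ?_
      rw [Q.pairing_lTensor _ (-(Q.σ.restrictScalars k))
        (fun φ e => by simp [σDual]), LinearMap.lTensor_neg, LinearMap.neg_apply, map_neg, neg_neg,
        show s⁻¹ (s i) = i from s.symm_apply_apply i]

/-- Binary planar trees whose leaves carry a label in α and a scalar in K and whose vertices carry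
an element of E. -/
inductive PTree (K : Type*) (E : Type*) (α : Type*)
  | leaf (a : α) (c : K) : PTree K E α
  | node (e : E) (s t : PTree K E α) : PTree K E α

namespace PTree

variable {K' E' α β : Type*}

/-- The left action of K, at the root. -/
def lact [Mul K'] [SMul K' E'] (c : K') : PTree K' E' α → PTree K' E' α
  | leaf a d => leaf a (c * d)
  | node e s t => node (c • e) s t

/-- The multiset of the labels of the leaves. -/
def leaves : PTree K' E' α → Multiset α
  | leaf a _ => {a}
  | node _ s t => s.leaves + t.leaves

theorem leaves_lact [Mul K'] [SMul K' E'] (c : K') (t : PTree K' E' α) :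
    (t.lact c).leaves = t.leaves := by
  cases t <;> rfl

theorem lact_node [Mul K'] [SMul K' E'] (c : K') (e : E') (s t : PTree K' E' α) :
    (node e s t).lact c = node (c • e) s t := rfl

end PTree

variable (α : Type*)

/-- The defining relations of the free algebra over P(K, E, R) on the generators α: k-linearity,
K-balancedness and symmetry of each operation, the quadratic relations R applied to any three
elements, and all consequences of these inside a larger tree. -/
inductive Rel : (PTree K Q.E α →₀ k) → Prop
  | leaf_add (a : α) (c d : K) :
      Rel (.single (.leaf a (c + d)) 1 - .single (.leaf a c) 1 - .single (.leaf a d) 1)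
  | leaf_smul (a : α) (x : k) (c : K) :
      Rel (.single (.leaf a (x • c)) 1 - .single (.leaf a c) x)
  | node_add (e f : Q.E) (s t : PTree K Q.E α) :
      Rel (.single (.node (e + f) s t) 1 - .single (.node e s t) 1 - .single (.node f s t) 1)
  | node_smul (x : k) (e : Q.E) (s t : PTree K Q.E α) :
      Rel (.single (.node (x • e) s t) 1 - .single (.node e s t) x)
  | balance₁ (a : K) (e : Q.E) (s t : PTree K Q.E α) :
      Rel (.single (.node (Q.r₁ (op a) e) s t) 1 - .single (.node e (s.lact a) t) 1)
  | balance₂ (a : K) (e : Q.E) (s t : PTree K Q.E α) :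
      Rel (.single (.node (Q.r₂ (op a) e) s t) 1 - .single (.node e s (t.lact a)) 1)
  | symm (e : Q.E) (s t : PTree K Q.E α) :
      Rel (.single (.node (Q.σ e) s t) 1 - .single (.node e t s) 1)
  | quad (l : Fin 3 → List (Q.E × Q.E))
      (hl : (fun i => ((l i).map fun p => p.1 ⊗ₜ[k] p.2).sum) ∈ Q.R)
      (t : Fin 3 → PTree K Q.E α) :
      Rel (∑ i, ((l i).map fun p =>
        Finsupp.single (.node p.1 (.node p.2 (t (i + 1)) (t (i + 2))) (t i)) 1).sum)
  | left (e : Q.E) (t : PTree K Q.E α) (x) : Rel x → Rel (x.mapDomain fun s => .node e s t)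
  | right (e : Q.E) (s : PTree K Q.E α) (x) : Rel x → Rel (x.mapDomain fun t => .node e s t)

/-- The free algebra over the operad P(K, E, R) on generators indexed by α: linear
combinations of trees modulo the relations. -/
def Alg : Type _ := (PTree K Q.E α →₀ k) ⧸ Submodule.span k {x | Q.Rel α x}

instance : AddCommGroup (Q.Alg α) :=
  inferInstanceAs (AddCommGroup ((PTree K Q.E α →₀ k) ⧸ Submodule.span k {x | Q.Rel α x}))

instance : Module k (Q.Alg α) :=
  inferInstanceAs (Module k ((PTree K Q.E α →₀ k) ⧸ Submodule.span k {x | Q.Rel α x}))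

variable {α} {β : Type*}

/-- The class of a linear combination of trees. -/
def clsₗ : (PTree K Q.E α →₀ k) →ₗ[k] Q.Alg α :=
  Submodule.mkQ (Submodule.span k {x | Q.Rel α x})

/-- The class of a tree. -/
def cls (t : PTree K Q.E α) : Q.Alg α := Q.clsₗ (.single t 1)

variable {Q} in
theorem clsₗ_rel {x : PTree K Q.E α →₀ k} (hx : Q.Rel α x) : Q.clsₗ x = 0 :=
  (Submodule.Quotient.mk_eq_zero _).2 (Submodule.subset_span hx)

theorem clsₗ_single (t : PTree K Q.E α) (c : k) : Q.clsₗ (.single t c) = c • Q.cls t := by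
  rw [cls, ← map_smul, Finsupp.smul_single, smul_eq_mul, mul_one]

/-- A linear map out of the free algebra, from its values on trees. -/
def liftₗ {M : Type*} [AddCommGroup M] [Module k M] (f : PTree K Q.E α → M)
    (hf : ∀ x, Q.Rel α x → Finsupp.linearCombination k f x = 0) : Q.Alg α →ₗ[k] M :=
  Submodule.liftQ _ (Finsupp.linearCombination k f) (Submodule.span_le.2 hf)

theorem liftₗ_cls {M : Type*} [AddCommGroup M] [Module k M] (f : PTree K Q.E α → M)
    (hf : ∀ x, Q.Rel α x → Finsupp.linearCombination k f x = 0) (t) :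
    Q.liftₗ f hf (Q.cls t) = f t := by
  change Finsupp.linearCombination k f (.single t 1) = _
  simp

theorem hom_ext {M : Type*} [AddCommGroup M] [Module k M] {f g : Q.Alg α →ₗ[k] M}
    (h : ∀ t, f (Q.cls t) = g (Q.cls t)) : f = g := by
  refine Submodule.linearMap_qext _ (Finsupp.lhom_ext' fun t => LinearMap.ext_ring (h t))

theorem linearCombination_mapDomain (f : PTree K Q.E α → PTree K Q.E β) (x : PTree K Q.E α →₀ k) :
    Finsupp.linearCombination k (fun t => Q.cls (f t)) x = Q.clsₗ (x.mapDomain f) := by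
  induction x using Finsupp.induction_linear with
  | zero => simp
  | add x y hx hy => rw [map_add, hx, hy, Finsupp.mapDomain_add, map_add]
  | single t c => simp [clsₗ_single]

/-- The operation e with a fixed tree as its second argument. -/
def nodeLeft (e : Q.E) (t : PTree K Q.E α) : Q.Alg α →ₗ[k] Q.Alg α :=
  Q.liftₗ (fun s => Q.cls (.node e s t)) fun x hx => by
    rw [linearCombination_mapDomain]
    exact clsₗ_rel (.left e t x hx)

/-- The binary operation e on the free algebra. -/
def node (e : Q.E) : Q.Alg α →ₗ[k] Q.Alg α →ₗ[k] Q.Alg α :=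
  (Q.liftₗ (fun t => Q.nodeLeft e t) fun x hx => Q.hom_ext fun s => by
    have h : ∀ y, Finsupp.linearCombination k (fun t => Q.nodeLeft e t) y (Q.cls s)
        = Finsupp.linearCombination k (fun t => Q.cls (.node e s t)) y := by
      intro y
      induction y using Finsupp.induction_linear with
      | zero => simp
      | add x y hx hy => simp only [map_add, LinearMap.add_apply, hx, hy]
      | single t c => simp [nodeLeft, liftₗ_cls]
    rw [h, linearCombination_mapDomain, clsₗ_rel (.right e s x hx), LinearMap.zero_apply]).flip

theorem node_cls (e : Q.E) (s t : PTree K Q.E α) :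
    Q.node e (Q.cls s) (Q.cls t) = Q.cls (.node e s t) := by
  simp [node, liftₗ_cls, nodeLeft]

/-- A generator. -/
def var (a : α) : Q.Alg α := Q.cls (.leaf a 1)

theorem cls_sub_eq {x y : PTree K Q.E α →₀ k} (h : Q.Rel α (x - y)) : Q.clsₗ x = Q.clsₗ y := by
  rw [← sub_eq_zero, ← map_sub]; exact clsₗ_rel h

theorem cls_leaf_add (a : α) (c d : K) :
    Q.cls (.leaf a (c + d)) = Q.cls (.leaf a c) + Q.cls (.leaf a d) := by
  have := clsₗ_rel (Rel.leaf_add (Q := Q) a c d)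
  rw [map_sub, map_sub, sub_sub, sub_eq_zero] at this
  exact this

theorem cls_leaf_smul (a : α) (x : k) (c : K) :
    Q.cls (.leaf a (x • c)) = x • Q.cls (.leaf a c) := by
  have := Q.cls_sub_eq (Rel.leaf_smul (Q := Q) a x c)
  simpa [clsₗ_single] using this

theorem cls_node_add (e f : Q.E) (s t : PTree K Q.E α) :
    Q.cls (.node (e + f) s t) = Q.cls (.node e s t) + Q.cls (.node f s t) := by
  have := clsₗ_rel (Rel.node_add (Q := Q) e f s t)
  rw [map_sub, map_sub, sub_sub, sub_eq_zero] at this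
  exact this

theorem cls_node_smul (x : k) (e : Q.E) (s t : PTree K Q.E α) :
    Q.cls (.node (x • e) s t) = x • Q.cls (.node e s t) := by
  have := Q.cls_sub_eq (Rel.node_smul (Q := Q) x e s t)
  simpa [clsₗ_single] using this

theorem cls_balance₁ (a : K) (e : Q.E) (s t : PTree K Q.E α) :
    Q.cls (.node (Q.r₁ (op a) e) s t) = Q.cls (.node e (s.lact a) t) :=
  Q.cls_sub_eq (Rel.balance₁ (Q := Q) a e s t)

theorem cls_balance₂ (a : K) (e : Q.E) (s t : PTree K Q.E α) :
    Q.cls (.node (Q.r₂ (op a) e) s t) = Q.cls (.node e s (t.lact a)) :=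
  Q.cls_sub_eq (Rel.balance₂ (Q := Q) a e s t)

theorem cls_symm (e : Q.E) (s t : PTree K Q.E α) :
    Q.cls (.node (Q.σ e) s t) = Q.cls (.node e t s) :=
  Q.cls_sub_eq (Rel.symm (Q := Q) e s t)

theorem clsₗ_list_sum {ι : Type*} (l : List ι) (f : ι → PTree K Q.E α) :
    Q.clsₗ (l.map fun p => Finsupp.single (f p) 1).sum = (l.map fun p => Q.cls (f p)).sum := by
  rw [map_list_sum, List.map_map]; rfl

theorem linearCombination_list_sum {M : Type*} [AddCommGroup M] [Module k M]
    {ι : Type*} (l : List ι) (f : ι → PTree K Q.E α) (g : PTree K Q.E α → M) :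
    Finsupp.linearCombination k g (l.map fun p => Finsupp.single (f p) 1).sum
      = (l.map fun p => g (f p)).sum := by
  rw [map_list_sum, List.map_map]
  congr 1
  refine List.map_congr_left fun p _ => ?_
  simp

theorem cls_quad (l : Fin 3 → List (Q.E × Q.E))
    (hl : (fun i => ((l i).map fun p => p.1 ⊗ₜ[k] p.2).sum) ∈ Q.R)
    (t : Fin 3 → PTree K Q.E α) :
    ∑ i, ((l i).map fun p =>
      Q.cls (.node p.1 (.node p.2 (t (i + 1)) (t (i + 2))) (t i))).sum = 0 := by
  have := clsₗ_rel (Rel.quad (Q := Q) l hl t)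
  simpa only [map_sum, clsₗ_list_sum] using this

theorem rTensor_list (a : K) (l : List (Q.E × Q.E)) :
    (DistribSMul.toLinearMap k Q.E a).rTensor Q.E (l.map fun p => p.1 ⊗ₜ[k] p.2).sum
      = ((l.map fun p => (a • p.1, p.2)).map fun p => p.1 ⊗ₜ[k] p.2).sum := by
  rw [map_list_sum, List.map_map, List.map_map]
  rfl

/-- The left action of K = P(1) on the output. -/
def lact (a : K) : Q.Alg α →ₗ[k] Q.Alg α :=
  Q.liftₗ (fun t => Q.cls (t.lact a)) fun x hx => by
    cases hx with
    | leaf_add b c d => simp [PTree.lact, mul_add, cls_leaf_add]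
    | leaf_smul b x c => simp [PTree.lact, cls_leaf_smul]
    | node_add e f s t => simp [PTree.lact, cls_node_add]
    | node_smul x e s t =>
      simp [PTree.lact, smul_comm a x e, cls_node_smul]
    | balance₁ b e s t =>
      simp only [map_sub, Finsupp.linearCombination_single, one_smul, PTree.lact_node, ← map_smul,
        cls_balance₁, sub_self]
    | balance₂ b e s t =>
      simp only [map_sub, Finsupp.linearCombination_single, one_smul, PTree.lact_node, ← map_smul,
        cls_balance₂, sub_self]
    | symm e s t =>
      simp only [map_sub, Finsupp.linearCombination_single, one_smul, PTree.lact_node, ← map_smul,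
        cls_symm, sub_self]
    | quad l hl t =>
      have h := Q.R_left a _ hl
      simp only [rTensor_list] at h
      have := Q.cls_quad (fun i => (l i).map fun p => (a • p.1, p.2)) h t
      simp only [map_sum, linearCombination_list_sum, PTree.lact]
      simpa only [List.map_map, Function.comp_def] using this
    | left e t x hx =>
      rw [Finsupp.linearCombination_mapDomain]
      exact (Q.linearCombination_mapDomain (fun s => .node (a • e) s t) x).trans
        (clsₗ_rel (.left _ t x hx))
    | right e s x hx =>
      rw [Finsupp.linearCombination_mapDomain]
      exact (Q.linearCombination_mapDomain (fun t => .node (a • e) s t) x).trans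
        (clsₗ_rel (.right _ s x hx))

theorem lact_cls (a : K) (t : PTree K Q.E α) : Q.lact a (Q.cls t) = Q.cls (t.lact a) :=
  Q.liftₗ_cls _ _ _

theorem lact_add (a b : K) (x : Q.Alg α) : Q.lact (a + b) x = Q.lact a x + Q.lact b x := by
  rw [← LinearMap.add_apply]
  congr 1
  refine Q.hom_ext fun t => ?_
  cases t <;> simp [lact_cls, PTree.lact, add_mul, add_smul, cls_leaf_add, cls_node_add]

theorem lact_smul (c : k) (b : K) (x : Q.Alg α) : Q.lact (c • b) x = c • Q.lact b x := by
  rw [← LinearMap.smul_apply]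
  congr 1
  refine Q.hom_ext fun t => ?_
  cases t <;> simp [lact_cls, PTree.lact, cls_leaf_smul, cls_node_smul]

theorem lact_mul (a b : K) (x : Q.Alg α) : Q.lact (a * b) x = Q.lact a (Q.lact b x) := by
  rw [← LinearMap.comp_apply]
  congr 1
  refine Q.hom_ext fun t => ?_
  cases t <;> simp [lact_cls, PTree.lact, mul_assoc, mul_smul]

theorem hom_ext₂ {M : Type*} [AddCommGroup M] [Module k M] {f g : Q.Alg α →ₗ[k] Q.Alg α →ₗ[k] M}
    (h : ∀ s t, f (Q.cls s) (Q.cls t) = g (Q.cls s) (Q.cls t)) : f = g :=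
  Q.hom_ext fun s => Q.hom_ext fun t => h s t

theorem node_add (e f : Q.E) : Q.node (α := α) (e + f) = Q.node e + Q.node f :=
  Q.hom_ext₂ fun s t => by simp [node_cls, cls_node_add]

theorem node_smul (c : k) (e : Q.E) : Q.node (α := α) (c • e) = c • Q.node e :=
  Q.hom_ext₂ fun s t => by simp [node_cls, cls_node_smul]

theorem node_balance₁ (a : K) (e : Q.E) (x y : Q.Alg α) :
    Q.node (Q.r₁ (op a) e) x y = Q.node e (Q.lact a x) y := by
  have : Q.node (α := α) (Q.r₁ (op a) e) = (Q.node e).comp (Q.lact a) :=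
    Q.hom_ext₂ fun s t => by simp [node_cls, lact_cls, cls_balance₁]
  rw [this]; rfl

theorem node_balance₂ (a : K) (e : Q.E) (x y : Q.Alg α) :
    Q.node (Q.r₂ (op a) e) x y = Q.node e x (Q.lact a y) := by
  have : Q.node (α := α) (Q.r₂ (op a) e) = (Q.node e).compl₂ (Q.lact a) :=
    Q.hom_ext₂ fun s t => by simp [node_cls, lact_cls, cls_balance₂]
  rw [this]; rfl

theorem node_symm (e : Q.E) (x y : Q.Alg α) : Q.node (Q.σ e) x y = Q.node e y x := by
  have : Q.node (α := α) (Q.σ e) = (Q.node e).flip :=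
    Q.hom_ext₂ fun s t => by simp [node_cls, cls_symm]
  rw [this]; rfl

theorem alg_induction {p : Q.Alg α → Prop} (h0 : p 0) (hadd : ∀ x y, p x → p y → p (x + y))
    (hsmul : ∀ (c : k) x, p x → p (c • x)) (hcls : ∀ t, p (Q.cls t)) (x : Q.Alg α) : p x := by
  obtain ⟨y, rfl⟩ := Submodule.mkQ_surjective _ x
  change p (Q.clsₗ y)
  induction y using Finsupp.induction_linear with
  | zero => simpa using h0
  | add x y hx hy => rw [map_add]; exact hadd _ _ hx hy
  | single t c => rw [clsₗ_single]; exact hsmul c _ (hcls t)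

theorem node_quad (l : Fin 3 → List (Q.E × Q.E))
    (hl : (fun i => ((l i).map fun p => p.1 ⊗ₜ[k] p.2).sum) ∈ Q.R)
    (x : Fin 3 → Q.Alg α) :
    ∑ i, ((l i).map fun p => Q.node p.1 (Q.node p.2 (x (i + 1)) (x (i + 2))) (x i)).sum = 0 := by
  have key : ∀ x0 x1 x2 : Q.Alg α,
      ((l 0).map fun p => Q.node p.1 (Q.node p.2 x1 x2) x0).sum
      + ((l 1).map fun p => Q.node p.1 (Q.node p.2 x2 x0) x1).sum
      + ((l 2).map fun p => Q.node p.1 (Q.node p.2 x0 x1) x2).sum = 0 := by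
    have h2 : ∀ l : List (Q.E × Q.E), ∀ g : Q.E × Q.E → Q.Alg α, ∀ c : k,
        (l.map fun p => c • g p).sum = c • (l.map g).sum := by
      intro l g c
      rw [List.smul_sum, List.map_map]; rfl
    have h3 : ∀ a b c a' b' c' : Q.Alg α, a + b + c = 0 → a' + b' + c' = 0 →
        (a + a') + (b + b') + (c + c') = 0 := by
      intro a b c a' b' c' h h'
      rw [← add_zero (0 : Q.Alg α)]
      nth_rewrite 1 [← h]
      rw [← h']
      abel
    intro x0 x1 x2
    induction x0 using Q.alg_induction with
    | h0 => simp
    | hadd x y hx hy =>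
      simp only [map_add, LinearMap.add_apply, List.sum_map_add]
      exact h3 _ _ _ _ _ _ hx hy
    | hsmul c x hx =>
      simp only [map_smul, LinearMap.smul_apply, h2, ← smul_add, hx, smul_zero]
    | hcls t0 =>
      induction x1 using Q.alg_induction with
      | h0 => simp
      | hadd x y hx hy =>
        simp only [map_add, LinearMap.add_apply, List.sum_map_add]
        exact h3 _ _ _ _ _ _ hx hy
      | hsmul c x hx =>
        simp only [map_smul, LinearMap.smul_apply, h2, ← smul_add, hx, smul_zero]
      | hcls t1 =>
        induction x2 using Q.alg_induction with
        | h0 => simp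
        | hadd x y hx hy =>
          simp only [map_add, LinearMap.add_apply, List.sum_map_add]
          exact h3 _ _ _ _ _ _ hx hy
        | hsmul c x hx =>
          simp only [map_smul, LinearMap.smul_apply, h2, ← smul_add, hx, smul_zero]
        | hcls t2 =>
          have := Q.cls_quad l hl ![t0, t1, t2]
          rw [Fin.sum_univ_three] at this
          simp only [node_cls]
          exact this
  rw [Fin.sum_univ_three]
  exact key (x 0) (x 1) (x 2)

/-- The evaluation of a tree with given values of the generators. -/
def eval (f : α → Q.Alg β) : PTree K Q.E α → Q.Alg β
  | .leaf a c => Q.lact c (f a)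
  | .node e s t => Q.node e (eval f s) (eval f t)

theorem eval_lact (f : α → Q.Alg β) (a : K) (t : PTree K Q.E α) :
    Q.eval f (t.lact a) = Q.lact a (Q.eval f t) := by
  have h : ∀ e (x y : Q.Alg β), Q.lact a (Q.node e x y) = Q.node (a • e) x y := by
    intro e x y
    have : (Q.node (α := β) e).compr₂ (Q.lact a) = Q.node (a • e) :=
      Q.hom_ext₂ fun s t => by simp [node_cls, lact_cls, PTree.lact]
    rw [← this]; rfl
  cases t <;> simp [PTree.lact, eval, lact_mul, h]

/-- The substitution of given elements for the generators. -/
def subst (f : α → Q.Alg β) : Q.Alg α →ₗ[k] Q.Alg β :=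
  Q.liftₗ (Q.eval f) fun x hx => by
    induction hx with
    | leaf_add b c d => simp [eval, lact_add]
    | leaf_smul b x c => simp [eval, lact_smul]
    | node_add e f s t => simp [eval, node_add]
    | node_smul x e s t => simp [eval, node_smul]
    | balance₁ b e s t => simp [eval, node_balance₁, eval_lact]
    | balance₂ b e s t => simp [eval, node_balance₂, eval_lact]
    | symm e s t => simp [eval, node_symm]
    | quad l hl t =>
      simp only [map_sum, linearCombination_list_sum, eval]
      exact Q.node_quad l hl fun i => Q.eval f (t i)
    | left e t x hx ih =>
      rw [Finsupp.linearCombination_mapDomain]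
      have : ∀ x, Finsupp.linearCombination k (Q.eval f ∘ fun s => .node e s t) x
          = Q.node e (Finsupp.linearCombination k (Q.eval f) x) (Q.eval f t) := by
        intro x
        induction x using Finsupp.induction_linear with
        | zero => simp
        | add x y hx hy => simp only [map_add, LinearMap.add_apply, hx, hy]
        | single t c => simp [eval]
      rw [this, ih, map_zero, LinearMap.zero_apply]
    | right e s x hx ih =>
      rw [Finsupp.linearCombination_mapDomain]
      have : ∀ x, Finsupp.linearCombination k (Q.eval f ∘ fun t => .node e s t) x
          = Q.node e (Q.eval f s) (Finsupp.linearCombination k (Q.eval f) x) := by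
        intro x
        induction x using Finsupp.induction_linear with
        | zero => simp
        | add x y hx hy => simp only [map_add, hx, hy]
        | single t c => simp [eval]
      rw [this, ih, map_zero]

theorem subst_cls (f : α → Q.Alg β) (t : PTree K Q.E α) : Q.subst f (Q.cls t) = Q.eval f t :=
  Q.liftₗ_cls _ _ _

section Graded

/-- The part of the free algebra spanned by the trees with the given multiset of leaf labels. -/
def multiPart (M : Multiset α) : Submodule k (Q.Alg α) :=
  Submodule.span k {x | ∃ t : PTree K Q.E α, t.leaves = M ∧ Q.cls t = x}

/-- The space P(A) of the operad P(K, E, R) for a finite set A of inputs: the multilinear part,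
in which each a in A occurs exactly once, of the free algebra. For A = {1, …, n} it is P(n). -/
def P (A : Finset α) : Submodule k (Q.Alg α) := Q.multiPart A.val

theorem map_mem_multiPart {M : Multiset α} {S : Submodule k (Q.Alg β)} (f : Q.Alg α →ₗ[k] Q.Alg β)
    (h : ∀ t : PTree K Q.E α, t.leaves = M → f (Q.cls t) ∈ S) {x : Q.Alg α}
    (hx : x ∈ Q.multiPart M) : f x ∈ S := by
  have : Q.multiPart M ≤ S.comap f := by
    refine Submodule.span_le.2 ?_
    rintro _ ⟨t, ht, rfl⟩
    exact h t ht
  exact this hx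

theorem cls_mem (t : PTree K Q.E α) : Q.cls t ∈ Q.multiPart t.leaves :=
  Submodule.subset_span ⟨t, rfl, rfl⟩

theorem var_mem (a : α) : Q.var a ∈ Q.multiPart {a} := Q.cls_mem (.leaf a 1)

theorem lact_mem (a : K) {M : Multiset α} {x : Q.Alg α} (hx : x ∈ Q.multiPart M) :
    Q.lact a x ∈ Q.multiPart M := by
  refine Q.map_mem_multiPart (Q.lact a) (fun t ht => ?_) hx
  rw [lact_cls, ← ht, ← t.leaves_lact a]
  exact Q.cls_mem _

theorem node_mem (e : Q.E) {M N : Multiset α} {x y : Q.Alg α} (hx : x ∈ Q.multiPart M)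
    (hy : y ∈ Q.multiPart N) : Q.node e x y ∈ Q.multiPart (M + N) := by
  refine Q.map_mem_multiPart ((Q.node e).flip y) (fun s hs => ?_) hx
  refine Q.map_mem_multiPart (Q.node e (Q.cls s)) (fun t ht => ?_) hy
  rw [node_cls, ← hs, ← ht]
  exact Q.cls_mem (.node e s t)

theorem eval_mem (f : α → Q.Alg β) (N : α → Multiset β) (t : PTree K Q.E α)
    (h : ∀ a ∈ t.leaves, f a ∈ Q.multiPart (N a)) :
    Q.eval f t ∈ Q.multiPart (t.leaves.bind N) := by
  induction t with
  | leaf a c =>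
    simpa [eval, PTree.leaves] using Q.lact_mem c (h a (by simp [PTree.leaves]))
  | node e s t ihs iht =>
    rw [PTree.leaves, Multiset.add_bind]
    exact Q.node_mem e (ihs fun a ha => h a (Multiset.mem_add.2 (.inl ha)))
      (iht fun a ha => h a (Multiset.mem_add.2 (.inr ha)))

theorem subst_mem (f : α → Q.Alg β) (N : α → Multiset β) {M : Multiset α} {x : Q.Alg α}
    (hx : x ∈ Q.multiPart M) (h : ∀ a ∈ M, f a ∈ Q.multiPart (N a)) :
    Q.subst f x ∈ Q.multiPart (M.bind N) := by
  refine Q.map_mem_multiPart (Q.subst f) (fun t ht => ?_) hx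
  subst ht
  rw [subst_cls]
  exact Q.eval_mem f N t h

/-- The left action of K on P(A). -/
def lactP (A : Finset α) (a : K) : Q.P A →ₗ[k] Q.P A :=
  (Q.lact a).restrict fun _ hx => Q.lact_mem a hx

theorem lactP_add (A : Finset α) (a b : K) :
    Q.lactP A (a + b) = Q.lactP A a + Q.lactP A b :=
  LinearMap.ext fun x => Subtype.ext (Q.lact_add a b x.1)

theorem lactP_smul (A : Finset α) (c : k) (a : K) :
    Q.lactP A (c • a) = c • Q.lactP A a :=
  LinearMap.ext fun x => Subtype.ext (Q.lact_smul c a x.1)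

variable [DecidableEq α]

/-- The operadic composition x ∘_a y. -/
def plug (a : α) (y : Q.Alg α) : Q.Alg α →ₗ[k] Q.Alg α :=
  Q.subst fun b => if b = a then y else Q.var b

theorem plug_mem {A B : Finset α} {a : α} (ha : a ∈ A) (hd : Disjoint (A.erase a) B)
    {x y : Q.Alg α} (hx : x ∈ Q.P A) (hy : y ∈ Q.P B) :
    Q.plug a y x ∈ Q.P (A.erase a ∪ B) := by
  have h := Q.subst_mem (fun b => if b = a then y else Q.var b)
    (fun b => if b = a then B.val else {b}) hx (by
      intro b _
      by_cases hb : b = a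
      · simp only [hb, if_true]; exact hy
      · simpa [hb] using Q.var_mem b)
  have e : A.val.bind (fun b => if b = a then B.val else {b}) = (A.erase a ∪ B).val := by
    rw [← Finset.disjUnion_eq_union _ _ hd, Finset.disjUnion_val]
    conv_lhs => rw [← Finset.insert_erase ha]
    rw [Finset.insert_val_of_notMem (Finset.notMem_erase a A), Multiset.cons_bind, if_pos rfl, add_comm]
    congr 1
    conv_rhs => rw [← Multiset.map_id (A.erase a).val, ← Multiset.bind_singleton (A.erase a).val id]
    refine Multiset.bind_congr fun b hb => ?_
    rw [if_neg (Finset.ne_of_mem_erase hb)]; rfl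
  rw [e] at h
  exact h

/-- The right action of K = P(1) at the input a. -/
def ract (a : α) (c : K) : Q.Alg α →ₗ[k] Q.Alg α :=
  Q.plug a (Q.cls (.leaf a c))

theorem ract_mem (a : α) (c : K) {A : Finset α} {x : Q.Alg α} (hx : x ∈ Q.P A) :
    Q.ract a c x ∈ Q.P A := by
  have h := Q.subst_mem (fun b => if b = a then Q.cls (.leaf a c) else Q.var b)
    (fun b => {b}) hx (by
      intro b _
      by_cases hb : b = a
      · simp only [hb, if_true]; exact Q.cls_mem (.leaf a c)
      · simpa [hb] using Q.var_mem b)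
  have e : A.val.bind (fun b => {b}) = A.val := by
    rw [Multiset.bind_singleton (f := fun b => b), Multiset.map_id']
  rw [e] at h
  exact h

/-- The right action of K on P(A) at the input a. -/
def ractP (A : Finset α) (a : α) (c : K) : Q.P A →ₗ[k] Q.P A :=
  (Q.ract a c).restrict fun _ hx => Q.ract_mem a c hx

end Graded

end QuadraticData

/-! Reduced trees -/

/-- Subsets of {0, …, n-1}. -/
abbrev Block (n : ℕ) := Finset (Fin n)

variable {n : ℕ}

/-- The binary code of a subset, which puts a total order on the subsets. -/
def key (u : Block n) : ℕ := ∑ i ∈ u, 2 ^ (i : ℕ)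

/-- The number of elements of S that precede u: u ∧ S equals (-1)^(inv u S) times the sorted wedge. -/
def inv (u : Block n) (S : Finset (Block n)) : ℕ := (S.filter fun w => key w < key u).card

/-- The sign that compares the wedge of a list with the sorted wedge. -/
def wedgeSign : List (Block n) → ℤ
  | [] => 1
  | u :: l => (-1) ^ (l.countP fun w => key w < key u) * wedgeSign l

/-- An isomorphism class of reduced n-trees (rooted trees with leaves 0, …, n-1 all of
whose vertices have at least two inputs). A vertex is given by the set of the leaves above it, so that a
reduced tree is a laminar family of sets with at least two elements, which contains the
set of all leaves. (There is none if n < 2.) -/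
structure RTree (n : ℕ) where
  verts : Finset (Block n)
  univ_mem : Finset.univ ∈ verts
  two_le_card : ∀ v ∈ verts, 2 ≤ v.card
  laminar : ∀ u ∈ verts, ∀ v ∈ verts, u ⊆ v ∨ v ⊆ u ∨ Disjoint u v

instance : Finite (RTree n) :=
  Finite.of_injective RTree.verts fun S T h => by
    cases S; cases T; cases h; rfl

instance : Fintype (RTree n) := Fintype.ofFinite _

namespace RTree

variable (T : RTree n)

/-- The external input edges, given by the singletons. -/
def leafEdges (n : ℕ) : Finset (Block n) := Finset.univ.image fun i => {i}

/-- The edges: each vertex v stands for its outgoing edge, and each leaf for its edge. The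
outgoing edge of the root vertex is the whole set. -/
def edges : Finset (Block n) := T.verts ∪ leafEdges n

/-- The set In(v) of the input edges of the vertex v. -/
def inputs (v : Block n) : Finset (Block n) :=
  T.edges.filter fun u => u ⊂ v ∧ ∀ w ∈ T.verts, w ⊂ v → ¬ u ⊂ w

/-- The tree T/e in which the internal edge e is contracted. -/
def contract (e : Block n) (he : e ≠ Finset.univ) : RTree n where
  verts := T.verts.erase e
  univ_mem := Finset.mem_erase.2 ⟨he.symm, T.univ_mem⟩
  two_le_card v hv := T.two_le_card v (Finset.mem_of_mem_erase hv)
  laminar u hu v hv := T.laminar u (Finset.mem_of_mem_erase hu) v (Finset.mem_of_mem_erase hv)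

theorem mem_edges {u : Block n} : u ∈ T.edges ↔ u ∈ T.verts ∨ ∃ i, {i} = u := by
  simp [edges, leafEdges]

theorem mem_inputs {u v : Block n} : u ∈ T.inputs v ↔
    u ∈ T.edges ∧ u ⊂ v ∧ ∀ w ∈ T.verts, w ⊂ v → ¬ u ⊂ w := by
  simp [inputs]

theorem edges_nonempty {u : Block n} (hu : u ∈ T.edges) : u.Nonempty := by
  rcases T.mem_edges.1 hu with h | ⟨i, rfl⟩
  · exact Finset.card_pos.1 (by have := T.two_le_card u h; omega)
  · simp

theorem inputs_contract_of_notMem {e v : Block n} (he : e ≠ Finset.univ) (heT : e ∈ T.verts)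
    (hv : v ≠ e) (h : e ∉ T.inputs v) : (T.contract e he).inputs v = T.inputs v := by
  ext u
  simp only [mem_inputs, mem_edges, contract, Finset.mem_erase]
  constructor
  · rintro ⟨hu, huv, hmax⟩
    refine ⟨hu.imp_left And.right, huv, fun w hw hwv huw => ?_⟩
    by_cases hwe : w = e
    · subst hwe
      refine h (T.mem_inputs.2 ⟨T.mem_edges.2 (.inl hw), hwv, fun w' hw' hw'v hww' => ?_⟩)
      exact hmax w' ⟨fun h => by subst h; exact absurd hww' (lt_irrefl _), hw'⟩ hw'v
        (huw.trans hww')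
    · exact hmax w ⟨hwe, hw⟩ hwv huw
  · rintro ⟨hu, huv, hmax⟩
    refine ⟨hu.imp_left fun hu' => ⟨?_, hu'⟩, huv, fun w hw => hmax w hw.2⟩
    rintro rfl
    exact h (T.mem_inputs.2 ⟨T.mem_edges.2 hu, huv, hmax⟩)

theorem inputs_contract_of_mem {e v : Block n} (he : e ≠ Finset.univ) (heT : e ∈ T.verts)
    (h : e ∈ T.inputs v) :
    (T.contract e he).inputs v = (T.inputs v).erase e ∪ T.inputs e := by
  obtain ⟨-, hev, hemax⟩ := T.mem_inputs.1 h
  ext u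
  simp only [mem_inputs, mem_edges, contract, Finset.mem_erase, Finset.mem_union]
  constructor
  · rintro ⟨hu, huv, hmax⟩
    have hu' := hu.imp_left And.right
    by_cases hue : u ⊂ e
    · exact .inr ⟨hu', hue, fun w hw hwe huw =>
        hmax w ⟨fun h => by subst h; exact absurd hwe (lt_irrefl _), hw⟩ (hwe.trans hev) huw⟩
    · refine .inl ⟨?_, hu', huv, fun w hw hwv huw => ?_⟩
      · rintro rfl
        rcases hu with hu | ⟨i, hi⟩
        · exact hu.1 rfl
        · have := T.two_le_card _ heT
          rw [← hi] at this; simp at this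
      · by_cases hwe : w = e
        · exact hue (hwe ▸ huw)
        · exact hmax w ⟨hwe, hw⟩ hwv huw
  · rintro (⟨hue, hu, huv, hmax⟩ | ⟨hu, hue, hmax⟩)
    · exact ⟨hu.imp_left fun h => ⟨hue, h⟩, huv, fun w hw => hmax w hw.2⟩
    · refine ⟨hu.imp_left fun h => ⟨fun h' => ?_, h⟩, hue.trans hev, ?_⟩
      · subst h'; exact absurd hue (lt_irrefl _)
      · rintro w ⟨hwe, hw⟩ hwv huw
        have hne := T.edges_nonempty (T.mem_edges.2 hu)
        rcases T.laminar w hw e heT with h1 | h1 | h1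
        · exact hmax w hw (lt_of_le_of_ne h1 hwe) huw
        · exact hemax w hw hwv (lt_of_le_of_ne h1 (Ne.symm hwe))
        · obtain ⟨x, hx⟩ := hne
          exact Finset.disjoint_left.1 h1 (huw.1 hx) (hue.1 hx)

theorem disjoint_inputs (e v : Block n) (heT : e ∈ T.verts) (h : e ∈ T.inputs v) :
    Disjoint ((T.inputs v).erase e) (T.inputs e) := by
  refine Finset.disjoint_left.2 fun u hu hu' => ?_
  have h1 := T.mem_inputs.1 (Finset.mem_of_mem_erase hu)
  exact h1.2.2 e heT (T.mem_inputs.1 h).2.1 (T.mem_inputs.1 hu').2.1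

theorem inputs_pairwise {v a b : Block n} (ha : a ∈ T.inputs v) (hb : b ∈ T.inputs v)
    (hab : a ≠ b) : Disjoint a b := by
  obtain ⟨ha1, ha2, ha3⟩ := T.mem_inputs.1 ha
  obtain ⟨hb1, hb2, hb3⟩ := T.mem_inputs.1 hb
  rcases T.mem_edges.1 ha1 with h | ⟨i, rfl⟩
  · rcases T.mem_edges.1 hb1 with h' | ⟨j, rfl⟩
    · rcases T.laminar a h b h' with h1 | h1 | h1
      · exact absurd (lt_of_le_of_ne h1 hab) (ha3 b h' hb2)
      · exact absurd (lt_of_le_of_ne h1 hab.symm) (hb3 a h ha2)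
      · exact h1
    · refine Finset.disjoint_singleton_right.2 fun hj => ?_
      exact hb3 a h ha2 (lt_of_le_of_ne (Finset.singleton_subset_iff.2 hj) hab.symm)
  · rcases T.mem_edges.1 hb1 with h' | ⟨j, rfl⟩
    · refine Finset.disjoint_singleton_left.2 fun hj => ?_
      exact ha3 b h' hb2 (lt_of_le_of_ne (Finset.singleton_subset_iff.2 hj) hab)
    · simpa using fun h => hab (by rw [h])

theorem exists_mem_inputs {v : Block n} (hv : v ∈ T.verts) {x : Fin n} (hx : x ∈ v) :
    ∃ u ∈ T.inputs v, x ∈ u := by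
  have hne : (T.edges.filter fun u => u ⊂ v ∧ x ∈ u).Nonempty := by
    refine ⟨{x}, Finset.mem_filter.2 ⟨T.mem_edges.2 (.inr ⟨x, rfl⟩), ?_, by simp⟩⟩
    refine lt_of_le_of_ne (Finset.singleton_subset_iff.2 hx) ?_
    rintro rfl
    have := T.two_le_card _ hv
    simp at this
  obtain ⟨u, hu, hmax⟩ := Finset.exists_max_image _ Finset.card hne
  obtain ⟨hu1, hu2, hu3⟩ := Finset.mem_filter.1 hu
  refine ⟨u, T.mem_inputs.2 ⟨hu1, hu2, fun w hw hwv huw => ?_⟩, hu3⟩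
  have := hmax w (Finset.mem_filter.2 ⟨T.mem_edges.2 (.inl hw), hwv, huw.1 hu3⟩)
  exact absurd (Finset.card_lt_card huw) (by omega)

/-- Each vertex has exactly two inputs. -/
def IsBinary : Prop := ∀ v ∈ T.verts, (T.inputs v).card = 2

variable {T}

theorem IsBinary.exists_children (h : T.IsBinary) (v : T.verts) :
    ∃ p : Block n × Block n, p.1 ≠ p.2 ∧ T.inputs v.1 = {p.1, p.2} := by
  obtain ⟨a, b, hab, h⟩ := Finset.card_eq_two.1 (h v.1 v.2)
  exact ⟨(a, b), hab, h⟩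

/-- The first input of v, in a chosen planar structure of T. -/
def child₁ (h : T.IsBinary) (v : T.verts) : Block n := (h.exists_children v).choose.1
/-- The second input of v, in a chosen planar structure of T. -/
def child₂ (h : T.IsBinary) (v : T.verts) : Block n := (h.exists_children v).choose.2

theorem child_ne (h : T.IsBinary) (v : T.verts) : child₁ h v ≠ child₂ h v :=
  (h.exists_children v).choose_spec.1

theorem inputs_eq (h : T.IsBinary) (v : T.verts) : T.inputs v.1 = {child₁ h v, child₂ h v} :=
  (h.exists_children v).choose_spec.2

theorem inputs_val (h : T.IsBinary) (v : T.verts) :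
    (T.inputs v.1).val = {child₁ h v} + {child₂ h v} := by
  rw [inputs_eq h v, Finset.insert_val_of_notMem (by simpa using child_ne h v)]
  rfl

theorem child_val (h : T.IsBinary) (v : T.verts) :
    v.1.val = (child₁ h v).val + (child₂ h v).val := by
  have h1 : child₁ h v ∈ T.inputs v.1 := by rw [inputs_eq h v]; simp
  have h2 : child₂ h v ∈ T.inputs v.1 := by rw [inputs_eq h v]; simp
  have hd := T.inputs_pairwise h1 h2 (child_ne h v)
  rw [← Finset.disjUnion_val _ _ hd, Finset.val_inj, Finset.disjUnion_eq_union]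
  refine Finset.Subset.antisymm (fun x hx => ?_)
    (Finset.union_subset (T.mem_inputs.1 h1).2.1.1 (T.mem_inputs.1 h2).2.1.1)
  obtain ⟨u, hu, hxu⟩ := T.exists_mem_inputs v.2 hx
  rw [inputs_eq h v, Finset.mem_insert, Finset.mem_singleton] at hu
  rcases hu with rfl | rfl
  · exact Finset.mem_union_left _ hxu
  · exact Finset.mem_union_right _ hxu

theorem child₁_mem (h : T.IsBinary) (v : T.verts) : child₁ h v ∈ T.inputs v.1 := by
  rw [inputs_eq h v]; simp

theorem child₂_mem (h : T.IsBinary) (v : T.verts) : child₂ h v ∈ T.inputs v.1 := by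
  rw [inputs_eq h v]; simp

/-- The wedge, over the vertices v, of child₁ v ∧ child₂ v, compared with the sorted wedge of all
edges except the outgoing edge of the root. The pairs have even degree, so that the order of the
vertices does not matter. -/
def orientation (h : T.IsBinary) : ℤ :=
  wedgeSign (Finset.univ.toList.flatMap fun v : T.verts => [child₁ h v, child₂ h v])

end RTree
/-- The internal edges. -/
abbrev RTree.internal {n : ℕ} (T : RTree n) : Type _ :=
  {e : Block n // e ∈ T.verts ∧ e ≠ Finset.univ}

namespace QuadraticData

variable {k : Type u} {K : Type v} [Field k] [Ring K] [Algebra k K]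
variable (Q : QuadraticData.{u, v, w} k K)
variable {n : ℕ}

/-- A finite dual basis of the K-module E: ∑ Ξ_i ⊗ X_i is the identity of E. -/
structure DualBasis where
  d : ℕ
  X : Fin d → Q.E
  Ξ : Fin d → Q.dual.E
  sum_eq : ∀ e : Q.E, ∑ i, (show Q.EDual from Ξ i) e • X i = e

theorem nonempty_dualBasis [IsSemisimpleRing K] [FiniteDimensional k Q.E] :
    Nonempty Q.DualBasis := by
  have : Module.Finite K Q.E := Module.Finite.of_restrictScalars_finite k K Q.E
  have : Module.Projective K Q.E := Module.projective_of_isSemisimpleRing K Q.E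
  obtain ⟨d, f, hf⟩ := Module.Finite.exists_fin' K Q.E
  obtain ⟨s, hs⟩ := Module.projective_lifting_property f LinearMap.id hf
  refine ⟨⟨d, fun i => f (Pi.single i 1), fun i => (LinearMap.proj i).comp s, fun e => ?_⟩⟩
  have h1 : f (s e) = e := LinearMap.congr_fun hs e
  conv_rhs => rw [← h1, ← Finset.univ_sum_single (s e), map_sum]
  refine Finset.sum_congr rfl fun i _ => ?_
  change s e i • f (Pi.single i 1) = _
  rw [← map_smul, ← Pi.single_smul, smul_eq_mul, mul_one]

/-- A chosen dual basis; ∑ Ξ_i ⊗ X_i is independent of the choice. -/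
def dualBasis [IsSemisimpleRing K] [FiniteDimensional k Q.E] : Q.DualBasis :=
  Q.nonempty_dualBasis.some

/-! The dual dg operad -/

/-- The choices of an element of P(In(v)) for each vertex v of T. -/
abbrev Deco (T : RTree n) : Type _ := (v : T.verts) → Q.P (T.inputs v.1)

/-- φ is an element of the dual P(T)^∨ = Hom_K(P(T), K) of the tensor product P(T), over K,
of the P(In(v)) along the tree T: φ is multilinear, left K-linear at the root, and balanced over
K along each internal edge. -/
structure IsForm (T : RTree n) (φ : Q.Deco T → K) : Prop where
  map_add : ∀ (m : Q.Deco T) (v : T.verts) (x y : Q.P (T.inputs v.1)),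
    φ (Function.update m v (x + y)) = φ (Function.update m v x) + φ (Function.update m v y)
  map_smul : ∀ (m : Q.Deco T) (v : T.verts) (c : k) (x : Q.P (T.inputs v.1)),
    φ (Function.update m v (c • x)) = c • φ (Function.update m v x)
  root : ∀ (m : Q.Deco T) (a : K),
    φ (Function.update m ⟨_, T.univ_mem⟩ (Q.lactP _ a (m ⟨_, T.univ_mem⟩))) = a * φ m
  balance : ∀ (m : Q.Deco T) (v w : T.verts) (a : K), v.1 ∈ T.inputs w.1 →
    φ (Function.update m w (Q.ractP _ v.1 a (m w)))
      = φ (Function.update m v (Q.lactP _ a (m v)))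

variable (n) in
/-- Families, indexed by the reduced trees T, of functions of the decorations of T. -/
abbrev Cochain : Type _ := (T : RTree n) → Q.Deco T → K

theorem isForm_zero (T : RTree n) : Q.IsForm T 0 :=
  ⟨by simp, by simp, by simp, by simp⟩

theorem IsForm.add {T : RTree n} {φ ψ : Q.Deco T → K} (hφ : Q.IsForm T φ) (hψ : Q.IsForm T ψ) :
    Q.IsForm T (φ + ψ) where
  map_add m v x y := by simp only [Pi.add_apply, hφ.map_add, hψ.map_add]; abel
  map_smul m v c x := by simp only [Pi.add_apply, hφ.map_smul, hψ.map_smul, smul_add]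
  root m a := by simp only [Pi.add_apply, hφ.root, hψ.root, mul_add]
  balance m v w a h := by simp only [Pi.add_apply, hφ.balance m v w a h, hψ.balance m v w a h]

theorem IsForm.smul {T : RTree n} {φ : Q.Deco T → K} (hφ : Q.IsForm T φ) (c : k) :
    Q.IsForm T (c • φ) where
  map_add m v x y := by simp only [Pi.smul_apply, hφ.map_add, smul_add]
  map_smul m v d x := by simp only [Pi.smul_apply, hφ.map_smul, smul_comm c d]
  root m a := by simp only [Pi.smul_apply, hφ.root, mul_smul_comm]
  balance m v w a h := by simp only [Pi.smul_apply, hφ.balance m v w a h]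

variable (n) in
/-- The component of degree -j of D(P)(n): the direct sum of P(T)^∨ ⊗ Det(T) over the reduced
n-trees T with n - 1 - j vertices, that is, with n - 2 - j internal edges. Here Det(T) is the top
exterior power of the space spanned by the edges of T other than the outgoing edge of the root; it is
identified with k by the sorted wedge of these edges. -/
def D (j : ℕ) : Submodule k (Q.Cochain n) where
  carrier := {Φ | ∀ T, Q.IsForm T (Φ T) ∧ (T.verts.card + j + 1 ≠ n → Φ T = 0)}
  add_mem' hΦ hΨ T := ⟨(hΦ T).1.add _ (hΨ T).1, fun h => by
    rw [Pi.add_apply, (hΦ T).2 h, (hΨ T).2 h, add_zero]⟩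
  zero_mem' T := ⟨Q.isForm_zero T, fun _ => rfl⟩
  smul_mem' c Φ hΦ T := ⟨(hΦ T).1.smul _ c, fun h => by
    rw [Pi.smul_apply, (hΦ T).2 h, smul_zero]⟩

theorem mem_P_of_eq {α : Type*} {A B : Finset α} (h : B = A) {x : Q.Alg α} (hx : x ∈ Q.P A) :
    x ∈ Q.P B := h ▸ hx

/-- The composition map P(T) → P(T/e) of the operad P along the internal edge e. -/
def contractDeco (T : RTree n) (e : T.internal) (m : Q.Deco T) :
    Q.Deco (T.contract e.1 e.2.2) := fun v =>
  let x : Q.P (T.inputs v.1) := m ⟨v.1, Finset.mem_of_mem_erase v.2⟩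
  let y : Q.P (T.inputs e.1) := m ⟨e.1, e.2.1⟩
  if h : e.1 ∈ T.inputs v.1 then
    ⟨Q.plug e.1 y x, Q.mem_P_of_eq (T.inputs_contract_of_mem e.2.2 e.2.1 h)
      (Q.plug_mem h (T.disjoint_inputs _ _ e.2.1 h) x.2 y.2)⟩
  else
    ⟨x, Q.mem_P_of_eq
      (T.inputs_contract_of_notMem e.2.2 e.2.1 (Finset.ne_of_mem_erase v.2) h) x.2⟩

/-- The differential of D(P)(n): on the summand of T it is the sum over the internal edges e of
the transposes of the compositions P(T) → P(T/e), tensored with the map e ∧ - from Det(T/e)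
to Det(T). -/
def δ : Q.Cochain n →ₗ[k] Q.Cochain n where
  toFun Φ T m := ∑ e : T.internal,
    ((-1) ^ inv e.1 (T.verts.erase Finset.univ ∪ RTree.leafEdges n) : ℤ) •
      Φ (T.contract e.1 e.2.2) (Q.contractDeco T e m)
  map_add' Φ Ψ := by
    funext T m; simp only [Pi.add_apply, smul_add, Finset.sum_add_distrib]
  map_smul' c Φ := by
    funext T m
    simp only [Pi.smul_apply, RingHom.id_apply, Finset.smul_sum]
    exact Finset.sum_congr rfl fun _ _ => smul_comm _ _ _

/-- The operation e at the vertex v of the binary tree T. -/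
def corolla (T : RTree n) (h : T.IsBinary) (v : T.verts) (e : Q.E) : Q.P (T.inputs v.1) :=
  ⟨Q.node e (Q.var (RTree.child₁ h v)) (Q.var (RTree.child₂ h v)), by
    have := Q.node_mem e (Q.var_mem (RTree.child₁ h v)) (Q.var_mem (RTree.child₂ h v))
    rwa [← RTree.inputs_val h v] at this⟩

/-- The composite in P of the operations ψ(v) along the part of the binary tree T above the edge
u (the first argument bounds the depth of the recursion). -/
def build {T : RTree n} (h : T.IsBinary) (ψ : T.verts → Q.E) : ℕ → Block n → Q.Alg (Fin n)
  | 0, _ => 0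
  | f + 1, u =>
    if hu : u ∈ T.verts then
      Q.node (ψ ⟨u, hu⟩) (build h ψ f (RTree.child₁ h ⟨u, hu⟩)) (build h ψ f (RTree.child₂ h ⟨u, hu⟩))
    else ∑ x ∈ u, Q.var x

theorem build_mem {T : RTree n} (h : T.IsBinary) (ψ : T.verts → Q.E) (f : ℕ) (u : Block n)
    (hu : u ∈ T.edges) (hf : u.card ≤ f) : Q.build h ψ f u ∈ Q.P u := by
  induction f generalizing u with
  | zero => exact Submodule.zero_mem _
  | succ f ih =>
    rw [build]
    split_ifs with huT
    · have h1 := T.mem_inputs.1 (RTree.child₁_mem h ⟨u, huT⟩)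
      have h2 := T.mem_inputs.1 (RTree.child₂_mem h ⟨u, huT⟩)
      have c1 := Finset.card_lt_card h1.2.1
      have c2 := Finset.card_lt_card h2.2.1
      have := Q.node_mem (ψ ⟨u, huT⟩) (ih _ h1.1 (by simp only at c1; omega))
        (ih _ h2.1 (by simp only at c2; omega))
      rwa [← RTree.child_val h ⟨u, huT⟩] at this
    · obtain h' | ⟨i, rfl⟩ := T.mem_edges.1 hu
      · exact absurd h' huT
      · rw [Finset.sum_singleton]
        exact Q.var_mem i

/-- The composite in P(n) of the operations ψ(v) along the binary tree T. -/
def treeMonomial {T : RTree n} (h : T.IsBinary) (ψ : T.verts → Q.E) :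
    Q.P (Finset.univ : Finset (Fin n)) :=
  ⟨Q.build h ψ n Finset.univ, Q.build_mem h ψ n _ (T.mem_edges.2 (.inl T.univ_mem)) (by simp)⟩

instance : Fintype {T : RTree n // T.IsBinary} := Fintype.ofFinite _

/-- The degree zero component D(P)(n)^0 → P^!(n) of the canonical morphism. The source is the
sum over the binary trees T of P(T)^∨ ⊗ Det(T), that is, the n-ary part of the free operad
on the sign-twisted dual E^∨, and the map is the projection to its quotient P^!(n): a form Φ on
P(T) = E(T) is expanded in the dual basis as ∑ Φ(T(X_i)) T(Ξ_i), and T(Ξ_i) is mapped to the composite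
of the Ξ_i in P^!. -/
def γ (B : Q.DualBasis) : Q.Cochain n →ₗ[k] Q.dual.P (Finset.univ : Finset (Fin n)) where
  toFun Φ := ∑ T : {T : RTree n // T.IsBinary}, RTree.orientation T.2 •
    ∑ i : T.1.verts → Fin B.d,
      Q.dual.lactP _ (op (Φ T.1 fun v => Q.corolla T.1 T.2 v (B.X (i v))))
        (Q.dual.treeMonomial T.2 fun v => B.Ξ (i v))
  map_add' Φ Ψ := by
    simp only [Pi.add_apply, op_add, lactP_add, LinearMap.add_apply, Finset.sum_add_distrib,
      smul_add]
  map_smul' c Φ := by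
    simp only [Pi.smul_apply, op_smul, lactP_smul, LinearMap.smul_apply, Finset.smul_sum,
      RingHom.id_apply]
    refine Finset.sum_congr rfl fun T _ => Finset.sum_congr rfl fun i _ => smul_comm _ _ _

/-- P is Koszul: for each n the canonical map D(P)(n) → P^!(n), where P^!(n) is in degree 0, is a
quasi-isomorphism. That is, D(P)(n) has no cohomology in degrees -(j+1) for j ≥ 0, and in degree 0 the
map induces an isomorphism of D(P)(n)^0 / δ(D(P)(n)^{-1}) with P^!(n). (For n = 1 the
map is the identity of K^op.) -/
def IsKoszul [IsSemisimpleRing K] [FiniteDimensional k Q.E] : Prop :=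
  ∀ n : ℕ, 2 ≤ n →
    (∀ j : ℕ, (Q.D n (j + 2)).map Q.δ = Q.D n (j + 1) ⊓ LinearMap.ker Q.δ) ∧
    (Q.D n 1).map Q.δ = Q.D n 0 ⊓ LinearMap.ker (Q.γ Q.dualBasis) ∧
    (Q.D n 0).map (Q.γ Q.dualBasis) = ⊤

end QuadraticData

variable {n : ℕ}

/-! The Koszul complex -/

/-- The partitions of {0, …, n-1} into nonempty blocks: the orbits of Σ_m on the surjections
[n] → [m]. -/
abbrev SetPart (n : ℕ) : Type := Finpartition (Finset.univ : Finset (Fin n))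

/-- Two distinct blocks B, C of the partition. -/
abbrev SetPart.pairs (π : SetPart n) : Type :=
  {p : Block n × Block n // p.1 ∈ π.parts ∧ p.2 ∈ π.parts ∧ key p.1 < key p.2}

namespace SetPart
variable (π : SetPart n) (p : π.pairs)

/-- The other blocks. -/
def rest : Finset (Block n) := (π.parts.erase p.1.1).erase p.1.2

theorem ne : p.1.1 ≠ p.1.2 := fun h => absurd p.2.2.2 (by rw [h]; exact lt_irrefl _)

theorem union_notMem_rest : p.1.1 ∪ p.1.2 ∉ SetPart.rest π p := by
  intro h
  obtain ⟨x, hx⟩ := π.nonempty_of_mem_parts p.2.1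
  have h1 := Finset.mem_erase.1 (Finset.mem_erase.1 h).2
  exact h1.1 (π.eq_of_mem_parts h1.2 p.2.1 (Finset.mem_union_left _ hx) hx)

theorem disjoint : Disjoint p.1.1 p.1.2 := Finpartition.disjoint π p.2.1 p.2.2.1 (SetPart.ne π p)

/-- The partition in which the blocks B and C are replaced by B ∪ C. -/
def merge : SetPart n :=
  Finpartition.ofExistsUnique (insert (p.1.1 ∪ p.1.2) (SetPart.rest π p))
    (fun _ _ => Finset.subset_univ _)
    (by
      intro x _
      obtain ⟨t, ⟨ht, hxt⟩, huniq⟩ := π.existsUnique_mem (Finset.mem_univ x)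
      by_cases h : t = p.1.1 ∨ t = p.1.2
      · refine ⟨p.1.1 ∪ p.1.2, ⟨Finset.mem_insert_self _ _, ?_⟩, ?_⟩
        · rcases h with rfl | rfl
          · exact Finset.mem_union_left _ hxt
          · exact Finset.mem_union_right _ hxt
        · rintro s ⟨hs, hxs⟩
          rcases Finset.mem_insert.1 hs with rfl | hs
          · rfl
          · have hs' := Finset.mem_erase.1 hs
            have hs'' := Finset.mem_erase.1 hs'.2
            have := huniq s ⟨hs''.2, hxs⟩
            subst this
            exact absurd h (by rintro (h | h); exacts [hs''.1 h, hs'.1 h])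
      · rw [not_or] at h
        refine ⟨t, ⟨Finset.mem_insert_of_mem (Finset.mem_erase.2
          ⟨h.2, Finset.mem_erase.2 ⟨h.1, ht⟩⟩), hxt⟩, ?_⟩
        rintro s ⟨hs, hxs⟩
        rcases Finset.mem_insert.1 hs with rfl | hs
        · rcases Finset.mem_union.1 hxs with hx | hx
          · exact absurd (huniq _ ⟨p.2.1, hx⟩).symm h.1
          · exact absurd (huniq _ ⟨p.2.2.1, hx⟩).symm h.2
        · exact huniq s ⟨(Finset.mem_erase.1 (Finset.mem_erase.1 hs).2).2, hxs⟩)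
    (by
      intro h
      rcases Finset.mem_insert.1 h with h | h
      · obtain ⟨x, hx⟩ := π.nonempty_of_mem_parts p.2.1
        have := h ▸ Finset.mem_union_left p.1.2 hx
        simp at this
      · exact π.empty_notMem_parts (Finset.mem_erase.1 (Finset.mem_erase.1 h).2).2)

theorem merge_parts : (SetPart.merge π p).parts = insert (p.1.1 ∪ p.1.2) (SetPart.rest π p) := rfl

theorem parts_eq : π.parts =
    (SetPart.merge π p).parts.erase (p.1.1 ∪ p.1.2) ∪ {p.1.1, p.1.2} := by
  rw [merge_parts, Finset.erase_insert (SetPart.union_notMem_rest π p)]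
  ext x
  simp only [rest, Finset.mem_union, Finset.mem_erase, Finset.mem_insert, Finset.mem_singleton]
  have h1 := p.2.1
  have h2 := p.2.2.1
  constructor
  · intro hx
    by_cases a : x = p.1.1
    · exact .inr (.inl a)
    by_cases b : x = p.1.2
    · exact .inr (.inr b)
    exact .inl ⟨b, a, hx⟩
  · rintro (h | rfl | rfl)
    exacts [h.2.2, h1, h2]

theorem disjoint_pair :
    Disjoint ((SetPart.merge π p).parts.erase (p.1.1 ∪ p.1.2)) {p.1.1, p.1.2} := by
  rw [merge_parts, Finset.erase_insert (SetPart.union_notMem_rest π p)]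
  simp [rest]

theorem mem_parts_of_mem_merge {b : Block n} (hb : b ∈ (SetPart.merge π p).parts)
    (h : b ≠ p.1.1 ∪ p.1.2) : b ∈ π.parts :=
  (Finset.mem_erase.1 (Finset.mem_erase.1
    ((Finset.mem_insert.1 hb).resolve_left h)).2).2

/-- The sign of the map (B ∪ C) ∧ rest ↦ B ∧ C ∧ rest between the top exterior powers of the
spaces spanned by the blocks, identified with k by the sorted wedges. (B, C are taken in
increasing order.) -/
def sign : ℤ :=
  (-1) ^ (inv (p.1.1 ∪ p.1.2) (SetPart.rest π p) + inv p.1.1 (SetPart.rest π p)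
    + inv p.1.2 (SetPart.rest π p))

end SetPart

namespace QuadraticData
variable {k : Type u} {K : Type v} [Field k] [Ring K] [Algebra k K]
variable (Q : QuadraticData.{u, v, w} k K)

/-- The choices of an element of P^!(b) for each block b of π. -/
abbrev Args (π : SetPart n) : Type _ := (b : π.parts) → Q.dual.P b.1

/-- φ is an element of P(π) ⊗_{K^⊗m} (⊗_b P^!(b)^∨) = Hom_{K^⊗m}(⊗_b P^!(b), P(π)), where m is the
number of the blocks b of π: it is k-multilinear and intertwines, for each block b, the action of K on
the output of P^!(b) with the one on the input b of P(π). -/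
structure IsKForm (π : SetPart n) (φ : Q.Args π → Q.P π.parts) : Prop where
  map_add : ∀ (y : Q.Args π) (b : π.parts) (x x' : Q.dual.P b.1),
    φ (Function.update y b (x + x')) = φ (Function.update y b x) + φ (Function.update y b x')
  map_smul : ∀ (y : Q.Args π) (b : π.parts) (c : k) (x : Q.dual.P b.1),
    φ (Function.update y b (c • x)) = c • φ (Function.update y b x)
  balance : ∀ (y : Q.Args π) (b : π.parts) (a : K),
    φ (Function.update y b (Q.dual.lactP b.1 (op a) (y b))) = Q.ractP π.parts b.1 a (φ y)

variable (n) in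
/-- Families, indexed by the partitions π, of functions of the elements of the P^!(b). -/
abbrev KCochain : Type _ := (π : SetPart n) → Q.Args π → Q.P π.parts

theorem IsKForm.add {π : SetPart n} {φ ψ : Q.Args π → Q.P π.parts} (hφ : Q.IsKForm π φ)
    (hψ : Q.IsKForm π ψ) : Q.IsKForm π (φ + ψ) where
  map_add y b x x' := by simp only [Pi.add_apply, hφ.map_add, hψ.map_add]; abel
  map_smul y b c x := by simp only [Pi.add_apply, hφ.map_smul, hψ.map_smul, smul_add]
  balance y b a := by
    rw [Pi.add_apply, Pi.add_apply, hφ.balance, hψ.balance, _root_.map_add]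

theorem IsKForm.smul {π : SetPart n} {φ : Q.Args π → Q.P π.parts} (hφ : Q.IsKForm π φ) (c : k) :
    Q.IsKForm π (c • φ) where
  map_add y b x x' := by simp only [Pi.smul_apply, hφ.map_add, smul_add]
  map_smul y b d x := by simp only [Pi.smul_apply, hφ.map_smul, smul_comm c d]
  balance y b a := by
    rw [Pi.smul_apply, Pi.smul_apply, hφ.balance, _root_.map_smul]

variable (n) in
/-- The m-th term of the n-th Koszul complex P((P^!)^∨)(n): the coinvariants under Σ_m of the
direct sum, over the surjections f from [n] to [m], of P(m) ⊗_{K^⊗m} (P^!)^∨(f), where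
(P^!)^∨(f) is the tensor product of the sign-twisted duals of the P^!(f⁻¹(i)). Since Σ_m acts freely on
the surjections, this is the direct sum, over the partitions π into m blocks, of
P(π) ⊗ ⊗_b P^!(b)^∨. The signs of the permutations of the factors are taken into account by the top
exterior power of the space spanned by the blocks, which is identified with k by the sorted wedge. -/
def KoszulTerm (m : ℕ) : Submodule k (Q.KCochain n) where
  carrier := {Φ | ∀ π, Q.IsKForm π (Φ π) ∧ (π.parts.card ≠ m → Φ π = 0)}
  add_mem' hΦ hΨ π := ⟨(hΦ π).1.add _ (hΨ π).1, fun h => by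
    rw [Pi.add_apply, (hΦ π).2 h, (hΨ π).2 h, add_zero]⟩
  zero_mem' π := ⟨⟨by simp, by simp, by simp⟩, fun _ => rfl⟩
  smul_mem' c Φ hΦ π := ⟨(hΦ π).1.smul _ c, fun h => by
    rw [Pi.smul_apply, (hΦ π).2 h, smul_zero]⟩

/-- The composition ξ(y_B, y_C) in P^!(B ∪ C), the other elements being kept. -/
def mergeArgs (π : SetPart n) (p : π.pairs) (ξ : Q.dual.E) (y : Q.Args π) :
    Q.Args (SetPart.merge π p) := fun b =>
  let y₁ : Q.dual.P p.1.1 := y ⟨p.1.1, p.2.1⟩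
  let y₂ : Q.dual.P p.1.2 := y ⟨p.1.2, p.2.2.1⟩
  if h : b.1 = p.1.1 ∪ p.1.2 then
    ⟨Q.dual.node ξ y₁ y₂, by
      have := Q.dual.node_mem ξ y₁.2 y₂.2
      rw [h, ← Finset.disjUnion_eq_union _ _ (SetPart.disjoint π p)]
      exact this⟩
  else y ⟨b.1, SetPart.mem_parts_of_mem_merge π p b.2 h⟩

/-- The composition x ∘_{B ∪ C} e(B, C) in P(π). -/
def splitBlock (π : SetPart n) (p : π.pairs) (e : Q.E) (x : Q.P (SetPart.merge π p).parts) :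
    Q.P π.parts :=
  ⟨Q.plug (p.1.1 ∪ p.1.2) (Q.node e (Q.var p.1.1) (Q.var p.1.2)) x.1,
    Q.mem_P_of_eq (SetPart.parts_eq π p) (Q.plug_mem (Finset.mem_insert_self _ _)
      (SetPart.disjoint_pair π p) x.2 (by
        have := Q.node_mem e (Q.var_mem p.1.1) (Q.var_mem p.1.2)
        rw [P, Finset.insert_val_of_notMem (by simpa using SetPart.ne π p)]
        exact this))⟩

theorem splitBlock_add (π : SetPart n) (p : π.pairs) (e : Q.E)
    (x y : Q.P (SetPart.merge π p).parts) :
    Q.splitBlock π p e (x + y) = Q.splitBlock π p e x + Q.splitBlock π p e y :=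
  Subtype.ext (map_add (Q.plug _ _) x.1 y.1)

theorem splitBlock_smul (π : SetPart n) (p : π.pairs) (e : Q.E) (c : k)
    (x : Q.P (SetPart.merge π p).parts) :
    Q.splitBlock π p e (c • x) = c • Q.splitBlock π p e x :=
  Subtype.ext (map_smul (Q.plug _ _) c x.1)

/-- The differential of the Koszul complex: the sum over the pairs of blocks B, C and over i of the
composition with X_i at the input B ∪ C of P, tensored with the transpose of the composition
with Ξ_i in P^!, which sends P^!(B ∪ C)^∨ to P^!(B)^∨ ⊗ P^!(C)^∨. -/
def koszulD (B : Q.DualBasis) : Q.KCochain n →ₗ[k] Q.KCochain n where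
  toFun Φ π y := ∑ p : π.pairs, SetPart.sign π p • ∑ i : Fin B.d,
    Q.splitBlock π p (B.X i) (Φ (SetPart.merge π p) (Q.mergeArgs π p (B.Ξ i) y))
  map_add' Φ Ψ := by
    funext π y
    simp only [Pi.add_apply, splitBlock_add, Finset.sum_add_distrib, smul_add]
  map_smul' c Φ := by
    funext π y
    simp only [Pi.smul_apply, splitBlock_smul, Finset.smul_sum, RingHom.id_apply]
    exact Finset.sum_congr rfl fun p _ => Finset.sum_congr rfl fun i _ => smul_comm _ _ _

/-- The n-th Koszul complex is exact (everywhere). -/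
def KoszulComplexExact [IsSemisimpleRing K] [FiniteDimensional k Q.E] (n : ℕ) : Prop :=
  ∀ m : ℕ, (Q.KoszulTerm n m).map (Q.koszulD Q.dualBasis)
    = Q.KoszulTerm n (m + 1) ⊓ LinearMap.ker (Q.koszulD Q.dualBasis)

end QuadraticData

end QuadOp

end

/-!
For a block A of leaves, let the cobar complex of A (`QuadraticData.cobar`) be the part of D(P) that
lives on A: its elements are families, indexed by the trees on A, of balanced forms on the decorations
of the tree by P, with values in K. A tree is encoded by the laminar family of the sets of leaves above
its vertices, so that trees on the blocks of a partition are combined by taking unions, and a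
contraction of an edge is the removal of a member. The canonical morphism `γc` goes from the cobar
complex of A to P^!(A); it evaluates a form at the canonical elements of the binary trees. `ExactAt`
says that cobar(A) → P^!(A) → 0 is exact. For the set of all leaves this is the Koszul condition
(`exactAt_univ_iff_quasiIso`): the planar structure that enters the definition of γ does not matter,
as the sum over the colourings of a planar binary tree, times its orientation, is an invariant of the
tree (`wedgeSign_smul_evalTrees`).

The theorem is proved by induction on n. The step is that, if all proper blocks of the set of n leaves
are exact, then so is the whole set if and only if the n-th Koszul complex is exact
(`exactAt_univ_iff_koszulComplexExact`). Relabelling of the leaves (`ExactAt.relabel`) reduces the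
hypothesis on the blocks to the sets of fewer than n leaves.

For the step, a tree is cut at its root. The inputs of the root form a partition π of the leaves into at
least two blocks, and the rest of the tree is a forest, with one tree on each block of π. Hence the cobar
complex of the set of all leaves is filtered, with graded pieces the complexes of forms on the forests over
π (`splitF`, `asmF`), which are the tensor products of P(π)^∨ with the cobar complexes of the blocks.
If the blocks are exact, then γ on each tree of the forest makes such a piece quasi-isomorphic
to the product of P(π)^∨ with the spaces P^!(b), b ∈ π, and this is the dual of the term at π of the
Koszul complex, which consists of the K-forms on ∏ P^!(b) with values in P(π). The partition into one
block does not occur in this way; it corresponds to P^!, the target of γ. Thus the cone of γ should be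
quasi-isomorphic to the dual of the Koszul complex.

This is made precise by a pairing between the cone and the complex of K-forms (`pair`). It sends a form on
trees and a family φ of K-forms to the sum over the partitions π, and over the binary forests over π whose
vertices are coloured by the indices i of Id_E = ∑ X_i ⊗ Ξ_i: the form is evaluated at the forest decorated
by the X_i, with the value of φ at the monomials in the Ξ_i at the root.

* The pairing is a morphism of complexes (`pair_δc`). The part of the cobar differential that contracts an
  edge at the root gives the Koszul differential; the contractions inside the forests
  cancel, as γ is a morphism of complexes on the blocks.
* It is onto the dual of the complex of K-forms (`coneρ_surjective`), by means of the sections of γ on the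
  blocks.
* Its kernel is acyclic (`exists_δc_eq_of_pairVanish`): over a semisimple ring, an exact complex with
  augmentation splits (`exists_contraction`), and the contractions of the blocks, applied one
  after the other, contract the complex of forests (`exists_forestD_eq`). A cycle in the kernel is
  then corrected at one number of blocks of π after the other.

As K is semisimple, dualizing reflects exactness, and the cone is exact if and only if the complex of
K-forms is (`exact_iff_exact_of_pairing`). The characteristic of k enters in the construction of the
contractions, which have to be odd for the parity of the number of edges, so that they satisfy the sign rule
when they are applied to one tree of a forest; the odd part of a contraction is obtained by averaging.
-/

open Finset (biUnion_congr card_biUnion card_eq_one card_eq_zero card_erase_add_one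
  card_erase_of_mem card_fin card_insert_of_notMem card_le_card card_le_one card_lt_card
  card_pair card_pos card_singleton card_union_of_disjoint disjoint_left disjoint_singleton_left
  disjoint_union_left eq_empty_of_forall_notMem eq_singleton_iff_unique_mem erase_eq_of_notMem
  erase_insert exists_min_image filter_subset image_image image_insert image_singleton insert_eq
  insert_erase mem_biUnion mem_erase mem_filter mem_image mem_image_of_mem mem_insert
  mem_insert_of_mem mem_insert_self mem_of_mem_erase mem_product mem_range mem_sigma
  mem_singleton mem_singleton_self mem_toList mem_union mem_union_left mem_univ mul_sum
  ne_of_mem_erase nodup_toList notMem_empty notMem_erase singleton_subset_iff smul_sum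
  ssubset_def subset_insert subset_union_left subset_union_right subset_univ sum_add_distrib
  sum_biUnion sum_bij' sum_comm sum_congr sum_const sum_empty sum_eq_single_of_mem sum_eq_zero
  sum_image sum_insert sum_involution sum_map_toList sum_neg_distrib sum_pair sum_product'
  sum_sigma' sum_singleton sum_union univ univ_sum_single)
open Function (update update_self update_of_ne)

noncomputable section

namespace QuadOp

universe u v w

variable {N : ℕ}

/-- The finite families of blocks. -/
local notation:max "𝓕" N:max => Finset (Block N)

/-- The block of all the leaves. -/
local notation "𝕌" => (univ : Block N)

namespace QuadraticData

variable {k : Type u} {K : Type v} [Field k] [Ring K] [Algebra k K]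
variable (Q : QuadraticData.{u, v, w} k K)

/-! ### Substitution in the free algebra -/

section Alg

variable {α β γ : Type*}

lemma lact_one (x : Q.Alg α) : Q.lact 1 x = x := by
  have : Q.lact (α := α) 1 = LinearMap.id := Q.hom_ext fun t => by
    cases t <;> simp [lact_cls, PTree.lact]
  rw [this]; rfl

lemma lact_node (a : K) (e : Q.E) (x y : Q.Alg α) :
    Q.lact a (Q.node e x y) = Q.node (a • e) x y := by
  have : (Q.node (α := α) e).compr₂ (Q.lact a) = Q.node (a • e) :=
    Q.hom_ext₂ fun s t => by simp [node_cls, lact_cls, PTree.lact]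
  rw [← this]; rfl

instance : Module K (Q.Alg α) where
  smul a x := Q.lact a x
  one_smul := Q.lact_one
  mul_smul a b x := Q.lact_mul a b x
  smul_zero a := map_zero (Q.lact a)
  smul_add a x y := map_add (Q.lact a) x y
  add_smul a b x := Q.lact_add a b x
  zero_smul x := by
    change Q.lact 0 x = 0
    simpa using Q.lact_smul (0 : k) 0 x

lemma smul_def (a : K) (x : Q.Alg α) : a • x = Q.lact a x := rfl

instance : IsScalarTower k K (Q.Alg α) := ⟨fun c a x => Q.lact_smul c a x⟩

instance (A : Finset α) : Module K (Q.P A) where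
  smul a x := Q.lactP A a x
  one_smul x := Subtype.ext (one_smul K x.1)
  mul_smul a b x := Subtype.ext (mul_smul a b x.1)
  smul_zero a := map_zero (Q.lactP A a)
  smul_add a x y := map_add (Q.lactP A a) x y
  add_smul a b x := Subtype.ext (add_smul a b x.1)
  zero_smul x := Subtype.ext (zero_smul K x.1)

instance (A : Finset α) : IsScalarTower k K (Q.P A) :=
  ⟨fun c a x => Subtype.ext (smul_assoc c a x.1)⟩

lemma smul_mem_P {A : Finset α} (a : K) {x : Q.Alg α} (hx : x ∈ Q.P A) : a • x ∈ Q.P A :=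
  Q.lact_mem a hx

lemma smul_node (a : K) (e : Q.E) (x y : Q.Alg α) :
    a • Q.node e x y = Q.node (a • e) x y := Q.lact_node a e x y

lemma node_smul_left (a : K) (e : Q.E) (x y : Q.Alg α) :
    Q.node e (a • x) y = Q.node (Q.r₁ (op a) e) x y := (Q.node_balance₁ a e x y).symm

lemma node_smul_right (a : K) (e : Q.E) (x y : Q.Alg α) :
    Q.node e x (a • y) = Q.node (Q.r₂ (op a) e) x y := (Q.node_balance₂ a e x y).symm

lemma cls_leaf (a : α) (c : K) : Q.cls (.leaf a c) = c • Q.var a := by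
  rw [smul_def, var, lact_cls]; simp [PTree.lact]

lemma subst_smulK (f : α → Q.Alg β) (a : K) (x : Q.Alg α) :
    Q.subst f (a • x) = a • Q.subst f x := by
  have : (Q.subst f).comp (Q.lact a) = (Q.lact a).comp (Q.subst f) := Q.hom_ext fun t => by
    simp [lact_cls, subst_cls, eval_lact]
  exact LinearMap.congr_fun this x

lemma subst_node (f : α → Q.Alg β) (e : Q.E) (x y : Q.Alg α) :
    Q.subst f (Q.node e x y) = Q.node e (Q.subst f x) (Q.subst f y) := by
  have : (Q.node e).compr₂ (Q.subst f) = (Q.node e).compl₁₂ (Q.subst f) (Q.subst f) :=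
    Q.hom_ext₂ fun s t => by simp [node_cls, subst_cls, eval]
  exact LinearMap.congr_fun (LinearMap.congr_fun this x) y

@[simp] lemma subst_var (f : α → Q.Alg β) (a : α) : Q.subst f (Q.var a) = f a := by
  rw [var, subst_cls, eval, lact_one]

lemma subst_subst (f : β → Q.Alg γ) (g : α → Q.Alg β) (x : Q.Alg α) :
    Q.subst f (Q.subst g x) = Q.subst (fun a => Q.subst f (g a)) x := by
  have : (Q.subst f).comp (Q.subst g) = Q.subst (fun a => Q.subst f (g a)) :=
    Q.hom_ext fun t => by
      simp only [LinearMap.comp_apply, subst_cls]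
      induction t with
      | leaf a c => simp only [eval, ← smul_def, subst_smulK]
      | node e s t hs ht => simp only [eval, subst_node, hs, ht]
  exact LinearMap.congr_fun this x

lemma eval_congr {f g : α → Q.Alg β} (t : PTree K Q.E α) (h : ∀ a ∈ t.leaves, f a = g a) :
    Q.eval f t = Q.eval g t := by
  induction t with
  | leaf a c => simp [eval, h a (by simp [PTree.leaves])]
  | node e s t hs ht =>
    rw [eval, eval, hs fun a ha => h a (Multiset.mem_add.2 (.inl ha)),
      ht fun a ha => h a (Multiset.mem_add.2 (.inr ha))]

/-- A property of linear maps can be checked on the trees that span a multigraded part. -/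
lemma eq_of_mem_multiPart {V : Type*} [AddCommGroup V] [Module k V] {M : Multiset α}
    {f g : Q.Alg α →ₗ[k] V} (h : ∀ t : PTree K Q.E α, t.leaves = M → f (Q.cls t) = g (Q.cls t))
    {x : Q.Alg α} (hx : x ∈ Q.multiPart M) : f x = g x := by
  have : Q.multiPart M ≤ LinearMap.ker (f - g) := by
    refine Submodule.span_le.2 ?_
    rintro _ ⟨t, ht, rfl⟩
    simp [h t ht]
  have := this hx
  rwa [LinearMap.mem_ker, LinearMap.sub_apply, sub_eq_zero] at this

lemma subst_congr {f g : α → Q.Alg β} {M : Multiset α} {x : Q.Alg α} (hx : x ∈ Q.multiPart M)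
    (h : ∀ a ∈ M, f a = g a) : Q.subst f x = Q.subst g x :=
  Q.eq_of_mem_multiPart (fun t ht => by
    rw [subst_cls, subst_cls]; exact Q.eval_congr t fun a ha => h a (ht ▸ ha)) hx

lemma subst_var_eq (x : Q.Alg α) : Q.subst Q.var x = x := by
  have : Q.subst (Q.var (α := α)) = LinearMap.id := Q.hom_ext fun t => by
    simp only [subst_cls, LinearMap.id_apply]
    induction t with
    | leaf a c => rw [eval, ← smul_def, cls_leaf]
    | node e s t hs ht => rw [eval, hs, ht, node_cls]
  rw [this]; rfl

lemma subst_eq_self {f : α → Q.Alg α} {M : Multiset α} {x : Q.Alg α} (hx : x ∈ Q.multiPart M)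
    (h : ∀ a ∈ M, f a = Q.var a) : Q.subst f x = x := by rw [Q.subst_congr hx h, subst_var_eq]

/-- Substitution is linear in the value of a generator that occurs exactly once. -/
lemma eval_update_linear [DecidableEq α] (f : α → Q.Alg β) (b : α) (t : PTree K Q.E α)
    (h : t.leaves.count b = 1) :
    ∃ g : Q.Alg β →ₗ[k] Q.Alg β, ∀ y, Q.eval (update f b y) t = g y := by
  induction t with
  | leaf a c =>
    have : a = b := by
      by_contra hab
      simp [PTree.leaves, Ne.symm hab] at h
    subst this
    exact ⟨Q.lact c, fun y => by simp [eval]⟩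
  | node e s t hs ht =>
    rw [PTree.leaves, Multiset.count_add] at h
    have key : ∀ (r : PTree K Q.E α), r.leaves.count b = 0 →
        ∀ y, Q.eval (update f b y) r = Q.eval f r := fun r hr y =>
      Q.eval_congr r fun a ha => by
        rw [update_of_ne]
        rintro rfl
        exact Multiset.count_eq_zero.1 hr ha
    obtain h' | h' : (s.leaves.count b = 1 ∧ t.leaves.count b = 0) ∨
        (s.leaves.count b = 0 ∧ t.leaves.count b = 1) := by omega
    · obtain ⟨g, hg⟩ := hs h'.1
      exact ⟨((Q.node e).flip (Q.eval f t)).comp g, fun y => by simp [eval, hg, key t h'.2]⟩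
    · obtain ⟨g, hg⟩ := ht h'.2
      exact ⟨(Q.node e (Q.eval f s)).comp g, fun y => by simp [eval, hg, key s h'.1]⟩

/-- The right action of a family of scalars, one for each input. -/
def ractm (a : α → K) : Q.Alg α →ₗ[k] Q.Alg α := Q.subst fun b => a b • Q.var b

lemma ractm_var (a : α → K) (b : α) : Q.ractm a (Q.var b) = a b • Q.var b := Q.subst_var _ _

lemma ractm_smul (a : α → K) (c : K) (x : Q.Alg α) : Q.ractm a (c • x) = c • Q.ractm a x :=
  Q.subst_smulK _ _ _

lemma ractm_congr {a a' : α → K} {A : Finset α} {x : Q.Alg α} (hx : x ∈ Q.P A)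
    (h : ∀ b ∈ A, a b = a' b) : Q.ractm a x = Q.ractm a' x :=
  Q.subst_congr hx fun b hb => by rw [h b hb]

lemma ractm_one (x : Q.Alg α) : Q.ractm 1 x = x := by
  have : (fun b : α => (1 : α → K) b • Q.var b) = Q.var := by funext b; simp
  rw [ractm, this, subst_var_eq]

lemma ractm_ractm (a b : α → K) (x : Q.Alg α) :
    Q.ractm a (Q.ractm b x) = Q.ractm (b * a) x := by
  rw [ractm, ractm, subst_subst, ractm]
  congr 2
  funext c
  rw [subst_smulK, subst_var, ← mul_smul]
  rfl

lemma ractm_mem {A : Finset α} {x : Q.Alg α} (a : α → K) (hx : x ∈ Q.P A) :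
    Q.ractm a x ∈ Q.P A := by
  have h := Q.subst_mem (fun b => a b • Q.var b) (fun b => {b}) hx
    (fun b _ => Q.lact_mem _ (Q.var_mem b))
  have e : A.val.bind (fun b => {b}) = A.val := by
    rw [Multiset.bind_singleton (f := fun b => b), Multiset.map_id']
  rw [e] at h
  exact h

/-- The generator coefficient: `c • var a` is mapped to `c`, and composites of positive
arity are mapped to zero. It shows that P(1) = K. -/
def coef : Q.Alg α →ₗ[k] K :=
  Q.liftₗ (fun t => match t with | .leaf _ c => c | .node _ _ _ => 0) fun x hx => by
    cases hx with
    | quad l hl t =>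
      simp [linearCombination_list_sum]
    | left e t x hx =>
      rw [Finsupp.linearCombination_mapDomain]
      simp [Function.comp_def, Finsupp.linearCombination_apply]
    | right e s x hx =>
      rw [Finsupp.linearCombination_mapDomain]
      simp [Function.comp_def, Finsupp.linearCombination_apply]
    | _ => simp

lemma coef_smul_var (c : K) (a : α) : Q.coef (c • Q.var a) = c := by
  rw [← cls_leaf]; exact Q.liftₗ_cls _ _ _

lemma mem_P_singleton {a : α} {x : Q.Alg α} : x ∈ Q.P {a} ↔ ∃ c : K, x = c • Q.var a := by
  constructor
  · intro hx
    refine ⟨Q.coef x, ?_⟩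
    let g : Q.Alg α →ₗ[k] Q.Alg α :=
      { toFun := fun x => Q.coef x • Q.var a
        map_add' := fun x y => by simp [add_smul]
        map_smul' := fun c x => by simp }
    refine Q.eq_of_mem_multiPart (f := LinearMap.id) (g := g) (fun t ht => ?_) hx
    cases t with
    | leaf b c =>
      have : b = a := by simpa [PTree.leaves] using ht
      subst this
      change _ = Q.coef _ • Q.var b
      rw [cls_leaf, coef_smul_var]; rfl
    | node e s t =>
      exfalso
      have h : ∀ t : PTree K Q.E α, 1 ≤ t.leaves.card := by
        intro t
        induction t with
        | leaf => simp [PTree.leaves]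
        | node e s t hs ht => rw [PTree.leaves, Multiset.card_add]; omega
      have := congrArg Multiset.card ht
      rw [PTree.leaves, Multiset.card_add] at this
      have h1 := h s
      have h2 := h t
      simp at this
      omega
  · rintro ⟨c, rfl⟩
    exact Q.smul_mem_P c (Q.var_mem a)

variable [DecidableEq α]

lemma subst_update_add {f : α → Q.Alg β} {b : α} {A : Finset α} (hb : b ∈ A) {x : Q.Alg α}
    (hx : x ∈ Q.P A) (y y' : Q.Alg β) :
    Q.subst (update f b (y + y')) x
      = Q.subst (update f b y) x + Q.subst (update f b y') x := by
  refine Q.eq_of_mem_multiPart (f := Q.subst (update f b (y + y')))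
    (g := Q.subst (update f b y) + Q.subst (update f b y')) (fun t ht => ?_) hx
  obtain ⟨g, hg⟩ := Q.eval_update_linear f b t
    (by rw [ht]; exact Multiset.count_eq_one_of_mem A.nodup hb)
  simp [subst_cls, hg]

lemma subst_update_smul {f : α → Q.Alg β} {b : α} {A : Finset α} (hb : b ∈ A) {x : Q.Alg α}
    (hx : x ∈ Q.P A) (c : k) (y : Q.Alg β) :
    Q.subst (update f b (c • y)) x = c • Q.subst (update f b y) x := by
  refine Q.eq_of_mem_multiPart (f := Q.subst (update f b (c • y)))
    (g := c • Q.subst (update f b y)) (fun t ht => ?_) hx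
  obtain ⟨g, hg⟩ := Q.eval_update_linear f b t
    (by rw [ht]; exact Multiset.count_eq_one_of_mem A.nodup hb)
  simp [subst_cls, hg]

lemma plug_eq (a : α) (y : Q.Alg α) : Q.plug a y = Q.subst (update Q.var a y) := by
  unfold plug
  congr 1
  funext b
  by_cases h : b = a <;> simp [h]

lemma plug_add {a : α} {A : Finset α} (ha : a ∈ A) {x : Q.Alg α} (hx : x ∈ Q.P A)
    (y y' : Q.Alg α) : Q.plug a (y + y') x = Q.plug a y x + Q.plug a y' x := by
  simp only [plug_eq]; exact Q.subst_update_add ha hx y y'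

lemma plug_smul {a : α} {A : Finset α} (ha : a ∈ A) {x : Q.Alg α} (hx : x ∈ Q.P A)
    (c : k) (y : Q.Alg α) : Q.plug a (c • y) x = c • Q.plug a y x := by
  simp only [plug_eq]; exact Q.subst_update_smul ha hx c y

lemma plug_smulK (a : α) (c : K) (x y : Q.Alg α) : Q.plug a y (c • x) = c • Q.plug a y x :=
  Q.subst_smulK _ _ _

lemma ract_eq (b : α) (c : K) : Q.ract b c = Q.ractm (update 1 b c) := by
  unfold ract ractm
  rw [plug_eq]
  congr 1
  funext x
  by_cases h : x = b
  · subst h; simp [cls_leaf]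
  · simp [h]

lemma ractm_update_add {A : Finset α} {x : Q.Alg α} (hx : x ∈ Q.P A) {b : α} (hb : b ∈ A)
    (a : α → K) (c c' : K) : Q.ractm (update a b (c + c')) x
      = Q.ractm (update a b c) x + Q.ractm (update a b c') x := by
  have key : ∀ c, Q.ractm (update a b c)
      = Q.subst (update (fun b => a b • Q.var b) b (c • Q.var b)) := by
    intro c
    unfold ractm
    congr 1
    funext d
    by_cases h : d = b
    · subst h; simp
    · simp [h]
  rw [key, key, key, add_smul, Q.subst_update_add hb hx]

lemma ract_mul (b : α) (c d : K) (x : Q.Alg α) :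
    Q.ract b d (Q.ract b c x) = Q.ract b (c * d) x := by
  rw [ract_eq, ract_eq, ract_eq, ractm_ractm]
  congr 2
  funext y
  by_cases h : y = b
  · subst h; simp
  · simp [h]

lemma ract_one (b : α) (x : Q.Alg α) : Q.ract b 1 x = x := by
  rw [ract_eq, show update (1 : α → K) b 1 = 1 from Function.update_eq_self b (1 : α → K), ractm_one]

lemma ract_smulK (b : α) (c d : K) (x : Q.Alg α) : Q.ract b c (d • x) = d • Q.ract b c x :=
  Q.subst_smulK _ _ _

lemma ract_add {A : Finset α} {x : Q.Alg α} (hx : x ∈ Q.P A) {b : α} (hb : b ∈ A) (c d : K) :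
    Q.ract b (c + d) x = Q.ract b c x + Q.ract b d x := by
  simp only [ract_eq]; exact Q.ractm_update_add hx hb 1 c d

lemma ract_algebraMap {A : Finset α} {x : Q.Alg α} (hx : x ∈ Q.P A) {b : α} (hb : b ∈ A)
    (c : k) : Q.ract b (algebraMap k K c) x = c • x := by
  have h := Q.plug_smul hb hx c (Q.var b)
  rw [plug_eq, plug_eq, Function.update_eq_self, subst_var_eq] at h
  rw [← h, ract, cls_leaf, plug_eq, algebraMap_smul]

lemma plug_smul_eq_ract (b : α) (a : K) (x y : Q.Alg α) :
    Q.plug b (a • y) x = Q.plug b y (Q.ract b a x) := by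
  rw [ract_eq, ractm, plug_eq, plug_eq, subst_subst]
  congr 2
  funext c
  by_cases h : c = b
  · subst h; simp [subst_smulK]
  · simp [h]
end Alg

/-! ### Finite-dimensionality -/

section Finite

variable {α : Type*}

/-- The binary operations, as a linear map in the operation. -/
def nodeₗ : Q.E →ₗ[k] Q.Alg α →ₗ[k] Q.Alg α →ₗ[k] Q.Alg α where
  toFun := Q.node
  map_add' := Q.node_add
  map_smul' := Q.node_smul

lemma fg_multiPart [FiniteDimensional k K] [FiniteDimensional k Q.E] (M : Multiset α) :
    (Q.multiPart M).FG := by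
  classical
  induction h : M.card using Nat.strong_induction_on generalizing M with
  | _ n ih =>
    subst h
    let S : Multiset α × Multiset α → Submodule k (Q.Alg α) := fun p =>
      if p.1.card < M.card ∧ p.2.card < M.card then
        Submodule.map₂ (TensorProduct.lift (Q.nodeₗ (α := α)) : _ →ₗ[k] _ →ₗ[k] _)
          (Submodule.map₂ (TensorProduct.mk k Q.E (Q.Alg α)) ⊤ (Q.multiPart p.1))
          (Q.multiPart p.2)
      else ⊥
    let L : α → Submodule k (Q.Alg α) := fun a =>
      LinearMap.range ((LinearMap.toSpanSingleton K (Q.Alg α) (Q.var a)).restrictScalars k)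
    have hfg : ((⨆ p ∈ M.antidiagonal.toFinset, S p) ⊔ ⨆ a ∈ M.toFinset, L a).FG := by
      refine Submodule.FG.sup (Submodule.fg_biSup _ _ fun p _ => ?_)
        (Submodule.fg_biSup _ _ fun a _ => ?_)
      · by_cases hp : p.1.card < M.card ∧ p.2.card < M.card
        · simp only [S, if_pos hp]
          exact ((Module.Finite.fg_top (R := k) (M := Q.E)).map₂ _ (ih _ hp.1 _ rfl)).map₂ _
            (ih _ hp.2 _ rfl)
        · simp only [S, if_neg hp]; exact Submodule.fg_bot
      · simp only [L]
        rw [LinearMap.range_eq_map]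
        exact (Module.Finite.fg_top (R := k) (M := K)).map _
    have hle : Q.multiPart M ≤ (⨆ p ∈ M.antidiagonal.toFinset, S p) ⊔ ⨆ a ∈ M.toFinset, L a := by
      refine Submodule.span_le.2 ?_
      rintro _ ⟨t, ht, rfl⟩
      cases t with
      | leaf a c =>
        refine Submodule.mem_sup_right (Submodule.mem_iSup_of_mem a
          (Submodule.mem_iSup_of_mem ?_ ⟨c, ?_⟩))
        · rw [← ht]; simp [PTree.leaves]
        · rw [cls_leaf]; rfl
      | node e s t =>
        have h : ∀ t : PTree K Q.E α, 1 ≤ t.leaves.card := by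
          intro t
          induction t with
          | leaf => simp [PTree.leaves]
          | node e s t hs ht => rw [PTree.leaves, Multiset.card_add]; omega
        have hc := congrArg Multiset.card ht
        rw [PTree.leaves, Multiset.card_add] at hc
        have h1 := h s
        have h2 := h t
        refine Submodule.mem_sup_left (Submodule.mem_iSup_of_mem (s.leaves, t.leaves)
          (Submodule.mem_iSup_of_mem ?_ ?_))
        · rw [Multiset.mem_toFinset, Multiset.mem_antidiagonal]; exact ht
        · simp only [S]
          rw [if_pos ⟨by omega, by omega⟩, ← node_cls]
          exact Submodule.apply_mem_map₂ _
            (Submodule.apply_mem_map₂ _ Submodule.mem_top (Q.cls_mem s)) (Q.cls_mem t)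
    have : IsNoetherian k ↥((⨆ p ∈ M.antidiagonal.toFinset, S p) ⊔ ⨆ a ∈ M.toFinset, L a) :=
      isNoetherian_of_fg_of_noetherian _ hfg
    exact Submodule.FG.of_le hfg hle

instance [FiniteDimensional k K] [FiniteDimensional k Q.E] (A : Finset α) :
    FiniteDimensional k (Q.P A) := Module.Finite.iff_fg.2 (Q.fg_multiPart A.val)

end Finite

end QuadraticData

/-! ### Trees on a block -/

/-- The inputs of the vertex `v` of the laminar family `V`: the maximal edges strictly inside
`v`. -/
def inp (V : 𝓕 N) (v : Block N) : 𝓕 N :=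
  (V ∪ RTree.leafEdges N).filter fun u => u ⊂ v ∧ ∀ w ∈ V, w ⊂ v → ¬ u ⊂ w

/-- The laminar family `V` is a reduced tree with the set of leaves `A`. The empty family is the
tree without vertices on a one-element set. -/
structure IsTree (A : Block N) (V : 𝓕 N) : Prop where
  sub : ∀ v ∈ V, v ⊆ A
  top : 2 ≤ A.card → A ∈ V
  two : ∀ v ∈ V, 2 ≤ v.card
  lam : ∀ u ∈ V, ∀ v ∈ V, u ⊆ v ∨ v ⊆ u ∨ Disjoint u v

/-- The family `P` is a partition of `A` into at least two nonempty blocks. -/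
structure IsPart (A : Block N) (P : 𝓕 N) : Prop where
  sub : ∀ b ∈ P, b ⊆ A
  nonempty : ∀ b ∈ P, b.Nonempty
  disj : ∀ a ∈ P, ∀ b ∈ P, a ≠ b → Disjoint a b
  cover : ∀ x ∈ A, ∃ b ∈ P, x ∈ b
  two : 2 ≤ P.card

/-- The edges strictly inside `A`. -/
def eA (A : Block N) (V : 𝓕 N) : 𝓕 N :=
  (V ∪ RTree.leafEdges N).filter (· ⊂ A)

lemma mem_leafEdges {u : Block N} : u ∈ RTree.leafEdges N ↔ ∃ i, {i} = u := by
  simp [RTree.leafEdges]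

lemma mem_inp {V : 𝓕 N} {u v : Block N} : u ∈ inp V v ↔
    (u ∈ V ∨ ∃ i, {i} = u) ∧ u ⊂ v ∧ ∀ w ∈ V, w ⊂ v → ¬ u ⊂ w := by simp [inp, mem_leafEdges]

lemma mem_eA {A : Block N} {V : 𝓕 N} {u : Block N} :
    u ∈ eA A V ↔ (u ∈ V ∨ ∃ i, {i} = u) ∧ u ⊂ A := by simp [eA, mem_leafEdges]

lemma inp_subset_eA {V : 𝓕 N} {A : Block N} : inp V A ⊆ eA A V := fun _ hu =>
  mem_eA.2 ⟨(mem_inp.1 hu).1, (mem_inp.1 hu).2.1⟩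

lemma eA_filter (V : 𝓕 N) (b : Block N) : eA b (V.filter (· ⊆ b)) = eA b V := by
  ext u
  simp only [mem_eA, mem_filter]
  constructor
  · rintro ⟨h1, h2⟩; exact ⟨h1.imp_left And.left, h2⟩
  · grind

lemma inp_filter (V : 𝓕 N) {b v : Block N} (h : v ⊆ b) :
    inp (V.filter (· ⊆ b)) v = inp V v := by
  ext u
  simp only [mem_inp, mem_filter]
  constructor
  · grind
  · grind

lemma isPart_setPart {π : SetPart N} (h : 2 ≤ π.parts.card) :
    IsPart univ π.parts where
  sub b _ := subset_univ b
  nonempty b hb := π.nonempty_of_mem_parts hb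
  disj a ha b hb hab := Finpartition.disjoint π ha hb hab
  cover x _ := by
    obtain ⟨b, ⟨hb, hx⟩, -⟩ := π.existsUnique_mem (mem_univ x)
    exact ⟨b, hb, hx⟩
  two := h

namespace IsPart

variable {A : Block N} {P : 𝓕 N} (hP : IsPart A P)
include hP

lemma eq_of_subset {b c u : Block N} (hb : b ∈ P) (hc : c ∈ P) (hu : u.Nonempty) (h : u ⊆ b)
    (h' : u ⊆ c) : b = c := by
  by_contra hbc
  obtain ⟨x, hx⟩ := hu
  exact disjoint_left.1 (hP.disj b hb c hc hbc) (h hx) (h' hx)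

lemma ssubset {b : Block N} (hb : b ∈ P) : b ⊂ A := by
  refine lt_of_le_of_ne (hP.sub b hb) ?_
  rintro rfl
  have h1 : P ⊆ {b} := fun c hc => mem_singleton.2
    (hP.eq_of_subset hc hb (hP.nonempty c hc) le_rfl (hP.sub c hc))
  have := card_le_card h1
  have := hP.two
  simp at *
  omega

lemma two_le_card : 2 ≤ A.card := by
  have h1 : P.card ≤ A.card := by
    have : ∀ b, ∃ x : Fin N, b ∈ P → x ∈ b := fun b => by
      by_cases hb : b ∈ P
      · obtain ⟨x, hx⟩ := hP.nonempty b hb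
        exact ⟨x, fun _ => hx⟩
      · obtain ⟨c, hc⟩ : P.Nonempty := card_pos.1 (by have := hP.two; omega)
        obtain ⟨x, -⟩ := hP.nonempty c hc
        exact ⟨x, fun h => absurd h hb⟩
    choose f hf using this
    refine Finset.card_le_card_of_injOn f (fun b hb => hP.sub b hb (hf b hb)) ?_
    intro b hb c hc h
    exact hP.eq_of_subset hb hc (Finset.singleton_nonempty (f b))
      (by simpa using hf b hb) (by simpa [h] using hf c hc)
  exact hP.two.trans h1

lemma sum_card : ∑ b ∈ P, b.card = A.card := by
  rw [← card_biUnion fun a ha b hb => hP.disj a ha b hb]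
  congr 1
  ext x
  simp only [mem_biUnion]
  exact ⟨fun ⟨b, hb, hx⟩ => hP.sub b hb hx, hP.cover x⟩

end IsPart

lemma inp_cover {V : 𝓕 N} {v : Block N} {u : Block N} (hu : u ∈ V ∨ ∃ i, {i} = u)
    (huv : u ⊂ v) : ∃ w ∈ inp V v, u ⊆ w := by
  have hne : ((V ∪ RTree.leafEdges N).filter fun w => w ⊂ v ∧ u ⊆ w).Nonempty :=
    ⟨u, by simp [mem_leafEdges, huv, hu]⟩
  obtain ⟨w, hw, hmax⟩ := Finset.exists_max_image _ Finset.card hne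
  obtain ⟨hw1, hw2, hw3⟩ := mem_filter.1 hw
  refine ⟨w, mem_inp.2 ⟨by simpa [mem_leafEdges] using hw1, hw2, fun z hz hzv hwz => ?_⟩, hw3⟩
  have := hmax z (mem_filter.2 ⟨mem_union_left _ hz, hzv, hw3.trans hwz.1⟩)
  exact absurd (card_lt_card hwz) (by omega)

lemma inp_erase_of_notMem {V : 𝓕 N} {e v : Block N} (heV : e ∈ V) (hv : v ≠ e)
    (h : e ∉ inp V v) : inp (V.erase e) v = inp V v := by
  ext u
  simp only [mem_inp, mem_erase]
  constructor
  · rintro ⟨hu, huv, hmax⟩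
    refine ⟨hu.imp_left And.right, huv, fun w hw hwv huw => ?_⟩
    by_cases hwe : w = e
    · subst hwe
      refine h (mem_inp.2 ⟨.inl hw, hwv, fun w' hw' hw'v hww' => ?_⟩)
      exact hmax w' ⟨fun h => by subst h; exact absurd hww' (lt_irrefl _), hw'⟩ hw'v
        (huw.trans hww')
    · exact hmax w ⟨hwe, hw⟩ hwv huw
  · rintro ⟨hu, huv, hmax⟩
    refine ⟨hu.imp_left fun hu' => ⟨?_, hu'⟩, huv, fun w hw => hmax w hw.2⟩
    rintro rfl
    exact h (mem_inp.2 ⟨hu, huv, hmax⟩)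

lemma notMem_inp_of_mem_inp {V : 𝓕 N} {e v u : Block N} (h : e ∈ inp V v) (heV : e ∈ V)
    (hu : u ∈ inp V e) : u ∉ inp V v := fun h' =>
  (mem_inp.1 h').2.2 e heV (mem_inp.1 h).2.1 (mem_inp.1 hu).2.1

lemma disjoint_inp {V : 𝓕 N} {e v : Block N} (heV : e ∈ V) (h : e ∈ inp V v) :
    Disjoint ((inp V v).erase e) (inp V e) :=
  disjoint_left.2 fun _ hu hu' =>
    notMem_inp_of_mem_inp h heV hu' (mem_of_mem_erase hu)

lemma mem_eA_iff {A : Block N} {V : 𝓕 N} {u : Block N} :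
    u ∈ eA A V ↔ u ∈ inp V A ∨ ∃ b ∈ inp V A, u ∈ eA b V := by
  constructor
  · intro hu
    obtain ⟨h1, h2⟩ := mem_eA.1 hu
    obtain ⟨w, hw, huw⟩ := inp_cover h1 h2
    by_cases h : u = w
    · exact .inl (h ▸ hw)
    · exact .inr ⟨w, hw, mem_eA.2 ⟨h1, lt_of_le_of_ne huw h⟩⟩
  · rintro (h | ⟨b, hb, h⟩)
    · exact inp_subset_eA h
    · exact mem_eA.2 ⟨(mem_eA.1 h).1, (mem_eA.1 h).2.trans (mem_inp.1 hb).2.1⟩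

namespace IsTree

variable {A : Block N} {V : 𝓕 N} (hV : IsTree A V)
include hV

lemma edge_nonempty {u : Block N} (hu : u ∈ V ∨ ∃ i, {i} = u) : u.Nonempty := by
  rcases hu with h | ⟨i, rfl⟩
  · exact card_pos.1 (by have := hV.two u h; omega)
  · simp

lemma inp_disj {v a b : Block N} (ha : a ∈ inp V v) (hb : b ∈ inp V v) (hab : a ≠ b) :
    Disjoint a b := by
  obtain ⟨ha1, ha2, ha3⟩ := mem_inp.1 ha
  obtain ⟨hb1, hb2, hb3⟩ := mem_inp.1 hb
  rcases ha1 with h | ⟨i, rfl⟩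
  · rcases hb1 with h' | ⟨j, rfl⟩
    · rcases hV.lam a h b h' with h1 | h1 | h1
      · exact absurd (lt_of_le_of_ne h1 hab) (ha3 b h' hb2)
      · exact absurd (lt_of_le_of_ne h1 hab.symm) (hb3 a h ha2)
      · exact h1
    · refine Finset.disjoint_singleton_right.2 fun hj => ?_
      exact hb3 a h ha2 (lt_of_le_of_ne (singleton_subset_iff.2 hj) hab.symm)
  · rcases hb1 with h' | ⟨j, rfl⟩
    · refine disjoint_singleton_left.2 fun hj => ?_
      exact ha3 b h' hb2 (lt_of_le_of_ne (singleton_subset_iff.2 hj) hab)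
    · simpa using fun h => hab (by rw [h])

lemma isPart_inp {v : Block N} (hv : v ∈ V) : IsPart v (inp V v) where
  sub b hb := (mem_inp.1 hb).2.1.1
  nonempty b hb := hV.edge_nonempty (mem_inp.1 hb).1
  disj a ha b hb := hV.inp_disj ha hb
  cover x hx := by
    have : ({x} : Block N) ⊂ v := lt_of_le_of_ne (singleton_subset_iff.2 hx) (by
      rintro rfl
      have := hV.two _ hv
      simp at this)
    obtain ⟨w, hw, h⟩ := inp_cover (.inr ⟨x, rfl⟩) this
    exact ⟨w, hw, h (by simp)⟩
  two := by
    by_contra hcon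
    have h1 : ∀ x ∈ v, ∃ w ∈ inp V v, x ∈ w := fun x hx => by
      have : ({x} : Block N) ⊂ v := lt_of_le_of_ne (singleton_subset_iff.2 hx) (by
        rintro rfl
        have := hV.two _ hv
        simp at this)
      obtain ⟨w, hw, h⟩ := inp_cover (.inr ⟨x, rfl⟩) this
      exact ⟨w, hw, h (by simp)⟩
    obtain ⟨x, hx⟩ := hV.edge_nonempty (.inl hv)
    obtain ⟨w, hw, -⟩ := h1 x hx
    have h2 : v ⊆ w := fun y hy => by
      obtain ⟨z, hz, hyz⟩ := h1 y hy
      rwa [card_le_one.1 (by omega) w hw z hz]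
    exact (mem_inp.1 hw).2.1.2 h2

lemma inp_subset_inp {v w : Block N} {u : Block N} (hu : u ∈ inp V v) (huw : u ∈ inp V w)
    (hv : v ∈ V) (hw : w ∈ V) : v = w := by
  obtain ⟨h1, h2, h3⟩ := mem_inp.1 hu
  obtain ⟨-, h5, h6⟩ := mem_inp.1 huw
  by_contra hne
  rcases hV.lam v hv w hw with h | h | h
  · exact h6 v hv (lt_of_le_of_ne h hne) h2
  · exact h3 w hw (lt_of_le_of_ne h (Ne.symm hne)) h5
  · obtain ⟨x, hx⟩ := hV.edge_nonempty h1
    exact disjoint_left.1 h (h2.1 hx) (h5.1 hx)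

lemma exists_parent {e : Block N} (he : e ∈ V) (heA : e ≠ A) : ∃ w ∈ V, e ∈ inp V w := by
  have hA : A ∈ V := hV.top ((hV.two e he).trans (card_le_card (hV.sub e he)))
  have hne : (V.filter fun w => e ⊂ w).Nonempty :=
    ⟨A, mem_filter.2 ⟨hA, lt_of_le_of_ne (hV.sub e he) heA⟩⟩
  obtain ⟨w, hw, hmin⟩ := exists_min_image _ Finset.card hne
  obtain ⟨hw1, hw2⟩ := mem_filter.1 hw
  refine ⟨w, hw1, mem_inp.2 ⟨.inl he, hw2, fun z hz hzw hez => ?_⟩⟩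
  have := hmin z (mem_filter.2 ⟨hz, hez⟩)
  exact absurd (card_lt_card hzw) (by omega)

lemma erase {e : Block N} (heA : e ≠ A) : IsTree A (V.erase e) where
  sub v hv := hV.sub v (mem_of_mem_erase hv)
  top h := mem_erase.2 ⟨heA.symm, hV.top h⟩
  two v hv := hV.two v (mem_of_mem_erase hv)
  lam u hu v hv := hV.lam u (mem_of_mem_erase hu) v (mem_of_mem_erase hv)

lemma inp_erase_of_mem {e v : Block N} (heV : e ∈ V) (h : e ∈ inp V v) :
    inp (V.erase e) v = (inp V v).erase e ∪ inp V e := by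
  obtain ⟨-, hev, hemax⟩ := mem_inp.1 h
  ext u
  simp only [mem_inp, mem_erase, mem_union]
  constructor
  · rintro ⟨hu, huv, hmax⟩
    have hu' := hu.imp_left And.right
    by_cases hue : u ⊂ e
    · grind
    · refine .inl ⟨?_, hu', huv, fun w hw hwv huw => ?_⟩
      · rintro rfl
        rcases hu with hu | ⟨i, hi⟩
        · exact hu.1 rfl
        · have := hV.two _ heV
          rw [← hi] at this; simp at this
      · grind
  · rintro (⟨hue, hu, huv, hmax⟩ | ⟨hu, hue, hmax⟩)
    · grind
    · refine ⟨hu.imp_left fun h => ⟨fun h' => ?_, h⟩, hue.trans hev, ?_⟩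
      · subst h'; exact absurd hue (lt_irrefl _)
      · rintro w ⟨hwe, hw⟩ hwv huw
        obtain ⟨x, hx⟩ := hV.edge_nonempty hu
        rcases hV.lam w hw e heV with h1 | h1 | h1
        · exact hmax w hw (lt_of_le_of_ne h1 hwe) huw
        · exact hemax w hw hwv (lt_of_le_of_ne h1 (Ne.symm hwe))
        · exact disjoint_left.1 h1 (huw.1 hx) (hue.1 hx)

lemma filter {b : Block N} (hb : b ∈ V ∨ ∃ i, {i} = b) : IsTree b (V.filter (· ⊆ b)) where
  sub v hv := (mem_filter.1 hv).2
  top h := by grind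
  two v hv := hV.two v (mem_filter.1 hv).1
  lam u hu v hv := hV.lam u (mem_filter.1 hu).1 v (mem_filter.1 hv).1

lemma eA_erase {e : Block N} (he : e ∈ V) : eA A (V.erase e) = (eA A V).erase e := by
  ext u
  simp only [mem_eA, mem_erase]
  constructor
  · rintro ⟨h1 | ⟨i, rfl⟩, h2⟩
    · exact ⟨h1.1, .inl h1.2, h2⟩
    · refine ⟨?_, .inr ⟨i, rfl⟩, h2⟩
      rintro rfl
      have := hV.two _ he
      simp at this
  · grind

lemma card_eA (h : 2 ≤ A.card) : (eA A V).card + 1 = V.card + A.card := by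
  have h1 : eA A V = V.erase A ∪ A.image (fun i => ({i} : Block N)) := by
    ext u
    simp only [mem_eA, mem_union, mem_erase, mem_image]
    constructor
    · grind
    · rintro (⟨h1, h2⟩ | ⟨i, hi, rfl⟩)
      · exact ⟨.inl h2, lt_of_le_of_ne (hV.sub u h2) h1⟩
      · grind
  have h2 : Disjoint (V.erase A) (A.image (fun i => ({i} : Block N))) := by
    refine disjoint_left.2 fun u hu hu' => ?_
    obtain ⟨i, -, rfl⟩ := mem_image.1 hu'
    have := hV.two _ (mem_of_mem_erase hu)
    simp at this
  rw [h1, card_union_of_disjoint h2, card_erase_of_mem (hV.top h),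
    Finset.card_image_of_injective _ Finset.singleton_injective]
  have := card_pos.2 ⟨A, hV.top h⟩
  omega

lemma eq_empty (h : A.card ≤ 1) : V = ∅ := by
  refine eq_empty_of_forall_notMem fun v hv => ?_
  have := hV.two v hv
  have := card_le_card (hV.sub v hv)
  omega

end IsTree

/-- The tree on `A` with the branches `W b`, for the blocks `b` of a partition of `A`. -/
def glueV (A : Block N) (P : 𝓕 N) (W : Block N → 𝓕 N) :
    𝓕 N := insert A (P.biUnion W)

section Glue

variable {A : Block N} {P : 𝓕 N} {W : Block N → 𝓕 N}

lemma mem_glueV {u : Block N} : u ∈ glueV A P W ↔ u = A ∨ ∃ b ∈ P, u ∈ W b := by simp [glueV]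

lemma glueV_isTree (hP : IsPart A P) (hW : ∀ b ∈ P, IsTree b (W b)) :
    IsTree A (glueV A P W) where
  sub v hv := by
    rcases mem_glueV.1 hv with rfl | ⟨b, hb, h⟩
    exacts [le_rfl, ((hW b hb).sub v h).trans (hP.sub b hb)]
  top _ := mem_glueV.2 (.inl rfl)
  two v hv := by
    rcases mem_glueV.1 hv with rfl | ⟨b, hb, h⟩
    exacts [hP.two_le_card, (hW b hb).two v h]
  lam u hu v hv := by
    rcases mem_glueV.1 hv with rfl | ⟨b, hb, h⟩
    · rcases mem_glueV.1 hu with rfl | ⟨c, hc, h'⟩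
      exacts [.inl le_rfl, .inl (((hW c hc).sub u h').trans (hP.sub c hc))]
    · rcases mem_glueV.1 hu with rfl | ⟨c, hc, h'⟩
      · exact .inr (.inl (((hW b hb).sub v h).trans (hP.sub b hb)))
      · by_cases hbc : b = c
        · subst hbc; exact (hW b hb).lam u h' v h
        · exact .inr (.inr (Disjoint.mono ((hW c hc).sub u h') ((hW b hb).sub v h)
            (hP.disj c hc b hb (Ne.symm hbc))))

lemma notMem_of_part (hP : IsPart A P) (hW : ∀ b ∈ P, IsTree b (W b)) {b : Block N}
    (hb : b ∈ P) : A ∉ W b := fun h => (hP.ssubset hb).2 ((hW b hb).sub A h)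

lemma glueV_filter (hP : IsPart A P) (hW : ∀ b ∈ P, IsTree b (W b)) {b : Block N} (hb : b ∈ P) :
    (glueV A P W).filter (· ⊆ b) = W b := by
  ext u
  simp only [mem_filter, mem_glueV]
  constructor
  · rintro ⟨rfl | ⟨c, hc, h⟩, h'⟩
    · exact absurd h' (hP.ssubset hb).2
    · rwa [hP.eq_of_subset hb hc ((hW c hc).edge_nonempty (.inl h)) h' ((hW c hc).sub u h)]
  · exact fun h => ⟨.inr ⟨b, hb, h⟩, (hW b hb).sub u h⟩

lemma mem_edge_of_part (hP : IsPart A P) (hW : ∀ b ∈ P, IsTree b (W b)) {b : Block N}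
    (hb : b ∈ P) : b ∈ W b ∨ ∃ i, {i} = b := by
  by_cases h : 2 ≤ b.card
  · exact .inl ((hW b hb).top h)
  · obtain ⟨i, hi⟩ := card_eq_one.1 (le_antisymm (by omega : b.card ≤ 1)
      (card_pos.2 (hP.nonempty b hb)))
    exact .inr ⟨i, hi.symm⟩

lemma glueV_inp (hP : IsPart A P) (hW : ∀ b ∈ P, IsTree b (W b)) : inp (glueV A P W) A = P := by
  have hT := glueV_isTree hP hW
  have hsub : P ⊆ inp (glueV A P W) A := fun b hb => by
    refine mem_inp.2 ⟨(mem_edge_of_part hP hW hb).imp_left fun h => mem_glueV.2 (.inr ⟨b, hb, h⟩),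
      hP.ssubset hb, fun w hw hwA hbw => ?_⟩
    rcases mem_glueV.1 hw with rfl | ⟨c, hc, h⟩
    · exact absurd hwA (lt_irrefl _)
    · have h1 := (hW c hc).sub w h
      have := hP.eq_of_subset hb hc (hP.nonempty b hb) le_rfl (hbw.1.trans h1)
      subst this
      exact hbw.2 h1
  refine (Finset.Subset.antisymm hsub fun u hu => ?_).symm
  obtain ⟨x, hx⟩ := hT.edge_nonempty (mem_inp.1 hu).1
  obtain ⟨b, hb, hxb⟩ := hP.cover x ((mem_inp.1 hu).2.1.1 hx)
  by_cases h : u = b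
  · rwa [h]
  · exact absurd hxb (disjoint_left.1 (hT.inp_disj hu (hsub hb) h) hx)

lemma glueV_inp_of_mem (hP : IsPart A P) (hW : ∀ b ∈ P, IsTree b (W b)) {b v : Block N}
    (hb : b ∈ P) (hv : v ∈ W b) : inp (glueV A P W) v = inp (W b) v := by
  rw [← glueV_filter hP hW hb, inp_filter _ ((hW b hb).sub v hv)]

lemma glueV_congr {W' : Block N → 𝓕 N} (h : ∀ b ∈ P, W b = W' b) :
    glueV A P W = glueV A P W' := by rw [glueV, glueV, biUnion_congr rfl h]

lemma IsTree.eq_glueV {V : 𝓕 N} (hV : IsTree A V) (hA : A ∈ V) :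
    glueV A (inp V A) (fun b => V.filter (· ⊆ b)) = V := by
  ext u
  simp only [mem_glueV, mem_filter]
  constructor
  · rintro (rfl | ⟨b, hb, h⟩)
    exacts [hA, h.1]
  · intro hu
    by_cases h : u = A
    · exact .inl h
    · obtain ⟨w, hw, h'⟩ := inp_cover (.inl hu) (lt_of_le_of_ne (hV.sub u hu) h)
      exact .inr ⟨w, hw, hu, h'⟩

lemma card_glueV (hP : IsPart A P) (hW : ∀ b ∈ P, IsTree b (W b)) :
    (glueV A P W).card = 1 + ∑ b ∈ P, (W b).card := by
  rw [glueV, card_insert_of_notMem, card_biUnion, add_comm]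
  · intro b hb c hc hbc
    refine disjoint_left.2 fun u hu hu' => hbc ?_
    exact hP.eq_of_subset hb hc ((hW b hb).edge_nonempty (.inl hu)) ((hW b hb).sub u hu)
      ((hW c hc).sub u hu')
  · simp only [mem_biUnion, not_exists, not_and]
    exact fun b hb => notMem_of_part hP hW hb

lemma IsTree.card_le {V : 𝓕 N} (hV : IsTree A V) (hA : A.Nonempty) :
    V.card + 1 ≤ A.card := by
  induction h : A.card using Nat.strong_induction_on generalizing A V with
  | _ c ih =>
    subst h
    by_cases h2 : 2 ≤ A.card
    · have hA' := hV.top h2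
      have hP := hV.isPart_inp hA'
      have hW : ∀ b ∈ inp V A, IsTree b (V.filter (· ⊆ b)) := fun b hb =>
        hV.filter (mem_inp.1 hb).1
      rw [← hV.eq_glueV hA', card_glueV hP hW]
      have h3 : ∑ b ∈ inp V A, ((V.filter (· ⊆ b)).card + 1) ≤ ∑ b ∈ inp V A, b.card :=
        Finset.sum_le_sum fun b hb =>
          ih _ (card_lt_card (hP.ssubset hb)) (hW b hb) (hP.nonempty b hb) rfl
      rw [sum_add_distrib, hP.sum_card] at h3
      have := hP.two
      simp only [sum_const, smul_eq_mul, mul_one] at h3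
      omega
    · rw [hV.eq_empty (by omega)]
      have := hA.card_pos
      simpa using this

end Glue

lemma mem_inp_erase {A : Block N} {V : 𝓕 N} (hV : IsTree A V) {e f v : Block N}
    (hf : f ∈ V) (hv : v ≠ f) : e ∈ inp (V.erase f) v ↔
      (e ≠ f ∧ e ∈ inp V v) ∨ (f ∈ inp V v ∧ e ∈ inp V f) := by
  by_cases h : f ∈ inp V v
  · rw [hV.inp_erase_of_mem hf h, mem_union, mem_erase]
    simp [h]
  · rw [inp_erase_of_notMem hf hv h]
    simp only [h, false_and, or_false]
    exact ⟨fun h' => ⟨fun h'' => h (h'' ▸ h'), h'⟩, And.right⟩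

namespace QuadraticData

variable {k : Type u} {K : Type v} [Field k] [Ring K] [Algebra k K]
variable (Q : QuadraticData.{u, v, w} k K)

/-! ### The cobar complex of a block -/

section Plug

variable {α : Type*} [DecidableEq α]

lemma plug_ract_left {e v : α} (hve : v ≠ e) (a : K) {B : Finset α} (hv : v ∉ B) {x : Q.Alg α}
    (hx : x ∈ Q.P B) (y : Q.Alg α) :
    Q.plug e (Q.ract v a y) x = Q.ract v a (Q.plug e y x) := by
  simp only [ract_eq, ractm, plug_eq, subst_subst]
  refine Q.subst_congr hx fun c hc => ?_
  have hcv : c ≠ v := by rintro rfl; exact hv hc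
  by_cases h : c = e
  · subst h; simp
  · simp [h, hcv]

lemma plug_ract_right {e v : α} (hve : v ≠ e) (a : K) {C : Finset α} (hv : v ∉ C) {y : Q.Alg α}
    (hy : y ∈ Q.P C) (x : Q.Alg α) :
    Q.plug e y (Q.ract v a x) = Q.ract v a (Q.plug e y x) := by
  simp only [ract_eq, ractm, plug_eq, subst_subst]
  congr 2
  funext c
  by_cases h : c = e
  · subst h
    simp only [update_self, update_of_ne hve.symm, Pi.one_apply, one_smul,
      subst_var]
    symm
    refine Q.subst_eq_self hy fun d hd => ?_
    have : d ≠ v := by rintro rfl; exact hv hd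
    simp [this]
  · simp [h, subst_smulK]

lemma plug_comm {e f : α} (hef : e ≠ f) {B C : Finset α} {y z : Q.Alg α} (hy : y ∈ Q.P B)
    (hz : z ∈ Q.P C) (hf : f ∉ B) (he : e ∉ C) (x : Q.Alg α) :
    Q.plug f z (Q.plug e y x) = Q.plug e y (Q.plug f z x) := by
  simp only [plug_eq, subst_subst]
  congr 2
  funext c
  have h1 : Q.subst (update Q.var f z) y = y := Q.subst_eq_self hy fun d hd => by
    rw [update_of_ne]; rintro rfl; exact hf hd
  have h2 : Q.subst (update Q.var e y) z = z := Q.subst_eq_self hz fun d hd => by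
    rw [update_of_ne]; rintro rfl; exact he hd
  by_cases hc : c = e
  · subst hc; simp [h1, hef]
  · by_cases hc' : c = f
    · subst hc'; simp [h2, hc]
    · simp [hc, hc']

lemma plug_plug {e f : α} {B : Finset α} {x : Q.Alg α} (hx : x ∈ Q.P B)
    (hf : f ∉ B) (y z : Q.Alg α) :
    Q.plug f z (Q.plug e y x) = Q.plug e (Q.plug f z y) x := by
  simp only [plug_eq, subst_subst]
  refine Q.subst_congr hx fun c hc => ?_
  have hcf : c ≠ f := by rintro rfl; exact hf hc
  by_cases h : c = e
  · subst h; simp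
  · simp [h, hcf]

end Plug

/-- Decorations of the vertices by elements of the free algebra on the blocks. -/
abbrev Dec (N : ℕ) : Type _ := Block N → Q.Alg (Block N)

/-- `m` decorates each vertex `v` of `V` by an element of P(In(v)), and is zero elsewhere. -/
structure Valid (V : 𝓕 N) (m : Q.Dec N) : Prop where
  mem : ∀ v ∈ V, m v ∈ Q.P (inp V v)
  zero : ∀ v, v ∉ V → m v = 0

/-- The contraction of the edge `e`. -/
def ctr (V : 𝓕 N) (e : Block N) (m : Q.Dec N) : Q.Dec N := fun v =>
  if v = e then 0 else if e ∈ inp V v then Q.plug e (m e) (m v) else m v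

variable {Q} {A : Block N} {V : 𝓕 N}

lemma Valid.set {m : Q.Dec N} (hm : Q.Valid V m) {v : Block N} (hv : v ∈ V)
    {x : Q.Alg (Block N)} (hx : x ∈ Q.P (inp V v)) : Q.Valid V (update m v x) where
  mem w hw := by
    by_cases h : w = v
    · subst h; simpa using hx
    · simpa [h] using hm.mem w hw
  zero w hw := by
    have hwv : w ≠ v := by rintro rfl; exact hw hv
    rw [update_of_ne hwv, hm.zero w hw]

lemma ctr_self (e : Block N) (m : Q.Dec N) : Q.ctr V e m e = 0 := by simp [ctr]

lemma ctr_of_mem {e v : Block N} (h : e ∈ inp V v) (m : Q.Dec N) :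
    Q.ctr V e m v = Q.plug e (m e) (m v) := by
  have : v ≠ e := fun h' => (mem_inp.1 h).2.1.ne h'.symm
  simp [ctr, h, this]

lemma ctr_of_notMem {e v : Block N} (hv : v ≠ e) (h : e ∉ inp V v) (m : Q.Dec N) :
    Q.ctr V e m v = m v := by simp [ctr, h, hv]

lemma Valid.ctr (hV : IsTree A V) {m : Q.Dec N} (hm : Q.Valid V m) {e : Block N} (he : e ∈ V) :
    Q.Valid (V.erase e) (Q.ctr V e m) where
  mem v hv := by
    obtain ⟨hv1, hv2⟩ := mem_erase.1 hv
    by_cases h : e ∈ inp V v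
    · rw [ctr_of_mem h, hV.inp_erase_of_mem he h]
      exact Q.plug_mem h (disjoint_inp he h) (hm.mem v hv2) (hm.mem e he)
    · rw [ctr_of_notMem hv1 h, inp_erase_of_notMem he hv1 h]
      exact hm.mem v hv2
  zero v hv := by
    by_cases h : v = e
    · rw [h, ctr_self]
    · have h0 : m v = 0 := hm.zero v fun h' => hv (mem_erase.2 ⟨h, h'⟩)
      unfold QuadraticData.ctr
      simp [h0]

lemma Valid.plug_mem (hV : IsTree A V) {e w : Block N} (he : e ∈ V) (h : e ∈ inp V w)
    {x y : Q.Alg (Block N)} (hy : y ∈ Q.P (inp V e)) (hx : x ∈ Q.P (inp V w)) :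
    Q.plug e y x ∈ Q.P (inp (V.erase e) w) := by
  rw [hV.inp_erase_of_mem he h]
  exact Q.plug_mem h (disjoint_inp he h) hx hy

lemma ctr_update_self {e w : Block N} (hw : w ∈ V) (hV : IsTree A V) (h : e ∈ inp V w)
    {m : Q.Dec N} (hm : Q.Valid V m) (z : Q.Alg (Block N)) :
    Q.ctr V e (update m e z)
      = update (Q.ctr V e m) w (Q.plug e z (m w)) := by
  have hwe : w ≠ e := fun h' => (mem_inp.1 h).2.1.ne h'.symm
  funext v
  by_cases hv : v = w
  · subst hv; rw [ctr_of_mem h]; simp [hwe]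
  · rw [update_of_ne hv]
    by_cases hve : v = e
    · rw [hve, ctr_self, ctr_self]
    · unfold ctr
      simp only [hve, if_false, update_self, update_of_ne hve]
      split_ifs with h'
      · have hvV : v ∉ V := fun hvV => hv (hV.inp_subset_inp h' h hvV hw)
        rw [hm.zero v hvV, map_zero, map_zero]
      · rfl

lemma ctr_update_parent {e w : Block N} (h : e ∈ inp V w) (m : Q.Dec N) (z : Q.Alg (Block N)) :
    Q.ctr V e (update m w z)
      = update (Q.ctr V e m) w (Q.plug e (m e) z) := by
  have hwe : w ≠ e := fun h' => (mem_inp.1 h).2.1.ne h'.symm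
  funext v
  by_cases hv : v = w
  · subst hv; rw [ctr_of_mem h]; simp [hwe.symm]
  · rw [update_of_ne hv]
    unfold ctr
    rw [update_of_ne hv, update_of_ne hwe.symm]

lemma ctr_update_of_ne {e v : Block N} (hve : v ≠ e) (h : e ∉ inp V v) (m : Q.Dec N)
    (z : Q.Alg (Block N)) :
    Q.ctr V e (update m v z) = update (Q.ctr V e m) v z := by
  funext u
  by_cases hu : u = v
  · subst hu; rw [ctr_of_notMem hve h]; simp
  · rw [update_of_ne hu]
    unfold ctr
    rw [update_of_ne hu, update_of_ne hve.symm]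

variable {M : Type*} [AddCommGroup M]

open scoped Classical in
/-- The differential: the sum over the internal edges `e` of the transposes of the contractions of
`e`. -/
def dif (A : Block N) (F : 𝓕 N → Q.Dec N → M) (V : 𝓕 N) (m : Q.Dec N) : M :=
  if IsTree A V ∧ Q.Valid V m then
    ∑ e ∈ V.erase A, ((-1) ^ inv e (eA A V) : ℤ) • F (V.erase e) (Q.ctr V e m)
  else 0

lemma dif_of (hV : IsTree A V) {m : Q.Dec N} (hm : Q.Valid V m)
    (F : 𝓕 N → Q.Dec N → M) :
    dif A F V m = ∑ e ∈ V.erase A, ((-1) ^ inv e (eA A V) : ℤ) • F (V.erase e) (Q.ctr V e m) :=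
  if_pos ⟨hV, hm⟩

lemma dif_map {M' : Type*} [AddCommGroup M'] (g : M →+ M') (A : Block N)
    (F : 𝓕 N → Q.Dec N → M) (V : 𝓕 N) (m : Q.Dec N) :
    dif A (fun V m => g (F V m)) V m = g (dif A F V m) := by
  unfold dif
  split_ifs
  · simp
  · simp

lemma dif_sum {ι : Type*} (t : Finset ι) (A : Block N) (F : ι → 𝓕 N → Q.Dec N → M)
    (V : 𝓕 N) (m : Q.Dec N) :
    dif A (fun V m => ∑ i ∈ t, F i V m) V m = ∑ i ∈ t, dif A (F i) V m := by
  unfold dif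
  split_ifs
  · simp only [smul_sum]
    exact sum_comm
  · simp

variable (Q)

variable [Module k M]

/-- `f` is an element of Hom_K(P(V), M), where P(V) is the tensor product over K, along the tree `V`
on `A`, of the P(In(v)), and `a : K` acts on `M` by `ρ a`; it is extended by zero to the invalid
decorations. -/
structure IsFm (ρ : K → M → M) (A : Block N) (V : 𝓕 N) (f : Q.Dec N → M) : Prop where
  off : ∀ m, ¬ Q.Valid V m → f m = 0
  lin : ∀ m, Q.Valid V m → ∀ v ∈ V, ∀ (c : k), ∀ x ∈ Q.P (inp V v), ∀ y ∈ Q.P (inp V v),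
    f (update m v (c • x + y)) = c • f (update m v x) + f (update m v y)
  root : ∀ m, Q.Valid V m → A ∈ V → ∀ a : K, f (update m A (a • m A)) = ρ a (f m)
  bal : ∀ m, Q.Valid V m → ∀ v ∈ V, ∀ u ∈ V, v ∈ inp V u → ∀ a : K,
    f (update m u (Q.ract v a (m u))) = f (update m v (a • m v))

/-- A family of elements of Hom_K(P(V), M), indexed by the trees `V` on `A`. -/
structure IsFam (ρ : K → M → M) (A : Block N) (F : 𝓕 N → Q.Dec N → M) : Prop where
  isFm : ∀ V, IsTree A V → Q.IsFm ρ A V (F V)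
  zero : ∀ V, ¬ IsTree A V → F V = 0

/-- K-valued functions of a tree and a decoration. -/
abbrev BF (N : ℕ) : Type _ := 𝓕 N → Q.Dec N → K

variable {Q} {ρ : K → M → M}

lemma IsFm.add {f : Q.Dec N → M} (hf : Q.IsFm ρ A V f) (hm : Q.Valid V m) {v : Block N} (hv : v ∈ V)
    {x y : Q.Alg (Block N)} (hx : x ∈ Q.P (inp V v)) (hy : y ∈ Q.P (inp V v)) :
    f (update m v (x + y)) = f (update m v x) + f (update m v y) := by
  simpa using hf.lin m hm v hv 1 x hx y hy

lemma IsFm.smul {f : Q.Dec N → M} (hf : Q.IsFm ρ A V f) (hm : Q.Valid V m) {v : Block N}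
    (hv : v ∈ V) (c : k) {x : Q.Alg (Block N)} (hx : x ∈ Q.P (inp V v)) :
    f (update m v (c • x)) = c • f (update m v x) := by
  have h0 := hf.add hm hv (Submodule.zero_mem _) (Submodule.zero_mem _)
  rw [add_zero, left_eq_add] at h0
  simpa [h0] using hf.lin m hm v hv c x hx 0 (Submodule.zero_mem _)

lemma IsFm.contract (hV : IsTree A V) {e : Block N} (he : e ∈ V) (heA : e ≠ A)
    {f : Q.Dec N → M} (hf : Q.IsFm ρ A (V.erase e) f) :
    (∀ m, Q.Valid V m → ∀ v ∈ V, ∀ (c : k), ∀ x ∈ Q.P (inp V v), ∀ y ∈ Q.P (inp V v),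
      f (Q.ctr V e (update m v (c • x + y)))
        = c • f (Q.ctr V e (update m v x)) + f (Q.ctr V e (update m v y))) ∧
    (∀ m, Q.Valid V m → A ∈ V → ∀ a : K,
      f (Q.ctr V e (update m A (a • m A))) = ρ a (f (Q.ctr V e m))) ∧
    ∀ m, Q.Valid V m → ∀ v ∈ V, ∀ u ∈ V, v ∈ inp V u → ∀ a : K,
      f (Q.ctr V e (update m u (Q.ract v a (m u))))
        = f (Q.ctr V e (update m v (a • m v))) := by
  obtain ⟨w, hw, hew⟩ := hV.exists_parent he heA
  have hwe : w ≠ e := fun h' => (mem_inp.1 hew).2.1.ne h'.symm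
  have hw' : w ∈ V.erase e := mem_erase.2 ⟨hwe, hw⟩
  -- Updating one vertex of `V` updates one vertex of the contracted tree by a linear function.
  have key : ∀ m, Q.Valid V m → ∀ v ∈ V, ∃ v' ∈ V.erase e, ∃ g : Q.Alg (Block N) → Q.Alg (Block N),
      (∀ x ∈ Q.P (inp V v), g x ∈ Q.P (inp (V.erase e) v')) ∧
      (∀ (c : k), ∀ x ∈ Q.P (inp V v), ∀ y ∈ Q.P (inp V v), g (c • x + y) = c • g x + g y) ∧
      ∀ z, Q.ctr V e (update m v z) = update (Q.ctr V e m) v' (g z) := by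
    intro m hm v hv
    by_cases hve : v = e
    · subst hve
      exact ⟨w, hw', fun z => Q.plug v z (m w),
        fun x hx => Valid.plug_mem hV he hew hx (hm.mem w hw),
        fun c x _ y _ => (Q.plug_add hew (hm.mem w hw) _ y).trans
          (congrArg (· + _) (Q.plug_smul hew (hm.mem w hw) c x)), fun z => ctr_update_self hw hV hew hm z⟩
    · by_cases hvw : v = w
      · subst hvw
        exact ⟨v, hw', fun z => Q.plug e (m e) z,
          fun x hx => Valid.plug_mem hV he hew (hm.mem e he) hx,
          fun c x _ y _ => (map_add _ _ y).trans (congrArg (· + _) (map_smul _ c x)),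
          fun z => ctr_update_parent hew m z⟩
      · have h : e ∉ inp V v := fun h => hvw (hV.inp_subset_inp h hew hv hw)
        refine ⟨v, mem_erase.2 ⟨hve, hv⟩, fun z => z, fun x hx => ?_,
          fun _ _ _ _ _ => rfl, fun z => ctr_update_of_ne hve h m z⟩
        rwa [inp_erase_of_notMem he hve h]
  refine ⟨fun m hm v hv c x hx y hy => ?_, fun m hm hA a => ?_,
    fun m hm v hv u hu hvu a => ?_⟩
  · obtain ⟨v', hv', g, hg, hg1, hg3⟩ := key m hm v hv
    rw [hg3, hg3, hg3, hg1 c x hx y hy, hf.lin _ (hm.ctr hV he) v' hv' c _ (hg x hx) _ (hg y hy)]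
  · have hA' : A ∈ V.erase e := mem_erase.2 ⟨heA.symm, hA⟩
    rw [← hf.root _ (hm.ctr hV he) hA']
    by_cases h : e ∈ inp V A
    · rw [ctr_update_parent h, ctr_of_mem h, plug_smulK]
    · rw [ctr_update_of_ne heA.symm h, ctr_of_notMem heA.symm h]
  · by_cases hve : v = e
    · subst hve
      obtain rfl := hV.inp_subset_inp hvu hew hu hw
      rw [ctr_update_self hu hV hvu hm, ctr_update_parent hvu, plug_smul_eq_ract]
    have hv' : v ∈ V.erase e := mem_erase.2 ⟨hve, hv⟩
    have hmc := hm.ctr hV he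
    -- The balancing relation of the contracted tree.
    suffices ∃ u' ∈ V.erase e, v ∈ inp (V.erase e) u' ∧
        Q.ctr V e (update m u (Q.ract v a (m u)))
          = update (Q.ctr V e m) u' (Q.ract v a (Q.ctr V e m u')) ∧
        Q.ctr V e (update m v (a • m v))
          = update (Q.ctr V e m) v (a • Q.ctr V e m v) by
      obtain ⟨u', hu', h1, h2, h3⟩ := this
      rw [h2, h3, hf.bal _ hmc v hv' u' hu' h1]
    by_cases hue : u = e
    · subst hue
      have hvw : v ≠ w := fun h => absurd ((mem_inp.1 hvu).2.1.trans (mem_inp.1 hew).2.1)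
        (by rw [h]; exact lt_irrefl _)
      have huv : u ∉ inp V v := fun h => absurd ((mem_inp.1 hvu).2.1.trans (mem_inp.1 h).2.1)
        (lt_irrefl _)
      refine ⟨w, hw', (mem_inp_erase hV he hwe).2 (.inr ⟨hew, hvu⟩), ?_, ?_⟩
      · rw [ctr_update_self hw hV hew hm, ctr_of_mem hew,
          Q.plug_ract_left hve a (notMem_inp_of_mem_inp hew he hvu) (hm.mem w hw)]
      · rw [ctr_update_of_ne hve huv, ctr_of_notMem hve huv]
    by_cases huw : u = w
    · subst huw
      have hev : e ∉ inp V v := fun h => notMem_inp_of_mem_inp hvu hv h hew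
      have hve' : v ∉ inp V e := fun h => notMem_inp_of_mem_inp hew he h hvu
      refine ⟨u, hw', (mem_inp_erase hV he hwe).2 (.inl ⟨hve, hvu⟩), ?_, ?_⟩
      · rw [ctr_update_parent hew, ctr_of_mem hew, Q.plug_ract_right hve a hve' (hm.mem e he)]
      · rw [ctr_update_of_ne hve hev, ctr_of_notMem hve hev]
    have heu : e ∉ inp V u := fun h => huw (hV.inp_subset_inp h hew hu hw)
    refine ⟨u, mem_erase.2 ⟨hue, hu⟩, (mem_inp_erase hV he hue).2 (.inl ⟨hve, hvu⟩), ?_, ?_⟩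
    · rw [ctr_update_of_ne hue heu, ctr_of_notMem hue heu]
    · by_cases hvw : v = w
      · subst hvw
        rw [ctr_update_parent hew, ctr_of_mem hew, plug_smulK]
      · have hev : e ∉ inp V v := fun h => hvw (hV.inp_subset_inp h hew hv hw)
        rw [ctr_update_of_ne hve hev, ctr_of_notMem hve hev]

lemma ctr_ctr (hV : IsTree A V) {m : Q.Dec N} (hm : Q.Valid V m) {e f : Block N} (he : e ∈ V)
    (hf : f ∈ V) (hef : e ≠ f) :
    Q.ctr (V.erase e) f (Q.ctr V e m) = Q.ctr (V.erase f) e (Q.ctr V f m) := by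
  -- The case in which `f` is an input of `e`, and `e` is an input of `v`.
  have nested : ∀ e f, e ∈ V → f ∈ V → e ≠ f → ∀ v ∈ V, v ≠ e → v ≠ f → e ∈ inp V v → f ∈ inp V e →
      Q.ctr (V.erase e) f (Q.ctr V e m) v = Q.ctr (V.erase f) e (Q.ctr V f m) v := by
    intro e f he hf hef v hv hve hvf h1 h2
    have h3 : f ∉ inp V v := notMem_inp_of_mem_inp h1 he h2
    have h4 : e ∉ inp V f := fun h => absurd ((mem_inp.1 h).2.1.trans (mem_inp.1 h2).2.1)
      (lt_irrefl _)
    rw [ctr_of_mem ((mem_inp_erase hV he hve).2 (.inr ⟨h1, h2⟩)),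
      ctr_of_mem ((mem_inp_erase hV hf hvf).2 (.inl ⟨hef, h1⟩)), ctr_of_mem h1, ctr_of_mem h2,
      ctr_of_notMem hvf h3, ctr_of_notMem hef.symm h4]
    exact Q.plug_plug (hm.mem v hv) h3 _ _
  have single : ∀ e f, e ∈ V → f ∈ V → e ≠ f → ∀ v ∈ V, v ≠ e → v ≠ f → e ∈ inp V v →
      f ∉ inp V e → f ∉ inp V v →
      Q.ctr (V.erase e) f (Q.ctr V e m) v = Q.ctr (V.erase f) e (Q.ctr V f m) v := by
    intro e f he hf hef v hv hve hvf h1 h2 h3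
    rw [ctr_of_notMem hvf (fun h => by
        rcases (mem_inp_erase hV he hve).1 h with h | h
        exacts [h3 h.2, h2 h.2]),
      ctr_of_mem ((mem_inp_erase hV hf hvf).2 (.inl ⟨hef, h1⟩)), ctr_of_mem h1,
      ctr_of_notMem hvf h3, ctr_of_notMem hef h2]
  funext v
  by_cases hve : v = e
  · subst hve
    rw [ctr_self]
    unfold ctr
    simp
  by_cases hvf : v = f
  · subst hvf
    rw [ctr_self]
    unfold ctr
    simp
  by_cases hv : v ∈ V
  swap
  · have h0 := hm.zero v hv
    unfold ctr
    simp [h0]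
  by_cases h1 : e ∈ inp V v
  · have hef' : e ∈ inp V f → f ∉ inp V v := fun h h' => notMem_inp_of_mem_inp h' hf h h1
    by_cases h2 : f ∈ inp V v
    · have h3 : f ∉ inp V e := fun h => notMem_inp_of_mem_inp h1 he h h2
      have h4 : e ∉ inp V f := fun h => hef' h h2
      rw [ctr_of_mem ((mem_inp_erase hV he hve).2 (.inl ⟨hef.symm, h2⟩)),
        ctr_of_mem ((mem_inp_erase hV hf hvf).2 (.inl ⟨hef, h1⟩)), ctr_of_mem h1, ctr_of_mem h2,
        ctr_of_notMem hef.symm h4, ctr_of_notMem hef h3]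
      exact Q.plug_comm hef (hm.mem e he) (hm.mem f hf) h3 h4 _
    · grind
  · by_cases h2 : f ∈ inp V v
    · grind
    · rw [ctr_of_notMem (V := V.erase e) hvf (fun h => by
          rcases (mem_inp_erase hV he hve).1 h with h | h
          exacts [h2 h.2, h1 h.1]),
        ctr_of_notMem (V := V.erase f) hve (fun h => by
          rcases (mem_inp_erase hV hf hvf).1 h with h | h
          exacts [h1 h.2, h2 h.1]), ctr_of_notMem hve h1, ctr_of_notMem hvf h2]

lemma IsFam.off {F : 𝓕 N → Q.Dec N → M} (hF : Q.IsFam ρ A F) {m : Q.Dec N}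
    (h : ¬ (IsTree A V ∧ Q.Valid V m)) : F V m = 0 := by
  by_cases hV : IsTree A V
  · exact (hF.isFm V hV).off m fun hm => h ⟨hV, hm⟩
  · rw [hF.zero V hV]; rfl

lemma Valid.smul {m : Q.Dec N} (hm : Q.Valid V m) {v : Block N} (hv : v ∈ V) (a : K) :
    Q.Valid V (update m v (a • m v)) :=
  hm.set hv (Q.smul_mem_P a (hm.mem v hv))

lemma Valid.ract {m : Q.Dec N} (hm : Q.Valid V m) {v : Block N} (hv : v ∈ V) (u : Block N)
    (a : K) : Q.Valid V (update m v (Q.ract u a (m v))) :=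
  hm.set hv (Q.ract_mem u a (hm.mem v hv))

lemma IsFam.dif {F : 𝓕 N → Q.Dec N → M} (hF : Q.IsFam ρ A F)
    (hρ : ∀ a, ∃ g : M →+ M, ∀ x, ρ a x = g x) : Q.IsFam ρ A (dif A F) where
  isFm V hV := by
    have hc : ∀ e ∈ V.erase A, _ := fun e he =>
      (hF.isFm _ (hV.erase (ne_of_mem_erase he))).contract hV (mem_of_mem_erase he)
        (ne_of_mem_erase he)
    refine ⟨fun m hm => if_neg fun h => hm h.2, fun m hm v hv c x hx y hy => ?_, fun m hm hA a => ?_, fun m hm v hv u hu hvu a => ?_⟩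
    · rw [dif_of hV (hm.set hv (Submodule.add_mem _ (Submodule.smul_mem _ c hx) hy)),
        dif_of hV (hm.set hv hx), dif_of hV (hm.set hv hy), smul_sum, ← sum_add_distrib]
      exact sum_congr rfl fun e he => by rw [(hc e he).1 m hm v hv c x hx y hy, smul_add, smul_comm]
    · obtain ⟨g, hg⟩ := hρ a
      rw [dif_of hV (hm.smul hA a), dif_of hV hm, hg, map_sum]
      exact sum_congr rfl fun e he => by rw [(hc e he).2.1 m hm hA a, map_zsmul, hg]
    · rw [dif_of hV (hm.ract hu v a), dif_of hV (hm.smul hv a)]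
      exact sum_congr rfl fun e he => by rw [(hc e he).2.2 m hm v hv u hu hvu a]
  zero V hV := by
    funext m
    exact if_neg fun h => hV h.1

lemma key_injective : Function.Injective (key (n := N)) := by
  intro u v h
  have := (Finset.geomSum_injective (le_refl 2)) (a₁ := u.map Fin.valEmbedding)
    (a₂ := v.map Fin.valEmbedding) (by simpa [key] using h)
  exact Finset.map_injective _ this

lemma inv_erase {e f : Block N} {S : 𝓕 N} (he : e ∈ S) :
    inv f (S.erase e) + (if key e < key f then 1 else 0) = inv f S := by
  unfold inv
  rw [Finset.filter_erase]
  split_ifs with h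
  · exact card_erase_add_one (mem_filter.2 ⟨he, h⟩)
  · rw [erase_eq_of_notMem (by simp [h]), add_zero]

lemma dif_dif {M : Type*} [AddCommGroup M] (A : Block N) (F : 𝓕 N → Q.Dec N → M) : dif A (dif A F) = 0 := by
  funext V m
  by_cases h : IsTree A V ∧ Q.Valid V m
  swap
  · exact if_neg h
  obtain ⟨hV, hm⟩ := h
  rw [dif_of hV hm]
  have h1 : ∀ e ∈ V.erase A, ((-1) ^ inv e (eA A V) : ℤ) • dif A F (V.erase e) (Q.ctr V e m)
      = ∑ f ∈ V.erase A, if e = f then 0 else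
        ((-1) ^ (inv e (eA A V) + inv f ((eA A V).erase e)) : ℤ) •
          F ((V.erase e).erase f) (Q.ctr (V.erase e) f (Q.ctr V e m)) := by
    intro e he
    obtain ⟨heA, heV⟩ := mem_erase.1 he
    rw [dif_of (hV.erase heA) (hm.ctr hV heV), hV.eA_erase heV, smul_sum,
      Finset.sum_ite, Finset.sum_const_zero, zero_add]
    refine sum_congr ?_ fun f _ => by rw [smul_smul, pow_add]
    ext f
    simp only [mem_erase, mem_filter]
    constructor
    · grind
    · grind
  rw [sum_congr rfl h1, ← sum_product']
  refine sum_involution (fun p _ => (p.2, p.1)) ?_ ?_ ?_ ?_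
  · rintro ⟨e, f⟩ hp
    obtain ⟨he, hf⟩ := mem_product.1 hp
    obtain ⟨heA, heV⟩ := mem_erase.1 he
    obtain ⟨hfA, hfV⟩ := mem_erase.1 hf
    dsimp only at *
    by_cases hef : e = f
    · simp [hef]
    have hsub : ∀ v ∈ V.erase A, v ∈ eA A V := fun v hv => by
      obtain ⟨hvA, hvV⟩ := mem_erase.1 hv
      exact mem_eA.2 ⟨.inl hvV, lt_of_le_of_ne (hV.sub v hvV) hvA⟩
    rw [if_neg hef, if_neg (Ne.symm hef), ctr_ctr hV hm heV hfV hef, Finset.erase_right_comm,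
      ← add_smul]
    convert zero_smul ℤ _
    have i1 := inv_erase (f := f) (hsub e he)
    have i2 := inv_erase (f := e) (hsub f hf)
    have i3 := lt_or_gt_of_ne fun h => hef (key_injective h)
    rw [← i1, ← i2]
    rcases i3 with i3 | i3
    · rw [if_pos i3, if_neg (lt_asymm i3)]; ring
    · rw [if_pos i3, if_neg (lt_asymm i3)]; ring
  · grind
  · grind
  · rintro ⟨e, f⟩ hp; rfl

variable (Q)

section Map

variable {M M' : Type*} [AddCommGroup M] [Module k M] [AddCommGroup M'] [Module k M']
variable {ρ : K → M → M} {ρ' : K → M' → M'} {A : Block N} {Q}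

lemma IsFam.map {F : 𝓕 N → Q.Dec N → M} (hF : Q.IsFam ρ A F) (g : 𝓕 N → M →ₗ[k] M')
    (hg : ∀ V a x, g V (ρ a x) = ρ' a (g V x)) : Q.IsFam ρ' A fun V m => g V (F V m) where
  isFm V hV := by
    have h1 := hF.isFm V hV
    refine ⟨fun m hm => ?_, fun m hm v hv c x hx y hy => ?_,
      fun m hm hA a => ?_, fun m hm v hv u hu hvu a => ?_⟩
    · rw [h1.off m hm, map_zero]
    · rw [h1.lin m hm v hv c x hx y hy, map_add, map_smul]
    · rw [h1.root m hm hA a, hg]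
    · rw [h1.bal m hm v hv u hu hvu a]
  zero V hV := by funext m; rw [hF.zero V hV]; simp

lemma isFam_zero (h0 : ∀ a, ρ a 0 = 0) : Q.IsFam ρ A fun _ _ => 0 :=
  ⟨fun _ _ => ⟨by simp, by simp, by simp [h0], by simp⟩, fun _ _ => rfl⟩

lemma IsFam.add {F F' : 𝓕 N → Q.Dec N → M} (hF : Q.IsFam ρ A F)
    (hF' : Q.IsFam ρ A F') (h : ∀ a x y, ρ a (x + y) = ρ a x + ρ a y) :
    Q.IsFam ρ A fun V m => F V m + F' V m where
  isFm V hV := by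
    have h1 := hF.isFm V hV
    have h2 := hF'.isFm V hV
    refine ⟨fun m hm => ?_, fun m hm v hv c x hx y hy => ?_,
      fun m hm hA a => ?_, fun m hm v hv u hu hvu a => ?_⟩
    · rw [h1.off m hm, h2.off m hm, add_zero]
    · rw [h1.lin m hm v hv c x hx y hy, h2.lin m hm v hv c x hx y hy, smul_add]; abel
    · rw [h1.root m hm hA a, h2.root m hm hA a, h]
    · rw [h1.bal m hm v hv u hu hvu a, h2.bal m hm v hv u hu hvu a]
  zero V hV := by funext m; rw [hF.zero V hV, hF'.zero V hV]; simp

end Map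

/-- The total cobar complex of `A`: families of elements of Hom_K(P(V), K). -/
def cobar (A : Block N) : Submodule Kᵐᵒᵖ (Q.BF N) where
  carrier := {Φ | Q.IsFam (fun a x => a * x) A Φ}
  add_mem' hΦ hΨ := hΦ.add hΨ mul_add
  zero_mem' := isFam_zero mul_zero
  smul_mem' b _ hΦ := hΦ.map (fun _ => LinearMap.mulRight k (unop b)) fun _ a x => mul_assoc a x _

variable {Q}

lemma mem_cobar {Φ : Q.BF N} : Φ ∈ Q.cobar A ↔ Q.IsFam (fun a x => a * x) A Φ := Iff.rfl

lemma dif_mem {Φ : Q.BF N} (hΦ : Φ ∈ Q.cobar A) : dif A Φ ∈ Q.cobar A :=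
  IsFam.dif hΦ fun a => ⟨AddMonoidHom.mulLeft a, fun _ => rfl⟩

variable (Q)

/-- The differential of the cobar complex. -/
def δc (A : Block N) : Module.End Kᵐᵒᵖ (Q.cobar A) where
  toFun Φ := ⟨dif A Φ.1, dif_mem Φ.2⟩
  map_add' Φ Ψ := by
    refine Subtype.ext ?_
    funext V m
    simp only [Submodule.coe_add, Pi.add_apply]
    unfold dif
    split_ifs
    · simp only [Pi.add_apply, smul_add, sum_add_distrib]
    · simp
  map_smul' a Φ := by
    refine Subtype.ext ?_
    funext V m
    exact dif_map (DistribSMul.toAddMonoidHom K a) A Φ.1 V m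

/-- The sign operator, by the parity of the number of edges. -/
def εc (A : Block N) : Module.End Kᵐᵒᵖ (Q.cobar A) where
  toFun Φ := ⟨_, Φ.2.map (fun V => DistribSMul.toLinearMap k K ((-1) ^ (eA A V).card : ℤ))
    fun _ a x => (mul_smul_comm _ a x).symm⟩
  map_add' Φ Ψ := Subtype.ext (by funext V m; simp)
  map_smul' a Φ := Subtype.ext (by
    funext V m; exact smul_comm ((-1) ^ (eA A V).card : ℤ) a (Φ.1 V m))

variable {Q}

lemma δc_apply (Φ : Q.cobar A) : (Q.δc A Φ).1 = dif A Φ.1 := rfl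

lemma δc_δc (A : Block N) : Q.δc A * Q.δc A = 0 :=
  LinearMap.ext fun Φ => Subtype.ext (dif_dif A Φ.1)

lemma εc_apply (Φ : Q.cobar A) (V : 𝓕 N) (m : Q.Dec N) :
    (Q.εc A Φ).1 V m = ((-1) ^ (eA A V).card : ℤ) • Φ.1 V m := rfl

lemma εc_εc (A : Block N) : Q.εc A * Q.εc A = 1 := by
  refine LinearMap.ext fun Φ => Subtype.ext ?_
  funext V m
  change (Q.εc A (Q.εc A Φ)).1 V m = Φ.1 V m
  rw [εc_apply, εc_apply, smul_smul, ← pow_add, Even.neg_one_pow ⟨_, rfl⟩, one_smul]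

lemma εc_δc (A : Block N) : Q.εc A * Q.δc A = -(Q.δc A * Q.εc A) := by
  refine LinearMap.ext fun Φ => Subtype.ext ?_
  funext V m
  change (Q.εc A (Q.δc A Φ)).1 V m = -(Q.δc A (Q.εc A Φ)).1 V m
  rw [εc_apply, δc_apply, δc_apply]
  by_cases h : IsTree A V ∧ Q.Valid V m
  swap
  · unfold dif; simp [h]
  rw [dif_of h.1 h.2, dif_of h.1 h.2, smul_sum, ← sum_neg_distrib]
  refine sum_congr rfl fun e he => ?_
  obtain ⟨heA, heV⟩ := mem_erase.1 he
  rw [εc_apply, h.1.eA_erase heV, smul_comm, ← smul_neg, ← neg_smul]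
  congr 2
  have hmem : e ∈ eA A V := mem_eA.2 ⟨.inl heV, lt_of_le_of_ne (h.1.sub e heV) heA⟩
  rw [← card_erase_add_one hmem]
  ring

end QuadraticData

variable {k : Type u} {K : Type v} [Field k] [Ring K] [Algebra k K]
variable {Q : QuadraticData.{u, v, w} k K} {A b v : Block N} {V S : 𝓕 N} {m : Q.Dec N}
  {π : SetPart N} {φ : Q.Args π → Q.P π.parts} {R : 𝓕 N}
  {c : Block N → Block N × Block N}

namespace QuadraticData

/-! ### Finite frames of the cobar complex -/

section Finite

open scoped Classical in
/-- The extension of a decoration by zero. -/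
def extDec (V : 𝓕 N) (d : (v : V) → Q.P (inp V v.1)) : Q.Dec N := fun v =>
  if h : v ∈ V then (d ⟨v, h⟩).1 else 0

lemma extDec_valid (d : (v : V) → Q.P (inp V v.1)) : Q.Valid V (extDec V d) where
  mem v hv := by simp [extDec, hv]
  zero v hv := by simp [extDec, hv]

lemma extDec_update [DecidableEq V] (d : (v : V) → Q.P (inp V v.1)) (v : V)
    (x : Q.P (inp V v.1)) :
    extDec V (update d v x) = update (extDec V d) v.1 x.1 := by
  funext u
  by_cases hu : u = v.1
  · subst hu; simp [extDec]
  · rw [update_of_ne hu]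
    unfold extDec
    split_ifs with h
    · rw [update_of_ne (fun h' => hu (congrArg Subtype.val h'))]
    · rfl

lemma Valid.eq_extDec (hm : Q.Valid V m) :
    m = extDec V fun v => ⟨m v.1, hm.mem v.1 v.2⟩ := by
  funext v
  unfold extDec
  split_ifs with h
  · rfl
  · exact hm.zero v h

/-- The values of a family of forms on the decorations of `V`. -/
def multiOf (A : Block N) (V : 𝓕 N) :
    Q.cobar A →ₗ[k] MultilinearMap k (fun v : V => Q.P (inp V v.1)) K where
  toFun Φ :=
    { toFun := fun d => Φ.1 V (extDec V d)
      map_update_add' := fun d v x y => by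
        by_cases hV : IsTree A V
        · simp only [extDec_update]
          exact (Φ.2.isFm V hV).add (extDec_valid d) v.2 x.2 y.2
        · simp [Φ.2.zero V hV]
      map_update_smul' := fun d v c x => by
        by_cases hV : IsTree A V
        · simp only [extDec_update]
          exact (Φ.2.isFm V hV).smul (extDec_valid d) v.2 c x.2
        · simp [Φ.2.zero V hV] }
  map_add' _ _ := rfl
  map_smul' _ _ := rfl

lemma cobar_ext {Φ Ψ : Q.cobar A} (h : ∀ V, IsTree A V → ∀ m, Q.Valid V m → Φ.1 V m = Ψ.1 V m) :
    Φ = Ψ := by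
  refine Subtype.ext ?_
  funext V m
  by_cases hV : IsTree A V ∧ Q.Valid V m
  · exact h V hV.1 m hV.2
  · rw [IsFam.off Φ.2 hV, IsFam.off Ψ.2 hV]

instance [FiniteDimensional k K] [FiniteDimensional k Q.E] : Module.Finite k (Q.cobar A) := by
  refine Module.Finite.of_injective (LinearMap.pi fun V => multiOf A V) fun Φ Ψ h => ?_
  refine cobar_ext fun V _ m hm => ?_
  rw [hm.eq_extDec]
  exact DFunLike.congr_fun (congrFun h V) _

end Finite

variable (Q) in
/-- Finitely many trees with decorations, and finitely many elements of the cobar complex, that express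
every element by its values. -/
structure Frame (A : Block N) where
  n : ℕ
  V : Fin n → 𝓕 N
  m : Fin n → Q.Dec N
  Φ : Fin n → Q.cobar A
  eq : ∀ F : Q.cobar A, F = ∑ l, op (F.1 (V l) (m l)) • Φ l

/-- The value at a decorated tree. -/
def evalc (A : Block N) (s : 𝓕 N × Q.Dec N) : Q.cobar A →ₗ[Kᵐᵒᵖ] K where
  toFun Φ := Φ.1 s.1 s.2
  map_add' _ _ := rfl
  map_smul' _ _ := rfl

lemma exists_separating [FiniteDimensional k K] [FiniteDimensional k Q.E] (A : Block N) :
    ∃ t : Finset (𝓕 N × Q.Dec N), ∀ F : Q.cobar A, (∀ s ∈ t, F.1 s.1 s.2 = 0) → F = 0 := by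
  have hfin : Module.Finite Kᵐᵒᵖ (Q.cobar A) := Module.Finite.of_restrictScalars_finite k _ _
  have : IsArtinian Kᵐᵒᵖ (Q.cobar A) := isArtinian_of_tower k inferInstance
  obtain ⟨S, ⟨t, rfl⟩, hmin⟩ := IsArtinian.set_has_minimal
    (Set.range fun t : Finset (𝓕 N × Q.Dec N) => ⨅ s ∈ t, LinearMap.ker (evalc A s))
    (Set.range_nonempty _)
  refine ⟨t, fun F hF => ?_⟩
  by_contra hne
  obtain ⟨s, hs⟩ : ∃ s : 𝓕 N × Q.Dec N, F.1 s.1 s.2 ≠ 0 := by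
    by_contra! h
    exact hne (Subtype.ext (by funext V m; exact h (V, m)))
  classical
  refine hmin _ ⟨insert s t, rfl⟩ (lt_of_le_of_ne ?_ fun h => hs ?_)
  · exact biInf_mono fun _ h => mem_insert_of_mem h
  · have this : F ∈ ⨅ s ∈ t, LinearMap.ker (evalc A s) := by
      simp only [Submodule.mem_iInf]
      exact hF
    have h2 : (⨅ s' ∈ insert s t, LinearMap.ker (evalc A s'))
        = ⨅ s ∈ t, LinearMap.ker (evalc A s) := h
    rw [← h2] at this
    simp only [Submodule.mem_iInf] at this
    exact this s (mem_insert_self _ _)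

variable (Q) in
lemma nonempty_frame [FiniteDimensional k K] [FiniteDimensional k Q.E] [IsSemisimpleRing K]
    (A : Block N) : Nonempty (Q.Frame A) := by
  obtain ⟨t, ht⟩ := exists_separating (Q := Q) A
  let e := t.equivFin.symm
  let f : Q.cobar A →ₗ[Kᵐᵒᵖ] (Fin t.card → K) := LinearMap.pi fun l => evalc A (e l).1
  have hf : Function.Injective f := by
    rw [← LinearMap.ker_eq_bot, LinearMap.ker_eq_bot']
    refine fun F hF => ht F fun s hs => ?_
    have := congrFun hF (e.symm ⟨s, hs⟩)
    simpa [f, evalc] using this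
  obtain ⟨g, hg⟩ := IsSemisimpleModule.extension_property f hf LinearMap.id
  refine ⟨⟨t.card, fun l => (e l).1.1, fun l => (e l).1.2, fun l => g (Pi.single l 1), fun F => ?_⟩⟩
  conv_lhs => rw [← show g (f F) = F from LinearMap.congr_fun hg F, ← univ_sum_single (f F),
    map_sum]
  refine sum_congr rfl fun l _ => ?_
  rw [← map_smul]
  congr 1
  funext j
  by_cases h : j = l
  · subst h; simp [f, evalc]
  · simp [h]

lemma Frame.apply (B : Q.Frame A) (F : Q.cobar A) (V : 𝓕 N) (m : Q.Dec N) :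
    F.1 V m = ∑ l, (B.Φ l).1 V m * F.1 (B.V l) (B.m l) := by
  conv_lhs => rw [B.eq F]
  simp only [AddSubmonoidClass.coe_finsetSum, Finset.sum_apply]
  rfl

/-- The expansion of forms with values in any K-module: K-linear functionals separate the points of a
K-module, K being semisimple. -/
lemma Frame.expand [IsSemisimpleRing K] {M : Type*} [AddCommGroup M] [Module k M]
    (ρ : K →ₐ[k] Module.End k M) (B : Q.Frame A) {F : 𝓕 N → Q.Dec N → M}
    (hF : Q.IsFam (fun a => ρ a) A F) (V : 𝓕 N) (m : Q.Dec N) :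
    F V m = ∑ l, ρ ((B.Φ l).1 V m) (F (B.V l) (B.m l)) := by
  let _ : Module K M := Module.compHom M ρ.toRingHom
  have hsm : ∀ (a : K) (x : M), a • x = ρ a x := fun _ _ => rfl
  have : IsScalarTower k K M := ⟨fun c a x => by rw [hsm, hsm, map_smul, LinearMap.smul_apply]⟩
  have : Module.Projective K M := Module.projective_of_isSemisimpleRing K M
  rw [← sub_eq_zero, ← Module.forall_dual_apply_eq_zero_iff K]
  intro f
  have hfF : (fun V m => f (F V m)) ∈ Q.cobar A :=
    hF.map (fun _ => f.restrictScalars k) fun _ a x => map_smul f a x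
  have := B.apply ⟨_, hfF⟩ V m
  simp only at this
  rw [map_sub, this, map_sum, sub_eq_zero]
  refine sum_congr rfl fun l _ => ?_
  rw [← hsm, map_smul, smul_eq_mul]

end QuadraticData

namespace QuadraticData

/-! ### Forms on the forests over a partition -/

section Map

variable {M : Type*} [AddCommGroup M] [Module k M] {ρ : K → M → M}

lemma isFam_sum {ι : Type*} (t : Finset ι) {F : ι → 𝓕 N → Q.Dec N → M}
    (hF : ∀ i ∈ t, Q.IsFam ρ A (F i)) (h : ∀ a x y, ρ a (x + y) = ρ a x + ρ a y) :
    Q.IsFam ρ A fun V m => ∑ i ∈ t, F i V m := by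
  classical
  induction t using Finset.induction_on with
  | empty =>
    simp only [sum_empty]
    exact isFam_zero fun a => by simpa using h a 0 0
  | insert i t hi ih =>
    simp only [sum_insert hi]
    exact (hF i (mem_insert_self _ _)).add
      (ih fun j hj => hF j (mem_insert_of_mem hj)) h

end Map

variable (Q) in
/-- The K-linear functionals on P(S). -/
abbrev X (S : 𝓕 N) : Type _ := Q.P S →ₗ[K] K

section Rho

lemma ractP_comm {b c : Block N} (hbc : b ≠ c) (a a' : K) (x : Q.P S) :
    Q.ractP S b a (Q.ractP S c a' x) = Q.ractP S c a' (Q.ractP S b a x) := by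
  refine Subtype.ext ?_
  change Q.ract b a (Q.ract c a' x.1) = Q.ract c a' (Q.ract b a x.1)
  rw [ract_eq, ract_eq, ractm_ractm, ractm_ractm]
  congr 2
  funext d
  by_cases h : d = b
  · subst h; simp [hbc]
  · simp [h]

lemma ractP_mul (b : Block N) (a a' : K) (x : Q.P S) :
    Q.ractP S b (a * a') x = Q.ractP S b a' (Q.ractP S b a x) :=
  Subtype.ext (Q.ract_mul b a a' x.1).symm

lemma ractP_smul (b : Block N) (a c : K) (x : Q.P S) :
    Q.ractP S b a (c • x) = c • Q.ractP S b a x := Subtype.ext (Q.ract_smulK b a c x.1)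

lemma ractP_add (hb : b ∈ S) (a a' : K) (x : Q.P S) :
    Q.ractP S b (a + a') x = Q.ractP S b a x + Q.ractP S b a' x :=
  Subtype.ext (Q.ract_add x.2 hb a a')

variable (Q S) in
/-- The action of K on the functionals that is dual to the right action at the input `b`. -/
def rho (b : Block N) (a : K) : Q.X S →ₗ[k] Q.X S where
  toFun f :=
    { toFun := fun x => f (Q.ractP S b a x)
      map_add' := by simp
      map_smul' := fun c x => by rw [ractP_smul, map_smul]; rfl }
  map_add' _ _ := rfl
  map_smul' _ _ := rfl

lemma rho_apply (b : Block N) (a : K) (f : Q.X S) (x : Q.P S) :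
    rho Q S b a f x = f (Q.ractP S b a x) := rfl

lemma rho_comm {b c : Block N} (hbc : b ≠ c) (a a' : K) (f : Q.X S) :
    rho Q S b a (rho Q S c a' f) = rho Q S c a' (rho Q S b a f) :=
  LinearMap.ext fun x => by simp only [rho_apply, ractP_comm hbc]

lemma rho_add (hb : b ∈ S) (a a' : K) :
    rho Q S b (a + a') = rho Q S b a + rho Q S b a' :=
  LinearMap.ext fun f => LinearMap.ext fun x => by
    simp only [rho_apply, ractP_add hb, LinearMap.add_apply, map_add]

variable (Q) in
/-- `rho` as a homomorphism of algebras. -/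
def rhoHom (hb : b ∈ S) : K →ₐ[k] Module.End k (Q.X S) :=
  AlgHom.ofLinearMap
    { toFun := rho Q S b
      map_add' := rho_add hb
      map_smul' := fun c a => LinearMap.ext fun f => LinearMap.ext fun x => by
        simp only [RingHom.id_apply, LinearMap.smul_apply, rho_apply]
        rw [Algebra.smul_def, ractP_mul, ← LinearMap.map_smul_of_tower,
          ← map_smul (Q.ractP S b a)]
        congr 2
        exact Subtype.ext (Q.ract_algebraMap x.2 hb c) }
    (LinearMap.ext fun f => LinearMap.ext fun x => by
      change f (Q.ractP S b 1 x) = f x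
      congr 1
      exact Subtype.ext (Q.ract_one b x.1))
    (fun a a' => LinearMap.ext fun f => LinearMap.ext fun x => by
      change f (Q.ractP S b (a * a') x) = f (Q.ractP S b a' (Q.ractP S b a x))
      rw [ractP_mul])

lemma rhoHom_apply (hb : b ∈ S) (a : K) : rhoHom Q hb a = rho Q S b a := rfl

end Rho

variable (Q) in
/-- Decorated trees. -/
abbrev St (N : ℕ) : Type _ := 𝓕 N × Q.Dec N

variable (Q) in

variable {s : Block N → Q.St N}
/-- `G` is an element of Hom_K(P(S) ⊗ ⊗_b P(V_b), K), for all choices of a tree `V_b` on each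
block `b` of `S`, where the tensor products are taken over K. -/
structure IsMF (S : 𝓕 N) (G : (Block N → Q.St N) → Q.X S) : Prop where
  congr : ∀ s s', (∀ b ∈ S, s b = s' b) → G s = G s'
  fam : ∀ s, ∀ b ∈ S, Q.IsFam (fun a => rho Q S b a) b fun V m => G (update s b (V, m))

variable (Q S) in
/-- The group of the forms on the forests over `S`. -/
def MF : AddSubgroup ((Block N → Q.St N) → Q.X S) where
  carrier := {G | Q.IsMF S G}
  add_mem' {G G'} h h' := ⟨fun s s' hs => by
      rw [Pi.add_apply, Pi.add_apply, h.congr s s' hs, h'.congr s s' hs],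
    fun s b hb => (h.fam s b hb).add (h'.fam s b hb) fun a x y => map_add _ x y⟩
  zero_mem' := ⟨fun _ _ _ => rfl, fun _ _ _ => isFam_zero fun a => map_zero _⟩
  neg_mem' {G} h := ⟨fun s s' hs => by rw [Pi.neg_apply, Pi.neg_apply, h.congr s s' hs],
    fun s b hb => (h.fam s b hb).map (fun _ => -LinearMap.id) fun _ a x => by simp⟩

lemma MF.fam (G : Q.MF S) (s : Block N → Q.St N) (hb : b ∈ S) :
    Q.IsFam (fun a => rhoHom Q hb a) b fun V m => G.1 (update s b (V, m)) :=
  G.2.fam s b hb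

section Star

variable (B : ∀ b : Block N, Q.Frame b)

/-- The action on the forms on forests of an endomorphism of the cobar complex of the block `b`. -/
def starF (b : Block N) (T : Module.End Kᵐᵒᵖ (Q.cobar b)) (G : (Block N → Q.St N) → Q.X S)
    (s : Block N → Q.St N) : Q.X S :=
  ∑ l, rho Q S b ((T ((B b).Φ l)).1 (s b).1 (s b).2)
    (G (update s b ((B b).V l, (B b).m l)))

lemma starF_mem (hb : b ∈ S) (T : Module.End Kᵐᵒᵖ (Q.cobar b)) (G : Q.MF S) :
    Q.IsMF S (starF B b T G.1) where
  congr s s' hs := by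
    unfold starF
    rw [hs b hb]
    refine sum_congr rfl fun l _ => ?_
    congr 1
    refine G.2.congr _ _ fun c hc => ?_
    by_cases h : c = b
    · subst h; simp
    · simp [h, hs c hc]
  fam s c hc := by
    refine isFam_sum _ (fun l _ => ?_) fun a x y => map_add _ x y
    by_cases h : c = b
    · subst h
      simp only [update_self, Function.update_idem]
      exact IsFam.map (T ((B c).Φ l)).2
        (fun _ => (rhoHom Q hb).toLinearMap.flip (G.1 (update s c ((B c).V l, (B c).m l))))
        fun _ a x => by
          change rhoHom Q hb (a * x) _ = rhoHom Q hb a (rhoHom Q hb x _)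
          rw [map_mul]; rfl
    · simp only [update_of_ne (Ne.symm h), Function.update_comm h]
      exact (G.2.fam _ c hc).map (fun _ => rho Q S b _) fun _ a x => rho_comm (Ne.symm h) _ _ _

lemma star_expand [IsSemisimpleRing K] (hb : b ∈ S) (G : Q.MF S)
    (s : Block N → Q.St N) (t : Q.St N) :
    G.1 (update s b t) = ∑ l, rho Q S b (((B b).Φ l).1 t.1 t.2)
      (G.1 (update s b ((B b).V l, (B b).m l))) :=
  (B b).expand (rhoHom Q hb) (MF.fam G s hb) t.1 t.2

lemma coe_sum_apply {ι : Type*} (t : Finset ι) (f : ι → Q.cobar A) (V : 𝓕 N)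
    (m : Q.Dec N) : (∑ i ∈ t, f i).1 V m = ∑ i ∈ t, (f i).1 V m := by
  simp only [AddSubmonoidClass.coe_finsetSum, Finset.sum_apply]

/-- The ring of endomorphisms of an abelian group. -/
abbrev GroupEnd (M : Type*) [AddCommGroup M] : Type _ := AddMonoid.End M

/-- The action on the forms on forests over `S` of the endomorphisms of the cobar complex of the block
`b` of `S`. -/
def star [IsSemisimpleRing K] (hb : b ∈ S) :
    Module.End Kᵐᵒᵖ (Q.cobar b) →+* GroupEnd (Q.MF S) where
  toFun T :=
    { toFun := fun G => ⟨starF B b T G.1, starF_mem B hb T G⟩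
      map_zero' := Subtype.ext (by funext s; simp [starF])
      map_add' := fun G G' => Subtype.ext (by funext s; simp [starF, sum_add_distrib]) }
  map_one' := AddMonoidHom.ext fun G => Subtype.ext (by
    funext s
    change starF B b 1 G.1 s = G.1 s
    conv_rhs => rw [← Function.update_eq_self b s, star_expand B hb G s (s b)]
    rfl)
  map_mul' T T' := AddMonoidHom.ext fun G => Subtype.ext (by
    funext s
    change starF B b (T * T') G.1 s = starF B b T (starF B b T' G.1) s
    simp only [starF, update_self, Function.update_idem, map_sum]
    rw [sum_comm]
    refine sum_congr rfl fun l _ => ?_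
    have h : (T * T') ((B b).Φ l)
        = ∑ j, op ((T' ((B b).Φ l)).1 ((B b).V j) ((B b).m j)) • T ((B b).Φ j) := by
      rw [Module.End.mul_apply]
      conv_lhs => rw [(B b).eq (T' ((B b).Φ l))]
      rw [map_sum]
      exact sum_congr rfl fun j _ => map_smul _ _ _
    rw [h, coe_sum_apply, ← rhoHom_apply hb, map_sum, LinearMap.sum_apply]
    refine sum_congr rfl fun j _ => ?_
    change rhoHom Q hb (_ * _) _ = _
    rw [map_mul]
    rfl)
  map_zero' := AddMonoidHom.ext fun G => Subtype.ext (by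
    funext s
    change starF B b 0 G.1 s = 0
    unfold starF
    refine sum_eq_zero fun l _ => ?_
    rw [← rhoHom_apply hb]
    change rhoHom Q hb 0 _ = 0
    rw [map_zero]; rfl)
  map_add' T T' := AddMonoidHom.ext fun G => Subtype.ext (by
    funext s
    change starF B b (T + T') G.1 s = starF B b T G.1 s + starF B b T' G.1 s
    unfold starF
    rw [← sum_add_distrib]
    refine sum_congr rfl fun l _ => ?_
    rw [← LinearMap.add_apply, ← rho_add hb]
    rfl)

variable [IsSemisimpleRing K]

lemma star_apply (hb : b ∈ S) (T : Module.End Kᵐᵒᵖ (Q.cobar b)) (G : Q.MF S)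
    (s : Block N → Q.St N) : (star B hb T G).1 s = ∑ l,
      rho Q S b ((T ((B b).Φ l)).1 (s b).1 (s b).2)
        (G.1 (update s b ((B b).V l, (B b).m l))) := rfl

lemma star_comm {b c : Block N} (hb : b ∈ S) (hc : c ∈ S) (hbc : b ≠ c)
    (T : Module.End Kᵐᵒᵖ (Q.cobar b)) (T' : Module.End Kᵐᵒᵖ (Q.cobar c)) :
    star B hb T * star B hc T' = star B hc T' * star B hb T := by
  refine AddMonoidHom.ext fun G => Subtype.ext ?_
  funext s
  change (star B hb T (star B hc T' G)).1 s = (star B hc T' (star B hb T G)).1 s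
  simp only [star_apply, map_sum, update_of_ne hbc, update_of_ne hbc.symm]
  rw [sum_comm]
  refine sum_congr rfl fun l _ => sum_congr rfl fun j _ => ?_
  rw [rho_comm hbc, Function.update_comm hbc]

lemma star_εc (hb : b ∈ S) (G : Q.MF S) (s : Block N → Q.St N) :
    (star B hb (Q.εc b) G).1 s = ((-1) ^ (eA b (s b).1).card : ℤ) • G.1 s := by
  conv_rhs => rw [← Function.update_eq_self b s, star_expand B hb G s (s b), smul_sum]
  rw [star_apply]
  refine sum_congr rfl fun l _ => ?_
  rw [εc_apply, ← rhoHom_apply hb, map_zsmul, ← rhoHom_apply hb]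
  simp

lemma star_δc (hb : b ∈ S) (G : Q.MF S) (s : Block N → Q.St N) :
    (star B hb (Q.δc b) G).1 s
      = dif b (fun V m => G.1 (update s b (V, m))) (s b).1 (s b).2 := by
  have h : (fun V m => G.1 (update s b (V, m))) = fun V m => ∑ l,
      rho Q S b (((B b).Φ l).1 V m) (G.1 (update s b ((B b).V l, (B b).m l))) := by
    funext V m
    exact star_expand B hb G s (V, m)
  rw [h, dif_sum, star_apply]
  refine sum_congr rfl fun l _ => ?_
  exact (dif_map (((rhoHom Q hb).toLinearMap).flip
    (G.1 (update s b ((B b).V l, (B b).m l)))).toAddMonoidHom b ((B b).Φ l).1 _ _).symm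

end Star

end QuadraticData

variable {s : Block N → Q.St N}

/-! ### Signs of reorderings of the edges -/

/-- The sign character of ℤ/2. -/
def sgn (z : ZMod 2) : ℤ := if z = 0 then 1 else -1

lemma sgn_add (a b : ZMod 2) : sgn (a + b) = sgn a * sgn b := by revert a b; decide

lemma sgn_mul_self (a : ZMod 2) : sgn a * sgn a = 1 := by revert a; decide

lemma sgn_zero : sgn 0 = 1 := rfl

lemma sgn_natCast (n : ℕ) : sgn n = (-1) ^ n := by
  induction n with
  | zero => rfl
  | succ n ih => rw [Nat.cast_succ, sgn_add, ih, pow_succ]; rfl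

lemma two_eq_zero (a : ZMod 2) : a + a = 0 := by revert a; decide

/-- The number, modulo 2, of the pairs of an element of `S` and a smaller element of `S'`. -/
def nlt (S S' : 𝓕 N) : ZMod 2 :=
  ∑ u ∈ S, ∑ w ∈ S', if key w < key u then 1 else 0

lemma cast_inv (u : Block N) (S : 𝓕 N) : (inv u S : ZMod 2) = nlt {u} S := by
  simp [inv, nlt]

lemma nlt_union_left {S T : 𝓕 N} (h : Disjoint S T) (U : 𝓕 N) :
    nlt (S ∪ T) U = nlt S U + nlt T U := sum_union h

lemma nlt_union_right {S T : 𝓕 N} (h : Disjoint S T) (U : 𝓕 N) :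
    nlt U (S ∪ T) = nlt U S + nlt U T := by simp only [nlt, sum_union h, sum_add_distrib]

lemma nlt_insert_left {u : Block N} {T : 𝓕 N} (h : u ∉ T) (U : 𝓕 N) :
    nlt (insert u T) U = nlt {u} U + nlt T U := by
  rw [insert_eq, nlt_union_left (disjoint_singleton_left.2 h)]

lemma nlt_insert_right {u : Block N} {T : 𝓕 N} (h : u ∉ T) (U : 𝓕 N) :
    nlt U (insert u T) = nlt U {u} + nlt U T := by
  rw [insert_eq, nlt_union_right (disjoint_singleton_left.2 h)]

lemma nlt_self (u : Block N) : nlt {u} {u} = 0 := by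
  simp only [nlt, sum_singleton, lt_irrefl, if_false]

lemma nlt_biUnion_right {E : Block N → 𝓕 N}
    (h : ∀ a ∈ R, ∀ b ∈ R, a ≠ b → Disjoint (E a) (E b)) (U : 𝓕 N) :
    nlt U (R.biUnion E) = ∑ b ∈ R, nlt U (E b) := by
  unfold nlt
  rw [sum_comm (s := R)]
  exact sum_congr rfl fun u _ => sum_biUnion fun a ha b hb hab => h a ha b hb hab

lemma nlt_swap {S S' : 𝓕 N} (h : Disjoint S S') :
    nlt S S' + nlt S' S = S.card * S'.card := by
  unfold nlt
  rw [sum_comm (s := S'), ← sum_add_distrib]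
  have : ∀ u ∈ S, ((∑ w ∈ S', if key w < key u then 1 else 0)
      + ∑ w ∈ S', if key u < key w then 1 else 0 : ZMod 2) = S'.card := by
    intro u hu
    rw [← sum_add_distrib, Finset.card_eq_sum_ones, Nat.cast_sum]
    refine sum_congr rfl fun w hw => ?_
    have hne : key u ≠ key w := fun h' =>
      disjoint_left.1 h hu (QuadraticData.key_injective h' ▸ hw)
    rcases lt_or_gt_of_ne hne with h' | h'
    · simp [h', lt_asymm h']
    · simp [h', lt_asymm h']
  rw [sum_congr rfl this]
  simp

lemma nlt_comm_of_even {S S' : 𝓕 N} (h : Disjoint S S') (hS : (S'.card : ZMod 2) = 0) :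
    nlt S S' = nlt S' S := by
  have := nlt_swap h
  rw [hS, mul_zero] at this
  rw [← sub_eq_zero, sub_eq_add_neg, ZMod.neg_eq_self_mod_two, this]

/-- The parity of the permutation that puts the sequence S, E_b (b ∈ S) of edges in
increasing order; S, each of the E_b, and the sequence of the blocks b are in increasing order. -/
def shx (S : 𝓕 N) (E : Block N → 𝓕 N) : ZMod 2 :=
  (∑ b ∈ S, ∑ b' ∈ S, if key b < key b' then nlt (E b) (E b') else 0) + ∑ b ∈ S, nlt (E b) S

lemma shx_congr {E E' : Block N → 𝓕 N}
    (h : ∀ b ∈ S, E b = E' b) : shx S E = shx S E' := by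
  have h1 : ∑ b ∈ S, (∑ b' ∈ S, if key b < key b' then nlt (E b) (E b') else 0)
      = ∑ b ∈ S, ∑ b' ∈ S, if key b < key b' then nlt (E' b) (E' b') else 0 :=
    sum_congr rfl fun b hb => sum_congr rfl fun b' hb' => by rw [h b hb, h b' hb']
  have h2 : ∑ b ∈ S, nlt (E b) S = ∑ b ∈ S, nlt (E' b) S :=
    sum_congr rfl fun b hb => by rw [h b hb]
  rw [shx, shx, h1, h2]

lemma shx_insert (hb : b ∉ R)
    (E : Block N → 𝓕 N) :
    shx (insert b R) E = (∑ a ∈ R, ∑ a' ∈ R, if key a < key a' then nlt (E a) (E a') else 0)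
      + (∑ a ∈ R, ((if key b < key a then nlt (E b) (E a) else 0)
        + (if key a < key b then nlt (E a) (E b) else 0)))
      + nlt (E b) (insert b R) + ∑ a ∈ R, nlt (E a) (insert b R) := by
  unfold shx
  rw [sum_insert hb, sum_insert hb, sum_insert hb, if_neg (lt_irrefl _)]
  simp only [sum_insert hb, sum_add_distrib]
  abel

lemma shx_insert_update (hb : b ∉ R)
    (E : Block N → 𝓕 N) (Y : 𝓕 N) :
    shx (insert b R) (update E b Y)
      = (∑ a ∈ R, ∑ a' ∈ R, if key a < key a' then nlt (E a) (E a') else 0)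
      + (∑ a ∈ R, ((if key b < key a then nlt Y (E a) else 0)
        + (if key a < key b then nlt (E a) Y else 0)))
      + nlt Y (insert b R) + ∑ a ∈ R, nlt (E a) (insert b R) := by
  have hu : ∀ a ∈ R, update E b Y a = E a := fun a ha =>
    update_of_ne (by rintro rfl; exact hb ha) _ _
  rw [shx_insert hb, update_self]
  congr 1
  · congr 2
    · exact sum_congr rfl fun a ha => sum_congr rfl fun a' ha' => by rw [hu a ha, hu a' ha']
    · exact sum_congr rfl fun a ha => by rw [hu a ha]
  · exact sum_congr rfl fun a ha => by rw [hu a ha]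

/-- The effect on the parity of the contraction of an edge of one of the trees. -/
lemma shx_erase (hb : b ∈ S)
    (E : Block N → 𝓕 N) {e : Block N} (he : e ∈ E b)
    (he' : ∀ a ∈ S, a ≠ b → e ∉ E a) :
    shx S E + (nlt {e} S + ∑ a ∈ S, nlt {e} (E a))
      = shx S (update E b ((E b).erase e))
        + (∑ a ∈ S, if key a < key b then ((E a).card : ZMod 2) else 0) + nlt {e} (E b) := by
  obtain ⟨R, hR, rfl⟩ : ∃ R, b ∉ R ∧ insert b R = S :=
    ⟨S.erase b, notMem_erase _ _, insert_erase hb⟩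
  rw [shx_insert hR, shx_insert_update hR, sum_insert hR, sum_insert hR,
    if_neg (lt_irrefl _)]
  have hX : E b = insert e ((E b).erase e) := (insert_erase he).symm
  set Y := (E b).erase e with hY
  have heY : e ∉ Y := notMem_erase _ _
  have h1 : ∑ a ∈ R, ((if key b < key a then nlt (E b) (E a) else 0)
        + (if key a < key b then nlt (E a) (E b) else 0)) + ∑ a ∈ R, nlt {e} (E a)
      = ∑ a ∈ R, ((if key b < key a then nlt Y (E a) else 0)
        + (if key a < key b then nlt (E a) Y else 0))
        + ∑ a ∈ R, if key a < key b then ((E a).card : ZMod 2) else 0 := by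
    rw [← sum_add_distrib, ← sum_add_distrib]
    refine sum_congr rfl fun a ha => ?_
    have hab : a ≠ b := by rintro rfl; exact hR ha
    have h2 := nlt_swap (disjoint_singleton_left.2
      (he' a (mem_insert_of_mem ha) hab))
    rw [card_singleton, Nat.cast_one, one_mul] at h2
    have h3 : nlt (E b) (E a) = nlt {e} (E a) + nlt Y (E a) := by rw [hX, nlt_insert_left heY]
    have h4 : nlt (E a) (E b) = nlt (E a) {e} + nlt (E a) Y := by rw [hX, nlt_insert_right heY]
    have h5 := two_eq_zero (nlt {e} (E a))
    rw [h3, h4]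
    rcases lt_or_gt_of_ne fun h => hab (QuadraticData.key_injective h) with h | h
    · grind
    · grind
  have h6 : nlt (E b) (insert b R) = nlt {e} (insert b R) + nlt Y (insert b R) := by
    conv_lhs => rw [hX, nlt_insert_left heY]
  rw [h6]
  linear_combination h1 + two_eq_zero (nlt {e} (insert b R))

/-- The effect on the parity of the contraction of an edge at the root, in the case in which
all trees have an even number of edges. -/
lemma shx_split {b c1 c2 : Block N} (hb : b ∉ R) (h₁ : c1 ∉ R)
    (h₂ : c2 ∉ R) (hc : key c1 < key c2) (E F : Block N → 𝓕 N)
    (hEF : ∀ a ∈ R, E a = F a) (hE : E b = {c1, c2} ∪ (F c1 ∪ F c2))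
    (hd : Disjoint {c1, c2} (F c1 ∪ F c2)) (hd' : Disjoint (F c1) (F c2))
    (heven : ∀ a, ((F a).card : ZMod 2) = 0) (hbF : ∀ a, b ∉ F a) (hbc1 : b ≠ c1) (hbc2 : b ≠ c2)
    (hdR : ∀ a ∈ R, Disjoint {c1, c2} (F a) ∧ Disjoint (F c1) (F a) ∧ Disjoint (F c2) (F a)) :
    shx (insert b R) E + (nlt {b} (insert b R) + ∑ a ∈ insert b R, nlt {b} (E a))
      = shx {c1, c2} F + shx (insert c1 (insert c2 R)) F
        + (nlt {b} R + nlt {c1} R + nlt {c2} R) := by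
  have hcc : c1 ≠ c2 := fun h => absurd hc (by rw [h]; exact lt_irrefl _)
  have h1' : c1 ∉ insert c2 R := by simp [hcc, h₁]
  have hU : ∀ (X : 𝓕 N), (∀ a ∈ R, Disjoint X (F a)) → ∀ a ∈ R,
      nlt (F a) X = nlt X (F a) := fun X hX a ha => (nlt_comm_of_even (hX a ha) (heven a)).symm
  have hC : nlt {c1, c2} = fun U => nlt {c1} U + nlt {c2} U := by
    funext U
    exact nlt_insert_left (by simpa using hcc) U
  have d1 : ∀ a ∈ R, Disjoint {c1} (F a) := fun a ha =>
    (hdR a ha).1.mono_left (by simp)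
  have d2 : ∀ a ∈ R, Disjoint {c2} (F a) := fun a ha =>
    (hdR a ha).1.mono_left (by simp)
  have db : ∀ a, Disjoint {b} (F a) := fun a => disjoint_singleton_left.2 (hbF a)
  have core : ∑ a ∈ R, (∑ a' ∈ R, if key a < key a' then nlt (E a) (E a') else 0)
      = ∑ a ∈ R, ∑ a' ∈ R, if key a < key a' then nlt (F a) (F a') else 0 :=
    sum_congr rfl fun a ha => sum_congr rfl fun a' ha' => by rw [hEF a ha, hEF a' ha']
  -- The terms of a set of edges `Y` that is on one side of all the trees of `R`.
  have side : ∀ (c : Block N) (Y : 𝓕 N), c ∉ R → (∀ a ∈ R, Disjoint Y (F a)) →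
      ∑ a ∈ R, ((if key c < key a then nlt Y (F a) else 0)
        + (if key a < key c then nlt (F a) Y else 0)) = ∑ a ∈ R, nlt Y (F a) := by
    intro c Y hc hY
    refine sum_congr rfl fun a ha => ?_
    have hac : a ≠ c := by rintro rfl; exact hc ha
    rw [hU Y hY a ha]
    rcases lt_or_gt_of_ne fun h => hac (QuadraticData.key_injective h) with h | h
    · simp [h, lt_asymm h]
    · simp [h, lt_asymm h]
  have hEb : ∀ U, nlt (E b) U = nlt {c1} U + nlt {c2} U + (nlt (F c1) U + nlt (F c2) U) := by
    intro U
    rw [hE, nlt_union_left hd, nlt_union_left hd', hC]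
  have hEb' : nlt {b} (E b) = nlt {b} {c1} + nlt {b} {c2} + (nlt {b} (F c1) + nlt {b} (F c2)) := by
    rw [hE, nlt_union_right hd, nlt_union_right hd', nlt_insert_right (by simpa using hcc)]
  have s1 : ∑ a ∈ R, ((if key b < key a then nlt (E b) (E a) else 0)
        + (if key a < key b then nlt (E a) (E b) else 0))
      = ∑ a ∈ R, nlt {c1} (F a) + ∑ a ∈ R, nlt {c2} (F a)
        + (∑ a ∈ R, nlt (F c1) (F a) + ∑ a ∈ R, nlt (F c2) (F a)) := by
    rw [sum_congr rfl fun a ha => by rw [hEF a ha], side b (E b) hb fun a ha => by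
      rw [hE, disjoint_union_left, disjoint_union_left]
      exact ⟨(hdR a ha).1, (hdR a ha).2.1, (hdR a ha).2.2⟩]
    simp only [hEb, sum_add_distrib]
  have s2 : ∑ a ∈ R, nlt (E a) (insert b R) = ∑ a ∈ R, nlt {b} (F a) + ∑ a ∈ R, nlt (F a) R := by
    rw [← sum_add_distrib]
    refine sum_congr rfl fun a ha => ?_
    rw [hEF a ha, nlt_insert_right hb, hU {b} (fun a _ => db a) a ha]
  have s3 : ∑ a ∈ R, nlt {b} (E a) = ∑ a ∈ R, nlt {b} (F a) :=
    sum_congr rfl fun a ha => by rw [hEF a ha]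
  have s4 : ∑ a ∈ R, nlt (F a) (insert c1 (insert c2 R))
      = ∑ a ∈ R, nlt {c1} (F a) + ∑ a ∈ R, nlt {c2} (F a) + ∑ a ∈ R, nlt (F a) R := by
    rw [← sum_add_distrib, ← sum_add_distrib]
    refine sum_congr rfl fun a ha => ?_
    rw [nlt_insert_right h1', nlt_insert_right h₂, hU _ d1 a ha, hU _ d2 a ha]
    ring
  have t1 : shx (insert b R) E = _ := shx_insert hb E
  have t2 : shx {c1, c2} F = _ := shx_insert (R := {c2}) (b := c1) (by simpa using hcc) F
  have t3 : shx (insert c1 (insert c2 R)) F = _ := shx_insert h1' F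
  simp only [sum_insert h₂, sum_insert hb, sum_singleton, lt_irrefl, if_false,
    hc, if_true, lt_asymm hc, zero_add, add_zero] at t1 t2 t3 ⊢
  have s5 := side c1 (F c1) h₁ fun a ha => (hdR a ha).2.1
  have s6 := side c2 (F c2) h₂ fun a ha => (hdR a ha).2.2
  rw [sum_add_distrib] at s6
  simp only [sum_add_distrib] at t3 s5
  have n1 : ∀ U, nlt U (insert b R) = nlt U {b} + nlt U R := nlt_insert_right hb
  have n2 : ∀ U, nlt U (insert c1 (insert c2 R)) = nlt U {c1} + (nlt U {c2} + nlt U R) := fun U => by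
    rw [nlt_insert_right h1', nlt_insert_right h₂]
  have n3 : ∀ U, nlt U {c1, c2} = nlt U {c1} + nlt U {c2} := fun U =>
    nlt_insert_right (by simpa using hcc) U
  have b1 := nlt_comm_of_even (db c1) (heven c1)
  have b2 := nlt_comm_of_even (db c2) (heven c2)
  have b3 := nlt_swap (S := {b}) (S' := {c1}) (by simpa using hbc1)
  have b4 := nlt_swap (S := {b}) (S' := {c2}) (by simpa using hbc2)
  simp only [card_singleton, Nat.cast_one, mul_one] at b3 b4
  have z0 := nlt_self b
  rw [t1, t2, t3, core, s1, s2, s3, s4, hEb (insert b R), hEb']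
  simp only [n1, n2, n3]
  rw [← b1, ← b2]
  linear_combination b3 + b4 - s5 - s6 + z0 + two_eq_zero (1 : ZMod 2)
    + two_eq_zero (nlt {b} (F c1)) + two_eq_zero (nlt {b} (F c2))
    + two_eq_zero (∑ a ∈ R, nlt {b} (F a)) - two_eq_zero (nlt (F c1) (F c2))
    - two_eq_zero (nlt (F c1) {c1}) - two_eq_zero (nlt (F c1) {c2})
    - two_eq_zero (nlt (F c2) {c1}) - two_eq_zero (nlt (F c2) {c2})

namespace QuadraticData

/-! ### Decomposition of the forms on trees by the partition at the root -/

variable (Q) in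
/-- `s` assigns to each block of `S` a tree on it with a decoration. -/
def Good (S : 𝓕 N) (s : Block N → Q.St N) : Prop :=
  ∀ b ∈ S, IsTree b (s b).1 ∧ Q.Valid (s b).1 (s b).2

/-- The tree that is obtained by grafting the trees of a forest. -/
def jV (A : Block N) (S : 𝓕 N) (s : Block N → Q.St N) : 𝓕 N :=
  glueV A S fun b => (s b).1

/-- The decoration of the grafted tree, with `x` at the root. -/
def jm (A : Block N) (S : 𝓕 N) (s : Block N → Q.St N) (x : Q.Alg (Block N)) : Q.Dec N :=
  fun v => if v = A then x else ∑ b ∈ S, (s b).2 v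

/-- The edges of the trees of a forest. -/
def edg (s : Block N → Q.St N) (b : Block N) : 𝓕 N := eA b (s b).1

/-- The forest that is obtained from a tree by the removal of the root. -/
def spl (V : 𝓕 N) (m : Q.Dec N) (b : Block N) : Q.St N :=
  (V.filter (· ⊆ b), fun v => if v ⊆ b then m v else 0)

lemma edg_spl (V : 𝓕 N) (m : Q.Dec N) (b : Block N) : edg (spl V m) b = eA b V :=
  eA_filter V b

lemma edg_update (s : Block N → Q.St N) (b : Block N) (t : Q.St N) :
    edg (update s b t) = update (edg s) b (eA b t.1) := by
  funext c
  by_cases h : c = b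
  · subst h; simp [edg]
  · simp [edg, h]

lemma jV_update (s : Block N → Q.St N) (b : Block N) (t : Q.St N) :
    jV A S (update s b t) = glueV A S (update (fun c => (s c).1) b t.1) := by
  unfold jV
  congr 1
  funext c
  by_cases h : c = b
  · subst h; simp
  · simp [h]

lemma Good.set (ho : ∀ c ∈ S, c ≠ b →
    IsTree c (s c).1 ∧ Q.Valid (s c).1 (s c).2) (hV : IsTree b V)
    (hm : Q.Valid V m) : Q.Good S (update s b (V, m)) := by
  intro c hc
  by_cases h : c = b
  · subst h; simpa using ⟨hV, hm⟩
  · simpa [h] using ho c hc h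

lemma jm_congr {s s' : Block N → Q.St N} (h : ∀ b ∈ S, s b = s' b) (x : Q.Alg (Block N)) :
    jm A S s x = jm A S s' x := by
  funext v
  unfold jm
  rw [sum_congr rfl fun b hb => by rw [h b hb]]

lemma jV_congr {s s' : Block N → Q.St N} (h : ∀ b ∈ S, s b = s' b) :
    jV A S s = jV A S s' := glueV_congr fun b hb => by rw [h b hb]

lemma jm_top (s : Block N → Q.St N) (x : Q.Alg (Block N)) : jm A S s x A = x := if_pos rfl

lemma jm_update_top (s : Block N → Q.St N) (x y : Q.Alg (Block N)) :
    jm A S s y = update (jm A S s x) A y := by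
  funext v
  by_cases h : v = A
  · subst h; simp [jm_top]
  · simp [jm, h]

lemma jV_top_mem (s : Block N → Q.St N) : A ∈ jV A S s := mem_insert_self _ _

lemma mem_jV_of_mem (hb : b ∈ S) (hv : v ∈ (s b).1) : v ∈ jV A S s :=
  mem_glueV.2 (.inr ⟨b, hb, hv⟩)

lemma notMem_edg (hP : IsPart A S) {b u : Block N} (hb : b ∈ S) (hu : u ∈ S) : u ∉ edg s b := by
  intro h
  have h1 := (mem_eA.1 h).2
  have := hP.eq_of_subset hu hb (hP.nonempty u hu) le_rfl h1.1
  exact h1.ne this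

section Join

variable (hP : IsPart A S) (hs : Q.Good S s)
include hP hs

lemma jV_isTree : IsTree A (jV A S s) := glueV_isTree hP fun b hb => (hs b hb).1

lemma jV_inp : inp (jV A S s) A = S := glueV_inp hP fun b hb => (hs b hb).1

lemma jV_inp_of_mem (hb : b ∈ S) (hv : v ∈ (s b).1) :
    inp (jV A S s) v = inp (s b).1 v := glueV_inp_of_mem hP (fun b hb => (hs b hb).1) hb hv

lemma part_unique {b c v : Block N} (hb : b ∈ S) (hc : c ∈ S) (hv : v ∈ (s b).1)
    (hvc : v ⊆ c) : c = b :=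
  hP.eq_of_subset hc hb ((hs b hb).1.edge_nonempty (.inl hv)) hvc ((hs b hb).1.sub v hv)

lemma ne_top_of_mem (hb : b ∈ S) (hv : v ∈ (s b).1) : v ≠ A := by
  rintro rfl
  exact notMem_of_part hP (fun b hb => (hs b hb).1) hb hv

lemma dec_eq_zero {b c v : Block N} (hb : b ∈ S) (hc : c ∈ S) (hv : v ∈ (s b).1) (hbc : c ≠ b) :
    (s c).2 v = 0 :=
  (hs c hc).2.zero v fun h => hbc (part_unique hP hs hb hc hv ((hs c hc).1.sub v h))

lemma jm_of_mem (hb : b ∈ S) (hv : v ∈ (s b).1) (x : Q.Alg (Block N)) :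
    jm A S s x v = (s b).2 v := by
  rw [jm, if_neg (ne_top_of_mem hP hs hb hv),
    sum_eq_single_of_mem b hb fun c hc hcb => dec_eq_zero hP hs hb hc hv hcb]

lemma jm_off (hv : v ∉ jV A S s) (x : Q.Alg (Block N)) : jm A S s x v = 0 := by
  have h : v ≠ A := by rintro rfl; exact hv (mem_insert_self _ _)
  rw [jm, if_neg h]
  exact sum_eq_zero fun b hb => (hs b hb).2.zero v fun h =>
    hv (mem_glueV.2 (.inr ⟨b, hb, h⟩))

lemma jm_valid {x : Q.Alg (Block N)} (hx : x ∈ Q.P S) : Q.Valid (jV A S s) (jm A S s x) where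
  mem v hv := by
    rcases mem_glueV.1 hv with rfl | ⟨b, hb, hvb⟩
    · rw [jm_top, jV_inp hP hs]; exact hx
    · rw [jm_of_mem hP hs hb hvb, jV_inp_of_mem hP hs hb hvb]
      exact (hs b hb).2.mem v hvb
  zero v hv := jm_off hP hs hv x

lemma spl_join (hb : b ∈ S) (x : Q.Alg (Block N)) :
    spl (jV A S s) (jm A S s x) b = s b := by
  have h1 : (jV A S s).filter (· ⊆ b) = (s b).1 :=
    glueV_filter hP (fun b hb => (hs b hb).1) hb
  refine Prod.ext h1 ?_
  funext v
  change (if v ⊆ b then jm A S s x v else 0) = (s b).2 v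
  by_cases hv : v ∈ (s b).1
  · rw [if_pos ((hs b hb).1.sub v hv), jm_of_mem hP hs hb hv]
  · rw [(hs b hb).2.zero v hv]
    split_ifs with h
    · exact jm_off hP hs (fun h' => hv (h1 ▸ mem_filter.2 ⟨h', h⟩)) x
    · rfl

lemma eA_jV : eA A (jV A S s) = S ∪ S.biUnion (edg s) := by
  ext u
  rw [mem_eA_iff, jV_inp hP hs, mem_union, mem_biUnion]
  refine or_congr Iff.rfl (exists_congr fun b => and_congr_right fun hb => ?_)
  have : (jV A S s).filter (· ⊆ b) = (s b).1 := glueV_filter hP (fun b hb => (hs b hb).1) hb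
  rw [edg, ← this, eA_filter]

lemma disjoint_edg {b c : Block N} (hb : b ∈ S) (hc : c ∈ S) (hbc : b ≠ c) :
    Disjoint (edg s b) (edg s c) := by
  refine disjoint_left.2 fun u hu hu' => hbc ?_
  have h1 := mem_eA.1 hu
  exact hP.eq_of_subset hb hc ((hs b hb).1.edge_nonempty h1.1) h1.2.1 (mem_eA.1 hu').2.1

lemma nlt_eA_jV (e : Block N) :
    nlt {e} (eA A (jV A S s)) = nlt {e} S + ∑ b ∈ S, nlt {e} (edg s b) := by
  rw [eA_jV hP hs, nlt_union_right, nlt_biUnion_right]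
  · exact fun a ha b hb hab => disjoint_edg hP hs ha hb hab
  · refine disjoint_left.2 fun u hu hu' => ?_
    obtain ⟨b, hb, h⟩ := mem_biUnion.1 hu'
    exact notMem_edg hP hb hu h

end Join

lemma jm_update (hP : IsPart A S) (hb : b ∈ S)
    (ho : ∀ c ∈ S, c ≠ b → IsTree c (s c).1 ∧ Q.Valid (s c).1 (s c).2)
    (hV : IsTree b V) (hm : Q.Valid V m)
    (hv : v ∈ V) (z : Q.Alg (Block N)) (x : Q.Alg (Block N)) :
    jm A S (update s b (V, update m v z)) x
      = update (jm A S (update s b (V, m)) x) v z := by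
  have hs := Good.set ho hV hm
  have hv' : v ∈ (update s b (V, m) b).1 := by simpa using hv
  funext u
  by_cases huv : u = v
  · subst huv
    rw [update_self, jm, if_neg (ne_top_of_mem hP hs hb hv'),
      sum_eq_single_of_mem b hb]
    · simp
    · intro c hc hcb
      have := dec_eq_zero hP hs hb hc hv' hcb
      rw [update_of_ne hcb] at this ⊢
      exact this
  · rw [update_of_ne huv, jm, jm]
    congr 1
    refine sum_congr rfl fun c _ => ?_
    by_cases h : c = b
    · subst h; simp [huv]
    · simp [h]

open scoped Classical in
/-- The component, at the partition `S`, of an element of the cobar complex; the sign puts the edges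
of the tree in the order: S, followed by the edges of the trees of the forest. -/
def splitF (hP : IsPart A S) (Φ : Q.cobar A) (s : Block N → Q.St N) : Q.X S :=
  if hs : Q.Good S s then
    { toFun := fun x => sgn (shx S (edg s)) • Φ.1 (jV A S s) (jm A S s x.1)
      map_add' := fun x y => by
        have h := (Φ.2.isFm _ (jV_isTree hP hs)).add (jm_valid hP hs x.2) (jV_top_mem s)
          (x := x.1) (y := y.1) (by rw [jV_inp hP hs]; exact x.2) (by rw [jV_inp hP hs]; exact y.2)
        rw [← jm_update_top, ← jm_update_top, ← jm_update_top] at h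
        rw [← smul_add, ← h]; rfl
      map_smul' := fun a x => by
        have h := (Φ.2.isFm _ (jV_isTree hP hs)).root _ (jm_valid hP hs x.2) (jV_top_mem s) a
        rw [← jm_update_top, jm_top] at h
        rw [RingHom.id_apply, smul_eq_mul, mul_smul_comm, ← h]; rfl }
  else 0

lemma splitF_apply (hP : IsPart A S) (Φ : Q.cobar A) (hs : Q.Good S s)
    (x : Q.P S) : splitF hP Φ s x = sgn (shx S (edg s)) • Φ.1 (jV A S s) (jm A S s x.1) := by
  rw [splitF, dif_pos hs]; rfl

lemma splitF_of_not (hP : IsPart A S) (Φ : Q.cobar A)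
    (hs : ¬ Q.Good S s) : splitF hP Φ s = 0 := by rw [splitF, dif_neg hs]

lemma Good.congr {s s' : Block N → Q.St N} (hs : Q.Good S s) (h : ∀ b ∈ S, s b = s' b) :
    Q.Good S s' := fun b hb => by rw [← h b hb]; exact hs b hb

lemma splitF_mem (hP : IsPart A S) (Φ : Q.cobar A) : Q.IsMF S (splitF hP Φ) where
  congr s s' h := by
    by_cases hs : Q.Good S s
    · refine LinearMap.ext fun x => ?_
      rw [splitF_apply hP Φ hs, splitF_apply hP Φ (hs.congr h), jV_congr h, jm_congr h,
        shx_congr (E' := edg s') fun b hb => by rw [edg, edg, h b hb]]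
    · rw [splitF_of_not hP Φ hs, splitF_of_not hP Φ fun hs' =>
        hs (hs'.congr fun b hb => (h b hb).symm)]
  fam s b hb := by
    by_cases ho : ∀ c ∈ S, c ≠ b → IsTree c (s c).1 ∧ Q.Valid (s c).1 (s c).2
    swap
    · have : (fun V m => splitF hP Φ (update s b (V, m))) = fun _ _ => 0 := by
        funext V m
        refine splitF_of_not hP Φ fun h => ho fun c hc hcb => ?_
        simpa [hcb] using h c hc
      rw [this]
      exact isFam_zero fun a => map_zero _
    have hoff : ∀ V m, ¬ (IsTree b V ∧ Q.Valid V m) →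
        splitF hP Φ (update s b (V, m)) = 0 := fun V m h =>
      splitF_of_not hP Φ fun h' => h (by simpa using h' b hb)
    refine ⟨fun V hV => ?_, fun V hV => by funext m; exact hoff V m fun h => hV h.1⟩
    have hg := fun m hm => Good.set (m := m) ho hV hm
    have hbot : b ∈ S := hb
    -- The grafted tree does not depend on the decoration.
    set W := glueV A S (update (fun c => (s c).1) b V) with hW
    have hJ : ∀ m, jV A S (update s b (V, m)) = W := fun m => jV_update s b (V, m)
    have hval : ∀ m, Q.Valid V m → ∀ x : Q.P S,
        splitF hP Φ (update s b (V, m)) x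
          = sgn (shx S (update (edg s) b (eA b V))) •
            Φ.1 W (jm A S (update s b (V, m)) x.1) := fun m hm x => by
      rw [splitF_apply hP Φ (hg m hm), edg_update, hJ]
    have hvb : ∀ m, ∀ v ∈ V, v ∈ (update s b (V, m) b).1 := fun m v hv => by simpa using hv
    have hvW : ∀ v ∈ V, v ∈ W := fun v hv => mem_glueV.2 (.inr ⟨b, hb, by simpa using hv⟩)
    by_cases hex : ∃ m : Q.Dec N, Q.Valid V m
    swap
    · refine ⟨fun m hm => hoff V m fun h => hm h.2, fun m hm => (hex ⟨m, hm⟩).elim,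
        fun m hm => (hex ⟨m, hm⟩).elim, fun m hm => (hex ⟨m, hm⟩).elim⟩
    obtain ⟨m0, hm₀⟩ := hex
    have hWt : IsTree A W := by rw [← hJ m0]; exact jV_isTree hP (hg m0 hm₀)
    have hinp : ∀ v ∈ V, inp W v = inp V v := fun v hv => by
      rw [← hJ m0, jV_inp_of_mem hP (hg m0 hm₀) hb (hvb m0 v hv)]
      simp
    have hinpA : inp W A = S := by rw [← hJ m0, jV_inp hP (hg m0 hm₀)]
    have hf := Φ.2.isFm W hWt
    have hjv : ∀ m, Q.Valid V m → ∀ x : Q.P S, Q.Valid W (jm A S (update s b (V, m)) x.1) :=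
      fun m hm x => by rw [← hJ m]; exact jm_valid hP (hg m hm) x.2
    have hjof : ∀ m, Q.Valid V m → ∀ v ∈ V, ∀ x,
        jm A S (update s b (V, m)) x v = m v := fun m hm v hv x => by
      rw [jm_of_mem hP (hg m hm) hb (hvb m v hv)]; simp
    refine ⟨fun m hm => hoff V m fun h => hm h.2, fun m hm v hv c x hx y hy => ?_, fun m hm hbV a => ?_, fun m hm v hv u hu hvu a => ?_⟩
    · refine LinearMap.ext fun z => ?_
      rw [LinearMap.add_apply, LinearMap.smul_apply, hval _ (hm.set hv (Submodule.add_mem _ (Submodule.smul_mem _ c hx) hy)),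
        hval _ (hm.set hv hx), hval _ (hm.set hv hy), jm_update hP hb ho hV hm hv,
        jm_update hP hb ho hV hm hv, jm_update hP hb ho hV hm hv, smul_comm c, ← smul_add]
      congr 1
      exact hf.lin _ (hjv m hm z) v (hvW v hv) c x (by rwa [hinp v hv]) y (by rwa [hinp v hv])
    · refine LinearMap.ext fun z => ?_
      rw [rho_apply, hval _ (hm.smul hbV a), hval _ hm, jm_update hP hb ho hV hm hbV]
      congr 1
      have h := hf.bal _ (hjv m hm z) b (hvW b hbV) A (mem_glueV.2 (.inl rfl))
        (by rw [hinpA]; exact hb) a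
      rw [jm_top, ← jm_update_top, hjof m hm b hbV] at h
      exact h.symm
    · refine LinearMap.ext fun z => ?_
      rw [hval _ (hm.ract hu v a), hval _ (hm.smul hv a), jm_update hP hb ho hV hm hu,
        jm_update hP hb ho hV hm hv]
      congr 1
      have h := hf.bal _ (hjv m hm z) v (hvW v hv) u (hvW u hu) (by rwa [hinp u hu]) a
      rwa [hjof m hm u hu, hjof m hm v hv] at h

/-- The component at the partition `S`. -/
def splitG (hP : IsPart A S) : Q.cobar A →+ Q.MF S where
  toFun Φ := ⟨splitF hP Φ, splitF_mem hP Φ⟩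
  map_zero' := Subtype.ext (by
    funext s
    by_cases hs : Q.Good S s
    · refine LinearMap.ext fun x => ?_
      rw [splitF_apply hP 0 hs]
      simp
    · exact splitF_of_not hP 0 hs)
  map_add' Φ Ψ := Subtype.ext (by
    funext s
    change splitF hP (Φ + Ψ) s = splitF hP Φ s + splitF hP Ψ s
    by_cases hs : Q.Good S s
    · refine LinearMap.ext fun x => ?_
      rw [LinearMap.add_apply, splitF_apply hP _ hs, splitF_apply hP _ hs, splitF_apply hP _ hs,
        ← smul_add]
      rfl
    · rw [splitF_of_not hP _ hs, splitF_of_not hP _ hs, splitF_of_not hP _ hs, add_zero])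

lemma splitG_apply (hP : IsPart A S) (Φ : Q.cobar A) (hs : Q.Good S s)
    (x : Q.P S) :
    (splitG hP Φ).1 s x = sgn (shx S (edg s)) • Φ.1 (jV A S s) (jm A S s x.1) :=
  splitF_apply hP Φ hs x

end QuadraticData

namespace QuadraticData

lemma exists_part (hV : IsTree A V) (hv : v ∈ V) (hvA : v ≠ A) : ∃ b ∈ inp V A, v ⊆ b :=
  inp_cover (.inl hv) (lt_of_le_of_ne (hV.sub v hv) hvA)

lemma spl_good (hV : IsTree A V) (hm : Q.Valid V m) : Q.Good (inp V A) (spl V m) := by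
  intro b hb
  refine ⟨hV.filter (mem_inp.1 hb).1, ⟨fun v hv => ?_, fun v hv => ?_⟩⟩
  · obtain ⟨h1, h2⟩ := mem_filter.1 hv
    change (if v ⊆ b then m v else 0) ∈ Q.P (inp (V.filter (· ⊆ b)) v)
    rw [if_pos h2, inp_filter V h2]
    exact hm.mem v h1
  · change (if v ⊆ b then m v else 0) = 0
    split_ifs with h
    · exact hm.zero v fun h' => hv (mem_filter.2 ⟨h', h⟩)
    · rfl

section Tree

variable (hV : IsTree A V) (hA : A ∈ V)
include hV hA

lemma jV_spl (m : Q.Dec N) : jV A (inp V A) (spl V m) = V := hV.eq_glueV hA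

lemma jm_spl (hm : Q.Valid V m) : jm A (inp V A) (spl V m) (m A) = m := by
  have hg := spl_good hV hm
  have hP := hV.isPart_inp hA
  funext v
  by_cases hv : v ∈ V
  · by_cases hvA : v = A
    · rw [hvA, jm_top]
    · obtain ⟨b, hb, hvb⟩ := exists_part hV hv hvA
      rw [jm_of_mem hP hg hb (mem_filter.2 ⟨hv, hvb⟩)]
      exact if_pos hvb
  · rw [hm.zero v hv, jm_off hP hg (by rwa [jV_spl hV hA])]

lemma split_apply (Φ : Q.cobar A) (hm : Q.Valid V m) :
    Φ.1 V m = sgn (shx (inp V A) fun b => eA b V) •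
      (splitG (hV.isPart_inp hA) Φ).1 (spl V m) ⟨m A, hm.mem A hA⟩ := by
  rw [splitG_apply _ _ (spl_good hV hm), smul_smul,
    shx_congr (E' := fun b => eA b V) fun b _ => edg_spl V m b, sgn_mul_self, one_smul,
    jV_spl hV hA]
  simp only [jm_spl hV hA hm]

end Tree

open scoped Classical in
/-- The value of a functional, extended by zero. -/
def ev (f : Q.X S) (x : Q.Alg (Block N)) : K := if h : x ∈ Q.P S then f ⟨x, h⟩ else 0

lemma ev_of_mem (f : Q.X S) {x : Q.Alg (Block N)} (h : x ∈ Q.P S) : ev f x = f ⟨x, h⟩ :=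
  dif_pos h

lemma ev_zero (x : Q.Alg (Block N)) : ev (0 : Q.X S) x = 0 := by unfold ev; split_ifs <;> rfl

lemma ev_add (f g : Q.X S) (x : Q.Alg (Block N)) : ev (f + g) x = ev f x + ev g x := by
  unfold ev; split_ifs <;> simp

open scoped Classical in
/-- The element of the cobar complex with the component `G` at the partition `S`, and zero
at the other partitions. -/
def asmF (A : Block N) (G : (Block N → Q.St N) → Q.X S) : Q.BF N := fun V m =>
  if IsTree A V ∧ Q.Valid V m ∧ inp V A = S then
    sgn (shx S fun b => eA b V) • ev (G (spl V m)) (m A)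
  else 0

lemma asmF_apply {G : (Block N → Q.St N) → Q.X S} (hV : IsTree A V)
    (hm : Q.Valid V m) (hS : inp V A = S) :
    asmF A G V m = sgn (shx S fun b => eA b V) • ev (G (spl V m)) (m A) := if_pos ⟨hV, hm, hS⟩

lemma asmF_mem (hP : IsPart A S) (G : Q.MF S) : asmF A G.1 ∈ Q.cobar A := by
  refine ⟨fun V hV => ?_, fun V hV => by funext m; exact if_neg fun h => hV h.1⟩
  by_cases hS : inp V A = S
  swap
  · have : asmF A G.1 V = fun _ => 0 := by funext m; exact if_neg fun h => hS h.2.2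
    rw [this]
    exact ⟨by simp, by simp, by simp, by simp⟩
  have hA : A ∈ V := hV.top hP.two_le_card
  have hval : ∀ m, Q.Valid V m → asmF A G.1 V m
      = sgn (shx S fun b => eA b V) • ev (G.1 (spl V m)) (m A) :=
    fun m hm => asmF_apply hV hm hS
  -- An update of the decoration of the root changes the argument of the functional.
  have htop : ∀ m : Q.Dec N, ∀ z, G.1 (spl V (update m A z)) = G.1 (spl V m) := by
    intro m z
    refine G.2.congr _ _ fun b hb => Prod.ext rfl ?_
    funext v
    change (if v ⊆ b then update m A z v else 0) = if v ⊆ b then m v else 0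
    split_ifs with h
    · rw [update_of_ne]
      rintro rfl
      exact (hP.ssubset hb).2 h
    · rfl
  -- An update of another decoration changes one of the trees of the forest.
  have hblk : ∀ v ∈ V, v ≠ A → ∃ b ∈ S, v ∈ V.filter (· ⊆ b) ∧ ∀ u ∈ V.filter (· ⊆ b),
      ∀ m : Q.Dec N, ∀ z, G.1 (spl V (update m u z)) =
        G.1 (update (spl V m) b (V.filter (· ⊆ b), update (spl V m b).2 u z)) := by
    intro v hv hvA
    obtain ⟨b, hb, hvb⟩ := exists_part hV hv hvA
    rw [hS] at hb
    refine ⟨b, hb, mem_filter.2 ⟨hv, hvb⟩, fun u hu m z => ?_⟩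
    obtain ⟨huV, hub⟩ := mem_filter.1 hu
    refine G.2.congr _ _ fun c hc => ?_
    by_cases hcb : c = b
    · subst hcb
      rw [update_self]
      refine Prod.ext rfl ?_
      funext w
      change (if w ⊆ c then update m u z w else 0) = update (spl V m c).2 u z w
      by_cases hwu : w = u
      · subst hwu; simp [hub]
      · rw [update_of_ne hwu, update_of_ne hwu]; rfl
    · rw [update_of_ne hcb]
      refine Prod.ext rfl ?_
      funext w
      change (if w ⊆ c then update m u z w else 0) = if w ⊆ c then m w else 0
      split_ifs with h
      · rw [update_of_ne]
        rintro rfl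
        exact hcb (hP.eq_of_subset hc hb (hV.edge_nonempty (.inl huV)) h hub)
      · rfl
  have hb_tree : ∀ b ∈ S, IsTree b (V.filter (· ⊆ b)) := fun b hb =>
    hV.filter (mem_inp.1 (hS ▸ hb)).1
  have hfm := fun m b hb => (G.2.fam (spl V m) b hb).isFm _ (hb_tree b hb)
  have hvalb : ∀ m, Q.Valid V m → ∀ b ∈ S, Q.Valid (V.filter (· ⊆ b)) (spl V m b).2 :=
    fun m hm b hb => (spl_good hV hm b (hS ▸ hb)).2
  have hsv : ∀ (m : Q.Dec N) b v, v ∈ V.filter (· ⊆ b) → (spl V m b).2 v = m v :=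
    fun m b v hv => if_pos (mem_filter.1 hv).2
  have hinp : ∀ b v, v ∈ V.filter (· ⊆ b) → inp (V.filter (· ⊆ b)) v = inp V v :=
    fun b v hv => inp_filter V (mem_filter.1 hv).2
  have hmA : ∀ m, Q.Valid V m → m A ∈ Q.P S := fun m hm => hS ▸ hm.mem A hA
  refine ⟨fun m hm => if_neg fun h => hm h.2.1, fun m hm v hv c x hx y hy => ?_, fun m hm _ a => ?_, fun m hm v hv u hu hvu a => ?_⟩
  · rw [hval _ (hm.set hv (Submodule.add_mem _ (Submodule.smul_mem _ c hx) hy)),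
      hval _ (hm.set hv hx), hval _ (hm.set hv hy), smul_comm c, ← smul_add]
    congr 1
    by_cases hvA : v = A
    · subst hvA
      rw [hS] at hx hy
      simp only [htop, update_self]
      rw [ev_of_mem _ hx, ev_of_mem _ hy, ev_of_mem _ (Submodule.add_mem _ (Submodule.smul_mem _ c hx) hy),
        ← LinearMap.map_smul_of_tower, ← map_add]
      rfl
    · obtain ⟨b, hb, hvb, h⟩ := hblk v hv hvA
      simp only [h v hvb, update_of_ne (Ne.symm hvA)]
      have h1 := (hfm m b hb).lin _ (hvalb m hm b hb) v hvb c x (by rwa [hinp b v hvb]) y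
        (by rwa [hinp b v hvb])
      simp only [h1, ev_of_mem _ (hmA m hm)]
      rfl
  · rw [hval _ (hm.smul hA a), hval _ hm, mul_smul_comm]
    congr 1
    simp only [htop, update_self]
    rw [ev_of_mem _ (hmA m hm), ev_of_mem _ (Q.smul_mem_P a (hmA m hm)), ← smul_eq_mul, ← map_smul]
    rfl
  · have hvA : v ≠ A := by
      rintro rfl
      exact (mem_inp.1 hvu).2.1.2 (hV.sub u hu)
    rw [hval _ (hm.ract hu v a), hval _ (hm.smul hv a)]
    congr 1
    obtain ⟨b, hb, hvb, h⟩ := hblk v hv hvA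
    by_cases huA : u = A
    · subst huA
      have hvb' : v = b := by
        rw [hS] at hvu
        exact hP.eq_of_subset hvu hb (hP.nonempty v hvu) le_rfl (mem_filter.1 hvb).2
      subst hvb'
      simp only [htop, update_self, h v hvb, update_of_ne (Ne.symm hvA)]
      have h1 := (hfm m v hb).root _ (hvalb m hm v hb) hvb a
      rw [hsv m v v hvb] at h1
      rw [h1, ev_of_mem _ (hmA m hm), ev_of_mem _ (Q.ract_mem v a (hmA m hm)), rho_apply]
      have h2 : G.1 (update (spl V m) v (V.filter (· ⊆ v), (spl V m v).2))
          = G.1 (spl V m) := congrArg G.1 (Function.update_eq_self v (spl V m))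
      rw [h2]
      rfl
    · have hub : u ∈ V.filter (· ⊆ b) := by
        obtain ⟨c, hc, huc, -⟩ := hblk u hu huA
        refine mem_filter.2 ⟨hu, ?_⟩
        have hcb : c = b := hP.eq_of_subset hc hb (hV.edge_nonempty (.inl hv))
          ((mem_inp.1 hvu).2.1.1.trans (mem_filter.1 huc).2) (mem_filter.1 hvb).2
        rw [← hcb]
        exact (mem_filter.1 huc).2
      simp only [h v hvb, h u hub, update_of_ne (Ne.symm hvA),
        update_of_ne (Ne.symm huA)]
      have h1 := (hfm m b hb).bal _ (hvalb m hm b hb) v hvb u hub (by rwa [hinp b u hub]) a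
      rw [hsv m b v hvb, hsv m b u hub] at h1
      rw [h1]

/-- The element of the cobar complex with a given component at the partition `S`. -/
def asm (hP : IsPart A S) (G : Q.MF S) : Q.cobar A := ⟨asmF A G.1, asmF_mem hP G⟩

lemma asm_zero (hP : IsPart A S) (G : Q.MF S) (h : inp V A ≠ S)
    (m : Q.Dec N) : (asm hP G).1 V m = 0 := if_neg fun h' => h h'.2.2

lemma MF_ext {G G' : Q.MF S} (h : ∀ s, Q.Good S s → ∀ x, G.1 s x = G'.1 s x) : G = G' := by
  refine Subtype.ext ?_
  funext s
  by_cases hs : Q.Good S s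
  · exact LinearMap.ext fun x => h s hs x
  · have : ∀ G : Q.MF S, G.1 s = 0 := by
      intro G
      unfold Good at hs
      push Not at hs
      obtain ⟨b, hb, h⟩ := hs
      have := (MF.fam G s hb).off (V := (s b).1) (m := (s b).2) fun h' => h h'.1 h'.2
      simpa using this
    rw [this, this]

lemma split_asm (hP : IsPart A S) (G : Q.MF S) : splitG hP (asm hP G) = G := by
  refine MF_ext fun s hs x => ?_
  have hv := jm_valid hP hs x.2
  rw [splitG_apply hP _ hs]
  change sgn _ • asmF A G.1 _ _ = _
  rw [asmF_apply (jV_isTree hP hs) hv (jV_inp hP hs), jm_top, ev_of_mem _ x.2, smul_smul]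
  have h1 : shx S (fun b => eA b (jV A S s)) = shx S (edg s) := shx_congr fun b hb => by
    rw [← edg_spl (jV A S s) (jm A S s x.1) b, edg, spl_join hP hs hb, edg]
  rw [h1, sgn_mul_self, one_smul, G.2.congr _ s fun b hb => spl_join hP hs hb x.1]

lemma split_asm_of_ne (hP : IsPart A S) (G : Q.MF S) {S' : 𝓕 N}
    (hP' : IsPart A S') (h : S' ≠ S) : splitG hP' (asm hP G) = 0 := by
  refine MF_ext fun s hs x => ?_
  rw [splitG_apply hP' _ hs, asm_zero _ _ (by rwa [jV_inp hP' hs]), smul_zero]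
  rfl

/-- The sum of the differentials of the trees of a forest, with the Koszul sign rule. -/
def forestDif (S : 𝓕 N) (G : (Block N → Q.St N) → Q.X S) (s : Block N → Q.St N) :
    Q.X S :=
  ∑ b ∈ S, sgn (∑ a ∈ S, if key a < key b then ((edg s a).card : ZMod 2) else 0) •
    dif b (fun V m => G (update s b (V, m))) (s b).1 (s b).2

lemma Good.others (hs : Q.Good S s) :
    ∀ c ∈ S, c ≠ b → IsTree c (s c).1 ∧ Q.Valid (s c).1 (s c).2 := fun c hc _ => hs c hc

section Contract

variable (hP : IsPart A S) (hs : Q.Good S s) {b e : Block N} (hb : b ∈ S)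
  (he : e ∈ (s b).1)
include hP hs hb he

lemma jV_erase :
    jV A S (update s b ((s b).1.erase e, Q.ctr (s b).1 e (s b).2)) = (jV A S s).erase e := by
  ext v
  rw [jV, mem_glueV, mem_erase, jV, mem_glueV]
  constructor
  · rintro (rfl | ⟨c, hc, hv⟩)
    · exact ⟨(ne_top_of_mem hP hs hb he).symm, .inl rfl⟩
    · by_cases h : c = b
      · grind
      · rw [update_of_ne h] at hv
        refine ⟨?_, .inr ⟨c, hc, hv⟩⟩
        rintro rfl
        exact h (part_unique hP hs hb hc he ((hs c hc).1.sub _ hv))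
  · grind

lemma jm_ctr (heb : e ≠ b) (x : Q.Alg (Block N)) :
    jm A S (update s b ((s b).1.erase e, Q.ctr (s b).1 e (s b).2)) x
      = Q.ctr (jV A S s) e (jm A S s x) := by
  have hg : Q.Good S (update s b ((s b).1.erase e, Q.ctr (s b).1 e (s b).2)) :=
    Good.set hs.others ((hs b hb).1.erase heb) ((hs b hb).2.ctr (hs b hb).1 he)
  have heA := ne_top_of_mem hP hs hb he
  have heB : e ⊆ b := (hs b hb).1.sub e he
  have hne := (hs b hb).1.edge_nonempty (.inl he)
  funext v
  by_cases hv : v ∈ jV A S s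
  swap
  · rw [jm_off hP hg (fun h => hv ?_)]
    · unfold ctr
      simp [jm_off hP hs hv]
    · rw [jV_erase hP hs hb he] at h
      exact mem_of_mem_erase h
  rcases mem_glueV.1 hv with rfl | ⟨c, hc, hvc⟩
  · rw [jm_top, ctr_of_notMem heA.symm, jm_top]
    rw [jV_inp hP hs]
    intro h
    exact heb (hP.eq_of_subset h hb hne le_rfl heB)
  · by_cases hcb : c = b
    · subst hcb
      by_cases hve : v = e
      · subst hve
        rw [ctr_self, jm_off hP hg]
        rw [jV_erase hP hs hb he]
        exact notMem_erase _ _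
      · have hv' : v ∈ (update s c ((s c).1.erase e, Q.ctr (s c).1 e (s c).2) c).1 := by
          rw [update_self]
          exact mem_erase.2 ⟨hve, hvc⟩
        rw [jm_of_mem hP hg hb hv', update_self]
        unfold ctr
        rw [jV_inp_of_mem hP hs hb hvc, jm_of_mem hP hs hb hvc, jm_of_mem hP hs hb he]
    · have hv' : v ∈ (update s b ((s b).1.erase e, Q.ctr (s b).1 e (s b).2) c).1 := by
        rwa [update_of_ne hcb]
      have hve : v ≠ e := by
        rintro rfl
        exact hcb (part_unique hP hs hb hc he ((hs c hc).1.sub _ hvc))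
      rw [jm_of_mem hP hg hc hv', update_of_ne hcb, ctr_of_notMem hve,
        jm_of_mem hP hs hc hvc]
      rw [jV_inp_of_mem hP hs hc hvc]
      intro h
      exact hcb (part_unique hP hs hb hc he ((mem_inp.1 h).2.1.1.trans ((hs c hc).1.sub _ hvc)))

lemma sign_erase (heb : e ≠ b) :
    sgn (shx S (edg s)) * (-1) ^ inv e (eA A (jV A S s))
      = sgn (∑ a ∈ S, if key a < key b then ((edg s a).card : ZMod 2) else 0)
        * ((-1) ^ inv e (eA b (s b).1)
        * sgn (shx S (edg (update s b ((s b).1.erase e, Q.ctr (s b).1 e (s b).2))))) := by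
  have heE : e ∈ edg s b :=
    mem_eA.2 ⟨.inl he, lt_of_le_of_ne ((hs b hb).1.sub e he) heb⟩
  have h := shx_erase hb (edg s) heE fun a ha hab h' =>
    disjoint_left.1 (disjoint_edg hP hs ha hb hab) h' heE
  rw [← nlt_eA_jV hP hs] at h
  rw [edg_update, (hs b hb).1.eA_erase he, ← sgn_natCast, ← sgn_natCast, cast_inv, cast_inv,
    ← sgn_add, h, sgn_add, sgn_add]
  rw [edg]
  ring

end Contract

/-- The differential, on the grafted tree of a forest: the contractions of the edges of the forest, and
those of the edges at the root. -/
lemma dif_split (hP : IsPart A S) (Φ : Q.cobar A) (hs : Q.Good S s)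
    (x : Q.P S) :
    sgn (shx S (edg s)) • dif A Φ.1 (jV A S s) (jm A S s x.1)
      = forestDif S (splitG hP Φ).1 s x
        + ∑ b ∈ S, if b ∈ (s b).1 then
          (sgn (shx S (edg s)) * (-1) ^ inv b (eA A (jV A S s))) •
            Φ.1 ((jV A S s).erase b) (Q.ctr (jV A S s) b (jm A S s x.1)) else 0 := by
  rw [dif_of (jV_isTree hP hs) (jm_valid hP hs x.2), smul_sum]
  have h1 : (jV A S s).erase A = S.biUnion fun b => (s b).1 := by
    rw [jV, glueV, erase_insert]
    intro h
    obtain ⟨b, hb, h⟩ := mem_biUnion.1 h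
    exact ne_top_of_mem hP hs hb h rfl
  rw [h1, sum_biUnion fun b hb c hc hbc => disjoint_left.2 fun v hv hv' =>
    hbc (part_unique hP hs hc hb hv' ((hs b hb).1.sub v hv)), forestDif, LinearMap.sum_apply,
    ← sum_add_distrib]
  refine sum_congr rfl fun b hb => ?_
  have h2 : ∀ e ∈ (s b).1.erase b, sgn (shx S (edg s)) • ((-1) ^ inv e (eA A (jV A S s)) : ℤ) •
      Φ.1 ((jV A S s).erase e) (Q.ctr (jV A S s) e (jm A S s x.1))
      = sgn (∑ a ∈ S, if key a < key b then ((edg s a).card : ZMod 2) else 0) •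
        ((-1) ^ inv e (eA b (s b).1) : ℤ) •
          (splitG hP Φ).1 (update s b ((s b).1.erase e, Q.ctr (s b).1 e (s b).2)) x := by
    intro e he
    obtain ⟨heb, he⟩ := mem_erase.1 he
    rw [splitG_apply hP Φ (Good.set hs.others ((hs b hb).1.erase heb)
      ((hs b hb).2.ctr (hs b hb).1 he)), jV_erase hP hs hb he, jm_ctr hP hs hb he heb,
      smul_smul, smul_smul, smul_smul, sign_erase hP hs hb he heb, mul_assoc]
  rw [dif_of (hs b hb).1 (hs b hb).2, LinearMap.smul_apply, LinearMap.sum_apply, smul_sum]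
  split_ifs with hbb
  · rw [← Finset.add_sum_erase _ _ hbb, add_comm, sum_congr rfl h2, smul_smul]
    rfl
  · rw [erase_eq_of_notMem hbb] at h2 ⊢
    rw [sum_congr rfl h2, add_zero]
    rfl

end QuadraticData

namespace QuadraticData

/-! ### The canonical element and the canonical morphism -/

variable (Q) in
/-- A decorated tree on `A` together with an element of P^!(A). -/
abbrev Tr (A : Block N) : Type _ := Q.dual.P A × Q.St N

/-- The decompositions of `A` into two nonempty subsets, in increasing order. -/
def splits (A : Block N) : Finset (Block N × Block N) :=
  univ.filter fun p => Disjoint p.1 p.2 ∧ p.1 ∪ p.2 = A ∧ p.1.Nonempty ∧ p.2.Nonempty ∧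
    key p.1 < key p.2

lemma mem_splits {p : Block N × Block N} : p ∈ splits A ↔ Disjoint p.1 p.2 ∧ p.1 ∪ p.2 = A ∧
    p.1.Nonempty ∧ p.2.Nonempty ∧ key p.1 < key p.2 := by simp [splits]

lemma ne_of_mem_splits {p : Block N × Block N} (h : p ∈ splits A) : p.1 ≠ p.2 := fun h' =>
  absurd (mem_splits.1 h).2.2.2.2 (by rw [h']; exact lt_irrefl _)

lemma isPart_splits {p : Block N × Block N} (h : p ∈ splits A) : IsPart A {p.1, p.2} := by
  obtain ⟨h1, rfl, h3, h4, h5⟩ := mem_splits.1 h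
  have hne := ne_of_mem_splits h
  refine ⟨?_, ?_, ?_, ?_, ?_⟩
  · grind
  · grind
  · grind
  · grind
  · rw [card_pair hne]

lemma card_of_mem_splits {p : Block N × Block N} (h : p ∈ splits A) :
    p.1.card < A.card ∧ p.2.card < A.card ∧ p.1.card + p.2.card = A.card := by
  obtain ⟨h1, rfl, h3, h4, h5⟩ := mem_splits.1 h
  have := card_union_of_disjoint h1
  have := card_pos.2 h3
  have := card_pos.2 h4
  omega

/-- Two trees as a forest. -/
def pairSt (c1 : Block N) (t₁ t₂ : Q.St N) (b : Block N) : Q.St N := if b = c1 then t₁ else t₂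

variable (E : Q.DualBasis)

open scoped Classical in
/-- The binary tree whose root carries the element X_i, and the corresponding composite with Ξ_i; the
sign is the one of the order of the edges. -/
def graft (A c1 c2 : Block N) (i : Fin E.d) (t₁ : Q.Tr c1) (t₂ : Q.Tr c2) : Q.Tr A :=
  (if h : Q.dual.node (E.Ξ i) t₁.1 t₂.1 ∈ Q.dual.P A then
    sgn (shx {c1, c2} (edg (pairSt c1 t₁.2 t₂.2))) • ⟨Q.dual.node (E.Ξ i) t₁.1 t₂.1, h⟩ else 0,
    jV A {c1, c2} (pairSt c1 t₁.2 t₂.2),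
    jm A {c1, c2} (pairSt c1 t₁.2 t₂.2) (Q.node (E.X i) (Q.var c1) (Q.var c2)))

lemma node_mem_split {p : Block N × Block N} (h : p ∈ splits A) (ξ : Q.dual.E)
    (y1 : Q.dual.P p.1) (y2 : Q.dual.P p.2) : Q.dual.node ξ y1 y2 ∈ Q.dual.P A := by
  obtain ⟨h1, h2, -⟩ := mem_splits.1 h
  have := Q.dual.node_mem ξ y1.2 y2.2
  rw [P, ← h2, ← Finset.disjUnion_eq_union _ _ h1]
  exact this

lemma coe_graft_fst {p : Block N × Block N} (h : p ∈ splits A) (i : Fin E.d) (t₁ : Q.Tr p.1)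
    (t₂ : Q.Tr p.2) : ((graft E A p.1 p.2 i t₁ t₂).1 : Q.dual.Alg (Fin N))
      = sgn (shx {p.1, p.2} (edg (pairSt p.1 t₁.2 t₂.2))) • Q.dual.node (E.Ξ i) t₁.1 t₂.1 := by
  rw [graft, dif_pos (node_mem_split h _ _ _)]; rfl

open scoped Classical in
/-- The tree without vertices. -/
def leafTr (A : Block N) : Q.Tr A :=
  (if h : ∑ x ∈ A, Q.dual.var x ∈ Q.dual.P A then ⟨_, h⟩ else 0, ∅, 0)

lemma coe_leafTr_fst (x : Fin N) : ((leafTr (Q := Q) {x}).1 : Q.dual.Alg (Fin N)) = Q.dual.var x := by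
  have h : ∑ x ∈ ({x} : Block N), Q.dual.var x ∈ Q.dual.P {x} := by
    rw [sum_singleton]; exact Q.dual.var_mem x
  rw [leafTr, dif_pos h]
  exact sum_singleton _ _

/-- The binary trees on `A` whose vertices carry elements of the dual basis, with their composites in
P^!; the first argument bounds the depth of the recursion. -/
def BTf : ℕ → (A : Block N) → Multiset (Q.Tr A)
  | 0, _ => 0
  | f + 1, A => if A.card = 1 then {leafTr A} else
    (splits A).val.bind fun p => (univ : Finset (Fin E.d)).val.bind fun i =>
      (BTf f p.1).bind fun t₁ => (BTf f p.2).map fun t₂ => graft E A p.1 p.2 i t₁ t₂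

/-- The canonical element of P^! ⊗ F(E): the sum of the binary trees whose vertices carry
elements of the dual basis. -/
def BT (A : Block N) : Multiset (Q.Tr A) := BTf E A.card A

lemma BTf_eq (f : ℕ) (A : Block N) (h : A.card ≤ f) : BTf E f A = BT E A := by
  have key : ∀ g f : ℕ, ∀ A : Block N, A.card ≤ f → A.card ≤ g → BTf E f A = BTf E g A := by
    intro g
    induction g with
    | zero =>
      intro f A _ h0
      have hA : A = ∅ := card_eq_zero.1 (by omega)
      subst hA
      have hs : splits (∅ : Block N) = ∅ := by
        refine eq_empty_of_forall_notMem fun p hp => ?_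
        have := card_of_mem_splits hp
        simp at this
      cases f with
      | zero => rfl
      | succ f => simp [BTf, hs]
    | succ g ih =>
      intro f A hf hg
      cases f with
      | zero =>
        have hA : A = ∅ := card_eq_zero.1 (by omega)
        subst hA
        have hs : splits (∅ : Block N) = ∅ := by
          refine eq_empty_of_forall_notMem fun p hp => ?_
          have := card_of_mem_splits hp
          simp at this
        simp [BTf, hs]
      | succ f =>
        rw [BTf, BTf]
        congr 1
        refine Multiset.bind_congr fun p hp => ?_
        have hc := card_of_mem_splits (Finset.mem_def.2 hp)
        rw [ih f p.1 (by omega) (by omega), ih f p.2 (by omega) (by omega)]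
  exact key _ _ _ h le_rfl

/-- The sum over the canonical element. -/
def bsum {M : Type*} [AddCommMonoid M] (A : Block N) (F : Q.Tr A → M) : M := ((BT E A).map F).sum

section Bsum

variable {M M' : Type*} [AddCommMonoid M] [AddCommMonoid M']

lemma bsum_leaf (h : A.card = 1) (F : Q.Tr A → M) : bsum E A F = F (leafTr A) := by
  rw [bsum, BT, h, BTf, if_pos h]
  simp

lemma bsum_node (h : 2 ≤ A.card) (F : Q.Tr A → M) : bsum E A F
    = ∑ p ∈ splits A, ∑ i, bsum E p.1 fun t₁ => bsum E p.2 fun t₂ =>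
      F (graft E A p.1 p.2 i t₁ t₂) := by
  obtain ⟨f, hf⟩ : ∃ f, A.card = f + 1 := ⟨A.card - 1, by omega⟩
  rw [bsum, BT, hf, BTf, if_neg (by omega), Multiset.map_bind, Multiset.sum_bind]
  refine sum_congr rfl fun p hp => ?_
  have hc := card_of_mem_splits hp
  rw [BTf_eq E f p.1 (by omega), BTf_eq E f p.2 (by omega), Multiset.map_bind, Multiset.sum_bind]
  refine sum_congr rfl fun i _ => ?_
  rw [Multiset.map_bind, Multiset.sum_bind, bsum]
  simp only [Multiset.map_map, Function.comp_def, bsum]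

lemma bsum_congr {F G : Q.Tr A → M} (h : ∀ t ∈ BT E A, F t = G t) : bsum E A F = bsum E A G := by
  rw [bsum, bsum, Multiset.map_congr rfl h]

lemma map_bsum (g : M →+ M') (F : Q.Tr A → M) : g (bsum E A F) = bsum E A fun t => g (F t) := by
  rw [bsum, bsum, map_multiset_sum, Multiset.map_map]; rfl

lemma bsum_add (F G : Q.Tr A → M) : (bsum E A fun t => F t + G t) = bsum E A F + bsum E A G :=
  Multiset.sum_map_add

lemma bsum_zero : (bsum E A fun _ => (0 : M)) = 0 := Multiset.sum_map_zero

lemma bsum_sum {ι : Type*} (s : Finset ι) (F : ι → Q.Tr A → M) :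
    (bsum E A fun t => ∑ i ∈ s, F i t) = ∑ i ∈ s, bsum E A (F i) := by
  classical
  induction s using Finset.induction_on with
  | empty => simp [bsum_zero]
  | insert i s hi ih => simp only [sum_insert hi, bsum_add, ih]

lemma bsum_comm {C : Block N} (F : Q.Tr A → Q.Tr C → M) :
    (bsum E A fun t => bsum E C fun t' => F t t') = bsum E C fun t' => bsum E A fun t => F t t' :=
  Multiset.sum_map_sum_map _ _

end Bsum

lemma pairSt_good {c1 c2 : Block N} (hne : c1 ≠ c2) {t₁ t₂ : Q.St N}
    (h₁ : IsTree c1 t₁.1 ∧ Q.Valid t₁.1 t₁.2) (h₂ : IsTree c2 t₂.1 ∧ Q.Valid t₂.1 t₂.2) :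
    Q.Good {c1, c2} (pairSt c1 t₁ t₂) := by
  intro b hb
  rcases mem_insert.1 hb with rfl | hb
  · simpa [pairSt] using h₁
  · rw [mem_singleton.1 hb, pairSt, if_neg hne.symm]; exact h₂

lemma node_var_mem {c1 c2 : Block N} (hne : c1 ≠ c2) (e : Q.E) :
    Q.node e (Q.var c1) (Q.var c2) ∈ Q.P {c1, c2} := by
  have := Q.node_mem e (Q.var_mem c1) (Q.var_mem c2)
  rw [P, Finset.insert_val_of_notMem (by simpa using hne)]
  exact this

/-- The trees of the canonical element are binary. -/
lemma BT_spec (A : Block N) : ∀ t ∈ BT E A,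
    (IsTree A t.2.1 ∧ Q.Valid t.2.1 t.2.2) ∧ t.2.1.card + 1 = A.card := by
  induction h : A.card using Nat.strong_induction_on generalizing A with
  | _ n ih =>
    subst h
    intro t ht
    rcases Nat.lt_or_ge A.card 2 with h2 | h2
    · rcases Nat.lt_or_ge A.card 1 with h1 | h1
      · rw [BT, show A.card = 0 by omega, BTf] at ht
        simp at ht
      · have h1 : A.card = 1 := by omega
        rw [BT, h1, BTf, if_pos h1, Multiset.mem_singleton] at ht
        subst ht
        refine ⟨⟨⟨by simp [leafTr], by omega, by simp [leafTr], by simp [leafTr]⟩,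
          ⟨by simp [leafTr], by simp [leafTr]⟩⟩, by simp [leafTr, h1]⟩
    · obtain ⟨f, hf⟩ : ∃ f, A.card = f + 1 := ⟨A.card - 1, by omega⟩
      rw [BT, hf, BTf, if_neg (by omega)] at ht
      simp only [Multiset.mem_bind, Multiset.mem_map] at ht
      obtain ⟨p, hp, i, -, t₁, ht1, t₂, ht2, rfl⟩ := ht
      have hp : p ∈ splits A := hp
      have hc := card_of_mem_splits hp
      rw [BTf_eq E f _ (by omega)] at ht1 ht2
      have h₁ := ih _ hc.1 p.1 rfl t₁ ht1
      have h₂ := ih _ hc.2.1 p.2 rfl t₂ ht2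
      have hne := ne_of_mem_splits hp
      have hP := isPart_splits hp
      have hg := pairSt_good hne h₁.1 h₂.1
      refine ⟨⟨jV_isTree hP hg, jm_valid hP hg (node_var_mem hne _)⟩, ?_⟩
      have := card_glueV hP fun b hb => (hg b hb).1
      rw [sum_pair hne] at this
      simp only [pairSt, if_true, if_neg hne.symm] at this
      change (glueV A {p.1, p.2} fun b => (pairSt p.1 t₁.2 t₂.2 b).1).card + 1 = A.card
      unfold pairSt
      omega

/-- The canonical morphism from the cobar complex to P^!. -/
def γc (A : Block N) : Q.cobar A →ₗ[Kᵐᵒᵖ] Q.dual.P A where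
  toFun Φ := bsum E A fun t => op (Φ.1 t.2.1 t.2.2) • t.1
  map_add' Φ Ψ := by
    rw [← bsum_add]
    simp only [Submodule.coe_add, Pi.add_apply, op_add, add_smul]
  map_smul' a Φ := by
    rw [RingHom.id_apply]
    refine Eq.trans ?_ (map_bsum E (DistribSMul.toAddMonoidHom (Q.dual.P A) a) _).symm
    congr 1
    funext t
    rw [DistribSMul.toAddMonoidHom_apply, smul_smul]
    rfl

lemma γc_apply (Φ : Q.cobar A) : γc E A Φ = bsum E A fun t => op (Φ.1 t.2.1 t.2.2) • t.1 := rfl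

lemma even_card_eA (hV : IsTree A V) (h : V.card + 1 = A.card) : Even (eA A V).card := by
  rcases Nat.lt_or_ge A.card 2 with h2 | h2
  · have : eA A V = ∅ := by
      refine eq_empty_of_forall_notMem fun u hu => ?_
      obtain ⟨h3, h4⟩ := mem_eA.1 hu
      have := card_lt_card h4
      have := card_pos.2 (hV.edge_nonempty h3)
      omega
    simp [this]
  · have := hV.card_eA h2
    exact ⟨V.card, by omega⟩

lemma γc_εc (A : Block N) : γc E A ∘ₗ Q.εc A = γc E A := by
  refine LinearMap.ext fun Φ => ?_
  change γc E A (Q.εc A Φ) = γc E A Φ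
  rw [γc_apply, γc_apply]
  refine bsum_congr E fun t ht => ?_
  obtain ⟨⟨h1, -⟩, h2⟩ := BT_spec E A t ht
  rw [εc_apply, (even_card_eA h1 h2).neg_one_pow, one_smul]

end QuadraticData

namespace QuadraticData

/-! ### Contracting homotopies -/

section Abstract

variable {S C P : Type*} [Ring S] [AddCommGroup C] [Module S C] [AddCommGroup P] [Module S P]

lemma exists_section [IsSemisimpleRing S] (d : Module.End S C) :
    ∃ t : Module.End S C, d * t * d = d := by
  let d' : C →ₗ[S] LinearMap.range d := LinearMap.rangeRestrict d
  obtain ⟨t₁, ht1⟩ := IsSemisimpleModule.lifting_property d'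
    (LinearMap.surjective_rangeRestrict d) LinearMap.id
  obtain ⟨t₂, ht2⟩ := IsSemisimpleModule.extension_property (LinearMap.range d).subtype
    (Submodule.injective_subtype _) t₁
  refine ⟨t₂, LinearMap.ext fun Φ => ?_⟩
  have h1 := LinearMap.congr_fun ht2 (d' Φ)
  have h2 := congrArg Subtype.val (LinearMap.congr_fun ht1 (d' Φ))
  change d (t₂ (d Φ)) = d Φ
  have h3 : t₂ (d Φ) = t₁ (d' Φ) := h1
  rw [h3]
  exact h2

/-- Over a semisimple ring, an exact complex with augmentation splits: `ε` is the sign of the parity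
of the degree, and `π` is the projection to the part that `γ` does not annihilate. -/
lemma exists_contraction [IsSemisimpleRing S] [CharZero k] [Algebra k (Module.End S C)]
    {d π ε : Module.End S C} {γ : C →ₗ[S] P} (hγ : Function.Surjective γ)
    (hex : ∀ Φ, d Φ = 0 → γ Φ = 0 → ∃ Ψ, d Ψ = Φ) (hdd : d * d = 0) (hdπ : d * π = 0)
    (hεd : ε * d = -(d * ε)) (hεπ : ε * π = π) (hεε : ε * ε = 1) (hγπ : γ ∘ₗ π = γ)
    (hγε : γ ∘ₗ ε = γ) (hγd : γ ∘ₗ d = 0) :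
    ∃ (s : P →ₗ[S] C) (h : Module.End S C), (∀ y, γ (s y) = y) ∧
      d * h + h * d = 1 - s ∘ₗ γ ∧ γ ∘ₗ h = 0 ∧ ε * h = -(h * ε) := by
  obtain ⟨s0, hs0⟩ := IsSemisimpleModule.lifting_property (γ) hγ LinearMap.id
  obtain ⟨t0, ht0⟩ := exists_section d
  set s := π ∘ₗ s0 with hs
  set t := (1 - π) * t0 with ht
  have hγs : γ ∘ₗ s = LinearMap.id := by rw [hs, ← LinearMap.comp_assoc, hγπ, hs0]
  have hγt : γ ∘ₗ t = 0 := by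
    rw [ht, Module.End.mul_eq_comp, ← LinearMap.comp_assoc, LinearMap.comp_sub, hγπ]
    change (γ ∘ₗ LinearMap.id - γ) ∘ₗ t0 = 0
    rw [LinearMap.comp_id, sub_self, LinearMap.zero_comp]
  have hdtd : d * t * d = d := by rw [ht, ← mul_assoc, mul_sub d, mul_one, hdπ, sub_zero, ht0]
  set e : Module.End S C := s ∘ₗ γ with he
  have hde : d * e = 0 := by
    rw [he, hs, Module.End.mul_eq_comp, ← LinearMap.comp_assoc, ← LinearMap.comp_assoc,
      ← Module.End.mul_eq_comp, hdπ, LinearMap.zero_comp, LinearMap.zero_comp]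
  have hed : e * d = 0 := by
    rw [he, Module.End.mul_eq_comp, LinearMap.comp_assoc, hγd, LinearMap.comp_zero]
  -- The element 1 - sγ - tδ takes values in the cycles that γ annihilates, which are boundaries.
  set z := 1 - e - t * d with hz
  have hdt : d * t * z = z := by
    refine LinearMap.ext fun Φ => ?_
    have h1 : d (z Φ) = 0 := by
      have : d * z = 0 := by
        rw [hz, mul_sub, mul_sub, mul_one, hde, sub_zero, ← mul_assoc, hdtd, sub_self]
      exact LinearMap.congr_fun this Φ
    have h2 : γ (z Φ) = 0 := by
      have : γ ∘ₗ z = 0 := by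
        rw [hz, LinearMap.comp_sub, LinearMap.comp_sub, he, ← LinearMap.comp_assoc, hγs,
          Module.End.mul_eq_comp, ← LinearMap.comp_assoc, hγt]
        change γ ∘ₗ LinearMap.id - _ - _ = _
        rw [LinearMap.comp_id, LinearMap.id_comp, sub_self, LinearMap.zero_comp, sub_self]
      exact LinearMap.congr_fun this Φ
    obtain ⟨Ψ, hΨ⟩ := hex _ h1 h2
    change d (t (z Φ)) = z Φ
    rw [← hΨ]
    exact LinearMap.congr_fun hdtd Ψ
  have hh : d * (t * z) + t * z * d = 1 - e := by
    have h1 : t * z * d = t * d := by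
      calc t * z * d = t * (d - e * d - t * (d * d)) := by rw [hz]; noncomm_ring
        _ = t * d := by rw [hed, hdd, mul_zero, sub_zero, sub_zero]
    rw [h1, ← mul_assoc, hdt, hz, sub_add_cancel]
  set h := t * z with hh'
  have hγh : γ ∘ₗ h = 0 := by
    rw [hh', Module.End.mul_eq_comp, ← LinearMap.comp_assoc, hγt, LinearMap.zero_comp]
  have hεe : ε * e = e := by
    rw [he, hs, Module.End.mul_eq_comp, ← LinearMap.comp_assoc, ← LinearMap.comp_assoc,
      ← Module.End.mul_eq_comp, hεπ]
  have heε : e * ε = e := by rw [he, Module.End.mul_eq_comp, LinearMap.comp_assoc, hγε]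
  have hdε : d * ε = -(ε * d) := by rw [hεd, neg_neg]
  -- The homotopy is made odd by averaging over its conjugates by the sign.
  refine ⟨s, (2⁻¹ : k) • (h - ε * h * ε), fun y => LinearMap.congr_fun hγs y, ?_, ?_, ?_⟩
  · have h1 : d * (h - ε * h * ε) + (h - ε * h * ε) * d = (2 : k) • (1 - e) := by
      calc _ = d * h + h * d - (d * ε) * h * ε - ε * h * (ε * d) := by noncomm_ring
        _ = d * h + h * d - -(ε * d) * h * ε - ε * h * -(d * ε) :=
          congrArg₂ (fun a b => d * h + h * d - a * h * ε - ε * h * b) hdε hεd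
        _ = d * h + h * d + ε * (d * h + h * d) * ε := by noncomm_ring
        _ = 1 - e + (ε * ε - ε * e * ε) := by rw [hh]; noncomm_ring
        _ = _ := by rw [hεε, hεe, heε, two_smul]
    rw [mul_smul_comm, smul_mul_assoc, ← smul_add, h1, inv_smul_smul₀ two_ne_zero]
  · have h1 : γ ∘ₗ (h - ε * h * ε) = 0 := by
      have h2 : γ ∘ₗ (ε * h * ε) = ((γ ∘ₗ ε) ∘ₗ h) ∘ₗ ε := rfl
      rw [LinearMap.comp_sub, h2, hγε, hγh, LinearMap.zero_comp, sub_zero]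
    rw [Algebra.smul_def, Algebra.commutes, Module.End.mul_eq_comp, ← LinearMap.comp_assoc, h1,
      LinearMap.zero_comp]
  · rw [mul_smul_comm, smul_mul_assoc, ← smul_neg]
    congr 1
    calc ε * (h - ε * h * ε) = ε * h - (ε * ε) * h * ε := by noncomm_ring
      _ = -(h * ε - ε * h * (ε * ε)) := by rw [hεε]; noncomm_ring
      _ = _ := by noncomm_ring

end Abstract

variable (E : Q.DualBasis)

/-- The cobar complex of `A`, together with the canonical morphism, is exact. -/
structure ExactAt (A : Block N) : Prop where
  exact : ∀ Φ : Q.cobar A, (Q.δc A Φ = 0 ∧ γc E A Φ = 0) ↔ ∃ Ψ, Q.δc A Ψ = Φ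
  surj : Function.Surjective (γc E A)

open scoped Classical in
variable (Q) in
/-- The projection to the trees with a given property. -/
def prj (A : Block N) (p : 𝓕 N → Prop) : Module.End Kᵐᵒᵖ (Q.cobar A) where
  toFun Φ := ⟨fun V m => if p V then Φ.1 V m else 0, by
    refine ⟨fun V hV => ?_, fun V hV => by funext m; rw [Φ.2.zero V hV]; simp⟩
    have h1 := Φ.2.isFm V hV
    by_cases h : p V
    · simp only [h, if_true]; exact h1
    · simp only [h, if_false]
      exact ⟨by simp, by simp, by simp, by simp⟩⟩
  map_add' Φ Ψ := Subtype.ext (by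
    funext V m
    by_cases h : p V <;> simp [h])
  map_smul' a Φ := Subtype.ext (by
    funext V m
    by_cases h : p V <;> simp [h])

lemma prj_apply (p : 𝓕 N → Prop) [DecidablePred p] (Φ : Q.cobar A)
    (V : 𝓕 N) (m : Q.Dec N) :
    (Q.prj A p Φ).1 V m = if p V then Φ.1 V m else 0 := by
  refine Eq.trans (b := @ite _ (p V) (Classical.propDecidable _) (Φ.1 V m) 0) rfl ?_
  congr

lemma prj_mul (p q r : 𝓕 N → Prop) (h : ∀ V, IsTree A V → ((p V ∧ q V) ↔ r V)) :
    Q.prj A p * Q.prj A q = Q.prj A r := by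
  classical
  refine LinearMap.ext fun Φ => cobar_ext fun V hV m _ => ?_
  change (Q.prj A p (Q.prj A q Φ)).1 V m = _
  rw [prj_apply, prj_apply, prj_apply]
  have := h V hV
  by_cases hp : p V <;> by_cases hq : q V <;> simp_all

lemma prj_false (p : 𝓕 N → Prop) (h : ∀ V, IsTree A V → ¬ p V) : Q.prj A p = 0 := by
  classical
  refine LinearMap.ext fun Φ => cobar_ext fun V hV m _ => ?_
  rw [prj_apply, if_neg (h V hV)]; rfl

lemma γc_prj (p : 𝓕 N → Prop)
    (h : ∀ V, IsTree A V → V.card + 1 = A.card → p V) : γc E A ∘ₗ Q.prj A p = γc E A := by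
  classical
  refine LinearMap.ext fun Φ => ?_
  change γc E A (Q.prj A p Φ) = γc E A Φ
  rw [γc_apply, γc_apply]
  refine bsum_congr E fun t ht => ?_
  obtain ⟨⟨h1, -⟩, h2⟩ := BT_spec E A t ht
  rw [prj_apply, if_pos (h _ h1 h2)]

lemma γc_prj_of_not (p : 𝓕 N → Prop)
    (h : ∀ V, IsTree A V → V.card + 1 = A.card → ¬ p V) : γc E A ∘ₗ Q.prj A p = 0 := by
  classical
  refine LinearMap.ext fun Φ => ?_
  change γc E A (Q.prj A p Φ) = 0
  rw [γc_apply, ← bsum_zero E]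
  refine bsum_congr E fun t ht => ?_
  obtain ⟨⟨h1, -⟩, h2⟩ := BT_spec E A t ht
  rw [prj_apply, if_neg (h _ h1 h2)]
  exact zero_smul Kᵐᵒᵖ t.1

lemma δc_prj (p q : 𝓕 N → Prop)
    (h : ∀ V, IsTree A V → ∀ e ∈ V, e ≠ A → (p (V.erase e) ↔ q V)) :
    Q.δc A * Q.prj A p = Q.prj A q * Q.δc A := by
  classical
  refine LinearMap.ext fun Φ => cobar_ext fun V hV m hm => ?_
  change dif A (Q.prj A p Φ).1 V m = (Q.prj A q (Q.δc A Φ)).1 V m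
  rw [prj_apply, δc_apply, dif_of hV hm, dif_of hV hm]
  split_ifs with hq
  · refine sum_congr rfl fun e he => ?_
    obtain ⟨heA, heV⟩ := mem_erase.1 he
    rw [prj_apply, if_pos ((h V hV e heV heA).2 hq)]
  · refine sum_eq_zero fun e he => ?_
    obtain ⟨heA, heV⟩ := mem_erase.1 he
    rw [prj_apply, if_neg fun h' => hq ((h V hV e heV heA).1 h'), smul_zero]

/-- A K-linear splitting of the canonical morphism, with a contracting homotopy that is odd with respect
to the number of edges. -/
structure Contraction (A : Block N) where
  s : Q.dual.P A →ₗ[Kᵐᵒᵖ] Q.cobar A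
  h : Module.End Kᵐᵒᵖ (Q.cobar A)
  γ_s : ∀ y, γc E A (s y) = y
  homotopy : Q.δc A * h + h * Q.δc A = 1 - s ∘ₗ γc E A
  γ_h : γc E A ∘ₗ h = 0
  γ_δ : γc E A ∘ₗ Q.δc A = 0
  ε_h : Q.εc A * h = -(h * Q.εc A)

lemma ExactAt.nonempty_contraction [IsSemisimpleRing K] [CharZero k] (hA : A.Nonempty)
    (hex : ExactAt E A) : Nonempty (Contraction E A) := by
  set π := Q.prj A fun V => V.card + 1 = A.card with hπ
  set d := Q.δc A with hd
  have hdπ : d * π = 0 := by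
    rw [hd, hπ, δc_prj _ (fun _ => False), prj_false _ fun _ _ h => h, zero_mul]
    intro V hV e he heA
    have h1 := card_erase_add_one he
    have h2 := hV.card_le hA
    simp only [iff_false]
    omega
  have hεπ : Q.εc A * π = π := by
    classical
    refine LinearMap.ext fun Φ => cobar_ext fun V hV m _ => ?_
    change (Q.εc A (π Φ)).1 V m = _
    rw [εc_apply, prj_apply]
    split_ifs with h
    · rw [(even_card_eA hV h).neg_one_pow, one_smul]
    · exact smul_zero _
  obtain ⟨s, h, h1, h2, h3, h4⟩ := exists_contraction (k := k) hex.surj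
    (fun Φ h1 h2 => (hex.exact Φ).1 ⟨h1, h2⟩) (δc_δc A) hdπ (εc_δc A) hεπ (εc_εc A)
    (γc_prj E _ fun V _ h => h) (γc_εc E A)
    (LinearMap.ext fun Φ => ((hex.exact _).2 ⟨Φ, rfl⟩).2)
  exact ⟨⟨s, h, h1, h2, h3, LinearMap.ext fun Φ => ((hex.exact _).2 ⟨Φ, rfl⟩).2, h4⟩⟩

end QuadraticData

namespace QuadraticData

/-! ### Forests of binary trees -/

variable (E : Q.DualBasis)

section Psum

variable {M M' : Type*} [AddCommMonoid M] [AddCommMonoid M']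

/-- The sum over the canonical element of the block `b`, as an operator on the functions of families of
trees. -/
def bop (b : Block N) : AddMonoid.End (((b : Block N) → Q.Tr b) → M) where
  toFun F f := bsum E b fun t => F (update f b t)
  map_zero' := by funext f; exact bsum_zero E
  map_add' F G := by funext f; exact bsum_add E _ _

lemma bop_commute (b c : Block N) (hbc : b ≠ c) :
    Commute (bop E (M := M) b) (bop E c) := by
  refine AddMonoidHom.ext fun F => funext fun f => ?_
  change (bsum E b fun t => bsum E c fun t' => _) = bsum E c fun t' => bsum E b fun t => _
  rw [bsum_comm]
  simp only [Function.update_comm hbc]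

lemma bop_pairwise (S : Set (Block N)) :
    S.Pairwise (Function.onFun Commute (bop E (M := M))) :=
  fun b _ c _ h => bop_commute E b c h

/-- The sum over the families of trees of the canonical elements of the blocks in `S`; the other blocks
carry the tree without vertices. -/
def psum (S : 𝓕 N) : (((b : Block N) → Q.Tr b) → M) →+ M where
  toFun F := S.noncommProd (bop E (M := M)) (bop_pairwise E _) F leafTr
  map_zero' := by rw [map_zero]; rfl
  map_add' F G := by rw [map_add]; rfl

lemma psum_empty (F : ((b : Block N) → Q.Tr b) → M) : psum E ∅ F = F leafTr := by
  change (∅ : 𝓕 N).noncommProd (bop E (M := M)) (bop_pairwise E _) F leafTr = _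
  rw [Finset.noncommProd_empty]; rfl

lemma psum_insert (hb : b ∉ S)
    (F : ((b : Block N) → Q.Tr b) → M) : psum E (insert b S) F
      = psum E S fun f => bsum E b fun t => F (update f b t) := by
  change (insert b S).noncommProd (bop E (M := M)) (bop_pairwise E _) F leafTr = _
  rw [Finset.noncommProd_insert_of_notMem' _ _ _ _ hb]
  rfl

lemma psum_of_mem (hb : b ∈ S)
    (F : ((b : Block N) → Q.Tr b) → M) : psum E S F
      = psum E (S.erase b) fun f => bsum E b fun t => F (update f b t) := by
  conv_lhs => rw [← insert_erase hb]
  exact psum_insert E (notMem_erase b S) F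

lemma psum_congr {F G : ((b : Block N) → Q.Tr b) → M}
    (h : ∀ f, (∀ b ∈ S, f b ∈ BT E b) → F f = G f) : psum E S F = psum E S G := by
  induction S using Finset.induction_on generalizing F G with
  | empty => rw [psum_empty, psum_empty, h _ (by simp)]
  | insert b S hb ih =>
    rw [psum_insert E hb, psum_insert E hb]
    refine ih fun f hf => bsum_congr E fun t ht => h _ fun c hc => ?_
    by_cases hcb : c = b
    · subst hcb; rwa [update_self]
    · grind

lemma map_psum (g : M →+ M') (F : ((b : Block N) → Q.Tr b) → M) :
    g (psum E S F) = psum E S fun f => g (F f) := by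
  induction S using Finset.induction_on generalizing F with
  | empty => rw [psum_empty, psum_empty]
  | insert b S hb ih =>
    rw [psum_insert E hb, psum_insert E hb, ih]
    simp only [map_bsum]

lemma psum_zero : psum E S (fun _ => (0 : M)) = 0 :=
  map_zero (psum E S)

end Psum

lemma update_fst {f : (b : Block N) → Q.Tr b} (hb : b ∈ π.parts)
    (t : Q.Tr b) : (fun c : π.parts => (update f b t c.1).1)
      = update (fun c : π.parts => (f c.1).1) ⟨b, hb⟩ t.1 := by grind

lemma update_snd {f : (b : Block N) → Q.Tr b} (t : Q.Tr b) :
    (fun c => (update f b t c).2) = update (fun c => (f c).2) b t.2 := by grind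

/-- A K-form as an additive function of one argument. -/
def IsKForm.hom {φ : Q.Args π → Q.P π.parts} (hφ : Q.IsKForm π φ) (y : Q.Args π) (b : π.parts) :
    Q.dual.P b.1 →+ Q.P π.parts :=
  AddMonoidHom.mk' (fun x => φ (update y b x)) (hφ.map_add y b)

lemma IsKForm.hom_smul (hφ : Q.IsKForm π φ) (y : Q.Args π)
    (b : π.parts) (a : K) (x : Q.dual.P b.1) :
    hφ.hom y b (op a • x) = Q.ractP π.parts b.1 a (hφ.hom y b x) := by
  have h := hφ.balance (update y b x) b a
  rwa [Function.update_idem, update_self] at h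

/-- The pairing of the forms on forests with the K-forms, through the canonical elements. -/
def rS (G : Q.MF π.parts) (φ : Q.Args π → Q.P π.parts) : K :=
  psum E π.parts fun f => G.1 (fun b => (f b).2) (φ fun b => (f b.1).1)

lemma rS_add (G G' : Q.MF π.parts) (φ : Q.Args π → Q.P π.parts) :
    rS E (G + G') φ = rS E G φ + rS E G' φ := by rw [rS, rS, rS, ← map_add]; rfl

lemma rS_zero (φ : Q.Args π → Q.P π.parts) : rS E (0 : Q.MF π.parts) φ = 0 :=
  psum_zero E

lemma rS_neg (G : Q.MF π.parts) (φ : Q.Args π → Q.P π.parts) :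
    rS E (-G) φ = -rS E G φ := by rw [eq_neg_iff_add_eq_zero, ← rS_add, neg_add_cancel, rS_zero]

lemma rS_sum {ι : Type*} (t : Finset ι) (G : ι → Q.MF π.parts) (φ : Q.Args π → Q.P π.parts) :
    rS E (∑ i ∈ t, G i) φ = ∑ i ∈ t, rS E (G i) φ := by
  classical
  induction t using Finset.induction_on with
  | empty => simp [rS_zero]
  | insert i t hi ih => rw [sum_insert hi, sum_insert hi, rS_add, ih]

variable (B : ∀ b : Block N, Q.Frame b) [IsSemisimpleRing K]

/-- The canonical element converts an endomorphism of the cobar complex of a block into the canonical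
morphism composed with it. -/
lemma rS_star (hb : b ∈ π.parts) (T : Module.End Kᵐᵒᵖ (Q.cobar b))
    (hT : γc E b ∘ₗ T = 0) (G : Q.MF π.parts) (hφ : Q.IsKForm π φ) :
    rS E (star B hb T G) φ = 0 := by
  rw [rS, psum_of_mem E hb, ← psum_zero E]
  refine psum_congr E fun f _ => ?_
  simp only [update_snd, update_fst hb, star_apply, update_self, Function.update_idem,
    LinearMap.sum_apply, rho_apply, bsum_sum]
  refine sum_eq_zero fun l _ => ?_
  set g : Q.dual.P b →+ K := ((G.1 (update (fun c => (f c).2) b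
    ((B b).V l, (B b).m l))).toAddMonoidHom).comp (hφ.hom (fun c => (f c.1).1) ⟨b, hb⟩) with hg
  have h : ∀ t : Q.Tr b, (G.1 (update (fun c => (f c).2) b ((B b).V l, (B b).m l)))
      (Q.ractP π.parts b ((T ((B b).Φ l)).1 t.2.1 t.2.2)
        (φ (update (fun c => (f c.1).1) ⟨b, hb⟩ t.1)))
      = g (op ((T ((B b).Φ l)).1 t.2.1 t.2.2) • t.1) := fun t => by
    rw [hg, AddMonoidHom.comp_apply, hφ.hom_smul]; rfl
  rw [bsum_congr E fun t _ => h t, ← map_bsum, ← γc_apply]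
  have h0 : γc E b (T ((B b).Φ l)) = 0 := LinearMap.congr_fun hT _
  rw [h0, map_zero]

/-- The action of the projection given by a splitting of the canonical morphism. -/
lemma star_section (hb : b ∈ π.parts) (s0 : Q.dual.P b →ₗ[Kᵐᵒᵖ] Q.cobar b)
    (G : Q.MF π.parts) (s : Block N → Q.St N) :
    (star B hb (s0 ∘ₗ γc E b) G).1 s = bsum E b fun t =>
      rho Q π.parts b ((s0 t.1).1 (s b).1 (s b).2) (G.1 (update s b t.2)) := by
  have h1 : ∀ t : Q.Tr b, rho Q π.parts b ((s0 t.1).1 (s b).1 (s b).2)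
      (G.1 (update s b t.2)) = ∑ l, rho Q π.parts b ((s0 t.1).1 (s b).1 (s b).2)
        (rho Q π.parts b (((B b).Φ l).1 t.2.1 t.2.2)
          (G.1 (update s b ((B b).V l, (B b).m l)))) := fun t => by
    rw [star_expand B hb G s t.2, map_sum]
  simp only [h1, bsum_sum, star_apply]
  refine sum_congr rfl fun l _ => ?_
  set g : Q.cobar b →+ Q.X π.parts :=
    { toFun := fun Φ => rhoHom Q hb (Φ.1 (s b).1 (s b).2)
        (G.1 (update s b ((B b).V l, (B b).m l)))
      map_zero' := by
        change rhoHom Q hb 0 _ = 0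
        rw [map_zero]; rfl
      map_add' := fun Φ Ψ => by
        change rhoHom Q hb (_ + _) _ = _
        rw [map_add]; rfl } with hg
  change g (s0 (γc E b ((B b).Φ l))) = _
  rw [γc_apply]
  refine (map_bsum E (g.comp s0.toAddMonoidHom) _).trans (bsum_congr E fun t _ => ?_)
  change g (s0 _) = _
  rw [map_smul]
  change rhoHom Q hb (_ * _) _ = _
  rw [map_mul]
  rfl

end QuadraticData

namespace QuadraticData

/-! ### Contracting the complex of forests -/

/-- The number of edges of the trees on the blocks in `R`, modulo 2. -/
def edgeCount (R : 𝓕 N) (s : Block N → Q.St N) : ZMod 2 :=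
  ∑ a ∈ R, ((edg s a).card : ZMod 2)

lemma edgeCount_congr {s s' : Block N → Q.St N}
    (h : ∀ a ∈ R, (s a).1 = (s' a).1) : edgeCount R s = edgeCount R s' :=
  sum_congr rfl fun a ha => by rw [edg, edg, h a ha]

lemma edgeCount_insert (hb : b ∉ R) (s : Block N → Q.St N) :
    edgeCount (insert b R) s = (edg s b).card + edgeCount R s := sum_insert hb

lemma isMF_sign (hR : R ⊆ S) (G : Q.MF S) :
    Q.IsMF S fun s => sgn (edgeCount R s) • G.1 s where
  congr s s' h := by rw [G.2.congr s s' h, edgeCount_congr fun a ha => by rw [h a (hR ha)]]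
  fam s b hb := by
    have h : ∀ (V : 𝓕 N) (m : Q.Dec N), edgeCount R (update s b (V, m))
        = edgeCount R (update s b (V, 0)) := fun V m =>
      edgeCount_congr fun a _ => by
        by_cases hab : a = b
        · subst hab; simp
        · rw [update_of_ne hab, update_of_ne hab]
    simp only [h]
    exact (G.2.fam s b hb).map
      (fun V => DistribSMul.toLinearMap k _ (sgn (edgeCount R (update s b (V, 0)))))
      fun V a x => (map_zsmul (rho Q S b a) _ x).symm

open scoped Classical in
variable (Q S) in
/-- The sign of the number of edges of the trees on the blocks in `R`, as an operator. -/
def κ (R : 𝓕 N) : GroupEnd (Q.MF S) where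
  toFun G := if hR : R ⊆ S then ⟨_, isMF_sign hR G⟩ else G
  map_zero' := by
    split_ifs
    · exact Subtype.ext (funext fun s => smul_zero _)
    · rfl
  map_add' G G' := by
    split_ifs
    · exact Subtype.ext (funext fun s => smul_add _ _ _)
    · rfl

lemma κ_apply (hR : R ⊆ S) (G : Q.MF S) (s : Block N → Q.St N) :
    (κ Q S R G).1 s = sgn (edgeCount R s) • G.1 s := by
  change (dite _ _ _ : Q.MF S).1 s = _
  rw [dif_pos hR]

lemma κ_mul_self (hR : R ⊆ S) : κ Q S R * κ Q S R = 1 := by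
  refine AddMonoidHom.ext fun G => Subtype.ext (funext fun s => ?_)
  change (κ Q S R (κ Q S R G)).1 s = G.1 s
  rw [κ_apply hR, κ_apply hR, smul_smul, sgn_mul_self, one_smul]

lemma κ_comm {R R' : 𝓕 N} (hR : R ⊆ S) (hR' : R' ⊆ S) :
    κ Q S R * κ Q S R' = κ Q S R' * κ Q S R := by
  refine AddMonoidHom.ext fun G => Subtype.ext (funext fun s => ?_)
  change (κ Q S R (κ Q S R' G)).1 s = (κ Q S R' (κ Q S R G)).1 s
  rw [κ_apply hR, κ_apply hR', κ_apply hR', κ_apply hR, smul_comm]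

variable (S) in
/-- The blocks in `S` that precede `b`. -/
def before (b : Block N) : 𝓕 N := S.filter fun a => key a < key b

lemma before_subset (b : Block N) : before S b ⊆ S := filter_subset _ _

lemma notMem_before (b : Block N) : b ∉ before S b := by simp [before]

lemma εc_anticomm {T : Module.End Kᵐᵒᵖ (Q.cobar b)}
    (hT : Q.εc b * T = -(T * Q.εc b)) : Q.εc b * T + T * Q.εc b = 0 := by
  rw [hT]; exact neg_add_cancel (T * Q.εc b)

/-- The sign of the number of edges does not change the pairing: a binary tree has an even number of
edges other than the outgoing one. -/
lemma rS_κ (E : Q.DualBasis) (hR : R ⊆ π.parts) (G : Q.MF π.parts)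
    (φ : Q.Args π → Q.P π.parts) : rS E (κ Q π.parts R G) φ = rS E G φ := by
  refine psum_congr E fun f hf => ?_
  rw [κ_apply hR, edgeCount, sum_eq_zero, sgn_zero, one_smul]
  intro a ha
  obtain ⟨⟨h1, -⟩, h2⟩ := BT_spec E a _ (hf a (hR ha))
  rw [edg]
  exact (ZMod.natCast_eq_zero_iff_even).2 (even_card_eA h1 h2)

lemma GroupEnd.sum_apply {M ι : Type*} [AddCommGroup M] (t : Finset ι) (f : ι → GroupEnd M) (x : M) :
    (∑ i ∈ t, f i) x = ∑ i ∈ t, f i x := by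
  classical
  induction t using Finset.induction_on with
  | empty => rfl
  | insert i t hi ih =>
    rw [sum_insert hi, sum_insert hi, ← ih]
    rfl

lemma isKForm_of
    (h1 : ∀ (y : Q.Args π) (b : π.parts) (x x' : Q.dual.P b.1),
      φ (update y b (x + x')) = φ (update y b x) + φ (update y b x'))
    (h2 : ∀ (y : Q.Args π) (b : π.parts) (a : K) (x : Q.dual.P b.1),
      φ (update y b (op a • x)) = Q.ractP π.parts b.1 a (φ (update y b x))) :
    Q.IsKForm π φ where
  map_add := h1
  map_smul y b c x := by
    have h : c • x = op (algebraMap k K c) • x := by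
      rw [show op (algebraMap k K c) = algebraMap k Kᵐᵒᵖ c from rfl, algebraMap_smul]
    rw [h, h2]
    exact Subtype.ext (Q.ract_algebraMap (φ _).2 b.2 c)
  balance y b a := by
    have := h2 y b a (y b)
    rwa [Function.update_eq_self] at this

variable (E : Q.DualBasis) (B : ∀ b : Block N, Q.Frame b) [IsSemisimpleRing K]

lemma κ_star (hR : R ⊆ S) (hb : b ∈ S) (hbR : b ∉ R)
    (T : Module.End Kᵐᵒᵖ (Q.cobar b)) : κ Q S R * star B hb T = star B hb T * κ Q S R := by
  refine AddMonoidHom.ext fun G => Subtype.ext (funext fun s => ?_)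
  change (κ Q S R (star B hb T G)).1 s = (star B hb T (κ Q S R G)).1 s
  rw [κ_apply hR, star_apply, star_apply, smul_sum]
  refine sum_congr rfl fun l _ => ?_
  have h : edgeCount R (update s b ((B b).V l, (B b).m l)) = edgeCount R s :=
    edgeCount_congr fun a ha => by
      rw [update_of_ne]
      rintro rfl
      exact hbR ha
  rw [κ_apply hR, map_zsmul, h]

lemma κ_insert (hR : R ⊆ S) (hb : b ∈ S) (hbR : b ∉ R) :
    κ Q S (insert b R) = star B hb (Q.εc b) * κ Q S R := by
  refine AddMonoidHom.ext fun G => Subtype.ext (funext fun s => ?_)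
  change (κ Q S (insert b R) G).1 s = (star B hb (Q.εc b) (κ Q S R G)).1 s
  rw [κ_apply (Finset.insert_subset hb hR), star_εc, κ_apply hR, edgeCount_insert hbR, sgn_add,
    sgn_natCast, mul_smul]
  rfl

lemma κ_star_of_mem (hR : R ⊆ S) (hb : b ∈ S) (hbR : b ∈ R)
    {T : Module.End Kᵐᵒᵖ (Q.cobar b)} (hT : Q.εc b * T + T * Q.εc b = 0) :
    star B hb T * κ Q S R + κ Q S R * star B hb T = 0 := by
  have h : insert b (R.erase b) = R := insert_erase hbR
  have h' := (Finset.erase_subset b R).trans hR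
  rw [← h, κ_insert B h' hb (notMem_erase b R), mul_assoc (star B hb (Q.εc b)),
    κ_star B h' hb (notMem_erase b R), ← mul_assoc, ← mul_assoc, ← add_mul, ← map_mul,
    ← map_mul, ← map_add, add_comm (T * _), hT, map_zero, zero_mul]

lemma anticomm_of_mul {R : Type*} [Ring R] {x y x' y' : R} (h1 : y * x' + x' * y = 0)
    (h2 : y' * x = x * y') (h3 : x * x' = x' * x) (h4 : y * y' = y' * y) :
    x * y * (x' * y') + x' * y' * (x * y) = 0 := by
  have e : y * x' = -(x' * y) := eq_neg_of_add_eq_zero_left h1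
  calc x * y * (x' * y') + x' * y' * (x * y)
      = x * (y * x') * y' + x' * (y' * x) * y := by noncomm_ring
    _ = -(x * x') * (y * y') + (x' * x) * (y' * y) := by rw [e, h2]; noncomm_ring
    _ = 0 := by rw [h3, h4]; noncomm_ring

/-- The action of an endomorphism of the cobar complex of a block, with the Koszul sign rule. -/
def starS (hb : b ∈ S) (T : Module.End Kᵐᵒᵖ (Q.cobar b)) : GroupEnd (Q.MF S) :=
  κ Q S (before S b) * star B hb T

lemma starS_mul (hb : b ∈ S) (T T' : Module.End Kᵐᵒᵖ (Q.cobar b)) :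
    starS B hb T * starS B hb T' = star B hb (T * T') := by
  rw [starS, starS, mul_assoc, ← mul_assoc (star B hb T), ← κ_star B (before_subset b) hb
    (notMem_before b), mul_assoc, ← mul_assoc, κ_mul_self (before_subset b), one_mul, map_mul]

lemma starS_anticomm {b c : Block N} (hb : b ∈ S) (hc : c ∈ S) (hbc : b ≠ c)
    {T : Module.End Kᵐᵒᵖ (Q.cobar b)} {T' : Module.End Kᵐᵒᵖ (Q.cobar c)}
    (hT : Q.εc b * T + T * Q.εc b = 0) (hT' : Q.εc c * T' + T' * Q.εc c = 0) :
    starS B hb T * starS B hc T' + starS B hc T' * starS B hb T = 0 := by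
  have key : ∀ {b c : Block N} (hb : b ∈ S) (hc : c ∈ S) (_ : QuadOp.key b < QuadOp.key c)
      {T : Module.End Kᵐᵒᵖ (Q.cobar b)} {T' : Module.End Kᵐᵒᵖ (Q.cobar c)}
      (_ : Q.εc b * T + T * Q.εc b = 0),
      starS B hb T * starS B hc T' + starS B hc T' * starS B hb T = 0 := by
    intro b c hb hc hbc T T' hT
    have hbc' : b ≠ c := by rintro rfl; exact lt_irrefl _ hbc
    have h1 : b ∈ before S c := mem_filter.2 ⟨hb, hbc⟩
    have h2 : c ∉ before S b := fun h => lt_asymm hbc (mem_filter.1 h).2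
    exact anticomm_of_mul (κ_star_of_mem B (before_subset c) hb h1 hT)
      (κ_star B (before_subset b) hc h2 T').symm (κ_comm (before_subset b) (before_subset c))
      (star_comm B hb hc hbc' T T')
  rcases lt_or_gt_of_ne (fun h => hbc (key_injective h) : QuadOp.key b ≠ QuadOp.key c) with h | h
  · exact key hb hc h hT
  · rw [add_comm]; exact key hc hb h hT'

/-- The differential of the complex of forests. -/
def forestD (S : 𝓕 N) : GroupEnd (Q.MF S) :=
  ∑ b ∈ S.attach, starS B b.2 (Q.δc b.1)

lemma forestD_apply (G : Q.MF S) (s : Block N → Q.St N) :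
    (forestD B S G).1 s = forestDif S G.1 s := by
  have h : (forestD B S G).1 s = ∑ b ∈ S.attach, (starS B b.2 (Q.δc b.1) G).1 s := by
    rw [forestD, GroupEnd.sum_apply, AddSubgroup.val_finsetSum, Finset.sum_apply]
  rw [h, forestDif, ← Finset.sum_attach S]
  refine sum_congr rfl fun b _ => ?_
  change (κ Q S (before S b.1) (star B b.2 (Q.δc b.1) G)).1 s = _
  rw [κ_apply (before_subset _), star_δc, edgeCount, before, Finset.sum_filter]

lemma forestD_homotopy (hb : b ∈ S) {h : Module.End Kᵐᵒᵖ (Q.cobar b)}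
    (hh : Q.εc b * h + h * Q.εc b = 0) :
    forestD B S * starS B hb h + starS B hb h * forestD B S
      = star B hb (Q.δc b * h + h * Q.δc b) := by
  rw [forestD, Finset.sum_mul, mul_sum, ← sum_add_distrib,
    sum_eq_single_of_mem ⟨b, hb⟩ (Finset.mem_attach _ _), starS_mul, starS_mul, map_add]
  intro c _ hc
  rw [starS_anticomm B c.2 hb (fun h => hc (Subtype.ext h)) (εc_anticomm (εc_δc _)) hh]

lemma forestD_forestD : forestD B S * forestD (Q := Q) B S = 0 := by
  rw [forestD, Finset.sum_mul_sum, ← sum_product']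
  refine sum_involution (fun p _ => (p.2, p.1)) ?_ ?_ ?_ ?_
  · rintro ⟨b, c⟩ -
    by_cases h : b = c
    · subst h
      simp only
      rw [starS_mul, δc_δc, map_zero, add_zero]
    · simp only
      rw [starS_anticomm B b.2 c.2 (fun h' => h (Subtype.ext h'))
        (εc_anticomm (εc_δc _)) (εc_anticomm (εc_δc _))]
  · rintro ⟨b, c⟩ - h h'
    obtain rfl : c = b := (Prod.ext_iff.1 h').1
    refine h ?_
    simp only
    rw [starS_mul, δc_δc, map_zero]
  · simp
  · simp

lemma rS_starS (hb : b ∈ π.parts) (T : Module.End Kᵐᵒᵖ (Q.cobar b))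
    (hT : γc E b ∘ₗ T = 0) (G : Q.MF π.parts) (hφ : Q.IsKForm π φ) :
    rS E (starS B hb T G) φ = 0 :=
  (rS_κ E (before_subset b) _ φ).trans (rS_star E B hb T hT G hφ)

lemma rS_forestD (hγ : ∀ b ∈ π.parts, γc E b ∘ₗ Q.δc b = 0) (G : Q.MF π.parts) (hφ : Q.IsKForm π φ) : rS E (forestD B π.parts G) φ = 0 := by
  rw [forestD, GroupEnd.sum_apply, rS_sum]
  exact sum_eq_zero fun b _ => rS_starS E B b.2 _ (hγ _ b.2) G hφ

/-- A form that is invariant under the projections to the image of P^! is determined by its pairing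
with the K-forms. -/
lemma eq_zero_of_star_section (s0 : ∀ b ∈ π.parts, Q.dual.P b →ₗ[Kᵐᵒᵖ] Q.cobar b)
    (G : Q.MF π.parts) (hG : ∀ b (hb : b ∈ π.parts), star B hb (s0 b hb ∘ₗ γc E b) G = G)
    (hr : ∀ φ, Q.IsKForm π φ → rS E G φ = 0) : G = 0 := by
  classical
  refine Subtype.ext (funext fun s => LinearMap.ext fun x => ?_)
  -- The coefficient at the input `b` of the value at `s` of the section.
  set a : 𝓕 N → Q.Args π → Block N → K := fun T y b =>
    if h : b ∈ π.parts then if b ∈ T then (s0 b h (y ⟨b, h⟩)).1 (s b).1 (s b).2 else 1 else 1 with ha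
  have ha_update : ∀ (T : 𝓕 N) (y : Q.Args π) (b : π.parts) (z : Q.dual.P b.1), b.1 ∈ T →
      a T (update y b z)
        = update (a T y) b.1 ((s0 b.1 b.2 z).1 (s b.1).1 (s b.1).2) := by
    intro T y b z hb
    funext c
    by_cases hc : c = b.1
    · subst hc
      rw [update_self]
      simp only [ha, b.2, dif_pos, hb, if_true]
      rw [update_self]
    · rw [update_of_ne hc]
      simp only [ha]
      split_ifs with h1 h2
      · rw [update_of_ne fun h => hc (congrArg Subtype.val h)]
      · rfl
      · rfl
  have hK : ∀ T, T = π.parts →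
      Q.IsKForm π fun y => ⟨Q.ractm (a T y) x.1, Q.ractm_mem _ x.2⟩ := by
    rintro T rfl
    refine isKForm_of (fun y b z z' => Subtype.ext ?_) fun y b c z => Subtype.ext ?_
    · rw [ha_update _ _ _ _ b.2, ha_update _ _ _ _ b.2, ha_update _ _ _ _ b.2, map_add]
      exact Q.ractm_update_add x.2 b.2 _ _ _
    · change Q.ractm _ _ = Q.ract _ _ (Q.ractm _ _)
      rw [ha_update _ _ _ _ b.2, ha_update _ _ _ _ b.2, map_smul, ract_eq, ractm_ractm]
      refine congrArg (fun a' => Q.ractm a' x.1) (funext fun d => ?_)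
      by_cases hd : d = b.1
      · subst hd
        rw [Pi.mul_apply, update_self, update_self, update_self]
        rfl
      · rw [Pi.mul_apply, update_of_ne hd, update_of_ne hd,
          update_of_ne hd, Pi.one_apply, mul_one]
  have key : ∀ T ⊆ π.parts, G.1 s x = psum E T fun f =>
      G.1 (fun b => if b ∈ T then (f b).2 else s b)
        ⟨Q.ractm (a T fun b => (f b.1).1) x.1, Q.ractm_mem _ x.2⟩ := by
    intro T
    induction T using Finset.induction_on with
    | empty =>
      intro _
      rw [psum_empty]
      have h1 : (fun b => if b ∈ (∅ : 𝓕 N) then (leafTr (Q := Q) b).2 else s b) = s := by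
        funext b; simp
      have h2 : a ∅ (fun b => (leafTr (Q := Q) b.1).1) = 1 := by funext b; simp [ha]
      rw [h1]
      congr 1
      refine Subtype.ext ?_
      simp only [h2]
      rw [ractm_one]
    | insert b T hbT ih =>
      intro hT
      have hb := hT (mem_insert_self b T)
      rw [ih ((subset_insert b T).trans hT), psum_insert E hbT]
      refine psum_congr E fun f _ => ?_
      conv_lhs => rw [← hG b hb, star_section]
      set z : Q.P π.parts := ⟨Q.ractm (a T fun b => (f b.1).1) x.1, Q.ractm_mem _ x.2⟩ with hz
      refine (map_bsum E (⟨⟨fun g => g z, rfl⟩, fun _ _ => rfl⟩ : Q.X π.parts →+ K) _).trans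
        (bsum_congr E fun t _ => ?_)
      change G.1 _ _ = _
      have h1 : update (fun c => if c ∈ T then (f c).2 else s c) b t.2
          = fun c => if c ∈ insert b T then (update f b t c).2 else s c := by
        funext c
        by_cases hc : c = b
        · subst hc; simp
        · simp [hc]
      rw [h1]
      congr 1
      refine Subtype.ext ?_
      change Q.ract _ _ (Q.ractm _ _) = Q.ractm _ _
      rw [ract_eq, ractm_ractm, if_neg hbT, update_fst hb, ha_update (insert b T) _ ⟨b, hb⟩ _
        (mem_insert_self b T)]
      refine congrArg (fun a' => Q.ractm a' x.1) (funext fun c => ?_)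
      by_cases hc : c = b
      · subst hc
        simp only [Pi.mul_apply, update_self, ha, hb, dif_pos, hbT, if_false, one_mul]
      · simp only [Pi.mul_apply, update_of_ne hc, Pi.one_apply, mul_one, ha,
          mem_insert, hc, false_or]
  rw [key _ subset_rfl]
  refine Eq.trans ?_ (hr _ (hK _ rfl))
  rw [rS]
  refine psum_congr E fun f _ => ?_
  rw [G.2.congr _ (fun b => (f b).2) fun b hb => by rw [if_pos hb]]

/-- If the cobar complexes of the blocks are contractible, then so is the complex of forests; the
contraction does not leave the forms that the pairing with the K-forms annihilates. -/
lemma exists_forestD_eq (C : ∀ b ∈ π.parts, Contraction E b) (G : Q.MF π.parts)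
    (hG : forestD B π.parts G = 0) (hr : ∀ φ, Q.IsKForm π φ → rS E G φ = 0) :
    ∃ G' : Q.MF π.parts, forestD B π.parts G' = G ∧ ∀ φ, Q.IsKForm π φ → rS E G' φ = 0 := by
  have hγ : ∀ b ∈ π.parts, γc E b ∘ₗ Q.δc b = 0 := fun b hb => (C b hb).γ_δ
  -- It suffices to contract one block after the other; at the end the form is invariant under all the
  -- projections to the image of P^!.
  suffices key : ∀ T ⊆ π.parts, ∃ G1 G2 : Q.MF π.parts, forestD B π.parts G1 + G2 = G ∧
      (∀ φ, Q.IsKForm π φ → rS E G1 φ = 0) ∧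
      ∀ b (hb : b ∈ π.parts), b ∈ T → star B hb ((C b hb).s ∘ₗ γc E b) G2 = G2 by
    obtain ⟨G1, G2, h1, h2, h3⟩ := key _ subset_rfl
    have h4 : ∀ φ, Q.IsKForm π φ → rS E G2 φ = 0 := fun φ hφ => by
      have := hr φ hφ
      rwa [← h1, rS_add, rS_forestD E B hγ G1 hφ, zero_add] at this
    rw [eq_zero_of_star_section E B (fun b hb => (C b hb).s) G2 (fun b hb => h3 b hb hb) h4,
      add_zero] at h1
    exact ⟨G1, h1, h2⟩
  intro T
  induction T using Finset.induction_on with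
  | empty => exact fun _ => ⟨0, G, by simp, fun φ _ => rS_zero E φ, by simp⟩
  | insert b T hbT ih =>
    intro hT
    obtain ⟨G1, G2, h1, h2, h3⟩ := ih ((subset_insert b T).trans hT)
    have hb := hT (mem_insert_self b T)
    have hD : forestD B π.parts G2 = 0 := by
      have h4 : forestD B π.parts (forestD B π.parts G1) = 0 :=
        DFunLike.congr_fun (forestD_forestD B) G1
      rw [← h1, map_add, h4, zero_add] at hG
      exact hG
    set P : Module.End Kᵐᵒᵖ (Q.cobar b) := (C b hb).s ∘ₗ γc E b with hP
    have hPP : P * P = P := LinearMap.ext fun Φ => congrArg (C b hb).s ((C b hb).γ_s _)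
    have hh : forestD B π.parts (starS B hb (C b hb).h G2) + star B hb P G2 = G2 := by
      have h4 := DFunLike.congr_fun (forestD_homotopy B hb (εc_anticomm (C b hb).ε_h)) G2
      change forestD B π.parts (starS B hb (C b hb).h G2)
        + starS B hb (C b hb).h (forestD B π.parts G2) = _ at h4
      rw [hD, map_zero, add_zero] at h4
      rw [h4]
      have h5 : Q.δc b * (C b hb).h + (C b hb).h * Q.δc b + P = 1 := by
        rw [(C b hb).homotopy]; exact sub_add_cancel (1 : Module.End Kᵐᵒᵖ (Q.cobar b)) P
      have h6 := congrArg (star B hb) h5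
      rw [map_add, map_one] at h6
      exact DFunLike.congr_fun h6 G2
    refine ⟨G1 + starS B hb (C b hb).h G2, star B hb P G2, ?_, fun φ hφ => ?_, ?_⟩
    · rw [map_add, add_assoc, hh, h1]
    · rw [rS_add, h2 φ hφ, zero_add, rS_starS E B hb _ (C b hb).γ_h G2 hφ]
    · intro c hc hcT
      change (star B hc _ * star B hb P) G2 = _
      by_cases hcb : c = b
      · subst hcb
        rw [← map_mul, hPP]
      · rw [star_comm B hc hb hcb]
        change star B hb P (star B hc _ G2) = _
        rw [h3 c hc ((mem_insert.1 hcT).resolve_left hcb)]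

end QuadraticData

namespace QuadraticData

/-! ### Contraction of a root edge -/

section RootEdge

variable {b c1 c2 : Block N}

lemma isPart_split (hP : IsPart A (insert b R)) (hbR : b ∉ R) (hp : (c1, c2) ∈ splits b) :
    IsPart A (insert c1 (insert c2 R)) ∧ c1 ∉ insert c2 R ∧ c2 ∉ R := by
  obtain ⟨h1, h2, h3, h4, h5⟩ := mem_splits.1 hp
  simp only at h1 h2 h3 h4 h5
  have hdR : ∀ a ∈ R, Disjoint b a := fun a ha =>
    hP.disj b (mem_insert_self _ _) a (mem_insert_of_mem ha)
      (by rintro rfl; exact hbR ha)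
  have hd1 : ∀ a ∈ R, Disjoint c1 a := fun a ha =>
    (hdR a ha).mono_left (h2 ▸ subset_union_left)
  have hd2 : ∀ a ∈ R, Disjoint c2 a := fun a ha =>
    (hdR a ha).mono_left (h2 ▸ subset_union_right)
  have hbA := hP.sub b (mem_insert_self _ _)
  have hn2 : c2 ∉ R := fun h => h4.ne_empty (disjoint_self.1 (hd2 _ h))
  have hn1 : c1 ∉ insert c2 R := fun h => by
    rcases mem_insert.1 h with h | h
    · exact ne_of_mem_splits hp h
    · exact h3.ne_empty (disjoint_self.1 (hd1 _ h))
  refine ⟨⟨?_, ?_, ?_, ?_, ?_⟩, hn1, hn2⟩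
  · intro a ha
    rcases mem_insert.1 ha with rfl | ha
    · exact (h2 ▸ subset_union_left).trans hbA
    rcases mem_insert.1 ha with rfl | ha
    · exact (h2 ▸ subset_union_right).trans hbA
    · exact hP.sub a (mem_insert_of_mem ha)
  · intro a ha
    rcases mem_insert.1 ha with rfl | ha
    · exact h3
    rcases mem_insert.1 ha with rfl | ha
    · exact h4
    · exact hP.nonempty a (mem_insert_of_mem ha)
  · intro a ha a' ha' haa
    rcases mem_insert.1 ha with rfl | ha
    · grind
    rcases mem_insert.1 ha with rfl | haR
    · grind
    · rcases mem_insert.1 ha' with rfl | ha'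
      · exact (hd1 _ haR).symm
      rcases mem_insert.1 ha' with rfl | ha'
      · exact (hd2 _ haR).symm
      · exact hP.disj a (mem_insert_of_mem haR) a' (mem_insert_of_mem ha') haa
  · intro x hx
    obtain ⟨a, ha, hxa⟩ := hP.cover x hx
    rcases mem_insert.1 ha with rfl | ha
    · grind
    · exact ⟨a, by simp [ha], hxa⟩
  · grind

/-- The tree on `b` with a binary root that carries `e`. -/
def rootSt (b c1 c2 : Block N) (e : Q.E) (t₁ t₂ : Q.St N) : Q.St N :=
  (jV b {c1, c2} (pairSt c1 t₁ t₂), jm b {c1, c2} (pairSt c1 t₁ t₂) (Q.node e (Q.var c1) (Q.var c2)))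

lemma rootSt_fst (hp : (c1, c2) ∈ splits b) (e : Q.E) (t₁ t₂ : Q.St N) :
    (rootSt b c1 c2 e t₁ t₂).1 = insert b (t₁.1 ∪ t₂.1) := by
  have hne : c2 ≠ c1 := (ne_of_mem_splits hp).symm
  ext v
  rw [rootSt, jV, mem_glueV]
  simp [pairSt, hne]

lemma rootSt_snd_self (e : Q.E) (t₁ t₂ : Q.St N) :
    (rootSt b c1 c2 e t₁ t₂).2 b = Q.node e (Q.var c1) (Q.var c2) :=
  jm_top _ _

variable (hP : IsPart A (insert b R)) (hbR : b ∉ R) (hp : (c1, c2) ∈ splits b)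
  (hs : Q.Good (insert c1 (insert c2 R)) s) (e : Q.E)

include hp hs

lemma pairSt_good_of_good : Q.Good {c1, c2} (pairSt c1 (s c1) (s c2)) :=
  pairSt_good (ne_of_mem_splits hp) (hs c1 (by simp)) (hs c2 (by simp))

lemma rootSt_snd {c v : Block N} (hc : c = c1 ∨ c = c2) (hv : v ∈ (s c).1) :
    (rootSt b c1 c2 e (s c1) (s c2)).2 v = (s c).2 v := by
  have hne : c2 ≠ c1 := (ne_of_mem_splits hp).symm
  have h : pairSt c1 (s c1) (s c2) c = s c := by
    rcases hc with rfl | rfl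
    · simp [pairSt]
    · simp [pairSt, hne]
  have := jm_of_mem (isPart_splits hp) (pairSt_good_of_good hp hs) (b := c) (v := v)
    (by simpa using hc) (by rwa [h]) (Q.node e (Q.var c1) (Q.var c2))
  rw [h] at this
  exact this

include hP hbR

lemma rootSt_good : Q.Good (insert b R) (update s b (rootSt b c1 c2 e (s c1) (s c2))) := by
  intro a ha
  by_cases h : a = b
  · subst h
    rw [update_self]
    exact ⟨jV_isTree (isPart_splits hp) (pairSt_good_of_good hp hs),
      jm_valid (isPart_splits hp) (pairSt_good_of_good hp hs) (node_var_mem (ne_of_mem_splits hp) e)⟩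
  · rw [update_of_ne h]
    exact hs a (by simp [(mem_insert.1 ha).resolve_left h])

lemma notMem_of_split {a : Block N} (ha : a ∈ insert c1 (insert c2 R)) : ¬ b ⊆ a := by
  intro hba
  obtain ⟨h1, h2, h3, h4, h5⟩ := mem_splits.1 hp
  simp only at h1 h2 h3 h4 h5
  rw [← h2] at hba
  rcases mem_insert.1 ha with rfl | ha
  · exact h4.ne_empty (disjoint_self.1 (h1.mono_left (Finset.union_subset_right hba)))
  rcases mem_insert.1 ha with rfl | ha
  · exact h3.ne_empty (disjoint_self.1 (h1.mono_right (Finset.union_subset_left hba)))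
  · have := hP.disj b (mem_insert_self _ _) a (mem_insert_of_mem ha)
      (by rintro rfl; exact hbR ha)
    rw [← h2] at this
    exact h3.ne_empty (disjoint_self.1 ((this.mono_right hba).mono subset_union_left
      subset_union_left))

lemma jV_rootSt :
    (jV A (insert b R) (update s b (rootSt b c1 c2 e (s c1) (s c2)))).erase b
      = jV A (insert c1 (insert c2 R)) s := by
  have hbs : ∀ a ∈ insert c1 (insert c2 R), b ∉ (s a).1 := fun a ha h =>
    notMem_of_split hP hbR hp hs ha ((hs a ha).1.sub b h)
  have hbA : b ≠ A := (hP.ssubset (mem_insert_self _ _)).ne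
  ext v
  rw [mem_erase, jV, mem_glueV, jV, mem_glueV]
  constructor
  · rintro ⟨hvb, rfl | ⟨a, ha, hv⟩⟩
    · exact .inl rfl
    · right
      by_cases hab : a = b
      · subst hab
        rw [update_self, rootSt_fst hp, mem_insert, mem_union] at hv
        rcases hv.resolve_left hvb with h | h
        exacts [⟨c1, by simp, h⟩, ⟨c2, by simp, h⟩]
      · grind
  · rintro (rfl | ⟨a, ha, hv⟩)
    · exact ⟨hbA.symm, .inl rfl⟩
    · refine ⟨fun h => hbs a ha (h ▸ hv), .inr ?_⟩
      by_cases hab : a = c1 ∨ a = c2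
      · refine ⟨b, by simp, ?_⟩
        rw [update_self, rootSt_fst hp, mem_insert, mem_union]
        rcases hab with rfl | rfl
        exacts [.inr (.inl hv), .inr (.inr hv)]
      · have haR : a ∈ R := by simpa [not_or.1 hab] using ha
        refine ⟨a, by simp [haR], ?_⟩
        rwa [update_of_ne]
        rintro rfl
        exact hbR haR

lemma ctr_rootSt {x : Q.Alg (Block N)} (hx : x ∈ Q.P (insert b R)) :
    Q.ctr (jV A (insert b R) (update s b (rootSt b c1 c2 e (s c1) (s c2)))) b
        (jm A (insert b R) (update s b (rootSt b c1 c2 e (s c1) (s c2))) x)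
      = jm A (insert c1 (insert c2 R)) s (Q.plug b (Q.node e (Q.var c1) (Q.var c2)) x) := by
  obtain ⟨hP', -, -⟩ := isPart_split hP hbR hp
  have hg := rootSt_good hP hbR hp hs e
  have hbA : b ≠ A := (hP.ssubset (mem_insert_self _ _)).ne
  set s₁ := update s b (rootSt b c1 c2 e (s c1) (s c2)) with hs1
  have hsb : s₁ b = rootSt b c1 c2 e (s c1) (s c2) := update_self _ _ _
  have hbV : b ∈ (s₁ b).1 := by rw [hsb, rootSt_fst hp]; simp
  have hbJ : b ∈ jV A (insert b R) s₁ := mem_jV_of_mem (by simp) hbV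
  have hin : b ∈ inp (jV A (insert b R) s₁) A := by rw [jV_inp hP hg]; simp
  funext v
  by_cases hv : v ∈ jV A (insert c1 (insert c2 R)) s
  · by_cases hvA : v = A
    · subst hvA
      rw [ctr_of_mem hin, jm_top, jm_top, jm_of_mem hP hg (by simp) hbV, hsb, rootSt_snd_self]
    · obtain ⟨a, ha, hva⟩ := (mem_glueV.1 hv).resolve_left hvA
      have hvJ := hv
      rw [← jV_rootSt hP hbR hp hs e] at hvJ
      have hT := jV_isTree hP hg
      have hbv : b ∉ inp (jV A (insert b R) s₁) v := fun h => hvA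
        (hT.inp_subset_inp h hin (mem_of_mem_erase hvJ) (jV_top_mem _))
      rw [ctr_of_notMem (ne_of_mem_erase hvJ) hbv, jm_of_mem hP' hs ha hva]
      by_cases hab : a = c1 ∨ a = c2
      · have : v ∈ (s₁ b).1 := by
          rw [hsb, rootSt_fst hp]
          rcases hab with rfl | rfl <;> simp [hva]
        rw [jm_of_mem hP hg (by simp) this, hsb, rootSt_snd hp hs e hab hva]
      · have haR : a ∈ R := by simpa [not_or.1 hab] using ha
        have hab' : a ≠ b := by rintro rfl; exact hbR haR
        have hsa : s₁ a = s a := update_of_ne hab' _ _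
        rw [jm_of_mem hP hg (mem_insert_of_mem haR) (by rwa [hsa]), hsa]
  · rw [jm_off hP' hs hv]
    have h1 := (jm_valid hP hg hx).ctr (jV_isTree hP hg) hbJ
    rw [jV_rootSt hP hbR hp hs e] at h1
    exact h1.zero v hv

lemma sign_rootSt (heven : ∀ a ∈ insert c1 (insert c2 R), Even (edg s a).card) :
    sgn (shx (insert b R) (edg (update s b (rootSt b c1 c2 e (s c1) (s c2)))))
        * (-1) ^ inv b (eA A (jV A (insert b R)
          (update s b (rootSt b c1 c2 e (s c1) (s c2)))))
      = sgn (shx {c1, c2} (edg (pairSt c1 (s c1) (s c2))))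
        * ((-1) ^ (inv b R + inv c1 R + inv c2 R) * sgn (shx (insert c1 (insert c2 R)) (edg s))) := by
  obtain ⟨hP', hn1, hn2⟩ := isPart_split hP hbR hp
  obtain ⟨h1, h2, h3, h4, h5⟩ := mem_splits.1 hp
  simp only at h1 h2 h3 h4 h5
  have hne : c2 ≠ c1 := (ne_of_mem_splits hp).symm
  have hg := rootSt_good hP hbR hp hs e
  have hg' := pairSt_good_of_good hp hs
  set s₁ := update s b (rootSt b c1 c2 e (s c1) (s c2)) with hs1
  set F : Block N → 𝓕 N := fun a => if a ∈ insert c1 (insert c2 R) then edg s a else ∅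
    with hF
  have hFe : ∀ a ∈ insert c1 (insert c2 R), F a = edg s a := fun a ha => if_pos ha
  have hFn : ∀ a, a ∉ insert c1 (insert c2 R) → F a = ∅ := fun a ha => if_neg ha
  have hF1 : F c1 = edg s c1 := hFe _ (by simp)
  have hF2 : F c2 = edg s c2 := hFe _ (by simp)
  have hFR : ∀ a ∈ R, F a = edg s a := fun a ha => hFe _ (by simp [ha])
  have hp1 : edg (pairSt c1 (s c1) (s c2)) c1 = F c1 := by rw [hF1]; simp [edg, pairSt]
  have hp2 : edg (pairSt c1 (s c1) (s c2)) c2 = F c2 := by rw [hF2]; simp [edg, pairSt, hne]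
  have hb₁ : b ≠ c1 := fun h => notMem_of_split hP hbR hp hs (a := c1) (by simp) h.le
  have hb₂ : b ≠ c2 := fun h => notMem_of_split hP hbR hp hs (a := c2) (by simp) h.le
  have hdS : ∀ a ∈ insert c1 (insert c2 R), ∀ c ∈ insert c1 (insert c2 R), c ∉ edg s a :=
    fun a ha c hc => notMem_edg hP' ha hc
  have hcc : ∀ X : 𝓕 N, (∀ c ∈ insert c1 (insert c2 R), c ∉ X) → Disjoint {c1, c2} X :=
    fun X hX => disjoint_left.2 fun u hu => by
      rcases mem_insert.1 hu with rfl | hu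
      · exact hX _ (by simp)
      · rw [mem_singleton.1 hu]; exact hX _ (by simp)
  have hdF : ∀ a ∈ insert c1 (insert c2 R), ∀ c ∈ insert c1 (insert c2 R), c ∉ F a :=
    fun a ha c hc => by rw [hFe a ha]; exact hdS a ha c hc
  have hdd : ∀ a ∈ insert c1 (insert c2 R), ∀ c ∈ insert c1 (insert c2 R), a ≠ c →
      Disjoint (F a) (F c) := fun a ha c hc hac => by
    rw [hFe a ha, hFe c hc]; exact disjoint_edg hP' hs ha hc hac
  have key := shx_split hbR (fun h => hn1 (mem_insert_of_mem h)) hn2 h5 (edg s₁) F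
    (fun a ha => by rw [hFR a ha, edg, edg, hs1, update_of_ne (by rintro rfl; exact hbR ha)])
    (by
      rw [hs1, edg, update_self]
      change eA b (jV b {c1, c2} _) = _
      rw [eA_jV (isPart_splits hp) hg', Finset.biUnion_insert, Finset.singleton_biUnion, hp1, hp2])
    ((hcc _ (hdF c1 (by simp))).sup_right (hcc _ (hdF c2 (by simp))))
    (hdd _ (by simp) _ (by simp) hne.symm)
    (fun a => by
      by_cases ha : a ∈ insert c1 (insert c2 R)
      · rw [hFe a ha, ZMod.natCast_eq_zero_iff_even]; exact heven a ha
      · rw [hFn a ha]; rfl)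
    (fun a h => by
      by_cases ha : a ∈ insert c1 (insert c2 R)
      · rw [hFe a ha] at h
        exact notMem_of_split hP hbR hp hs ha (mem_eA.1 h).2.1
      · rw [hFn a ha] at h; exact absurd h (notMem_empty _)) hb₁ hb₂
    (fun a ha => ⟨hcc _ (hdF a (by simp [ha])),
      hdd _ (by simp) _ (by simp [ha]) (fun h => hn1 (by simp [h, ha])),
      hdd _ (by simp) _ (by simp [ha]) (fun h => hn2 (by simp [h, ha]))⟩)
  have e1 : ∀ (u : Block N) (X : 𝓕 N), ((-1 : ℤ)) ^ inv u X = sgn (nlt {u} X) := by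
    intro u X
    rw [← cast_inv, sgn_natCast]
  have e2 : shx {c1, c2} (edg (pairSt c1 (s c1) (s c2))) = shx {c1, c2} F := shx_congr fun a ha => by
    rcases mem_insert.1 ha with rfl | ha
    · exact hp1
    · rw [mem_singleton.1 ha]; exact hp2
  rw [e1, nlt_eA_jV hP hg, ← sgn_add, key, e2, shx_congr hFe, sgn_add, sgn_add, sgn_add, sgn_add,
    pow_add, pow_add, e1, e1, e1]
  ring

end RootEdge

end QuadraticData

/-! ### Splitting a block of a partition -/

lemma exists_setPart (hS : IsPart univ S) :
    ∃ π : SetPart N, π.parts = S :=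
  ⟨Finpartition.ofExistsUnique S (fun _ _ => subset_univ _)
    (fun x _ => by
      obtain ⟨b, hb, hxb⟩ := hS.cover x (mem_univ x)
      refine ⟨b, ⟨hb, hxb⟩, fun c hc => by_contra fun h => ?_⟩
      exact disjoint_left.1 (hS.disj c hc.1 b hb h) hc.2 hxb)
    (fun h => by simpa using hS.nonempty _ h), rfl⟩

lemma parts_eq_univ (h : π.parts.card < 2) (hb : b ∈ π.parts) :
    b = univ := by
  refine Finset.eq_univ_of_forall fun x => ?_
  obtain ⟨c, ⟨hc, hxc⟩, -⟩ := π.existsUnique_mem (mem_univ x)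
  rwa [card_le_one.1 (by omega) b hb c hc]

namespace QuadraticData

lemma sum_pairs {M : Type*} [AddCommMonoid M]
    (f : SetPart N → Block N → Block N × Block N → M) :
    ∑ π : SetPart N, ∑ b ∈ π.parts, ∑ p ∈ splits b, f π b p
      = ∑ π : SetPart N, ∑ p : π.pairs, f (SetPart.merge π p) (p.1.1 ∪ p.1.2) p.1 := by
  rw [sum_sigma' _ (fun π : SetPart N => π.parts),
    sum_sigma' _ (fun x : Σ _ : SetPart N, Block N => splits x.2),
    sum_sigma' _ (fun π : SetPart N => (univ : Finset π.pairs))]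
  symm
  refine Finset.sum_bij (fun x _ => ⟨⟨SetPart.merge x.1 x.2, x.2.1.1 ∪ x.2.1.2⟩, x.2.1⟩) ?_ ?_ ?_ ?_
  · rintro ⟨π, p⟩ -
    simp only [mem_sigma, mem_univ, true_and]
    exact ⟨mem_insert_self _ _, mem_splits.2 ⟨SetPart.disjoint π p, rfl,
      π.nonempty_of_mem_parts p.2.1, π.nonempty_of_mem_parts p.2.2.1, p.2.2.2⟩⟩
  · rintro ⟨π, p⟩ - ⟨π', p'⟩ - h
    simp only [Sigma.mk.injEq, heq_eq_eq] at h
    obtain ⟨⟨h1, h2⟩, h3⟩ := h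
    have h4 : π = π' := by
      refine Finpartition.ext ?_
      rw [SetPart.parts_eq π p, SetPart.parts_eq π' p', h1, h3]
    subst h4
    obtain rfl : p = p' := Subtype.ext h3
    rfl
  · rintro ⟨⟨π, b⟩, ⟨c1, c2⟩⟩ h
    simp only [mem_sigma, mem_univ, true_and] at h
    obtain ⟨hb, hp⟩ := h
    obtain ⟨h1, h2, h3, h4, h5⟩ := mem_splits.1 hp
    simp only at h1 h2 h3 h4 h5
    have key : IsPart univ (insert c1 (insert c2 (π.parts.erase b))) ∧
        c1 ∉ insert c2 (π.parts.erase b) ∧ c2 ∉ π.parts.erase b := by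
      by_cases h : 2 ≤ π.parts.card
      · exact isPart_split (by rw [insert_erase hb]; exact isPart_setPart h)
          (notMem_erase _ _) hp
      · have hu := parts_eq_univ (by omega) hb
        have he : π.parts.erase b = ∅ := card_eq_zero.1 (by rw [card_erase_of_mem hb]; omega)
        rw [he]
        have := isPart_splits hp
        rw [hu] at this
        exact ⟨by simpa using this, by simpa using ne_of_mem_splits hp, by simp⟩
    obtain ⟨hP, hn1, hn2⟩ := key
    obtain ⟨π', hπ'⟩ := exists_setPart hP
    have m1 : c1 ∈ π'.parts := by rw [hπ']; simp
    have m2 : c2 ∈ π'.parts := by rw [hπ']; simp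
    refine ⟨⟨π', ⟨(c1, c2), m1, m2, h5⟩⟩, by simp, ?_⟩
    have h6 : SetPart.merge π' ⟨(c1, c2), m1, m2, h5⟩ = π := by
      refine Finpartition.ext ?_
      rw [SetPart.merge_parts]
      simp only [SetPart.rest]
      rw [hπ', erase_insert hn1, erase_insert hn2, h2, insert_erase hb]
    simp only [h6, h2]
  · rintro ⟨π, p⟩ -
    rfl

/-! ### The pairing of the cone of the canonical morphism with the Koszul complex -/

lemma coef_ract {x : Q.Alg (Block N)} (hx : x ∈ Q.P {A}) (a : K) :
    Q.coef (Q.ract A a x) = Q.coef x * a := by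
  obtain ⟨c, rfl⟩ := Q.mem_P_singleton.1 hx
  rw [ract_eq, ractm_smul, ractm_var, update_self, smul_smul, coef_smul_var, coef_smul_var]

/-- An element of P^! of all the leaves as an argument of a K-form on a partition into one block. -/
def argTop (π : SetPart N) (y : Q.dual.P 𝕌) : Q.Args π := fun b =>
  if h : b.1 = univ then ⟨y.1, by rw [h]; exact y.2⟩ else 0

lemma argTop_update (hπ : π.parts.card < 2) {b : π.parts}
    (y : Q.dual.P 𝕌) (z : Q.dual.P b.1) (h : z.1 = y.1) (y' : Q.Args π) :
    argTop π y = update y' b z := by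
  funext c
  obtain rfl : c = b := Subtype.ext (card_le_one.1 (by omega) _ c.2 _ b.2)
  rw [update_self, argTop, dif_pos (parts_eq_univ hπ c.2)]
  exact Subtype.ext h.symm

variable (E : Q.DualBasis)

/-- The pairing of a pair, of an element of the cobar complex and an element of P^!, with a family of
K-forms: the element of P^! is paired with the component of the partition into one block. -/
def pair (Ψ : Q.cobar 𝕌) (y : Q.dual.P 𝕌)
    (φ : Q.KCochain N) : K :=
  ∑ π : SetPart N, if h : 2 ≤ π.parts.card then rS E (splitG (isPart_setPart h) Ψ) (φ π)
    else Q.coef (φ π (argTop π y)).1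

lemma psum_sum {M ι : Type*} [AddCommMonoid M] (t : Finset ι)
    (F : ι → ((b : Block N) → Q.Tr b) → M) :
    (psum E S fun f => ∑ i ∈ t, F i f) = ∑ i ∈ t, psum E S (F i) := by
  rw [← map_sum]
  congr 1
  funext f
  rw [Finset.sum_apply]

/-- A family of trees without their composites in P^!. -/
def trSt (f : (b : Block N) → Q.Tr b) (b : Block N) : Q.St N := (f b).2

/-- The composites in P^! of a family of trees, for the blocks of a partition. -/
def trArgs (π : SetPart N) (f : (b : Block N) → Q.Tr b) : Q.Args π := fun b => (f b.1).1

lemma trSt_update (f : (b : Block N) → Q.Tr b) (b : Block N) (t : Q.Tr b) :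
    trSt (update f b t) = update (trSt f) b t.2 := update_snd t

lemma trSt_good {f : (b : Block N) → Q.Tr b}
    (hf : ∀ b ∈ S, f b ∈ BT E b) : Q.Good S (trSt f) := fun b hb => (BT_spec E b _ (hf b hb)).1

/-- The contribution of the contraction of the root edge `b` to the differential. -/
def edgeTerm (Ψ : Q.cobar 𝕌) (π : SetPart N) (φ : Q.Args π → Q.P π.parts)
    (b : Block N) (f : (b : Block N) → Q.Tr b) : K :=
  (sgn (shx π.parts (edg (trSt f))) * (-1) ^ inv b (eA univ (jV univ π.parts (trSt f)))) •
    Ψ.1 ((jV univ π.parts (trSt f)).erase b) (Q.ctr (jV univ π.parts (trSt f)) b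
      (jm univ π.parts (trSt f) (φ (trArgs π f)).1))

lemma card_of_splits_nonempty {p : Block N × Block N} (hp : p ∈ splits b) :
    2 ≤ b.card := by
  have h1 := card_of_mem_splits hp
  omega

lemma rS_splitG_δc (B : ∀ b : Block N, Q.Frame b) [IsSemisimpleRing K]
    (hγ : ∀ b : Block N, b.Nonempty → b ≠ univ → γc E b ∘ₗ Q.δc b = 0)
    (Ψ : Q.cobar 𝕌) (h : 2 ≤ π.parts.card) (hφ : Q.IsKForm π φ) :
    rS E (splitG (isPart_setPart h) (Q.δc univ Ψ)) φ
      = ∑ b ∈ π.parts, ∑ p ∈ splits b, ∑ i, psum E (π.parts.erase b) fun f =>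
          bsum E p.1 fun t₁ => bsum E p.2 fun t₂ =>
            edgeTerm Ψ π φ b (update f b (graft E b p.1 p.2 i t₁ t₂)) := by
  have hP := isPart_setPart h
  have h1 : rS E (splitG hP (Q.δc univ Ψ)) φ
      = rS E (forestD B π.parts (splitG hP Ψ)) φ
        + ∑ b ∈ π.parts, psum E π.parts fun f =>
          if b ∈ (trSt f b).1 then edgeTerm Ψ π φ b f else 0 := by
    rw [rS, rS, ← psum_sum, ← map_add]
    refine psum_congr E fun f hf => ?_
    refine (splitG_apply hP _ (trSt_good E hf) _).trans
      ((dif_split hP Ψ (trSt_good E hf) _).trans ?_)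
    rw [← forestD_apply B]
    rfl
  rw [h1, rS_forestD E B (fun b hb => hγ b (hP.nonempty b hb) (hP.ssubset hb).ne) _ hφ, zero_add]
  refine sum_congr rfl fun b hb => ?_
  rw [psum_of_mem E hb]
  simp only [trSt_update, update_self]
  by_cases h2 : 2 ≤ b.card
  · have h3 : ∀ f : (b : Block N) → Q.Tr b, (bsum E b fun t =>
        if b ∈ t.2.1 then edgeTerm Ψ π φ b (update f b t) else 0)
        = bsum E b fun t => edgeTerm Ψ π φ b (update f b t) := fun f =>
      bsum_congr E fun t ht => if_pos ((BT_spec E b t ht).1.1.top h2)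
    simp only [h3, bsum_node E h2, psum_sum]
  · have h3 : splits b = ∅ := eq_empty_of_forall_notMem fun p hp =>
      h2 (card_of_splits_nonempty hp)
    rw [h3, sum_empty]
    refine (psum_congr E (G := fun _ => 0) fun f _ => ?_).trans (psum_zero E)
    exact (bsum_congr E fun t ht => if_neg fun h4 => h2 ((BT_spec E b t ht).1.1.two b h4)).trans
      (bsum_zero E)

/-- The component of the partition into one block, as a functional on P^!. -/
lemma exists_topHom (h : π.parts.card < 2) (hb : b ∈ π.parts) (hφ : Q.IsKForm π φ) :
    ∃ g : Q.dual.P 𝕌 →+ K, (∀ (a : K) y, g (op a • y) = g y * a) ∧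
      ∀ y, g y = Q.coef (φ (argTop π y)).1 := by
  have hbu := parts_eq_univ h hb
  have hparts : π.parts = {b} := eq_singleton_iff_unique_mem.2
    ⟨hb, fun c hc => (parts_eq_univ h hc).trans hbu.symm⟩
  let z : Q.dual.P 𝕌 → Q.dual.P b := fun y => ⟨y.1, hbu ▸ y.2⟩
  have e1 : ∀ y, φ (argTop π y) = hφ.hom (argTop π 0) ⟨b, hb⟩ (z y) := fun y =>
    congrArg φ (argTop_update h y (b := ⟨b, hb⟩) (z y) rfl _)
  have e4 : ∀ y y', z (y + y') = z y + z y' := fun _ _ => rfl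
  have e5 : ∀ (a : K) y, z (op a • y) = op a • z y := fun _ _ => rfl
  refine ⟨AddMonoidHom.mk' (fun y => Q.coef (φ (argTop π y)).1) fun y y' => ?_, fun a y => ?_,
    fun _ => rfl⟩
  · simp only [e1, e4, map_add]
    exact map_add Q.coef _ _
  · simp only [AddMonoidHom.mk'_apply, e1, e5, hφ.hom_smul]
    exact coef_ract (hparts ▸ Subtype.prop _) a

lemma coef_γc (Ψ : Q.cobar 𝕌) (hN : 2 ≤ (𝕌).card)
    (h : π.parts.card < 2) (hb : b ∈ π.parts) (hφ : Q.IsKForm π φ) :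
    Q.coef (φ (argTop π (γc E univ Ψ))).1
      = ∑ p ∈ splits univ, ∑ i, bsum E p.1 fun t₁ => bsum E p.2 fun t₂ =>
          Q.coef (φ (argTop π (graft E univ p.1 p.2 i t₁ t₂).1)).1
            * Ψ.1 (graft E univ p.1 p.2 i t₁ t₂).2.1
              (graft E univ p.1 p.2 i t₁ t₂).2.2 := by
  obtain ⟨g, h1, h2⟩ := exists_topHom h hb hφ
  rw [← h2, γc_apply, map_bsum, bsum_node E hN]
  simp only [h1, h2]

end QuadraticData

namespace QuadraticData

/-! ### The pairing is compatible with the differentials -/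

section Term

variable (E : Q.DualBasis) (p : π.pairs)

lemma mem_splits_pair : p.1 ∈ splits (p.1.1 ∪ p.1.2) :=
  mem_splits.2 ⟨SetPart.disjoint π p, rfl, π.nonempty_of_mem_parts p.2.1,
    π.nonempty_of_mem_parts p.2.2.1, p.2.2.2⟩

lemma union_mem_merge : p.1.1 ∪ p.1.2 ∈ (SetPart.merge π p).parts := mem_insert_self _ _

variable (f : (b : Block N) → Q.Tr b) (t₁ : Q.Tr p.1.1) (t₂ : Q.Tr p.1.2) (i : Fin E.d)

/-- The family of trees `f`, with `t₁` and `t₂` on the blocks of the pair `p`. -/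
def updPair (b : Block N) : Q.Tr b := update (update f p.1.2 t₂) p.1.1 t₁ b

lemma updPair_fst : updPair p f t₁ t₂ p.1.1 = t₁ := update_self _ _ _

lemma updPair_snd : updPair p f t₁ t₂ p.1.2 = t₂ := by
  rw [updPair, update_of_ne (SetPart.ne π p).symm, update_self]

lemma updPair_of_mem {c : Block N} (hc : c ∈ SetPart.rest π p) : updPair p f t₁ t₂ c = f c := by
  have h := mem_erase.1 hc
  rw [updPair, update_of_ne (mem_erase.1 h.2).1, update_of_ne h.1]

/-- The value of a K-form on a merged block. -/
lemma map_trArgs_graft {φ : Q.Args (SetPart.merge π p) → Q.P (SetPart.merge π p).parts}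
    (hφ : Q.IsKForm _ φ) (y : Q.Args (SetPart.merge π p))
    (hy : ((y ⟨_, union_mem_merge p⟩ : Q.dual.P (p.1.1 ∪ p.1.2)) : Q.dual.Alg (Fin N))
      = (graft E (p.1.1 ∪ p.1.2) p.1.1 p.1.2 i t₁ t₂).1)
    (hy' : ∀ c : (SetPart.merge π p).parts, c.1 ≠ p.1.1 ∪ p.1.2 → y c = (f c.1).1) :
    φ y = sgn (shx {p.1.1, p.1.2} (edg (pairSt p.1.1 t₁.2 t₂.2))) •
      φ (Q.mergeArgs π p (E.Ξ i) (trArgs π (updPair p f t₁ t₂))) := by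
  set z := Q.mergeArgs π p (E.Ξ i) (trArgs π (updPair p f t₁ t₂)) with hz
  have h1 : y = update z ⟨_, union_mem_merge p⟩
      (sgn (shx {p.1.1, p.1.2} (edg (pairSt p.1.1 t₁.2 t₂.2))) • z ⟨_, union_mem_merge p⟩) := by
    funext c
    by_cases hc : c = ⟨_, union_mem_merge p⟩
    · subst hc
      rw [update_self]
      refine Subtype.ext ?_
      refine (hy.trans (coe_graft_fst E (mem_splits_pair p) i t₁ t₂)).trans ?_
      congr 1
      rw [hz, mergeArgs, dif_pos rfl]
      simp only [trArgs, updPair_fst, updPair_snd]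
    · have hc' : c.1 ≠ p.1.1 ∪ p.1.2 := fun h => hc (Subtype.ext h)
      rw [update_of_ne hc, hy' c hc', hz, mergeArgs, dif_neg hc']
      rw [trArgs, updPair_of_mem p f t₁ t₂ ((mem_insert.1 c.2).resolve_left hc')]
  have h2 := map_zsmul (hφ.hom z ⟨_, union_mem_merge p⟩)
    (sgn (shx {p.1.1, p.1.2} (edg (pairSt p.1.1 t₁.2 t₂.2)))) (z ⟨_, union_mem_merge p⟩)
  rw [h1]
  refine h2.trans ?_
  congr 1
  exact congrArg φ (Function.update_eq_self _ _)

lemma rest_eq : SetPart.rest π p = (SetPart.merge π p).parts.erase (p.1.1 ∪ p.1.2) := by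
  rw [SetPart.merge_parts, erase_insert (SetPart.union_notMem_rest π p)]

lemma parts_eq_insert : π.parts = insert p.1.1 (insert p.1.2 (SetPart.rest π p)) := by
  rw [SetPart.rest, insert_erase, insert_erase p.2.1]
  exact mem_erase.2 ⟨(SetPart.ne π p).symm, p.2.2.1⟩

lemma two_le_card_of_pair (p : π.pairs) : 2 ≤ π.parts.card := by
  rw [parts_eq_insert p, card_insert_of_notMem, card_insert_of_notMem]
  · omega
  · simp [SetPart.rest]
  · simp [SetPart.rest, SetPart.ne π p]

variable {f t₁ t₂} (hf : ∀ b ∈ SetPart.rest π p, f b ∈ BT E b) (h₁ : t₁ ∈ BT E p.1.1)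
  (h₂ : t₂ ∈ BT E p.1.2)
include hf h₁ h₂

lemma updPair_mem : ∀ b ∈ π.parts, updPair p f t₁ t₂ b ∈ BT E b := by
  intro b hb
  rw [parts_eq_insert p] at hb
  rcases mem_insert.1 hb with rfl | hb
  · rwa [updPair_fst]
  rcases mem_insert.1 hb with rfl | hb
  · rwa [updPair_snd]
  · rw [updPair_of_mem p f t₁ t₂ hb]; exact hf b hb

lemma edgeTerm_eq (Ψ : Q.cobar 𝕌) (hm : 2 ≤ (SetPart.merge π p).parts.card)
    {φ : Q.Args (SetPart.merge π p) → Q.P (SetPart.merge π p).parts} (hφ : Q.IsKForm _ φ) :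
    edgeTerm Ψ (SetPart.merge π p) φ (p.1.1 ∪ p.1.2)
        (update f (p.1.1 ∪ p.1.2) (graft E (p.1.1 ∪ p.1.2) p.1.1 p.1.2 i t₁ t₂))
      = (splitG (isPart_setPart (two_le_card_of_pair p)) Ψ).1 (trSt (updPair p f t₁ t₂))
        (SetPart.sign π p • Q.splitBlock π p (E.X i)
          (φ (Q.mergeArgs π p (E.Ξ i) (trArgs π (updPair p f t₁ t₂))))) := by
  have hP : IsPart univ (insert (p.1.1 ∪ p.1.2) (SetPart.rest π p)) := isPart_setPart hm
  have hbR := SetPart.union_notMem_rest π p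
  have hp := mem_splits_pair p
  have hS := parts_eq_insert p
  have hgood := trSt_good E (updPair_mem E p hf h₁ h₂)
  set s := trSt (updPair p f t₁ t₂) with hs
  have hgood' : Q.Good (insert p.1.1 (insert p.1.2 (SetPart.rest π p))) s := by rwa [← hS]
  have hs1 : s p.1.1 = t₁.2 := by rw [hs, trSt, updPair_fst]
  have hs2 : s p.1.2 = t₂.2 := by rw [hs, trSt, updPair_snd]
  set b := p.1.1 ∪ p.1.2 with hb
  set R := SetPart.rest π p with hR
  set s₁ := update s b (rootSt b p.1.1 p.1.2 (E.X i) (s p.1.1) (s p.1.2)) with hs1'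
  have hagree : ∀ c ∈ insert b R,
      trSt (update f b (graft E b p.1.1 p.1.2 i t₁ t₂)) c = s₁ c := by
    intro c hc
    rw [trSt_update]
    by_cases h : c = b
    · subst h
      rw [hs1', update_self, update_self, hs1, hs2]
      rfl
    · rw [hs1', update_of_ne h, update_of_ne h, hs, trSt, trSt,
        updPair_of_mem p f t₁ t₂ ((mem_insert.1 hc).resolve_left h)]
  have hφy := map_trArgs_graft E p f t₁ t₂ i hφ
    (trArgs (SetPart.merge π p) (update f b (graft E b p.1.1 p.1.2 i t₁ t₂)))
    (by simp only [trArgs]; rw [update_self])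
    (fun c hc => by rw [trArgs, update_of_ne hc])
  rw [edgeTerm, hφy]
  set x := φ (Q.mergeArgs π p (E.Ξ i) (trArgs π (updPair p f t₁ t₂))) with hx
  set σ := sgn (shx {p.1.1, p.1.2} (edg (pairSt p.1.1 t₁.2 t₂.2))) with hσ
  change (sgn (shx (insert b R) _) * (-1) ^ inv b (eA univ (jV univ (insert b R) _))) •
    Ψ.1 ((jV univ (insert b R) _).erase b) (Q.ctr (jV univ (insert b R) _) b
      (jm univ (insert b R) _ _)) = _
  rw [jV_congr hagree, jm_congr hagree, shx_congr (E' := edg s₁) fun c hc => by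
      rw [edg, edg, hagree c hc], jV_rootSt hP hbR hp hgood' (E.X i),
    ctr_rootSt hP hbR hp hgood' (E.X i) (σ • x).2,
    sign_rootSt hP hbR hp hgood' (E.X i) fun a ha => even_card_eA
      (BT_spec E a _ (updPair_mem E p hf h₁ h₂ a (by rwa [hS]))).1.1
      (BT_spec E a _ (updPair_mem E p hf h₁ h₂ a (by rwa [hS]))).2]
  rw [hs1, hs2, ← hσ, ← mul_assoc, mul_smul, ← hS]
  have h3 := splitG_apply (isPart_setPart (two_le_card_of_pair p)) Ψ hgood
    (Q.splitBlock π p (E.X i) (σ • x))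
  have h4 : Q.splitBlock π p (E.X i) (σ • x) = σ • Q.splitBlock π p (E.X i) x :=
    Subtype.ext (map_zsmul (Q.plug _ _) σ x.1)
  have h5 : σ * σ = 1 := sgn_mul_self _
  refine (congrArg (_ • ·) h3.symm).trans ?_
  rw [h4, map_zsmul, map_zsmul, smul_smul, mul_comm σ, mul_assoc, h5, mul_one]
  rfl

lemma topTerm_eq (Ψ : Q.cobar 𝕌) (hm : (SetPart.merge π p).parts.card < 2)
    {φ : Q.Args (SetPart.merge π p) → Q.P (SetPart.merge π p).parts} (hφ : Q.IsKForm _ φ) :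
    Q.coef (φ (argTop _ (graft E univ p.1.1 p.1.2 i t₁ t₂).1)).1
        * Ψ.1 (graft E univ p.1.1 p.1.2 i t₁ t₂).2.1
          (graft E univ p.1.1 p.1.2 i t₁ t₂).2.2
      = (splitG (isPart_setPart (two_le_card_of_pair p)) Ψ).1 (trSt (updPair p f t₁ t₂))
        (SetPart.sign π p • Q.splitBlock π p (E.X i)
          (φ (Q.mergeArgs π p (E.Ξ i) (trArgs π (updPair p f t₁ t₂))))) := by
  have hu : p.1.1 ∪ p.1.2 = univ := parts_eq_univ hm (union_mem_merge p)
  have hp := mem_splits_pair p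
  rw [hu] at hp
  have hR : SetPart.rest π p = ∅ := by
    rw [rest_eq p, ← card_eq_zero, card_erase_of_mem (union_mem_merge p)]
    omega
  have hS := parts_eq_insert p
  rw [hR] at hS
  have hmp : (SetPart.merge π p).parts = {univ} := by rw [SetPart.merge_parts, hR, hu]; rfl
  have hgood := trSt_good E (updPair_mem E p hf h₁ h₂)
  set s := trSt (updPair p f t₁ t₂) with hs
  have hs1 : s p.1.1 = t₁.2 := by rw [hs, trSt, updPair_fst]
  have hs2 : s p.1.2 = t₂.2 := by rw [hs, trSt, updPair_snd]
  have hagree : ∀ c ∈ ({p.1.1, p.1.2} : 𝓕 N), pairSt p.1.1 t₁.2 t₂.2 c = s c := by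
    intro c hc
    rcases mem_insert.1 hc with rfl | hc
    · rw [hs1]; simp [pairSt]
    · rw [mem_singleton.1 hc, hs2, pairSt, if_neg (SetPart.ne π p).symm]
  have hφy := map_trArgs_graft E p f t₁ t₂ i hφ
    (argTop _ (graft E univ p.1.1 p.1.2 i t₁ t₂).1)
    (by
      rw [argTop, dif_pos hu]
      change ((graft E univ p.1.1 p.1.2 i t₁ t₂).1 : Q.dual.Alg (Fin N)) = _
      rw [coe_graft_fst E hp, coe_graft_fst E (mem_splits_pair p)])
    (fun c hc => absurd (card_le_one.1 (by omega) _ c.2 _ (union_mem_merge p)) hc)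
  rw [hφy]
  set x := φ (Q.mergeArgs π p (E.Ξ i) (trArgs π (updPair p f t₁ t₂))) with hx
  obtain ⟨c, hc⟩ := Q.mem_P_singleton.1 (show x.1 ∈ Q.P {univ} from hmp ▸ x.2)
  have hsign : SetPart.sign π p = 1 := by rw [SetPart.sign, hR]; simp [inv]
  have hnode : Q.node (E.X i) (Q.var p.1.1) (Q.var p.1.2) ∈ Q.P π.parts := by
    exact Q.mem_P_of_eq (hS.trans rfl) (node_var_mem (SetPart.ne π p) _)
  have h4 : Q.splitBlock π p (E.X i) x = c • (⟨_, hnode⟩ : Q.P π.parts) := by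
    refine Subtype.ext ?_
    change Q.plug _ _ x.1 = c • _
    rw [hc, plug_smulK, hu, plug_eq, subst_var, update_self]
    rfl
  have h3 := splitG_apply (isPart_setPart (two_le_card_of_pair p)) Ψ hgood ⟨_, hnode⟩
  rw [hsign, one_smul, h4, map_smul]
  refine Eq.trans ?_ (congrArg (c • ·) h3.symm)
  change _ * Ψ.1 (jV _ _ _) (jm _ _ _ _) = _
  have hcoef : Q.coef ((sgn (shx {p.1.1, p.1.2} (edg (pairSt p.1.1 t₁.2 t₂.2))) • x :
      Q.P (SetPart.merge π p).parts) : Q.Alg (Block N))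
      = sgn (shx {p.1.1, p.1.2} (edg (pairSt p.1.1 t₁.2 t₂.2))) • c := by
    refine (map_zsmul Q.coef _ x.1).trans ?_
    rw [hc, coef_smul_var]
  rw [hcoef, jV_congr hagree, jm_congr hagree, shx_congr (E' := edg s) fun c hc => by
      rw [edg, edg, hagree c hc]]
  have h7 := congrArg (fun S : 𝓕 N => c • (sgn (shx S (edg s)) • Ψ.1 (jV univ S s)
    (jm univ S s (Q.node (E.X i) (Q.var p.1.1) (Q.var p.1.2))))) hS
  refine Eq.trans ?_ h7.symm
  simp only [smul_eq_mul, zsmul_eq_mul, insert_empty_eq]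
  have h6 := (Int.cast_commute (sgn (shx {p.1.1, p.1.2} (edg s))) c).eq
  rw [h6, mul_assoc]

end Term

lemma koszulD_of_card_lt (E : Q.DualBasis) (φ : Q.KCochain N)
    (h : π.parts.card < 2) : Q.koszulD E φ π = 0 := by
  have : IsEmpty π.pairs := ⟨fun p => absurd (two_le_card_of_pair p) (by omega)⟩
  exact funext fun y => Fintype.sum_empty _

lemma pair_zero_koszulD (E : Q.DualBasis) (Ψ : Q.cobar 𝕌) (φ : Q.KCochain N) :
    pair E Ψ 0 (Q.koszulD E φ) = ∑ π : SetPart N, ∑ p : π.pairs, ∑ i,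
      psum E (SetPart.rest π p) fun f => bsum E p.1.1 fun t₁ => bsum E p.1.2 fun t₂ =>
        (splitG (isPart_setPart (two_le_card_of_pair p)) Ψ).1 (trSt (updPair p f t₁ t₂))
          (SetPart.sign π p • Q.splitBlock π p (E.X i) (φ (SetPart.merge π p)
            (Q.mergeArgs π p (E.Ξ i) (trArgs π (updPair p f t₁ t₂))))) := by
  refine sum_congr rfl fun π _ => ?_
  split_ifs with h
  · change (psum E π.parts fun f => (splitG (isPart_setPart h) Ψ).1 (trSt f)
      (∑ p : π.pairs, SetPart.sign π p • ∑ i, Q.splitBlock π p (E.X i) (φ (SetPart.merge π p)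
        (Q.mergeArgs π p (E.Ξ i) (trArgs π f))))) = _
    simp only [smul_sum, map_sum, psum_sum]
    refine sum_congr rfl fun p _ => sum_congr rfl fun i _ => ?_
    rw [psum_of_mem E p.2.1, psum_of_mem E (mem_erase.2 ⟨(SetPart.ne π p).symm, p.2.2.1⟩)]
    refine psum_congr E fun f _ => ?_
    rw [bsum_comm]
    rfl
  · have : IsEmpty π.pairs := ⟨fun p => h (two_le_card_of_pair p)⟩
    rw [Fintype.sum_empty, koszulD_of_card_lt E φ (by omega)]
    exact map_zero _

/-- The pairing is a morphism of complexes. -/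
lemma pair_δc (E : Q.DualBasis) (B : ∀ b : Block N, Q.Frame b) [IsSemisimpleRing K] (hN : 2 ≤ N)
    (hγ : ∀ b : Block N, b.Nonempty → b ≠ univ → γc E b ∘ₗ Q.δc b = 0)
    (Ψ : Q.cobar 𝕌) {φ : Q.KCochain N} (hφ : ∀ π, Q.IsKForm π (φ π)) :
    pair E (Q.δc _ Ψ) (γc E _ Ψ) φ = pair E Ψ 0 (Q.koszulD E φ) := by
  have h1 : pair E (Q.δc _ Ψ) (γc E _ Ψ) φ
      = ∑ π : SetPart N, ∑ b ∈ π.parts, ∑ p ∈ splits b, ∑ i,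
        if 2 ≤ π.parts.card then
          psum E (π.parts.erase b) fun f => bsum E p.1 fun t₁ => bsum E p.2 fun t₂ =>
            edgeTerm Ψ π (φ π) b (update f b (graft E b p.1 p.2 i t₁ t₂))
        else bsum E p.1 fun t₁ => bsum E p.2 fun t₂ =>
          Q.coef (φ π (argTop π (graft E univ p.1 p.2 i t₁ t₂).1)).1
            * Ψ.1 (graft E univ p.1 p.2 i t₁ t₂).2.1
              (graft E univ p.1 p.2 i t₁ t₂).2.2 := by
    refine sum_congr rfl fun π _ => ?_
    split_ifs with h
    · exact rS_splitG_δc E B hγ Ψ h (hφ π)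
    · have h' : π.parts.card < 2 := by omega
      obtain ⟨x⟩ : Nonempty (Fin N) := ⟨⟨0, by omega⟩⟩
      obtain ⟨b, ⟨hb, -⟩, -⟩ := π.existsUnique_mem (mem_univ x)
      have hbu := parts_eq_univ h' hb
      have hparts : π.parts = {univ} := eq_singleton_iff_unique_mem.2
        ⟨hbu ▸ hb, fun c hc => parts_eq_univ h' hc⟩
      have h2 := coef_γc E Ψ (by simpa using hN) h' hb (hφ π)
      rw [h2, show ∀ g : Block N → K, ∑ b ∈ π.parts, g b = g univ from fun g => by
        rw [hparts, sum_singleton]]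
  rw [h1, pair_zero_koszulD, sum_pairs fun π b p => ∑ i,
        if 2 ≤ π.parts.card then
          psum E (π.parts.erase b) fun f => bsum E p.1 fun t₁ => bsum E p.2 fun t₂ =>
            edgeTerm Ψ π (φ π) b (update f b (graft E b p.1 p.2 i t₁ t₂))
        else bsum E p.1 fun t₁ => bsum E p.2 fun t₂ =>
          Q.coef (φ π (argTop π (graft E univ p.1 p.2 i t₁ t₂).1)).1
            * Ψ.1 (graft E univ p.1 p.2 i t₁ t₂).2.1
              (graft E univ p.1 p.2 i t₁ t₂).2.2]
  refine sum_congr rfl fun π _ => sum_congr rfl fun p _ =>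
    sum_congr rfl fun i _ => ?_
  split_ifs with h
  · rw [← rest_eq p]
    exact psum_congr E fun f hf => bsum_congr E fun t₁ h₁ => bsum_congr E fun t₂ h₂ =>
      edgeTerm_eq E p i hf h₁ h₂ Ψ h (hφ _)
  · have hR : SetPart.rest π p = ∅ := by
      rw [rest_eq p, ← card_eq_zero, card_erase_of_mem (union_mem_merge p)]
      omega
    rw [hR, psum_empty]
    exact bsum_congr E fun t₁ h₁ => bsum_congr E fun t₂ h₂ =>
      topTerm_eq E p i (f := leafTr) (by simp [hR]) h₁ h₂ Ψ (by omega) (hφ _)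

end QuadraticData

namespace QuadraticData

/-! ### The complex of K-forms -/

lemma DualBasis.expand (E : Q.DualBasis) (ξ : Q.dual.E) :
    ∑ i, op ((show Q.EDual from ξ) (E.X i)) • E.Ξ i = ξ := by
  refine LinearMap.ext fun e => ?_
  refine Eq.trans ?_ (congrArg (show Q.EDual from ξ) (E.sum_eq e))
  refine Eq.trans ?_ (map_sum (show Q.EDual from ξ) _ _).symm
  refine (LinearMap.sum_apply _ _ _).trans (sum_congr rfl fun i _ => ?_)
  exact (map_smul (show Q.EDual from ξ) _ _).symm

/-- The canonical element ∑ Ξ_i ⊗ X_i is compatible with each K-linear endomorphism of E. -/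
lemma DualBasis.exchange (E : Q.DualBasis) {M : Type*} [AddCommGroup M]
    (T : Q.dual.E →+ Q.E →+ M) (hT : ∀ (c : K) ξ e, T (op c • ξ) e = T ξ (c • e))
    (r : Q.E →ₗ[K] Q.E) :
    ∑ i, T (show Q.EDual from (show Q.EDual from E.Ξ i) ∘ₗ r) (E.X i)
      = ∑ i, T (E.Ξ i) (r (E.X i)) := by
  have h1 : ∀ i, T (show Q.EDual from (show Q.EDual from E.Ξ i) ∘ₗ r) (E.X i)
      = ∑ j, T (E.Ξ j) ((show Q.EDual from E.Ξ i) (r (E.X j)) • E.X i) := by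
    intro i
    rw [← E.expand (show Q.EDual from (show Q.EDual from E.Ξ i) ∘ₗ r), map_sum,
      AddMonoidHom.finsetSum_apply]
    exact sum_congr rfl fun j _ => hT _ _ _
  rw [sum_congr rfl fun i _ => h1 i, sum_comm]
  refine sum_congr rfl fun j _ => ?_
  rw [← map_sum, E.sum_eq]

section Preserve

variable (p : π.pairs)

lemma splitBlock_ract_of_ne (e : Q.E) (hb₁ : b ≠ p.1.1) (hb₂ : b ≠ p.1.2)
    (hb : b ≠ p.1.1 ∪ p.1.2) (a : K) (x : Q.P (SetPart.merge π p).parts) :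
    Q.splitBlock π p e (Q.ractP _ b a x) = Q.ractP _ b a (Q.splitBlock π p e x) := by
  refine Subtype.ext ?_
  change Q.plug _ _ (Q.ract b a x.1) = Q.ract b a (Q.plug _ _ x.1)
  simp only [ract_eq, ractm, plug_eq, subst_subst]
  congr 2
  funext c
  rw [subst_smulK, subst_var]
  by_cases hc : c = p.1.1 ∪ p.1.2
  · subst hc
    simp only [update_self, update_of_ne hb.symm, Pi.one_apply, one_smul,
      subst_node, subst_var, update_of_ne hb₁.symm, update_of_ne hb₂.symm]
  · simp only [update_of_ne hc, subst_var]

lemma ract_splitBlock_fst (e : Q.E) (a : K) (x : Q.P (SetPart.merge π p).parts) :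
    Q.ractP _ p.1.1 a (Q.splitBlock π p e x) = Q.splitBlock π p (Q.r₁ (op a) e) x := by
  refine Subtype.ext ?_
  change Q.ract _ a (Q.plug _ _ x.1) = Q.plug _ _ x.1
  simp only [ract_eq, ractm, plug_eq, subst_subst]
  refine Q.subst_congr x.2 fun c hc => ?_
  by_cases h : c = p.1.1 ∪ p.1.2
  · subst h
    simp only [update_self, subst_node, subst_var, update_of_ne (SetPart.ne π p).symm,
      Pi.one_apply, one_smul, node_smul_left]
  · have : c ≠ p.1.1 := by
      rintro rfl
      have h1 := (mem_insert.1 hc).resolve_left h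
      simp [SetPart.rest] at h1
    simp [h, this, subst_var]

lemma ract_splitBlock_snd (e : Q.E) (a : K) (x : Q.P (SetPart.merge π p).parts) :
    Q.ractP _ p.1.2 a (Q.splitBlock π p e x) = Q.splitBlock π p (Q.r₂ (op a) e) x := by
  refine Subtype.ext ?_
  change Q.ract _ a (Q.plug _ _ x.1) = Q.plug _ _ x.1
  simp only [ract_eq, ractm, plug_eq, subst_subst]
  refine Q.subst_congr x.2 fun c hc => ?_
  by_cases h : c = p.1.1 ∪ p.1.2
  · subst h
    simp only [update_self, subst_node, subst_var, update_of_ne (SetPart.ne π p),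
      Pi.one_apply, one_smul, node_smul_right]
  · have : c ≠ p.1.2 := by
      rintro rfl
      have h1 := (mem_insert.1 hc).resolve_left h
      simp [SetPart.rest] at h1
    simp [h, this, subst_var]

lemma splitBlock_ract_union (e : Q.E) (c : K) (x : Q.P (SetPart.merge π p).parts) :
    Q.splitBlock π p e (Q.ractP _ (p.1.1 ∪ p.1.2) c x) = Q.splitBlock π p (c • e) x := by
  refine Subtype.ext ?_
  change Q.plug _ _ (Q.ract _ c x.1) = Q.plug _ _ x.1
  rw [← plug_smul_eq_ract, smul_node]

lemma splitBlock_smulK (e : Q.E) (c : K) (x : Q.P (SetPart.merge π p).parts) :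
    Q.splitBlock π p e (c • x) = c • Q.splitBlock π p e x :=
  Subtype.ext (Q.plug_smulK _ _ _ _)

lemma splitBlock_add_left (e e' : Q.E) (x : Q.P (SetPart.merge π p).parts) :
    Q.splitBlock π p (e + e') x = Q.splitBlock π p e x + Q.splitBlock π p e' x := by
  refine Subtype.ext ?_
  change Q.plug _ _ x.1 = Q.plug _ _ x.1 + Q.plug _ _ x.1
  rw [← Q.plug_add (union_mem_merge p) x.2, Q.node_add]
  rfl

/-- The composite ξ(x1, x2) of elements of P^! of the blocks of a pair. -/
def nodeP (ξ : Q.dual.E) (x1 : Q.dual.P p.1.1) (x2 : Q.dual.P p.1.2) : Q.dual.P (p.1.1 ∪ p.1.2) :=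
  ⟨Q.dual.node ξ x1 x2, node_mem_split (mem_splits_pair p) ξ x1 x2⟩

lemma nodeP_add (ξ ξ' : Q.dual.E) (x1 : Q.dual.P p.1.1) (x2 : Q.dual.P p.1.2) :
    nodeP p (ξ + ξ') x1 x2 = nodeP p ξ x1 x2 + nodeP p ξ' x1 x2 :=
  Subtype.ext (LinearMap.congr_fun (LinearMap.congr_fun (Q.dual.node_add ξ ξ') x1.1) x2.1)

lemma nodeP_add_left (ξ : Q.dual.E) (x x' : Q.dual.P p.1.1) (x2 : Q.dual.P p.1.2) :
    nodeP p ξ (x + x') x2 = nodeP p ξ x x2 + nodeP p ξ x' x2 :=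
  Subtype.ext (LinearMap.congr_fun (map_add (Q.dual.node ξ) x.1 x'.1) x2.1)

lemma nodeP_add_right (ξ : Q.dual.E) (x1 : Q.dual.P p.1.1) (x x' : Q.dual.P p.1.2) :
    nodeP p ξ x1 (x + x') = nodeP p ξ x1 x + nodeP p ξ x1 x' :=
  Subtype.ext (map_add (Q.dual.node ξ x1.1) x.1 x'.1)

lemma nodeP_smul_left (a : Kᵐᵒᵖ) (ξ : Q.dual.E) (x1 : Q.dual.P p.1.1) (x2 : Q.dual.P p.1.2) :
    nodeP p ξ (a • x1) x2 = nodeP p (Q.dual.r₁ (op a) ξ) x1 x2 :=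
  Subtype.ext (Q.dual.node_smul_left a ξ x1.1 x2.1)

lemma nodeP_smul_right (a : Kᵐᵒᵖ) (ξ : Q.dual.E) (x1 : Q.dual.P p.1.1) (x2 : Q.dual.P p.1.2) :
    nodeP p ξ x1 (a • x2) = nodeP p (Q.dual.r₂ (op a) ξ) x1 x2 :=
  Subtype.ext (Q.dual.node_smul_right a ξ x1.1 x2.1)

lemma mergeArgs_update_of_ne (ξ : Q.dual.E) (y : Q.Args π) (b : π.parts) (hb₁ : b.1 ≠ p.1.1)
    (hb₂ : b.1 ≠ p.1.2) (hb : b.1 ∈ (SetPart.merge π p).parts) (x : Q.dual.P b.1) :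
    Q.mergeArgs π p ξ (update y b x)
      = update (Q.mergeArgs π p ξ y) ⟨b.1, hb⟩ x := by
  have hu : b.1 ≠ p.1.1 ∪ p.1.2 := by
    rintro h
    obtain ⟨x, hx⟩ := π.nonempty_of_mem_parts p.2.1
    exact hb₁ (π.eq_of_mem_parts b.2 p.2.1 (h ▸ mem_union_left _ hx) hx)
  have h1 : ∀ (c : Block N) (hc : c ∈ π.parts), c ≠ b.1 → (⟨c, hc⟩ : π.parts) ≠ b :=
    fun c hc h h' => h (congrArg Subtype.val h')
  funext c
  by_cases hc : c = ⟨b.1, hb⟩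
  · subst hc
    rw [update_self]
    simp only [mergeArgs, dif_neg hu]
    exact update_self _ _ _
  · have hc' : c.1 ≠ b.1 := fun h => hc (Subtype.ext h)
    rw [update_of_ne hc]
    by_cases hcu : c.1 = p.1.1 ∪ p.1.2
    · have e₁ := update_of_ne (h1 _ p.2.1 hb₁.symm) x y
      have e₂ := update_of_ne (h1 _ p.2.2.1 hb₂.symm) x y
      simp only [mergeArgs, dif_pos hcu, e₁, e₂]
    · simp only [mergeArgs, dif_neg hcu]
      rw [update_of_ne (h1 _ _ hc')]

lemma mergeArgs_eq (ξ ξ' : Q.dual.E) (y y' : Q.Args π)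
    (h : ∀ b : π.parts, b.1 ≠ p.1.1 → b.1 ≠ p.1.2 → y b = y' b) :
    Q.mergeArgs π p ξ y = update (Q.mergeArgs π p ξ' y') ⟨_, union_mem_merge p⟩
      (nodeP p ξ (y ⟨_, p.2.1⟩) (y ⟨_, p.2.2.1⟩)) := by
  funext c
  by_cases hc : c = ⟨_, union_mem_merge p⟩
  · subst hc
    rw [update_self, mergeArgs, dif_pos rfl]
    rfl
  · have hc' : c.1 ≠ p.1.1 ∪ p.1.2 := fun h => hc (Subtype.ext h)
    rw [update_of_ne hc, mergeArgs, mergeArgs, dif_neg hc', dif_neg hc']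
    have h2 := mem_erase.1 ((mem_insert.1 c.2).resolve_left hc')
    exact h _ (mem_erase.1 h2.2).1 h2.1

/-- The term of the Koszul differential for given operations, and given elements of P^!. -/
def splitTerm {φ : Q.Args (SetPart.merge π p) → Q.P (SetPart.merge π p).parts}
    (hφ : Q.IsKForm _ φ) (z : Q.Args (SetPart.merge π p)) (x1 : Q.dual.P p.1.1)
    (x2 : Q.dual.P p.1.2) : Q.dual.E →+ Q.E →+ Q.P π.parts :=
  AddMonoidHom.mk' (fun ξ => AddMonoidHom.mk' (fun e => Q.splitBlock π p e
    (hφ.hom z ⟨_, union_mem_merge p⟩ (nodeP p ξ x1 x2))) fun e e' => splitBlock_add_left p e e' _)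
    fun ξ ξ' => AddMonoidHom.ext fun e => by
      change Q.splitBlock π p e (hφ.hom z _ _) = Q.splitBlock π p e _ + Q.splitBlock π p e _
      rw [nodeP_add, map_add, splitBlock_add]

lemma splitTerm_smul {φ : Q.Args (SetPart.merge π p) → Q.P (SetPart.merge π p).parts}
    (hφ : Q.IsKForm _ φ) (z : Q.Args (SetPart.merge π p)) (x1 : Q.dual.P p.1.1)
    (x2 : Q.dual.P p.1.2) (c : K) (ξ : Q.dual.E) (e : Q.E) :
    splitTerm p hφ z x1 x2 (op c • ξ) e = splitTerm p hφ z x1 x2 ξ (c • e) := by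
  have h : nodeP p (op c • ξ) x1 x2 = op c • nodeP p ξ x1 x2 :=
    Subtype.ext (Q.dual.smul_node (op c) ξ _ _).symm
  change Q.splitBlock π p e (hφ.hom z _ _) = Q.splitBlock π p (c • e) _
  rw [h, hφ.hom_smul, splitBlock_ract_union]

lemma sum_splitBlock_eq (E : Q.DualBasis)
    {φ : Q.Args (SetPart.merge π p) → Q.P (SetPart.merge π p).parts}
    (hφ : Q.IsKForm _ φ) (ξ' : Q.dual.E) (y y' : Q.Args π)
    (h : ∀ b : π.parts, b.1 ≠ p.1.1 → b.1 ≠ p.1.2 → y b = y' b) :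
    ∑ i, Q.splitBlock π p (E.X i) (φ (Q.mergeArgs π p (E.Ξ i) y))
      = ∑ i, splitTerm p hφ (Q.mergeArgs π p ξ' y') (y ⟨_, p.2.1⟩) (y ⟨_, p.2.2.1⟩)
        (E.Ξ i) (E.X i) := by
  refine sum_congr rfl fun i _ => ?_
  rw [mergeArgs_eq p (E.Ξ i) ξ' y y' h]
  rfl

/-- The terms of the Koszul differential are K-forms: linearity over K in the two new blocks is
the invariance of ∑ X_i ⊗ Ξ_i. -/
lemma isKForm_splitSum (E : Q.DualBasis)
    {φ : Q.Args (SetPart.merge π p) → Q.P (SetPart.merge π p).parts} (hφ : Q.IsKForm _ φ) :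
    Q.IsKForm π fun y => ∑ i, Q.splitBlock π p (E.X i) (φ (Q.mergeArgs π p (E.Ξ i) y)) := by
  have hne1 : (⟨_, p.2.1⟩ : π.parts) ≠ ⟨_, p.2.2.1⟩ := fun h =>
    SetPart.ne π p (congrArg Subtype.val h)
  have hmem : ∀ b : π.parts, b.1 ≠ p.1.1 → b.1 ≠ p.1.2 → b.1 ∈ (SetPart.merge π p).parts :=
    fun b h1 h2 => mem_insert_of_mem (mem_erase.2 ⟨h2, mem_erase.2 ⟨h1, b.2⟩⟩)
  have hoff1 : ∀ (y : Q.Args π) x, ∀ b : π.parts, b.1 ≠ p.1.1 → b.1 ≠ p.1.2 →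
      update y ⟨_, p.2.1⟩ x b = y b :=
    fun y x b hb _ => update_of_ne (fun h => hb (congrArg Subtype.val h)) _ _
  have hoff2 : ∀ (y : Q.Args π) x, ∀ b : π.parts, b.1 ≠ p.1.1 → b.1 ≠ p.1.2 →
      update y ⟨_, p.2.2.1⟩ x b = y b :=
    fun y x b _ hb => update_of_ne (fun h => hb (congrArg Subtype.val h)) _ _
  have e₁ := fun (y : Q.Args π) x => sum_splitBlock_eq p E hφ 0 (update y ⟨_, p.2.1⟩ x) y
    (hoff1 y x)
  have e₂ := fun (y : Q.Args π) x => sum_splitBlock_eq p E hφ 0 (update y ⟨_, p.2.2.1⟩ x) y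
    (hoff2 y x)
  simp only [update_self, update_of_ne hne1, update_of_ne hne1.symm]
    at e₁ e₂
  refine isKForm_of (fun y b x x' => ?_) fun y b a x => ?_
  · rw [← sum_add_distrib]
    by_cases h1 : b.1 = p.1.1
    · obtain rfl : b = ⟨_, p.2.1⟩ := Subtype.ext h1
      rw [sum_add_distrib, e₁, e₁, e₁, ← sum_add_distrib]
      refine sum_congr rfl fun i _ => ?_
      change Q.splitBlock π p _ (hφ.hom _ _ _) = Q.splitBlock π p _ _ + Q.splitBlock π p _ _
      rw [nodeP_add_left, map_add, splitBlock_add]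
    by_cases h2 : b.1 = p.1.2
    · obtain rfl : b = ⟨_, p.2.2.1⟩ := Subtype.ext h2
      rw [sum_add_distrib, e₂, e₂, e₂, ← sum_add_distrib]
      refine sum_congr rfl fun i _ => ?_
      change Q.splitBlock π p _ (hφ.hom _ _ _) = Q.splitBlock π p _ _ + Q.splitBlock π p _ _
      rw [nodeP_add_right, map_add, splitBlock_add]
    · refine sum_congr rfl fun i _ => ?_
      simp only [mergeArgs_update_of_ne p _ _ b h1 h2 (hmem b h1 h2)]
      rw [← splitBlock_add]
      exact congrArg _ (hφ.map_add _ ⟨b.1, hmem b h1 h2⟩ x x')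
  · by_cases h1 : b.1 = p.1.1
    · obtain rfl : b = ⟨_, p.2.1⟩ := Subtype.ext h1
      rw [e₁, e₁, map_sum]
      have h : ∀ i, splitTerm p hφ (Q.mergeArgs π p 0 y) (op a • x) (y ⟨_, p.2.2.1⟩) (E.Ξ i) (E.X i)
          = splitTerm p hφ (Q.mergeArgs π p 0 y) x (y ⟨_, p.2.2.1⟩)
            (show Q.EDual from (show Q.EDual from E.Ξ i) ∘ₗ Q.r₁ (op a)) (E.X i) := fun i =>
        congrArg (fun z => Q.splitBlock π p (E.X i) (hφ.hom _ ⟨_, union_mem_merge p⟩ z))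
          (nodeP_smul_left p (op a) (E.Ξ i) x _)
      rw [sum_congr rfl fun i _ => h i,
        E.exchange _ (fun c ξ e => splitTerm_smul p hφ _ _ _ c ξ e)]
      exact sum_congr rfl fun i _ => (ract_splitBlock_fst p _ a _).symm
    by_cases h2 : b.1 = p.1.2
    · obtain rfl : b = ⟨_, p.2.2.1⟩ := Subtype.ext h2
      rw [e₂, e₂, map_sum]
      have h : ∀ i, splitTerm p hφ (Q.mergeArgs π p 0 y) (y ⟨_, p.2.1⟩) (op a • x) (E.Ξ i) (E.X i)
          = splitTerm p hφ (Q.mergeArgs π p 0 y) (y ⟨_, p.2.1⟩) x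
            (show Q.EDual from (show Q.EDual from E.Ξ i) ∘ₗ Q.r₂ (op a)) (E.X i) := fun i =>
        congrArg (fun z => Q.splitBlock π p (E.X i) (hφ.hom _ ⟨_, union_mem_merge p⟩ z))
          (nodeP_smul_right p (op a) (E.Ξ i) _ x)
      rw [sum_congr rfl fun i _ => h i,
        E.exchange _ (fun c ξ e => splitTerm_smul p hφ _ _ _ c ξ e)]
      exact sum_congr rfl fun i _ => (ract_splitBlock_snd p _ a _).symm
    · rw [map_sum]
      refine sum_congr rfl fun i _ => ?_
      have hu : b.1 ≠ p.1.1 ∪ p.1.2 := fun h => by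
        obtain ⟨x, hx⟩ := π.nonempty_of_mem_parts p.2.1
        exact h1 (π.eq_of_mem_parts b.2 p.2.1 (h ▸ mem_union_left _ hx) hx)
      simp only [mergeArgs_update_of_ne p _ _ b h1 h2 (hmem b h1 h2)]
      rw [← splitBlock_ract_of_ne p _ h1 h2 hu]
      exact congrArg _ (hφ.hom_smul _ ⟨b.1, hmem b h1 h2⟩ a x)

end Preserve

lemma IsKForm.zero (π : SetPart N) : Q.IsKForm π 0 := ⟨by simp, by simp, by simp⟩

lemma IsKForm.smulK (hφ : Q.IsKForm π φ) (c : K) :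
    Q.IsKForm π (c • φ) := by
  refine isKForm_of (fun y b x x' => ?_) fun y b a x => ?_
  · simp only [Pi.smul_apply, hφ.map_add, smul_add]
  · simp only [Pi.smul_apply]
    rw [ractP_smul]
    exact congrArg _ (hφ.hom_smul y b a x)

lemma IsKForm.sum {ι : Type*} (t : Finset ι) {φ : ι → Q.Args π → Q.P π.parts}
    (hφ : ∀ i ∈ t, Q.IsKForm π (φ i)) : Q.IsKForm π (∑ i ∈ t, φ i) := by
  classical
  induction t using Finset.induction_on with
  | empty => rw [sum_empty]; exact IsKForm.zero π
  | insert i t hi ih =>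
    rw [sum_insert hi]
    exact (hφ i (mem_insert_self _ _)).add _
      (ih fun j hj => hφ j (mem_insert_of_mem hj))

lemma IsKForm.zsmul (hφ : Q.IsKForm π φ) (n : ℤ) :
    Q.IsKForm π (n • φ) := by
  have h : n • φ = (n : K) • φ := (Int.cast_smul_eq_zsmul K n φ).symm
  rw [h]
  exact hφ.smulK _

lemma isKForm_koszulD (E : Q.DualBasis) {φ : Q.KCochain N} (hφ : ∀ π, Q.IsKForm π (φ π))
    (π : SetPart N) : Q.IsKForm π (Q.koszulD E φ π) := by
  have h : Q.koszulD E φ π = ∑ p : π.pairs, SetPart.sign π p • fun y => ∑ i,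
      Q.splitBlock π p (E.X i) (φ (SetPart.merge π p) (Q.mergeArgs π p (E.Ξ i) y)) := by
    funext y
    rw [Finset.sum_apply]
    rfl
  rw [h]
  exact IsKForm.sum _ fun p _ => (isKForm_splitSum p E (hφ _)).zsmul _

lemma koszulD_smul (E : Q.DualBasis) (c : K) (φ : Q.KCochain N) :
    Q.koszulD E (c • φ) = c • Q.koszulD E φ := by
  funext π y
  change ∑ p : π.pairs, (_ : Q.P π.parts) = c • ∑ p : π.pairs, (_ : Q.P π.parts)
  rw [smul_sum]
  refine sum_congr rfl fun p _ => ?_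
  rw [smul_comm c]
  congr 1
  rw [smul_sum]
  exact sum_congr rfl fun i _ => splitBlock_smulK (Q := Q) p _ c _

end QuadraticData

section Duality

variable {K C W : Type*} [Ring K] [IsSemisimpleRing K] [AddCommGroup C] [AddCommGroup W] [Module K W]

lemma exists_functional_ne_zero (w : W) (hw : w ≠ 0) : ∃ f : W →ₗ[K] K, f w ≠ 0 := by
  have : Module.Projective K W := Module.projective_of_isSemisimpleRing K W
  by_contra! h
  exact hw ((Module.forall_dual_apply_eq_zero_iff K w).1 h)

lemma exists_comp_eq_of_ker_le {d : W →ₗ[K] W} {f : W →ₗ[K] K}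
    (h : LinearMap.ker d ≤ LinearMap.ker f) : ∃ g : W →ₗ[K] K, g ∘ₗ d = f := by
  obtain ⟨g, hg⟩ := IsSemisimpleModule.extension_property ((LinearMap.ker d).liftQ d le_rfl)
    (LinearMap.ker_eq_bot.1 (Submodule.ker_liftQ_eq_bot' _ d rfl)) ((LinearMap.ker d).liftQ f h)
  exact ⟨g, LinearMap.ext fun w => LinearMap.congr_fun hg (Submodule.Quotient.mk w)⟩

/-- A complex that maps onto the dual of another one, with an acyclic kernel, is exact if and only if
the other one is. -/
lemma exact_iff_exact_of_pairing (D : C →+ C) (d : W →ₗ[K] W) (ρ : C →+ (W →ₗ[K] K))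
    (hρ : Function.Surjective ρ) (hD : ∀ x, ρ (D x) = ρ x ∘ₗ d)
    (hker : ∀ x, ρ x = 0 → D x = 0 → ∃ y, ρ y = 0 ∧ D y = x)
    (hDD : ∀ x, ρ (D (D x)) = 0 → D (D x) = 0) :
    (∀ x, D x = 0 ↔ ∃ y, D y = x) ↔ ∀ w, d w = 0 ↔ ∃ w', d w' = w := by
  constructor
  · intro h
    have hdd : ∀ w, d (d w) = 0 := fun w => by
      by_contra hw
      obtain ⟨f, hf⟩ := exists_functional_ne_zero (K := K) _ hw
      obtain ⟨x, rfl⟩ := hρ f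
      refine hf ?_
      change ((ρ x ∘ₗ d) ∘ₗ d) w = 0
      rw [← hD, ← hD, (h _).2 ⟨x, rfl⟩, map_zero, LinearMap.zero_apply]
    refine fun w => ⟨fun hw => ?_, fun ⟨w', hw'⟩ => hw' ▸ hdd w'⟩
    by_contra hw'
    have hne : (LinearMap.range d).mkQ w ≠ 0 := fun h' => hw' (by
      rwa [Submodule.mkQ_apply, Submodule.Quotient.mk_eq_zero] at h')
    obtain ⟨f, hf⟩ := exists_functional_ne_zero (K := K) _ hne
    obtain ⟨x, hx⟩ := hρ (f ∘ₗ (LinearMap.range d).mkQ)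
    have hfd : ρ (D x) = 0 := by
      rw [hD, hx]
      refine LinearMap.ext fun w => ?_
      change f ((LinearMap.range d).mkQ (d w)) = 0
      rw [Submodule.mkQ_apply, (Submodule.Quotient.mk_eq_zero _).2 (LinearMap.mem_range_self d w),
        map_zero]
    obtain ⟨y, hy, hyx⟩ := hker _ hfd ((h _).2 ⟨x, rfl⟩)
    obtain ⟨z, hz⟩ := (h (x - y)).1 (by rw [map_sub, hyx, sub_self])
    refine hf ?_
    change (f ∘ₗ (LinearMap.range d).mkQ) w = 0
    rw [← hx, ← sub_zero (ρ x), ← hy, ← map_sub, ← hz, hD, LinearMap.comp_apply, hw, map_zero]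
  · intro h x
    have hdd : ∀ f : W →ₗ[K] K, (f ∘ₗ d) ∘ₗ d = 0 := fun f => LinearMap.ext fun w => by
      change f (d (d w)) = 0
      rw [(h _).2 ⟨w, rfl⟩, map_zero]
    refine ⟨fun hx => ?_, fun ⟨y, hy⟩ => hy ▸ hDD y (by rw [hD, hD, hdd])⟩
    obtain ⟨g, hg⟩ := exists_comp_eq_of_ker_le (d := d) (f := ρ x) fun w hw => by
      obtain ⟨w', rfl⟩ := (h w).1 hw
      rw [LinearMap.mem_ker, ← LinearMap.comp_apply, ← hD, hx, map_zero, LinearMap.zero_apply]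
    obtain ⟨y, rfl⟩ := hρ g
    have hDDy : D (D y) = 0 := hDD y (by rw [hD, hD, hdd])
    obtain ⟨z, -, hz⟩ := hker (x - D y) (by rw [map_sub, hD, hg, sub_self])
      (by rw [map_sub, hx, hDDy, sub_self])
    exact ⟨y + z, by rw [map_add, hz, add_sub_cancel]⟩

end Duality

lemma setPart_eq_of_card_lt {π π' : SetPart N} (h : π.parts.card < 2) (h' : π'.parts.card < 2) :
    π = π' := by
  refine Finpartition.ext ?_
  rcases N.eq_zero_or_pos with rfl | hN
  · have : ∀ π : SetPart 0, π.parts = ∅ := fun π => eq_empty_of_forall_notMem fun b hb => by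
      obtain ⟨x, -⟩ := π.nonempty_of_mem_parts hb
      exact x.elim0
    rw [this, this]
  · have key : ∀ π : SetPart N, π.parts.card < 2 → π.parts = {univ} := fun π h => by
      obtain ⟨b, ⟨hb, -⟩, -⟩ := π.existsUnique_mem (mem_univ (⟨0, hN⟩ : Fin N))
      exact eq_singleton_iff_unique_mem.2
        ⟨parts_eq_univ h hb ▸ hb, fun c hc => parts_eq_univ h hc⟩
    rw [key π h, key π' h']

namespace QuadraticData

/-! ### The pairing is onto the dual of the complex of K-forms -/

variable (E : Q.DualBasis)

section Collapse

variable (hφ : Q.IsKForm π φ)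
include hφ

lemma IsKForm.map_smul_args (c : Block N → K) (z : Q.Args π) :
    φ (fun b => op (c b.1) • z b) = ⟨Q.ractm c (φ z).1, Q.ractm_mem _ (φ z).2⟩ := by
  have key : ∀ T ⊆ π.parts, φ (fun b => if b.1 ∈ T then op (c b.1) • z b else z b)
      = ⟨Q.ractm (fun b => if b ∈ T then c b else 1) (φ z).1, Q.ractm_mem _ (φ z).2⟩ := by
    intro T
    induction T using Finset.induction_on with
    | empty =>
      intro _
      simp only [notMem_empty, if_false]
      exact Subtype.ext (Q.ractm_one _).symm
    | insert b T hbT ih =>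
      intro hT
      have hb := hT (mem_insert_self b T)
      have h1 := hφ.hom_smul (fun d => if d.1 ∈ T then op (c d.1) • z d else z d) ⟨b, hb⟩ (c b)
        (z ⟨b, hb⟩)
      have h2 : (fun d : π.parts => if d.1 ∈ insert b T then op (c d.1) • z d else z d)
          = update (fun d => if d.1 ∈ T then op (c d.1) • z d else z d) ⟨b, hb⟩
            (op (c b) • z ⟨b, hb⟩) := by grind
      have h3 : update (fun d : π.parts => if d.1 ∈ T then op (c d.1) • z d else z d)
          ⟨b, hb⟩ (z ⟨b, hb⟩) = fun d => if d.1 ∈ T then op (c d.1) • z d else z d := by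
        rw [Function.update_eq_self_iff, if_neg hbT]
      rw [h2]
      refine h1.trans ?_
      change Q.ractP _ b _ (φ (update _ _ _)) = _
      rw [h3, ih ((subset_insert b T).trans hT)]
      refine Subtype.ext ?_
      change Q.ract b _ (Q.ractm _ _) = Q.ractm _ _
      rw [ract_eq, ractm_ractm]
      refine congrArg (fun a => Q.ractm a (φ z).1) (funext fun d => ?_)
      by_cases hd : d = b
      · subst hd; simp [hbT]
      · simp [hd]
  have h1 := key _ subset_rfl
  have h2 : (fun b : π.parts => if b.1 ∈ π.parts then op (c b.1) • z b else z b)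
      = fun b => op (c b.1) • z b := by funext b; rw [if_pos b.2]
  rw [← h2, h1]
  exact Subtype.ext (Q.ractm_congr (φ z).2 fun b hb => if_pos hb)

/-- Sections of the canonical morphisms recover the arguments from the canonical element. -/
lemma psum_section (s0 : ∀ b ∈ π.parts, Q.dual.P b → Q.cobar b)
    (hs : ∀ b hb y, γc E b (s0 b hb y) = y) (y : Q.Args π) :
    (psum E π.parts fun f => φ fun b =>
      op ((s0 b.1 b.2 (y b)).1 (f b.1).2.1 (f b.1).2.2) • (f b.1).1) = φ y := by
  have key : ∀ T ⊆ π.parts, (psum E T fun f => φ fun b => if b.1 ∈ T then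
      op ((s0 b.1 b.2 (y b)).1 (f b.1).2.1 (f b.1).2.2) • (f b.1).1 else y b) = φ y := by
    intro T
    induction T using Finset.induction_on with
    | empty => intro _; rw [psum_empty]; simp
    | insert b T hbT ih =>
      intro hT
      have hb := hT (mem_insert_self b T)
      refine Eq.trans ?_ (ih ((subset_insert b T).trans hT))
      rw [psum_insert E hbT]
      refine psum_congr E fun f _ => ?_
      set z : Q.Args π := fun b => if b.1 ∈ T then
        op ((s0 b.1 b.2 (y b)).1 (f b.1).2.1 (f b.1).2.2) • (f b.1).1 else y b with hz
      have h1 : ∀ t : Q.Tr b, (fun d : π.parts => if d.1 ∈ insert b T then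
          op ((s0 d.1 d.2 (y d)).1 (update f b t d.1).2.1 (update f b t d.1).2.2)
            • (update f b t d.1).1 else y d)
          = update z ⟨b, hb⟩ (op ((s0 b hb (y ⟨b, hb⟩)).1 t.2.1 t.2.2) • t.1) := by grind
      simp only [h1]
      refine (map_bsum E (hφ.hom z ⟨b, hb⟩) _).symm.trans ?_
      have h2 := hs b hb (y ⟨b, hb⟩)
      rw [γc_apply] at h2
      rw [h2]
      change φ (update z _ _) = φ z
      congr 1
      rw [Function.update_eq_self_iff, hz]
      exact (if_neg hbT).symm
  refine Eq.trans ?_ (key _ subset_rfl)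
  congr 1
  funext f
  congr 1
  funext b
  rw [if_pos b.2]

end Collapse

end QuadraticData

namespace QuadraticData

lemma ractm_update_smul {α : Type*} [DecidableEq α] {A : Finset α} {x : Q.Alg α} (hx : x ∈ Q.P A)
    {b : α} (hb : b ∈ A) (a : α → K) (c : k) (d : K) : Q.ractm (update a b (c • d)) x
      = c • Q.ractm (update a b d) x := by
  have key : ∀ d, Q.ractm (update a b d)
      = Q.subst (update (fun b => a b • Q.var b) b (d • Q.var b)) := by
    intro d
    unfold ractm
    congr 1
    funext e
    by_cases h : e = b
    · subst h; simp
    · simp [h]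
  rw [key, key, smul_assoc, Q.subst_update_smul hb hx]

variable (E : Q.DualBasis)

section Onto

variable (s0 : ∀ b ∈ π.parts, Q.dual.P b →ₗ[Kᵐᵒᵖ] Q.cobar b)

open scoped Classical in
/-- The values of the sections `s0` at the arguments `y`, on the decorated trees `s`. -/
def secVal (y : Q.Args π) (s : Block N → Q.St N) (b : Block N) : K :=
  if h : b ∈ π.parts then (s0 b h (y ⟨b, h⟩)).1 (s b).1 (s b).2 else 1

lemma secVal_congr (y : Q.Args π) {s s' : Block N → Q.St N} (h : ∀ b ∈ π.parts, s b = s' b) :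
    secVal s0 y s = secVal s0 y s' := by
  funext b
  unfold secVal
  split_ifs with hb
  · rw [h b hb]
  · rfl

lemma secVal_update (y : Q.Args π) (s : Block N → Q.St N) (hb : b ∈ π.parts)
    (t : Q.St N) : secVal s0 y (update s b t)
      = update (secVal s0 y s) b ((s0 b hb (y ⟨b, hb⟩)).1 t.1 t.2) := by
  funext c
  by_cases hc : c = b
  · subst hc
    rw [update_self, secVal, dif_pos hb, update_self]
  · rw [update_of_ne hc, secVal, secVal, update_of_ne hc]

/-- The insertion of a family of elements of P(π). -/
def single (π : SetPart N) : (Q.Args π → Q.P π.parts) →ₗ[K] Q.KCochain N :=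
  LinearMap.single K (fun π : SetPart N => Q.Args π → Q.P π.parts) π

/-- The form on forests that represents a functional on the families of K-forms. -/
def repF (f : Q.KCochain N →ₗ[K] K) (s : Block N → Q.St N) : Q.X π.parts where
  toFun x := f (single π fun y => ⟨Q.ractm (secVal s0 y s) x.1, Q.ractm_mem _ x.2⟩)
  map_add' x x' := by
    rw [← map_add, ← map_add]
    congr 2
    funext y
    exact Subtype.ext (map_add (Q.ractm _) x.1 x'.1)
  map_smul' c x := by
    rw [RingHom.id_apply, ← map_smul, ← map_smul]
    congr 2
    funext y
    exact Subtype.ext (Q.ractm_smul _ c x.1)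

lemma repF_mem (f : Q.KCochain N →ₗ[K] K) : Q.IsMF π.parts (repF s0 f) where
  congr s s' h := LinearMap.ext fun x => by
    change f _ = f _
    simp only [secVal_congr s0 _ h]
  fam s b hb := by
    have h1 : Q.IsFam (fun a (g : Q.Args π → K) y => a * g y) b
        fun V m y => (s0 b hb (y ⟨b, hb⟩)).1 V m := by
      refine ⟨fun V hV => ⟨fun m hm => ?_, fun m hm v hv c x hx y hy => ?_,
        fun m hm hA a => ?_, fun m hm v hv u hu hvu a => ?_⟩, fun V hV => ?_⟩
      · exact funext fun z => ((s0 b hb (z ⟨b, hb⟩)).2.isFm V hV).off m hm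
      · exact funext fun z => ((s0 b hb (z ⟨b, hb⟩)).2.isFm V hV).lin m hm v hv c x hx y hy
      · exact funext fun z => ((s0 b hb (z ⟨b, hb⟩)).2.isFm V hV).root m hm hA a
      · exact funext fun z => ((s0 b hb (z ⟨b, hb⟩)).2.isFm V hV).bal m hm v hv u hu hvu a
      · exact funext fun m => funext fun z => congrFun ((s0 b hb (z ⟨b, hb⟩)).2.zero V hV) m
    let G : (Q.Args π → K) →ₗ[k] Q.X π.parts :=
      { toFun := fun g =>
          { toFun := fun x => f (single π fun y =>
              ⟨Q.ractm (update (secVal s0 y s) b (g y)) x.1, Q.ractm_mem _ x.2⟩)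
            map_add' := fun x x' => by
              rw [← map_add, ← map_add]
              congr 2
              funext y
              exact Subtype.ext (map_add (Q.ractm _) x.1 x'.1)
            map_smul' := fun c x => by
              rw [RingHom.id_apply, ← map_smul, ← map_smul]
              congr 2
              funext y
              exact Subtype.ext (Q.ractm_smul _ c x.1) }
        map_add' := fun g g' => LinearMap.ext fun x => by
          change f _ = f _ + f _
          rw [← map_add, ← map_add]
          congr 2
          funext y
          exact Subtype.ext (Q.ractm_update_add x.2 hb _ _ _)
        map_smul' := fun c g => LinearMap.ext fun x => by
          change f _ = c • f _
          rw [← LinearMap.map_smul_of_tower, ← LinearMap.map_smul_of_tower]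
          congr 2
          funext y
          exact Subtype.ext (ractm_update_smul x.2 hb _ _ _) }
    have h2 : ∀ (a : K) (g : Q.Args π → K), G (fun y => a * g y) = rho Q π.parts b a (G g) := by
      refine fun a g => LinearMap.ext fun x => ?_
      refine congrArg (fun F => f (single π F)) (funext fun y => Subtype.ext ?_)
      change Q.ractm _ x.1 = Q.ractm _ (Q.ract b a x.1)
      rw [ract_eq, ractm_ractm]
      refine congrArg (fun a => Q.ractm a x.1) (funext fun d => ?_)
      by_cases hd : d = b
      · subst hd; simp
      · simp [hd]
    have h3 : (fun V m => repF s0 f (update s b (V, m)))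
        = fun V m => G fun y => (s0 b hb (y ⟨b, hb⟩)).1 V m := by
      funext V m
      refine LinearMap.ext fun x => ?_
      refine congrArg (fun F => f (single π F)) (funext fun y => Subtype.ext ?_)
      change Q.ractm _ x.1 = Q.ractm _ x.1
      rw [secVal_update s0 y s hb]
    rw [h3]
    exact h1.map (fun _ => G) fun _ => h2

lemma rS_repF (hs : ∀ b hb y, γc E b (s0 b hb y) = y) (f : Q.KCochain N →ₗ[K] K) (hφ : Q.IsKForm π φ) :
    rS E ⟨repF s0 f, repF_mem s0 f⟩ φ = f (single π φ) := by
  have h1 : psum E π.parts (fun t => (fun y => ⟨Q.ractm (secVal s0 y (trSt t)) (φ (trArgs π t)).1,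
      Q.ractm_mem _ (φ (trArgs π t)).2⟩ : Q.Args π → Q.P π.parts)) = φ := by
    funext y
    refine (map_psum E (Pi.evalAddMonoidHom (fun _ : Q.Args π => Q.P π.parts) y) _).trans ?_
    refine Eq.trans ?_ (psum_section E hφ (fun b hb => s0 b hb) hs y)
    congr 1
    funext t
    change (⟨Q.ractm _ _, _⟩ : Q.P π.parts) = _
    have h := hφ.map_smul_args (secVal s0 y (trSt t)) (trArgs π t)
    rw [← h]
    congr 1
    funext b
    rw [secVal, dif_pos b.2]
    rfl
  conv_rhs => rw [← h1]
  exact (map_psum E (f.toAddMonoidHom.comp (single π).toAddMonoidHom) _).symm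

end Onto

end QuadraticData

lemma exists_finite_dual_basis (R M : Type*) [Ring R] [AddCommGroup M] [Module R M]
    [Module.Finite R M] [Module.Projective R M] :
    ∃ (d : ℕ) (y : Fin d → M) (g : Fin d → M →ₗ[R] R), ∀ z, ∑ l, g l z • y l = z := by
  obtain ⟨d, f, hf⟩ := Module.Finite.exists_fin' R M
  obtain ⟨s, hs⟩ := Module.projective_lifting_property f LinearMap.id hf
  refine ⟨d, fun i => f (Pi.single i 1), fun i => (LinearMap.proj i).comp s, fun z => ?_⟩
  have h1 : f (s z) = z := LinearMap.congr_fun hs z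
  conv_rhs => rw [← h1, ← univ_sum_single (s z), map_sum]
  refine sum_congr rfl fun i _ => ?_
  change s z i • f (Pi.single i 1) = _
  rw [← map_smul, ← Pi.single_smul, smul_eq_mul, mul_one]

/-- The partition into one block. -/
def oneBlock (hN : 0 < N) : SetPart N :=
  Finpartition.indiscrete (Finset.nonempty_iff_ne_empty.1 ⟨⟨0, hN⟩, mem_univ _⟩)

lemma oneBlock_parts (hN : 0 < N) : (oneBlock hN).parts = {univ} := rfl

namespace QuadraticData

variable (E : Q.DualBasis)

/-! ### The component of the partition into one block -/

lemma isKForm_single (hφ : Q.IsKForm π φ)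
    (π' : SetPart N) : Q.IsKForm π' (single π φ π') := by
  by_cases h : π' = π
  · subst h
    change Q.IsKForm π' (Pi.single (M := fun π : SetPart N => Q.Args π → Q.P π.parts) π' φ π')
    rwa [Pi.single_eq_same]
  · change Q.IsKForm π' (Pi.single (M := fun π : SetPart N => Q.Args π → Q.P π.parts) π φ π')
    rw [Pi.single_eq_of_ne h]
    exact IsKForm.zero π'

lemma rS_zero_right (G : Q.MF π.parts) : rS E G 0 = 0 := by
  refine Eq.trans ?_ (psum_zero E (S := π.parts))
  refine congrArg _ (funext fun f => map_zero _)

lemma pair_single (Ψ : Q.cobar 𝕌) (y : Q.dual.P 𝕌)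
    (π : SetPart N) (φ : Q.Args π → Q.P π.parts) : pair E Ψ y (single π φ)
      = if h : 2 ≤ π.parts.card then rS E (splitG (isPart_setPart h) Ψ) φ
        else Q.coef (φ (argTop π y)).1 := by
  have h1 : single π φ π = φ := Pi.single_eq_same (M := fun π : SetPart N => Q.Args π → Q.P π.parts) π φ
  have h2 : ∀ π', π' ≠ π → single π φ π' = 0 := fun π' h =>
    Pi.single_eq_of_ne (M := fun π : SetPart N => Q.Args π → Q.P π.parts) h φ
  rw [pair, sum_eq_single_of_mem π (mem_univ π), h1]
  intro π' _ h
  rw [h2 π' h]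
  split_ifs
  · exact rS_zero_right E _
  · exact map_zero _

lemma pair_add (Ψ : Q.cobar 𝕌) (y : Q.dual.P 𝕌)
    (φ φ' : Q.KCochain N) : pair E Ψ y (φ + φ') = pair E Ψ y φ + pair E Ψ y φ' := by
  rw [pair, pair, pair, ← sum_add_distrib]
  refine sum_congr rfl fun π _ => ?_
  split_ifs
  · rw [rS, rS, rS, ← map_add]
    refine congrArg _ (funext fun f => map_add _ _ _)
  · exact map_add Q.coef _ _

lemma coef_smul (c : K) (x : Q.Alg (Block N)) : Q.coef (c • x) = c * Q.coef x := by
  have : (Q.coef).comp (Q.lact c) = (LinearMap.mulLeft k c).comp (Q.coef (α := Block N)) :=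
    Q.hom_ext fun t => by
      cases t with
      | leaf a d =>
        simp only [LinearMap.comp_apply, cls_leaf, LinearMap.mulLeft_apply]
        rw [← smul_def, smul_smul, coef_smul_var, coef_smul_var]
      | node e s t =>
        simp only [LinearMap.comp_apply, lact_cls, PTree.lact, LinearMap.mulLeft_apply]
        rw [coef, liftₗ_cls, liftₗ_cls, mul_zero]
  exact LinearMap.congr_fun this x

lemma pair_smul (Ψ : Q.cobar 𝕌) (y : Q.dual.P 𝕌)
    (c : K) (φ : Q.KCochain N) : pair E Ψ y (c • φ) = c * pair E Ψ y φ := by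
  rw [pair, pair, mul_sum]
  refine sum_congr rfl fun π _ => ?_
  split_ifs
  · rw [rS, rS]
    refine Eq.trans ?_ (map_psum E (AddMonoidHom.mulLeft c) _).symm
    exact congrArg _ (funext fun f => map_smul _ c _)
  · exact coef_smul c _

/-- The K-form on the partition into one block given by a functional. -/
def topForm (hN : 0 < N) (g : Q.dual.P 𝕌 →ₗ[Kᵐᵒᵖ] Kᵐᵒᵖ)
    (y : Q.Args (oneBlock hN)) : Q.P (oneBlock hN).parts :=
  ⟨unop (g (y ⟨univ, mem_singleton_self _⟩)) • Q.var univ,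
    Q.mem_P_singleton.2 ⟨_, rfl⟩⟩

lemma isKForm_topForm (hN : 0 < N) (g : Q.dual.P 𝕌 →ₗ[Kᵐᵒᵖ] Kᵐᵒᵖ) :
    Q.IsKForm (oneBlock hN) (topForm hN g) := by
  have hb : ∀ b : (oneBlock hN).parts, b = ⟨univ, mem_singleton_self _⟩ := fun b =>
    Subtype.ext (mem_singleton.1 b.2)
  refine isKForm_of (fun y b x x' => Subtype.ext ?_) fun y b a x => Subtype.ext ?_
  · obtain rfl := hb b
    change unop (g _) • _ = unop (g _) • _ + unop (g _) • _
    rw [update_self, update_self, update_self, ← add_smul]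
    exact congrArg (· • _) (congrArg unop (map_add g _ _))
  · obtain rfl := hb b
    change unop (g _) • Q.var _ = Q.ract 𝕌 a (unop (g _) • Q.var _)
    rw [update_self, update_self, ract_eq, ractm_smul, ractm_var,
      update_self, smul_smul]
    exact congrArg (· • _) (congrArg unop (map_smul g _ _))

lemma coef_topForm (hN : 0 < N) (g : Q.dual.P 𝕌 →ₗ[Kᵐᵒᵖ] Kᵐᵒᵖ) (y) :
    Q.coef (topForm hN g (argTop _ y)).1 = unop (g y) := by
  refine (Q.coef_smul_var _ _).trans ?_
  congr 2
  rw [argTop, dif_pos rfl]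

section Finite

variable [FiniteDimensional k K] [FiniteDimensional k Q.E] [IsSemisimpleRing K]

lemma exists_dual_basis_P (A : Finset (Fin N)) : ∃ (d : ℕ) (y : Fin d → Q.dual.P A)
    (g : Fin d → Q.dual.P A →ₗ[Kᵐᵒᵖ] Kᵐᵒᵖ), ∀ z, ∑ l, g l z • y l = z := by
  have : FiniteDimensional k Q.dual.E := inferInstanceAs (FiniteDimensional k Q.EDual)
  have : Module.Finite Kᵐᵒᵖ (Q.dual.P A) := Module.Finite.of_restrictScalars_finite k _ _
  have : Module.Projective Kᵐᵒᵖ (Q.dual.P A) := Module.projective_of_isSemisimpleRing _ _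
  exact exists_finite_dual_basis _ _

lemma eq_zero_of_topForm (hN : 0 < N) (y : Q.dual.P 𝕌)
    (h : ∀ φ, Q.IsKForm (oneBlock hN) φ → Q.coef (φ (argTop _ y)).1 = 0) : y = 0 := by
  obtain ⟨d, z, g, hg⟩ := exists_dual_basis_P (Q := Q) (univ : Finset (Fin N))
  rw [← hg y]
  refine sum_eq_zero fun l _ => ?_
  have h1 := h _ (isKForm_topForm hN (g l))
  rw [coef_topForm] at h1
  rw [show g l y = 0 from MulOpposite.unop_injective h1, zero_smul]

lemma exists_top_of_functional (hN : 0 < N)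
    (f : (Q.Args (oneBlock hN) → Q.P (oneBlock hN).parts) →ₗ[K] K) :
    ∃ y : Q.dual.P 𝕌, ∀ φ, Q.IsKForm (oneBlock hN) φ →
      Q.coef (φ (argTop _ y)).1 = f φ := by
  obtain ⟨d, z, g, hg⟩ := exists_dual_basis_P (Q := Q) (univ : Finset (Fin N))
  refine ⟨∑ l, op (f (topForm hN (g l))) • z l, fun φ hφ => ?_⟩
  obtain ⟨g', h1, h2⟩ := exists_topHom (π := oneBlock hN) (by rw [oneBlock_parts]; simp)
    (mem_singleton_self _) hφ
  have h3 : φ = ∑ l, g' (z l) • topForm hN (g l) := by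
    funext y
    obtain ⟨c, hc⟩ := Q.mem_P_singleton.1 (φ y).2
    have h4 : y = argTop _ (y ⟨univ, mem_singleton_self _⟩) := by
      funext b
      obtain rfl : b = ⟨univ, mem_singleton_self _⟩ :=
        Subtype.ext (mem_singleton.1 b.2)
      rw [argTop, dif_pos rfl]
    have h5 : c = ∑ l, g' (z l) * unop (g l (y ⟨univ, mem_singleton_self _⟩)) := by
      rw [← Q.coef_smul_var c 𝕌, ← hc, h4, ← h2, ← h4]
      conv_lhs => rw [← hg (y ⟨univ, mem_singleton_self _⟩), map_sum]
      exact sum_congr rfl fun l _ => h1 _ _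
    refine Subtype.ext ?_
    rw [Finset.sum_apply, hc, h5, Finset.sum_smul, AddSubmonoidClass.coe_finsetSum]
    exact sum_congr rfl fun l _ => mul_smul _ _ _
  rw [← h2, map_sum]
  conv_rhs => rw [h3, map_sum]
  refine sum_congr rfl fun l _ => ?_
  rw [h1, map_smul, smul_eq_mul]

end Finite

end QuadraticData

namespace QuadraticData

variable (E : Q.DualBasis)

/-! ### The kernel of the pairing is acyclic -/

section Kernel

lemma card_lt_card_inp_erase (hP : IsPart A S) (hV : IsTree A V)
    (hS : inp V A = S) (hb : b ∈ S) (hbV : b ∈ V) :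
    S.card < (inp (V.erase b) A).card := by
  have h1 := hV.isPart_inp hbV
  rw [hV.inp_erase_of_mem hbV (hS ▸ hb), hS, card_union_of_disjoint, 
    card_erase_of_mem hb]
  · have := h1.two
    have := card_pos.2 ⟨b, hb⟩
    omega
  · refine disjoint_left.2 fun u hu hu' => ?_
    obtain ⟨hub, huS⟩ := mem_erase.1 hu
    exact hub (hP.eq_of_subset huS hb (h1.nonempty u hu') le_rfl (h1.sub u hu'))

lemma apply_eq_zero_of_splitG (hV : IsTree A V) (hA : A ∈ V) (Φ : Q.cobar A)
    (h : splitG (hV.isPart_inp hA) Φ = 0) (hm : Q.Valid V m) : Φ.1 V m = 0 := by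
  rw [split_apply hV hA Φ hm, h]
  exact smul_zero _

/-- The pairing with the K-forms vanishes, except perhaps at the partition into one block. -/
def PairVanish (Ψ : Q.cobar 𝕌) : Prop :=
  ∀ (π : SetPart N) (h : 2 ≤ π.parts.card) (φ : Q.Args π → Q.P π.parts), Q.IsKForm π φ →
    rS E (splitG (isPart_setPart h) Ψ) φ = 0

variable {E}

lemma PairVanish.sub {Ψ Ψ' : Q.cobar 𝕌} (h : PairVanish E Ψ)
    (h' : PairVanish E Ψ') : PairVanish E (Ψ - Ψ') := fun π hπ φ hφ => by
  rw [map_sub, sub_eq_add_neg, rS_add, rS_neg, h π hπ φ hφ, h' π hπ φ hφ, neg_zero, add_zero]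

lemma PairVanish.add {Ψ Ψ' : Q.cobar 𝕌} (h : PairVanish E Ψ)
    (h' : PairVanish E Ψ') : PairVanish E (Ψ + Ψ') := fun π hπ φ hφ => by
  rw [map_add, rS_add, h π hπ φ hφ, h' π hπ φ hφ, add_zero]

lemma coef_argTop_zero (hN : 0 < N) (h : ¬ 2 ≤ π.parts.card) (hφ : Q.IsKForm π φ) : Q.coef (φ (argTop π 0)).1 = 0 := by
  obtain ⟨b, ⟨hb, -⟩, -⟩ := π.existsUnique_mem (mem_univ (⟨0, hN⟩ : Fin N))
  obtain ⟨g, -, hg⟩ := exists_topHom (by omega) hb hφ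
  rw [← hg, map_zero]

lemma PairVanish.pair_eq_zero (hN : 0 < N) {Ψ : Q.cobar 𝕌}
    (h : PairVanish E Ψ) {φ : Q.KCochain N} (hφ : ∀ π, Q.IsKForm π (φ π)) :
    pair E Ψ 0 φ = 0 := by
  refine sum_eq_zero fun π _ => ?_
  split_ifs with hπ
  · exact h π hπ _ (hφ π)
  · exact coef_argTop_zero hN hπ (hφ π)

variable (B : ∀ b : Block N, Q.Frame b) [IsSemisimpleRing K]

/-- On the finest partitions at which a cochain does not vanish, its differential is that of the forests. -/
lemma splitG_δc (hP : IsPart A S) (Φ : Q.cobar A)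
    (hΦ : ∀ S' (hP' : IsPart A S'), S.card < S'.card → splitG hP' Φ = 0) :
    splitG hP (Q.δc A Φ) = forestD B S (splitG hP Φ) := by
  refine MF_ext fun s hs x => ?_
  rw [splitG_apply hP _ hs, δc_apply, dif_split hP Φ hs, forestD_apply]
  refine (congrArg _ (sum_eq_zero fun b hb => ?_)).trans (add_zero _)
  split_ifs with hbV
  · have hV := jV_isTree hP hs
    have hA : A ∈ jV A S s := jV_top_mem s
    have hbV' := mem_jV_of_mem (A := A) hb hbV
    have hbA : b ≠ A := (hP.ssubset hb).ne
    have hcard := card_lt_card_inp_erase hP hV (jV_inp hP hs) hb hbV'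
    rw [apply_eq_zero_of_splitG (hV.erase hbA) (mem_erase.2 ⟨hbA.symm, hA⟩) Φ
      (hΦ _ _ hcard) ((jm_valid hP hs x.2).ctr hV hbV'), smul_zero]
  · rfl

section

variable (hN : 2 ≤ N)
  (hγ : ∀ b : Block N, b.Nonempty → b ≠ univ → γc E b ∘ₗ Q.δc b = 0)
include hN B hγ

lemma PairVanish.pair_δc {Ψ : Q.cobar 𝕌} (h : PairVanish E Ψ)
    {φ : Q.KCochain N} (hφ : ∀ π, Q.IsKForm π (φ π)) :
    pair E (Q.δc _ Ψ) (γc E _ Ψ) φ = 0 := by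
  rw [QuadraticData.pair_δc E B hN hγ Ψ hφ]
  exact h.pair_eq_zero (by omega) (isKForm_koszulD E hφ)

lemma PairVanish.δc {Ψ : Q.cobar 𝕌} (h : PairVanish E Ψ) :
    PairVanish E (Q.δc _ Ψ) := fun π hπ φ hφ => by
  have h1 := h.pair_δc B hN hγ (isKForm_single hφ)
  rwa [pair_single, dif_pos hπ] at h1

lemma PairVanish.γc_eq_zero [FiniteDimensional k K] [FiniteDimensional k Q.E]
    {Ψ : Q.cobar 𝕌} (h : PairVanish E Ψ) : γc E _ Ψ = 0 := by
  refine eq_zero_of_topForm (by omega : 0 < N) _ fun φ hφ => ?_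
  have h1 := h.pair_δc B hN hγ (isKForm_single hφ)
  rwa [pair_single, dif_neg (by rw [oneBlock_parts]; simp)] at h1

end

/-- The kernel of the pairing is acyclic if the proper blocks are contractible. -/
lemma exists_δc_eq_of_pairVanish (B : ∀ b : Block N, Q.Frame b) (hN : 2 ≤ N)
    (hC : ∀ b : Block N, b.Nonempty → b ≠ univ → Nonempty (Contraction E b))
    {Ψ : Q.cobar 𝕌} (hδ : Q.δc _ Ψ = 0) (h : PairVanish E Ψ) :
    ∃ Ψ', Q.δc _ Ψ' = Ψ ∧ PairVanish E Ψ' := by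
  have hγ : ∀ b : Block N, b.Nonempty → b ≠ univ → γc E b ∘ₗ Q.δc b = 0 :=
    fun b hb hb' => (hC b hb hb').some.γ_δ
  -- Descending induction on the number of blocks of the partitions at which the cochain does not vanish.
  suffices key : ∀ (n : ℕ) (Ψ : Q.cobar 𝕌), Q.δc _ Ψ = 0 → PairVanish E Ψ →
      (∀ (π : SetPart N) (hπ : 2 ≤ π.parts.card), n < π.parts.card →
        splitG (isPart_setPart hπ) Ψ = 0) → ∃ Ψ', Q.δc _ Ψ' = Ψ ∧ PairVanish E Ψ' by
    refine key N Ψ hδ h fun π hπ hn => ?_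
    have := π.card_parts_le_card
    rw [Finset.card_univ, Fintype.card_fin] at this
    omega
  intro n
  induction n with
  | zero =>
    intro Ψ _ h hn
    refine ⟨0, ?_, fun π hπ φ _ => by rw [map_zero]; exact rS_zero E φ⟩
    rw [map_zero]
    refine cobar_ext fun V hV m hm => ?_
    have hA : univ ∈ V := hV.top (by rwa [Finset.card_univ, Fintype.card_fin])
    have hP := hV.isPart_inp hA
    obtain ⟨π, hπ⟩ := exists_setPart hP
    have h2 : 2 ≤ π.parts.card := hπ ▸ hP.two
    refine (apply_eq_zero_of_splitG hV hA Ψ ?_ hm).symm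
    have h3 := hn π h2 (by omega)
    revert h3
    generalize isPart_setPart h2 = hP'
    revert hP'
    rw [hπ]
    exact fun _ h => h
  | succ n ih =>
    intro Ψ hδ h hn
    have hG : ∀ π : SetPart N, ∃ G : Q.MF π.parts, (∀ φ, Q.IsKForm π φ → rS E G φ = 0) ∧
        (n + 1 < π.parts.card → G = 0) ∧ ∀ hπ : 2 ≤ π.parts.card, n < π.parts.card →
          forestD B π.parts G = splitG (isPart_setPart hπ) Ψ := by
      intro π
      by_cases hπ : 2 ≤ π.parts.card ∧ π.parts.card = n + 1
      · have h1 : forestD B π.parts (splitG (isPart_setPart hπ.1) Ψ) = 0 := by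
          rw [← splitG_δc B _ Ψ fun S' hP' hS' => ?_, hδ, map_zero]
          obtain ⟨π', rfl⟩ := exists_setPart hP'
          exact hn π' (by omega) (by omega)
        obtain ⟨G, h2, h3⟩ := exists_forestD_eq E B (fun b hb => (hC b (π.nonempty_of_mem_parts hb)
          ((isPart_setPart hπ.1).ssubset hb).ne).some) _ h1 (h π hπ.1)
        exact ⟨G, h3, fun h => absurd hπ.2 (by omega), fun _ _ => h2⟩
      · refine ⟨0, fun φ _ => rS_zero E φ, fun _ => rfl, fun hπ' hn' => ?_⟩
        rw [map_zero, hn π hπ' (by omega)]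
    choose G hG1 hG2 hG3 using hG
    set Ψ1 : Q.cobar 𝕌 := ∑ π : SetPart N,
      if hπ : 2 ≤ π.parts.card then asm (isPart_setPart hπ) (G π) else 0 with hΨ1
    have hsplit : ∀ (π : SetPart N) (hπ : 2 ≤ π.parts.card),
        splitG (isPart_setPart hπ) Ψ1 = G π := by
      intro π hπ
      rw [hΨ1, map_sum, sum_eq_single_of_mem π (mem_univ π), dif_pos hπ, split_asm]
      intro π' _ hne
      split_ifs with hπ'
      · exact split_asm_of_ne _ _ _ fun h => hne (Finpartition.ext h).symm
      · exact map_zero _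
    have hv₁ : PairVanish E Ψ1 := fun π hπ φ hφ => by rw [hsplit π hπ]; exact hG1 π φ hφ
    have hδ1 : Q.δc _ (Ψ - Q.δc _ Ψ1) = 0 := by
      have : Q.δc _ (Q.δc _ Ψ1) = 0 := LinearMap.congr_fun (δc_δc _) Ψ1
      rw [map_sub, hδ, this, sub_zero]
    obtain ⟨Ψ2, h2, hv₂⟩ := ih (Ψ - Q.δc _ Ψ1) hδ1 (h.sub (hv₁.δc B hN hγ)) fun π hπ hn' => by
      have h3 : ∀ S' (hP' : IsPart univ S'), π.parts.card < S'.card → splitG hP' Ψ1 = 0 := by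
        intro S' hP' hS'
        obtain ⟨π', rfl⟩ := exists_setPart hP'
        rw [hsplit π' (by omega), hG2 π' (by omega)]
      rw [map_sub, splitG_δc B _ Ψ1 h3, hsplit π hπ, hG3 π hπ hn', sub_self]
    exact ⟨Ψ1 + Ψ2, by rw [map_add, h2, add_sub_cancel], hv₁.add hv₂⟩

end Kernel

end QuadraticData

lemma card_merge (p : π.pairs) :
    (SetPart.merge π p).parts.card + 1 = π.parts.card := by
  rw [SetPart.merge_parts, card_insert_of_notMem (SetPart.union_notMem_rest π p), SetPart.rest,
    card_erase_of_mem (mem_erase.2 ⟨(SetPart.ne π p).symm, p.2.2.1⟩),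
    card_erase_of_mem p.2.1]
  have : 2 ≤ π.parts.card := by
    rw [← card_pair (SetPart.ne π p)]
    refine card_le_card fun b hb => ?_
    rcases mem_insert.1 hb with rfl | hb
    exacts [p.2.1, mem_singleton.1 hb ▸ p.2.2.1]
  omega

namespace QuadraticData

variable (E : Q.DualBasis)

/-! ### The grading of the Koszul complex -/

variable (Q N) in
/-- The families of K-forms. -/
def kForms : Submodule K (Q.KCochain N) where
  carrier := {φ | ∀ π, Q.IsKForm π (φ π)}
  add_mem' h h' π := (h π).add _ (h' π)
  zero_mem' := IsKForm.zero
  smul_mem' c _ h π := (h π).smulK c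

/-- The differential of the complex of the families of K-forms. -/
def kD : Q.kForms N →ₗ[K] Q.kForms N where
  toFun φ := ⟨Q.koszulD E φ.1, isKForm_koszulD E φ.2⟩
  map_add' _ _ := Subtype.ext (map_add _ _ _)
  map_smul' c φ := Subtype.ext (koszulD_smul E c φ.1)

open scoped Classical in
/-- The part of a family at the partitions into `m` blocks. -/
def trunc (m : ℕ) (φ : Q.KCochain N) : Q.KCochain N := fun π => if π.parts.card = m then φ π else 0

lemma trunc_mem {m : ℕ} {φ : Q.KCochain N} (hφ : φ ∈ Q.kForms N) :
    trunc m φ ∈ Q.KoszulTerm N m := fun π => by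
  unfold trunc
  split_ifs with h
  · exact ⟨hφ π, fun h' => absurd h h'⟩
  · exact ⟨IsKForm.zero π, fun _ => rfl⟩

lemma trunc_eq {m : ℕ} {φ : Q.KCochain N} (hφ : φ ∈ Q.KoszulTerm N m) : trunc m φ = φ := by
  funext π
  unfold trunc
  split_ifs with h
  · rfl
  · exact ((hφ π).2 h).symm

lemma koszulD_trunc (m : ℕ) (φ : Q.KCochain N) :
    Q.koszulD E (trunc m φ) = trunc (m + 1) (Q.koszulD E φ) := by
  funext π y
  have h : ∀ p : π.pairs, ((SetPart.merge π p).parts.card = m ↔ π.parts.card = m + 1) := fun p => by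
    have := card_merge p; omega
  by_cases hm : π.parts.card = m + 1
  · rw [trunc, if_pos hm]
    have h1 : ∀ p : π.pairs, trunc m φ (SetPart.merge π p) = φ (SetPart.merge π p) := fun p =>
      if_pos ((h p).2 hm)
    change ∑ p : π.pairs, SetPart.sign π p • ∑ i, Q.splitBlock π p (E.X i)
      (trunc m φ (SetPart.merge π p) (Q.mergeArgs π p (E.Ξ i) y)) = _
    simp only [h1]
    rfl
  · rw [trunc, if_neg hm]
    have h1 : ∀ p : π.pairs, trunc m φ (SetPart.merge π p) = 0 := fun p =>
      if_neg fun h' => hm ((h p).1 h')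
    refine sum_eq_zero fun p _ => ?_
    rw [h1, sum_eq_zero, smul_zero]
    exact fun i _ => Subtype.ext (map_zero _)

lemma sum_trunc (hN : 0 < N) (φ : Q.KCochain N) : ∑ m ∈ Finset.range N, trunc (m + 1) φ = φ := by
  funext π
  rw [Finset.sum_apply]
  have h1 : 0 < π.parts.card := by
    obtain ⟨b, ⟨hb, -⟩, -⟩ := π.existsUnique_mem (mem_univ (⟨0, hN⟩ : Fin N))
    exact card_pos.2 ⟨b, hb⟩
  have h2 := π.card_parts_le_card
  rw [Finset.card_univ, Fintype.card_fin] at h2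
  rw [sum_eq_single_of_mem (π.parts.card - 1) (mem_range.2 (by omega))]
  · exact if_pos (by omega)
  · exact fun m _ hm => if_neg (by omega)

/-- Exactness of the total complex of K-forms is exactness of its homogeneous parts. -/
lemma exact_kD_iff (hN : 0 < N) : (∀ φ, kD (N := N) E φ = 0 ↔ ∃ φ', kD E φ' = φ) ↔
    ∀ m : ℕ, (Q.KoszulTerm N m).map (Q.koszulD E)
      = Q.KoszulTerm N (m + 1) ⊓ LinearMap.ker (Q.koszulD E) := by
  have hmem : ∀ {m} {φ : Q.KCochain N}, φ ∈ Q.KoszulTerm N m → φ ∈ Q.kForms N := fun h π => (h π).1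
  constructor
  · intro h m
    refine le_antisymm ?_ fun φ hφ => ?_
    · rintro _ ⟨φ, hφ, rfl⟩
      refine ⟨?_, ?_⟩
      · rw [← trunc_eq hφ, koszulD_trunc]
        exact trunc_mem (isKForm_koszulD E (hmem hφ))
      · exact congrArg Subtype.val ((h (kD E ⟨φ, hmem hφ⟩)).2 ⟨_, rfl⟩)
    · obtain ⟨φ', h'⟩ := (h ⟨φ, hmem hφ.1⟩).1 (Subtype.ext hφ.2)
      refine ⟨trunc m φ'.1, trunc_mem φ'.2, ?_⟩
      have h1 : Q.koszulD E φ'.1 = φ := congrArg Subtype.val h'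
      rw [koszulD_trunc, h1, trunc_eq hφ.1]
  · intro h φ
    constructor
    · intro hφ
      have h1 : ∀ m, ∃ φ' ∈ Q.KoszulTerm N m, Q.koszulD E φ' = trunc (m + 1) φ.1 := fun m => by
        have h2 : trunc (m + 1) φ.1 ∈ Q.KoszulTerm N (m + 1) ⊓ LinearMap.ker (Q.koszulD E) := by
          refine ⟨trunc_mem φ.2, ?_⟩
          have h3 : Q.koszulD E φ.1 = 0 := congrArg Subtype.val hφ
          change Q.koszulD E (trunc (m + 1) φ.1) = 0
          rw [koszulD_trunc, h3]
          funext π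
          exact ite_self _
        rw [← h m] at h2
        exact h2
      choose g hg₁ hg₂ using h1
      refine ⟨⟨∑ m ∈ Finset.range N, g m, Submodule.sum_mem _ fun m _ => hmem (hg₁ m)⟩,
        Subtype.ext ?_⟩
      change Q.koszulD E (∑ m ∈ Finset.range N, g m) = φ.1
      rw [map_sum, ← sum_trunc hN φ.1]
      exact sum_congr rfl fun m _ => hg₂ m
    · rintro ⟨φ', rfl⟩
      refine Subtype.ext ?_
      change Q.koszulD E (Q.koszulD E φ'.1) = 0
      rw [← sum_trunc hN φ'.1, map_sum, map_sum]
      refine sum_eq_zero fun m _ => ?_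
      have h2 : Q.koszulD E (trunc (m + 1) φ'.1) ∈ (Q.KoszulTerm N (m + 1)).map (Q.koszulD E) :=
        ⟨_, trunc_mem φ'.2, rfl⟩
      rw [h (m + 1)] at h2
      exact h2.2

/-! ### The duality between the cobar complex and the Koszul complex -/

lemma argTop_add (hπ : ¬ 2 ≤ π.parts.card) (hN : 0 < N) (hφ : Q.IsKForm π φ) (y y' : Q.dual.P 𝕌) :
    Q.coef (φ (argTop π (y + y'))).1 = Q.coef (φ (argTop π y)).1 + Q.coef (φ (argTop π y')).1 := by
  obtain ⟨b, ⟨hb, -⟩, -⟩ := π.existsUnique_mem (mem_univ (⟨0, hN⟩ : Fin N))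
  obtain ⟨g, -, hg⟩ := exists_topHom (by omega) hb hφ
  rw [← hg, ← hg, ← hg, map_add]

lemma pair_zero_left (hN : 0 < N) {φ : Q.KCochain N} (hφ : ∀ π, Q.IsKForm π (φ π)) :
    pair E (0 : Q.cobar 𝕌) 0 φ = 0 := by
  unfold pair
  refine sum_eq_zero fun π _ => ?_
  split_ifs with hπ
  · rw [map_zero]
    exact rS_zero E _
  · exact coef_argTop_zero hN hπ (hφ π)

lemma pair_add_left (hN : 0 < N)
    (x y : Q.cobar 𝕌 × Q.dual.P 𝕌)
    {φ : Q.KCochain N} (hφ : ∀ π, Q.IsKForm π (φ π)) :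
    pair E (x + y).1 (x + y).2 φ = pair E x.1 x.2 φ + pair E y.1 y.2 φ := by
  unfold pair
  rw [← sum_add_distrib]
  refine sum_congr rfl fun π _ => ?_
  split_ifs with hπ
  · rw [Prod.fst_add, map_add, rS_add]
  · exact argTop_add hπ hN (hφ π) _ _

variable (N) in
/-- The differential of the cone of the canonical morphism. -/
def coneD : Q.cobar 𝕌 × Q.dual.P 𝕌 →+
    Q.cobar 𝕌 × Q.dual.P 𝕌 where
  toFun x := (Q.δc _ x.1, γc E _ x.1)
  map_zero' := by simp
  map_add' x y := by simp

/-- The pairing, as a map from the cone to the dual of the complex of K-forms. -/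
def coneρ (hN : 0 < N) : Q.cobar 𝕌 × Q.dual.P 𝕌 →+
    (Q.kForms N →ₗ[K] K) where
  toFun x :=
    { toFun := fun φ => pair E x.1 x.2 φ.1
      map_add' := fun _ _ => pair_add E _ _ _ _
      map_smul' := fun c _ => pair_smul E _ _ c _ }
  map_zero' := LinearMap.ext fun φ => pair_zero_left E hN φ.2
  map_add' x y := LinearMap.ext fun φ => pair_add_left E hN x y φ.2

/-- A morphism to a complex that is concentrated in one degree is a quasi-isomorphism if and only if its
cone is exact. -/
lemma exactAt_univ_iff (hN : 0 < N) :
    ExactAt E 𝕌 ↔ ∀ x, coneD N E x = 0 ↔ ∃ y, coneD N E y = x := by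
  constructor
  · intro h x
    constructor
    · intro hx
      obtain ⟨Ψ, hΨ⟩ := (h.exact x.1).1 ⟨congrArg Prod.fst hx, congrArg Prod.snd hx⟩
      obtain ⟨Ψ1, hΨ1⟩ := h.surj x.2
      set b := Q.prj 𝕌 fun V => V.card + 1 = (𝕌).card with hb
      have hγb : ∀ Ψ, γc E _ (b Ψ) = γc E _ Ψ :=
        LinearMap.congr_fun (γc_prj E _ fun V _ h => h)
      have hδb : ∀ Ψ, Q.δc _ (b Ψ) = 0 := fun Ψ => by
        have h1 : Q.δc _ * b = 0 := by
          rw [hb, δc_prj _ (fun _ => False), prj_false _ fun _ _ h => h, zero_mul]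
          intro V hV e he heA
          have h1 := card_erase_add_one he
          have h2 := hV.card_le ⟨⟨0, hN⟩, mem_univ _⟩
          simp only [iff_false]
          omega
        exact LinearMap.congr_fun h1 Ψ
      refine ⟨(Ψ - b Ψ + b Ψ1, 0), Prod.ext ?_ ?_⟩
      · change Q.δc _ (Ψ - b Ψ + b Ψ1) = x.1
        rw [map_add, map_sub, hδb, hδb, hΨ, sub_zero, add_zero]
      · change γc E _ (Ψ - b Ψ + b Ψ1) = x.2
        rw [map_add, map_sub, hγb, hγb, hΨ1, sub_self, zero_add]
    · rintro ⟨y, rfl⟩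
      obtain ⟨h1, h2⟩ := (h.exact (Q.δc _ y.1)).2 ⟨_, rfl⟩
      exact Prod.ext h1 h2
  · intro h
    refine ⟨fun Φ => ⟨fun hΦ => ?_, ?_⟩, fun y => ?_⟩
    · obtain ⟨Ψ, hΨ⟩ := (h (Φ, 0)).1 (Prod.ext hΦ.1 hΦ.2)
      exact ⟨Ψ.1, congrArg Prod.fst hΨ⟩
    · rintro ⟨Ψ, rfl⟩
      have h1 := (h (coneD N E (Ψ, 0))).2 ⟨_, rfl⟩
      exact ⟨congrArg Prod.fst h1, congrArg Prod.snd h1⟩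
    · obtain ⟨Ψ, hΨ⟩ := (h (0, y)).1 (Prod.ext (map_zero _) (map_zero _))
      exact ⟨Ψ.1, congrArg Prod.snd hΨ⟩

lemma coneρ_apply (hN : 0 < N) (x : Q.cobar 𝕌 × Q.dual.P 𝕌)
    (φ : Q.kForms N) : coneρ E hN x φ = pair E x.1 x.2 φ.1 := rfl

section Duality

variable [FiniteDimensional k K] [FiniteDimensional k Q.E] [IsSemisimpleRing K]
  (hC : ∀ b : Block N, b.Nonempty → b ≠ univ → Nonempty (Contraction E b))
include hC

/-- Every functional extends to all families, by semisimplicity; its component at π is a form on the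
forests over π, composed with γ at each block, and the sections of γ lift it. -/
lemma coneρ_surjective (hN : 0 < N) : Function.Surjective (coneρ (Q := Q) (N := N) E hN) := by
  intro f
  obtain ⟨f', hf'⟩ := IsSemisimpleModule.extension_property (Q.kForms N).subtype
    Subtype.val_injective f
  have hsec : ∀ (π : SetPart N), 2 ≤ π.parts.card → ∃ G : Q.MF π.parts, ∀ φ, Q.IsKForm π φ →
      rS E G φ = f' (single π φ) := fun π hπ => by
    have hC' := fun b hb => (hC b (π.nonempty_of_mem_parts hb) ((isPart_setPart hπ).ssubset hb).ne).some
    exact ⟨_, fun φ hφ => rS_repF E (fun b hb => (hC' b hb).s) (fun b hb => (hC' b hb).γ_s) f' hφ⟩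
  have hsec' : ∀ π : SetPart N, ∃ G : Q.MF π.parts, 2 ≤ π.parts.card → ∀ φ, Q.IsKForm π φ →
      rS E G φ = f' (single π φ) := fun π => by
    by_cases hπ : 2 ≤ π.parts.card
    · obtain ⟨G, hG⟩ := hsec π hπ
      exact ⟨G, fun _ => hG⟩
    · exact ⟨0, fun h => absurd h hπ⟩
  choose G hG using hsec'
  obtain ⟨y, hy⟩ := exists_top_of_functional hN (f' ∘ₗ single (oneBlock hN))
  refine ⟨(∑ π : SetPart N, if hπ : 2 ≤ π.parts.card then asm (isPart_setPart hπ) (G π) else 0, y),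
    LinearMap.ext fun φ => ?_⟩
  have h1 : f φ = f' φ.1 := (LinearMap.congr_fun hf' φ).symm
  have h2 : φ.1 = ∑ π : SetPart N, single π (φ.1 π) :=
    (univ_sum_single (M := fun π : SetPart N => Q.Args π → Q.P π.parts) φ.1).symm
  rw [h1]
  conv_rhs => rw [h2, map_sum]
  rw [coneρ_apply]
  unfold pair
  dsimp only
  refine sum_congr rfl fun π _ => ?_
  split_ifs with hπ
  · rw [← hG π hπ _ (φ.2 π)]
    congr 1
    rw [map_sum, sum_eq_single_of_mem π (mem_univ π), dif_pos hπ, split_asm]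
    intro π' _ hne
    split_ifs with hπ'
    · exact split_asm_of_ne _ _ _ fun h => hne (Finpartition.ext h).symm
    · exact map_zero _
  · obtain rfl : π = oneBlock hN := setPart_eq_of_card_lt (by omega) (by rw [oneBlock_parts]; simp)
    exact hy _ (φ.2 _)

/-- If the proper blocks are contractible, then the cone of γ and the complex of K-forms are exact
simultaneously. -/
lemma exact_cone_iff (hN : 2 ≤ N) :
    (∀ x, coneD N E x = 0 ↔ ∃ y, coneD N E y = x) ↔
      ∀ φ, kD (N := N) E φ = 0 ↔ ∃ φ', kD E φ' = φ := by
  have hN' : 0 < N := by omega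
  have B : ∀ b : Block N, Q.Frame b := fun b => (Q.nonempty_frame b).some
  have hγ : ∀ b : Block N, b.Nonempty → b ≠ univ → γc E b ∘ₗ Q.δc b = 0 :=
    fun b hb hb' => (hC b hb hb').some.γ_δ
  have hpair : ∀ x, coneρ E hN' x = 0 → PairVanish E x.1 ∧ x.2 = 0 := by
    intro x hx
    have h1 : ∀ π φ, Q.IsKForm π φ → pair E x.1 x.2 (single π φ) = 0 := fun π φ hφ =>
      LinearMap.congr_fun hx ⟨_, isKForm_single hφ⟩
    refine ⟨fun π hπ φ hφ => ?_, eq_zero_of_topForm hN' _ fun φ hφ => ?_⟩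
    · have h2 := h1 π φ hφ
      rwa [pair_single, dif_pos hπ] at h2
    · have h2 := h1 _ φ hφ
      rwa [pair_single, dif_neg (by rw [oneBlock_parts]; simp)] at h2
  refine exact_iff_exact_of_pairing (coneD N E) (kD E) (coneρ E hN') (coneρ_surjective E hC hN')
    (fun x => LinearMap.ext fun φ => ?_) (fun x hx hDx => ?_) fun x hx => ?_
  · refine (pair_δc E B hN hγ x.1 φ.2).trans ?_
    refine sum_congr rfl fun π _ => ?_
    split_ifs with hπ
    · rfl
    · have h1 : (kD E φ).1 π = 0 := koszulD_of_card_lt E φ.1 (by omega)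
      change Q.coef ((kD E φ).1 π _).1 = Q.coef ((kD E φ).1 π _).1
      rw [h1]
      rfl
  · obtain ⟨h1, h2⟩ := hpair x hx
    obtain ⟨Ψ, h3, h4⟩ := exists_δc_eq_of_pairVanish B hN hC (congrArg Prod.fst hDx) h1
    refine ⟨(Ψ, 0), LinearMap.ext fun φ => h4.pair_eq_zero hN' φ.2, ?_⟩
    exact Prod.ext h3 ((h4.γc_eq_zero B hN hγ).trans h2.symm)
  · obtain ⟨h1, h2⟩ := hpair _ hx
    exact Prod.ext (LinearMap.congr_fun (δc_δc _) x.1) h2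

end Duality

end QuadraticData

namespace QuadraticData

/-! ### The canonical morphism and the planar structures -/

lemma ract_node_fst {a b : Block N} (hab : a ≠ b) (c : K) (e : Q.E) :
    Q.ract a c (Q.node e (Q.var a) (Q.var b)) = Q.node (Q.r₁ (op c) e) (Q.var a) (Q.var b) := by
  rw [ract_eq, ractm, subst_node, subst_var, subst_var, update_self,
    update_of_ne hab.symm, Pi.one_apply, one_smul, node_smul_left]

lemma ract_node_snd {a b : Block N} (hab : a ≠ b) (c : K) (e : Q.E) :
    Q.ract b c (Q.node e (Q.var a) (Q.var b)) = Q.node (Q.r₂ (op c) e) (Q.var a) (Q.var b) := by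
  rw [ract_eq, ractm, subst_node, subst_var, subst_var, update_self,
    update_of_ne hab, Pi.one_apply, one_smul, node_smul_right]

/-- The sum, over the elements of the dual basis, of the composite with Ξ_i, multiplied by the value of
a functional on the corolla with X_i. -/
def rootSum (E : Q.DualBasis) (f : Q.X S) (a b : Block N) :
    Q.dual.Alg (Fin N) →+ Q.dual.Alg (Fin N) →+ Q.dual.Alg (Fin N) :=
  AddMonoidHom.mk' (fun y1 => AddMonoidHom.mk' (fun y2 =>
      ∑ i, op (ev f (Q.node (E.X i) (Q.var a) (Q.var b))) • Q.dual.node (E.Ξ i) y1 y2)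
    fun y y' => by simp only [map_add, smul_add, sum_add_distrib])
    fun y y' => AddMonoidHom.ext fun z => by
      simp only [AddMonoidHom.mk'_apply, AddMonoidHom.add_apply, map_add, LinearMap.add_apply,
        smul_add, sum_add_distrib]

section RootSum

variable (E : Q.DualBasis)

lemma rootSum_apply (f : Q.X S) (a b : Block N) (y1 y2 : Q.dual.Alg (Fin N)) :
    rootSum E f a b y1 y2
      = ∑ i, op (ev f (Q.node (E.X i) (Q.var a) (Q.var b))) • Q.dual.node (E.Ξ i) y1 y2 := rfl

lemma rootSum_sum {ι : Type*} (t : Finset ι) (f : ι → Q.X S) (a b : Block N)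
    (y1 y2 : Q.dual.Alg (Fin N)) :
    rootSum E (∑ l ∈ t, f l) a b y1 y2 = ∑ l ∈ t, rootSum E (f l) a b y1 y2 := by
  classical
  induction t using Finset.induction_on with
  | empty =>
    rw [sum_empty, sum_empty, rootSum_apply]
    refine sum_eq_zero fun i _ => ?_
    rw [ev_zero]
    exact zero_smul Kᵐᵒᵖ _
  | insert l t hl ih =>
    rw [sum_insert hl, sum_insert hl, ← ih]
    simp only [rootSum_apply, ev_add, op_add, add_smul, sum_add_distrib]

/-- The term of a root sum as a function of the two elements of the canonical element. -/
def rootTerm (f : Q.X S) {a b : Block N} (h : ∀ e, Q.node e (Q.var a) (Q.var b) ∈ Q.P S)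
    (y1 y2 : Q.dual.Alg (Fin N)) : Q.dual.E →+ Q.E →+ Q.dual.Alg (Fin N) :=
  AddMonoidHom.mk' (fun ξ => AddMonoidHom.mk' (fun e =>
      op (ev f (Q.node e (Q.var a) (Q.var b))) • Q.dual.node ξ y1 y2)
    fun e e' => by
      rw [ev_of_mem f (h _), ev_of_mem f (h _), ev_of_mem f (h _), ← add_smul, ← op_add, ← map_add]
      exact congrArg (fun x => op (f x) • Q.dual.node ξ y1 y2)
        (Subtype.ext (LinearMap.congr_fun (LinearMap.congr_fun (Q.node_add e e') _) _)))
    fun ξ ξ' => AddMonoidHom.ext fun e => by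
      simp only [AddMonoidHom.mk'_apply, AddMonoidHom.add_apply, node_add, LinearMap.add_apply,
        smul_add]

lemma rootTerm_smul (f : Q.X S) {a b : Block N} (h : ∀ e, Q.node e (Q.var a) (Q.var b) ∈ Q.P S)
    (y1 y2 : Q.dual.Alg (Fin N)) (c : K) (ξ : Q.dual.E) (e : Q.E) :
    rootTerm f h y1 y2 (op c • ξ) e = rootTerm f h y1 y2 ξ (c • e) := by
  change op (ev f _) • Q.dual.node (op c • ξ) y1 y2 = op (ev f _) • Q.dual.node ξ y1 y2
  have h1 : (⟨_, h (c • e)⟩ : Q.P S) = c • ⟨_, h e⟩ := Subtype.ext (Q.smul_node c e _ _).symm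
  rw [ev_of_mem f (h _), ev_of_mem f (h _), h1, map_smul, ← smul_node, smul_smul]
  rfl

lemma ev_rho (f : Q.X S) (b : Block N) (c : K) {x : Q.Alg (Block N)} (hx : x ∈ Q.P S) :
    ev (rho Q S b c f) x = ev f (Q.ract b c x) := by
  rw [ev_of_mem _ hx, ev_of_mem _ (Q.ract_mem b c hx)]
  rfl

/-- The sign twist of E^∨ makes the canonical element odd under the exchange of the two inputs. -/
lemma rootSum_swap {a b : Block N} (f : Q.X S) (h : ∀ e, Q.node e (Q.var a) (Q.var b) ∈ Q.P S)
    (y1 y2 : Q.dual.Alg (Fin N)) : rootSum E f b a y2 y1 = -rootSum E f a b y1 y2 := by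
  have h2 : ∀ i, op (ev f (Q.node (E.X i) (Q.var b) (Q.var a))) • Q.dual.node (E.Ξ i) y2 y1
      = rootTerm f h y1 y2 (Q.dual.σ (E.Ξ i)) (Q.σ (E.X i)) := fun i => by
    rw [← Q.node_symm, ← Q.dual.node_symm]; rfl
  let T : Q.dual.E →+ Q.E →+ Q.dual.Alg (Fin N) := AddMonoidHom.mk'
    (fun ξ => AddMonoidHom.mk' (fun e => rootTerm f h y1 y2 ξ (Q.σ e)) fun e e' => by
      rw [map_add, map_add]) fun ξ ξ' => AddMonoidHom.ext fun e => by
      simp only [AddMonoidHom.mk'_apply, AddMonoidHom.add_apply, map_add]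
  have h3 := E.exchange T (fun c ξ e => by
    change rootTerm f h y1 y2 (op c • ξ) (Q.σ e) = rootTerm f h y1 y2 ξ (Q.σ (c • e))
    rw [rootTerm_smul, map_smul Q.σ]) Q.σ
  have h4 : ∀ i, rootTerm f h y1 y2 (Q.dual.σ (E.Ξ i)) (Q.σ (E.X i))
      = -T (show Q.EDual from (show Q.EDual from E.Ξ i) ∘ₗ Q.σ) (E.X i) := fun i => by
    have h5 : Q.dual.σ (E.Ξ i) = -(show Q.dual.E from (show Q.EDual from
      (show Q.EDual from E.Ξ i) ∘ₗ Q.σ)) := rfl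
    rw [h5, map_neg]; rfl
  have h6 : ∀ i, T (E.Ξ i) (Q.σ (E.X i)) = rootTerm f h y1 y2 (E.Ξ i) (E.X i) := fun i =>
    congrArg (rootTerm f h y1 y2 (E.Ξ i)) (Q.σ_σ (E.X i))
  have h7 : ∑ i, rootTerm f h y1 y2 (Q.dual.σ (E.Ξ i)) (Q.σ (E.X i))
      = -∑ i, rootTerm f h y1 y2 (E.Ξ i) (E.X i) := by
    rw [sum_congr rfl fun i _ => h4 i, sum_neg_distrib, h3,
      sum_congr rfl fun i _ => h6 i]
  exact (sum_congr rfl fun i _ => h2 i).trans h7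

variable {a b : Block N} (hab : a ≠ b)
include hab

lemma rootSum_rho_left (f : Q.X S) (h : ∀ e, Q.node e (Q.var a) (Q.var b) ∈ Q.P S) (c : K)
    (y1 y2 : Q.dual.Alg (Fin N)) :
    rootSum E (rho Q S a c f) a b y1 y2 = rootSum E f a b (op c • y1) y2 := by
  have h1 := E.exchange (rootTerm f h y1 y2) (rootTerm_smul f h y1 y2) (Q.r₁ (op c))
  rw [rootSum_apply, rootSum_apply]
  refine Eq.trans (sum_congr rfl fun i _ => ?_) (h1.symm.trans (sum_congr rfl fun i _ => ?_))
  · rw [ev_rho f a c (h _), ract_node_fst hab]; rfl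
  · rw [node_smul_left]; rfl

lemma rootSum_rho_right (f : Q.X S) (h : ∀ e, Q.node e (Q.var a) (Q.var b) ∈ Q.P S) (c : K)
    (y1 y2 : Q.dual.Alg (Fin N)) :
    rootSum E (rho Q S b c f) a b y1 y2 = rootSum E f a b y1 (op c • y2) := by
  have h1 := E.exchange (rootTerm f h y1 y2) (rootTerm_smul f h y1 y2) (Q.r₂ (op c))
  rw [rootSum_apply, rootSum_apply]
  refine Eq.trans (sum_congr rfl fun i _ => ?_) (h1.symm.trans (sum_congr rfl fun i _ => ?_))
  · rw [ev_rho f b c (h _), ract_node_snd hab]; rfl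
  · rw [node_smul_right]; rfl

end RootSum

/-- The image in P^! of the canonical element that is given by a collection of trees, evaluated at
an element of the cobar complex. -/
def evalTrees (T : Multiset (Q.dual.Alg (Fin N) × Q.St N)) (F : 𝓕 N → Q.Dec N → K) :
    Q.dual.Alg (Fin N) := (T.map fun t => op (F t.2.1 t.2.2) • t.1).sum

lemma sum_map_biadditive {ι ι' M M' M'' : Type*} [AddCommMonoid M] [AddCommMonoid M']
    [AddCommMonoid M''] (H : M →+ M' →+ M'') (T : Multiset ι) (T' : Multiset ι') (g : ι → M)
    (g' : ι' → M') : (T.map fun t => (T'.map fun t' => H (g t) (g' t')).sum).sum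
      = H (T.map g).sum (T'.map g').sum := by
  rw [map_multiset_sum H, Multiset.map_map, ← AddMonoidHom.eval_apply_apply, map_multiset_sum,
    Multiset.map_map]
  refine congrArg Multiset.sum (Multiset.map_congr rfl fun t _ => ?_)
  rw [Function.comp_apply, Function.comp_apply, AddMonoidHom.eval_apply_apply, map_multiset_sum,
    Multiset.map_map]
  rfl

/-- The collections of trees on the two blocks enter only through their values at the elements of the
frames. -/
lemma sum_rootSum (E : Q.DualBasis) (B : ∀ b : Block N, Q.Frame b) [IsSemisimpleRing K]
    {a b : Block N} (hab : a ≠ b) (hS : S = {a, b}) (G : Q.MF S)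
    (T1 T2 : Multiset (Q.dual.Alg (Fin N) × Q.St N)) :
    (T1.map fun t₁ => (T2.map fun t₂ =>
        rootSum E (G.1 (pairSt a t₁.2 t₂.2)) a b t₁.1 t₂.1).sum).sum
      = ∑ l, ∑ l', rootSum E (G.1 (pairSt a ((B a).V l, (B a).m l) ((B b).V l', (B b).m l'))) a b
        (evalTrees T1 ((B a).Φ l).1) (evalTrees T2 ((B b).Φ l').1) := by
  subst hS
  have h : ∀ e, Q.node e (Q.var a) (Q.var b) ∈ Q.P {a, b} := node_var_mem hab
  have ha : a ∈ ({a, b} : 𝓕 N) := by simp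
  have hb : b ∈ ({a, b} : 𝓕 N) := by simp
  have hst : ∀ t₁ t₂ : Q.St N, G.1 (pairSt a t₁ t₂)
      = G.1 (update (update (fun _ => (∅, 0)) b t₂) a t₁) := fun t₁ t₂ =>
    G.2.congr _ _ fun c hc => by
      rcases mem_insert.1 hc with rfl | hc
      · simp [pairSt]
      · rw [mem_singleton.1 hc]
        simp [pairSt, hab.symm]
  have hterm : ∀ t₁ t₂ : Q.dual.Alg (Fin N) × Q.St N,
      rootSum E (G.1 (pairSt a t₁.2 t₂.2)) a b t₁.1 t₂.1
      = ∑ l, ∑ l', rootSum E (G.1 (pairSt a ((B a).V l, (B a).m l) ((B b).V l', (B b).m l'))) a b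
        (op (((B a).Φ l).1 t₁.2.1 t₁.2.2) • t₁.1) (op (((B b).Φ l').1 t₂.2.1 t₂.2.2) • t₂.1) := by
    intro t₁ t₂
    rw [hst, star_expand B ha, rootSum_sum]
    refine sum_congr rfl fun l _ => ?_
    rw [rootSum_rho_left E hab _ h, Function.update_comm hab.symm, star_expand B hb, rootSum_sum]
    refine sum_congr rfl fun l' _ => ?_
    rw [rootSum_rho_right E hab _ h, Function.update_comm hab, hst]
  simp only [hterm, Multiset.sum_map_sum]
  refine sum_congr rfl fun l _ => sum_congr rfl fun l' _ => ?_
  exact sum_map_biadditive _ _ _ _ _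

end QuadraticData

/-! ### The orientation of a binary tree -/

/-- The number, modulo 2, of the pairs of an entry of `l` and a smaller entry of `l'`. -/
def nlist (l l' : List (Block N)) : ZMod 2 :=
  (l.map fun u => (l'.map fun w => if key w < key u then (1 : ZMod 2) else 0).sum).sum

lemma nlist_append_left (l1 l2 l : List (Block N)) :
    nlist (l1 ++ l2) l = nlist l1 l + nlist l2 l := by simp [nlist]

lemma nlist_append_right (l l1 l2 : List (Block N)) :
    nlist l (l1 ++ l2) = nlist l l1 + nlist l l2 := by simp [nlist, List.sum_map_add]

lemma nlist_nil (l : List (Block N)) : nlist l [] = 0 := by simp [nlist]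

lemma wedgeSign_append (l1 l2 : List (Block N)) :
    wedgeSign (l1 ++ l2) = wedgeSign l1 * wedgeSign l2 * sgn (nlist l1 l2) := by
  have hcount : ∀ (u : Block N) (l : List (Block N)), ((l.countP fun w => key w < key u : ℕ) : ZMod 2)
      = (l.map fun w => if key w < key u then (1 : ZMod 2) else 0).sum := by
    intro u l
    induction l with
    | nil => rfl
    | cons w l ih =>
      rw [List.countP_cons, Nat.cast_add, ih, List.map_cons, List.sum_cons, add_comm]
      by_cases h : key w < key u <;> simp [h]
  induction l1 with
  | nil => simp [wedgeSign, nlist, sgn_zero]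
  | cons u l1 ih =>
    rw [List.cons_append, wedgeSign, wedgeSign, ih, List.countP_append, pow_add,
      show nlist (u :: l1) l2 = (l2.map fun w => if key w < key u then (1 : ZMod 2) else 0).sum
        + nlist l1 l2 from rfl, sgn_add, ← hcount, sgn_natCast]
    ring

/-- The concatenation of the pairs of inputs of the vertices in the list `L`. -/
def childList (c : Block N → Block N × Block N) (L : List (Block N)) : List (Block N) :=
  L.flatMap fun v => [(c v).1, (c v).2]

lemma childList_cons (c : Block N → Block N × Block N) (v : Block N) (L : List (Block N)) :
    childList c (v :: L) = [(c v).1, (c v).2] ++ childList c L := List.flatMap_cons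

lemma childList_append (c : Block N → Block N × Block N) (L L' : List (Block N)) :
    childList c (L ++ L') = childList c L ++ childList c L' := List.flatMap_append

/-- `c` puts the two inputs of each vertex of `V` in order. -/
def IsPlanar (V : 𝓕 N) (c : Block N → Block N × Block N) : Prop :=
  ∀ v ∈ V, (c v).1 ≠ (c v).2 ∧ inp V v = {(c v).1, (c v).2}

section Planar

variable {A : Block N}

lemma IsPlanar.filter (hc : IsPlanar V c) (b : Block N) : IsPlanar (V.filter (· ⊆ b)) c :=
  fun v hv => by
    obtain ⟨h1, h2⟩ := mem_filter.1 hv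
    rw [inp_filter V h2]
    exact hc v h1

lemma IsPlanar.card_inp (hc : IsPlanar V c) (hv : v ∈ V) : (inp V v).card = 2 := by
  rw [(hc v hv).2, card_pair (hc v hv).1]

lemma IsPlanar.child_mem (hc : IsPlanar V c) (hv : v ∈ V) :
    (c v).1 ∈ inp V v ∧ (c v).2 ∈ inp V v := by
  rw [(hc v hv).2]
  exact ⟨mem_insert_self _ _, mem_insert_of_mem (mem_singleton_self _)⟩

lemma IsPlanar.child_subset (hc : IsPlanar V c) (hv : v ∈ V) :
    (c v).1 ⊂ v ∧ (c v).2 ⊂ v :=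
  ⟨(mem_inp.1 (hc.child_mem hv).1).2.1, (mem_inp.1 (hc.child_mem hv).2).2.1⟩

lemma nlist_pair {a b a' b' : Block N} (h : a ≠ b) (h' : a' ≠ b') :
    nlist [a, b] [a', b'] = nlt {a, b} {a', b'} := by simp [nlist, nlt, sum_pair h, sum_pair h']

lemma IsPlanar.nlist_pair_childList (hc : IsPlanar V c) (hv : v ∈ V)
    {L : List (Block N)} (hL : ∀ w ∈ L, w ∈ V) :
    nlist [(c v).1, (c v).2] (childList c L) = (L.map fun w => nlt (inp V v) (inp V w)).sum := by
  induction L with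
  | nil => exact nlist_nil _
  | cons w L ih =>
    have hw := hL w List.mem_cons_self
    rw [childList_cons, nlist_append_right, ih fun w' h => hL w' (List.mem_cons_of_mem _ h),
      List.map_cons, List.sum_cons, nlist_pair (hc v hv).1 (hc w hw).1, ← (hc v hv).2, ← (hc w hw).2]

lemma IsPlanar.nlist_childList (hc : IsPlanar V c) {L L' : List (Block N)} (hL : ∀ v ∈ L, v ∈ V)
    (hL' : ∀ w ∈ L', w ∈ V) : nlist (childList c L) (childList c L')
      = (L.map fun v => (L'.map fun w => nlt (inp V v) (inp V w)).sum).sum := by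
  induction L with
  | nil => rfl
  | cons v L ih =>
    rw [childList_cons, nlist_append_left, ih fun w' h => hL w' (List.mem_cons_of_mem _ h),
      List.map_cons, List.sum_cons, hc.nlist_pair_childList (hL v List.mem_cons_self) hL']

lemma IsPlanar.nlt_inp_comm (hV : IsTree A V) (hc : IsPlanar V c) {v w : Block N} (hv : v ∈ V)
    (hw : w ∈ V) : nlt (inp V v) (inp V w) = nlt (inp V w) (inp V v) := by
  by_cases h : v = w
  · rw [h]
  · refine nlt_comm_of_even (disjoint_left.2 fun u hu hu' => h ?_) ?_
    · exact hV.inp_subset_inp hu hu' hv hw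
    · rw [hc.card_inp hw]; rfl

/-- Pairs have even degree, so that the order of the vertices does not matter. -/
lemma IsPlanar.wedgeSign_perm (hV : IsTree A V) (hc : IsPlanar V c) {L L' : List (Block N)}
    (h : L.Perm L') (hL : ∀ v ∈ L, v ∈ V) :
    wedgeSign (childList c L) = wedgeSign (childList c L') := by
  induction h with
  | nil => rfl
  | @cons v L L' h ih =>
    have hv := hL v List.mem_cons_self
    have hL1 : ∀ v ∈ L, v ∈ V := fun w hw => hL w (List.mem_cons_of_mem _ hw)
    rw [childList_cons, childList_cons, wedgeSign_append, wedgeSign_append, ih hL1,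
      hc.nlist_pair_childList hv hL1, hc.nlist_pair_childList hv fun w hw => hL1 w (h.mem_iff.2 hw),
      (h.map _).sum_eq]
  | swap v w L =>
    have hw := hL w List.mem_cons_self
    have hv := hL v (List.mem_cons_of_mem _ List.mem_cons_self)
    have hL1 : ∀ v ∈ L, v ∈ V := fun u hu =>
      hL u (List.mem_cons_of_mem _ (List.mem_cons_of_mem _ hu))
    simp only [childList_cons, wedgeSign_append, nlist_append_right,
      hc.nlist_pair_childList hv hL1, hc.nlist_pair_childList hw hL1,
      nlist_pair (hc v hv).1 (hc w hw).1, nlist_pair (hc w hw).1 (hc v hv).1, ← (hc v hv).2,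
      ← (hc w hw).2, hc.nlt_inp_comm hV hw hv, sgn_add]
    ring
  | trans h _ ih ih' => exact (ih hL).trans (ih' fun v hv => hL v (h.mem_iff.2 hv))

lemma IsTree.eA_eq_biUnion (hV : IsTree A V) : eA A V = V.biUnion (inp V) := by
  ext u
  rw [mem_biUnion, mem_eA]
  constructor
  · rintro ⟨h1, h2⟩
    have hA : A ∈ V := hV.top (by
      have := card_lt_card h2
      have := card_pos.2 (hV.edge_nonempty h1)
      omega)
    obtain ⟨w, hw, hmin⟩ := exists_min_image (V.filter fun w => u ⊂ w) Finset.card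
      ⟨A, mem_filter.2 ⟨hA, h2⟩⟩
    obtain ⟨hw1, hw2⟩ := mem_filter.1 hw
    refine ⟨w, hw1, mem_inp.2 ⟨h1, hw2, fun z hz hzw huz => ?_⟩⟩
    exact absurd (card_lt_card hzw)
      (not_lt.2 (hmin z (mem_filter.2 ⟨hz, huz⟩)))
  · rintro ⟨v, hv, h⟩
    obtain ⟨h1, h2, -⟩ := mem_inp.1 h
    exact ⟨h1, h2.trans_subset (hV.sub v hv)⟩

lemma nlt_biUnion_left {T : Block N → 𝓕 N}
    (h : ∀ a ∈ R, ∀ b ∈ R, a ≠ b → Disjoint (T a) (T b)) (U : 𝓕 N) :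
    nlt (R.biUnion T) U = ∑ b ∈ R, nlt (T b) U :=
  sum_biUnion fun a ha b hb hab => h a ha b hb hab

lemma IsTree.inp_disjoint (hV : IsTree A V) : ∀ v ∈ V, ∀ w ∈ V, v ≠ w →
    Disjoint (inp V v) (inp V w) := fun _ hv _ hw hvw =>
  disjoint_left.2 fun _ hu hu' => hvw (hV.inp_subset_inp hu hu' hv hw)

lemma IsPlanar.card_eA (hV : IsTree A V) (hc : IsPlanar V c) : ((eA A V).card : ZMod 2) = 0 := by
  rw [hV.eA_eq_biUnion, card_biUnion hV.inp_disjoint,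
    sum_congr rfl fun v hv => hc.card_inp hv, sum_const, smul_eq_mul, Nat.cast_mul]
  exact mul_zero _

/-- The edges strictly inside `b`, for an edge `b` of the tree. -/
lemma IsTree.eA_eq_biUnion_filter (hV : IsTree A V) (hb : b ∈ V ∨ ∃ i, {i} = b) :
    eA b V = (V.filter (· ⊆ b)).biUnion (inp V) := by
  rw [← eA_filter, (hV.filter hb).eA_eq_biUnion]
  exact biUnion_congr rfl fun v hv => inp_filter V (mem_filter.1 hv).2

lemma nlt_pair_eq_shx {a b : Block N} (hab : a ≠ b) {T : Block N → 𝓕 N}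
    (ha : ((T a).card : ZMod 2) = 0) (hb : ((T b).card : ZMod 2) = 0) (hd : Disjoint (T a) (T b))
    (ha' : Disjoint (T a) {a, b}) (hb' : Disjoint (T b) {a, b}) :
    nlt {a, b} (T a) + nlt {a, b} (T b) + nlt (T a) (T b) = shx {a, b} T := by
  have h0 : ((({a, b} : 𝓕 N).card : ℕ) : ZMod 2) = 0 := by rw [card_pair hab]; rfl
  rw [nlt_comm_of_even ha'.symm ha, nlt_comm_of_even hb'.symm hb, shx, sum_pair hab,
    sum_pair hab, sum_pair hab, sum_pair hab]
  rcases lt_or_gt_of_ne fun h => hab (QuadraticData.key_injective h) with h | h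
  · simp only [h, lt_asymm h, lt_irrefl, if_true, if_false]
    abel
  · simp only [h, lt_asymm h, lt_irrefl, if_true, if_false, nlt_comm_of_even hd hb]
    abel

/-- The orientation of a binary tree, in terms of the orientations of the two trees at the root. -/
lemma IsPlanar.wedgeSign_root (hV : IsTree A V) (hA : A ∈ V) (hc : IsPlanar V c) :
    wedgeSign (childList c V.toList) = wedgeSign [(c A).1, (c A).2]
      * wedgeSign (childList c (V.filter (· ⊆ (c A).1)).toList)
      * wedgeSign (childList c (V.filter (· ⊆ (c A).2)).toList)
      * sgn (shx (inp V A) fun b => eA b V) := by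
  obtain ⟨hab, hS⟩ := hc A hA
  have hP := hV.isPart_inp hA
  set a := (c A).1
  set b := (c A).2
  have ha : a ∈ inp V A := by rw [hS]; simp
  have hb : b ∈ inp V A := by rw [hS]; simp
  have hae := (mem_inp.1 ha).1
  have hbe := (mem_inp.1 hb).1
  set V1 := V.filter (· ⊆ a) with hV1
  set V2 := V.filter (· ⊆ b) with hV2
  have hA1 : A ∉ V1 := fun h => (mem_inp.1 ha).2.1.2 (mem_filter.1 h).2
  have hA2 : A ∉ V2 := fun h => (mem_inp.1 hb).2.1.2 (mem_filter.1 h).2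
  have hd : Disjoint V1 V2 := disjoint_left.2 fun u hu hu' => hab (hP.eq_of_subset ha hb
    (hV.edge_nonempty (.inl (mem_filter.1 hu).1)) (mem_filter.1 hu).2
    (mem_filter.1 hu').2)
  have hperm : V.toList.Perm (A :: (V1.toList ++ V2.toList)) := by
    refine List.perm_of_nodup_nodup_toFinset_eq V.nodup_toList ?_ ?_
    · refine List.nodup_cons.2 ⟨by simp [hA1, hA2], List.nodup_append.2 ⟨V1.nodup_toList,
        V2.nodup_toList, ?_⟩⟩
      rintro u hu _ hu' rfl
      exact disjoint_left.1 hd (mem_toList.1 hu) (mem_toList.1 hu')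
    · ext u
      simp only [List.mem_toFinset, mem_toList, List.mem_cons, List.mem_append]
      constructor
      · intro hu
        by_cases h : u = A
        · exact .inl h
        · obtain ⟨w, hw, huw⟩ := inp_cover (.inl hu) (lt_of_le_of_ne (hV.sub u hu) h)
          rw [hS, mem_insert, mem_singleton] at hw
          rcases hw with rfl | rfl
          · exact .inr (.inl (mem_filter.2 ⟨hu, huw⟩))
          · exact .inr (.inr (mem_filter.2 ⟨hu, huw⟩))
      · grind
  have hL1 : ∀ v ∈ V1.toList, v ∈ V := fun v hv => (mem_filter.1 (mem_toList.1 hv)).1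
  have hL2 : ∀ v ∈ V2.toList, v ∈ V := fun v hv => (mem_filter.1 (mem_toList.1 hv)).1
  have hdisj : ∀ b', ∀ v ∈ V.filter (· ⊆ b'), ∀ w ∈ V.filter (· ⊆ b'), v ≠ w →
      Disjoint (inp V v) (inp V w) := fun b' v hv w hw =>
    hV.inp_disjoint v (mem_filter.1 hv).1 w (mem_filter.1 hw).1
  have e₁ := hV.eA_eq_biUnion_filter hae
  have e₂ := hV.eA_eq_biUnion_filter hbe
  have n₁ : (V1.toList.map fun w => nlt (inp V A) (inp V w)).sum = nlt (inp V A) (eA a V) := by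
    rw [e₁, nlt_biUnion_right (hdisj a), sum_map_toList]
  have n₂ : (V2.toList.map fun w => nlt (inp V A) (inp V w)).sum = nlt (inp V A) (eA b V) := by
    rw [e₂, nlt_biUnion_right (hdisj b), sum_map_toList]
  have n₃ : (V1.toList.map fun v => (V2.toList.map fun w => nlt (inp V v) (inp V w)).sum).sum
      = nlt (eA a V) (eA b V) := by
    rw [e₁, e₂, nlt_biUnion_left (hdisj a), sum_map_toList]
    refine sum_congr rfl fun v _ => ?_
    rw [nlt_biUnion_right (hdisj b), sum_map_toList]
  have hshx := nlt_pair_eq_shx hab (T := fun b => eA b V)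
    (by simpa only [eA_filter] using (hc.filter a).card_eA (hV.filter hae))
    (by simpa only [eA_filter] using (hc.filter b).card_eA (hV.filter hbe))
    (disjoint_left.2 fun u hu hu' => hab (hP.eq_of_subset ha hb
      (hV.edge_nonempty (mem_eA.1 hu).1) (mem_eA.1 hu).2.1 (mem_eA.1 hu').2.1))
    (disjoint_left.2 fun u hu hu' => by
      rw [← hS] at hu'
      have h1 := (mem_eA.1 hu).2
      exact h1.ne (hP.eq_of_subset hu' ha (hP.nonempty u hu') le_rfl h1.1))
    (disjoint_left.2 fun u hu hu' => by
      rw [← hS] at hu'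
      have h1 := (mem_eA.1 hu).2
      exact h1.ne (hP.eq_of_subset hu' hb (hP.nonempty u hu') le_rfl h1.1))
  rw [hc.wedgeSign_perm hV hperm fun v hv => mem_toList.1 hv, childList_cons,
    childList_append, wedgeSign_append, wedgeSign_append, nlist_append_right,
    hc.nlist_pair_childList hA hL1, hc.nlist_pair_childList hA hL2, hc.nlist_childList hL1 hL2,
    n₁, n₂, n₃, hS, ← hshx, sgn_add, sgn_add, sgn_add]
  ring

end Planar

namespace QuadraticData

/-! ### Sums over the colourings of a planar binary tree -/

open scoped Classical in
/-- The composite of the operations `ψ v` along the part above `u` of a planar tree; the numerical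
argument bounds the depth of the recursion. -/
def monomial (c : Block N → Block N × Block N) (V : 𝓕 N) (ψ : V → Q.E) :
    ℕ → Block N → Q.Alg (Fin N)
  | 0, _ => 0
  | f + 1, u => if hu : u ∈ V then
      Q.node (ψ ⟨u, hu⟩) (monomial c V ψ f (c u).1) (monomial c V ψ f (c u).2)
    else ∑ x ∈ u, Q.var x

open scoped Classical in
/-- The decoration of a planar binary tree by the operations `ψ v`. -/
def corollas (c : Block N → Block N × Block N) (V : 𝓕 N) (ψ : V → Q.E) : Q.Dec N :=
  fun v => if hv : v ∈ V then Q.node (ψ ⟨v, hv⟩) (Q.var (c v).1) (Q.var (c v).2) else 0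

lemma corollas_of_mem (hv : v ∈ V) (ψ : V → Q.E) :
    corollas c V ψ v = Q.node (ψ ⟨v, hv⟩) (Q.var (c v).1) (Q.var (c v).2) := dif_pos hv

lemma corollas_of_notMem (hv : v ∉ V) (ψ : V → Q.E) : corollas c V ψ v = 0 :=
  dif_neg hv

lemma corollas_valid (hc : IsPlanar V c) (ψ : V → Q.E) : Q.Valid V (corollas c V ψ) where
  mem v hv := by
    rw [corollas_of_mem hv, (hc v hv).2]
    exact node_var_mem (hc v hv).1 _
  zero v hv := corollas_of_notMem hv ψ

lemma monomial_filter (hc : IsPlanar V c) (ψ : V → Q.E) (b : Block N) (f : ℕ) (u : Block N)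
    (hu : u ⊆ b) : monomial c V ψ f u = monomial c (V.filter (· ⊆ b))
      (fun v => ψ ⟨v.1, (mem_filter.1 v.2).1⟩) f u := by
  induction f generalizing u with
  | zero => rfl
  | succ f ih =>
    rw [monomial, monomial]
    by_cases h : u ∈ V
    · obtain ⟨h1, h2⟩ := hc.child_subset h
      rw [dif_pos h, dif_pos (mem_filter.2 ⟨h, hu⟩), ih _ (h1.1.trans hu), ih _ (h2.1.trans hu)]
    · rw [dif_neg h, dif_neg fun h' => h (mem_filter.1 h').1]

lemma monomial_depth (hc : IsPlanar V c) (ψ : V → Q.E) (f g : ℕ) (u : Block N)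
    (hf : u.card ≤ f) (hg : u.card ≤ g) (hu : u.Nonempty) (hne : ∀ v ∈ V, (c v).1.Nonempty ∧ (c v).2.Nonempty) :
    monomial c V ψ f u = monomial c V ψ g u := by
  have h0 := card_pos.2 hu
  induction f generalizing g u with
  | zero => omega
  | succ f ih =>
    obtain ⟨g, rfl⟩ : ∃ g', g = g' + 1 := ⟨g - 1, by omega⟩
    rw [monomial, monomial]
    split_ifs with h
    · obtain ⟨h1, h2⟩ := hc.child_subset h
      have h3 := card_lt_card h1
      have h4 := card_lt_card h2
      obtain ⟨h5, h6⟩ := hne u h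
      rw [ih g _ (by omega) (by omega) h5 (card_pos.2 h5),
        ih g _ (by omega) (by omega) h6 (card_pos.2 h6)]
    · rfl

variable (E : Q.DualBasis)

/-- The planar trees with the underlying tree `V` on `A` whose vertices carry elements of the dual basis. -/
def planarTrees (c : Block N → Block N × Block N) (V : 𝓕 N) (A : Block N) :
    Multiset (Q.dual.Alg (Fin N) × Q.St N) :=
  (univ : Finset (V → Fin E.d)).val.map fun i =>
    (monomial c V (fun v => E.Ξ (i v)) A.card A, V, corollas c V fun v => E.X (i v))

lemma sum_map_planarTrees {M : Type*} [AddCommMonoid M] (V : 𝓕 N) (A : Block N)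
    (g : Q.dual.Alg (Fin N) × Q.St N → M) : ((planarTrees E c V A).map g).sum
      = ∑ i : V → Fin E.d, g (monomial c V (fun v => E.Ξ (i v)) A.card A, V,
        corollas c V fun v => E.X (i v)) := by
  rw [planarTrees, Multiset.map_map]
  rfl

lemma evalTrees_planarTrees (V : 𝓕 N) (A : Block N)
    (F : 𝓕 N → Q.Dec N → K) : evalTrees (planarTrees E c V A) F
      = ∑ i : V → Fin E.d, op (F V (corollas c V fun v => E.X (i v)))
        • monomial c V (fun v => E.Ξ (i v)) A.card A := by rw [evalTrees, sum_map_planarTrees]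

/-- The root sum of two collections of trees. -/
def rootSums (G : Q.MF S) (a b : Block N) (T1 T2 : Multiset (Q.dual.Alg (Fin N) × Q.St N)) :
    Q.dual.Alg (Fin N) := (T1.map fun t₁ => (T2.map fun t₂ =>
      rootSum E (G.1 (pairSt a t₁.2 t₂.2)) a b t₁.1 t₂.1).sum).sum

lemma rootSums_swap (G : Q.MF S) {a b : Block N} (hab : a ≠ b) (hS : S = {a, b})
    (T1 T2 : Multiset (Q.dual.Alg (Fin N) × Q.St N)) :
    rootSums E G b a T2 T1 = -rootSums E G a b T1 T2 := by
  have h : ∀ e, Q.node e (Q.var a) (Q.var b) ∈ Q.P S := fun e => hS ▸ node_var_mem hab e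
  have hG : ∀ t₁ t₂ : Q.St N, G.1 (pairSt b t₂ t₁) = G.1 (pairSt a t₁ t₂) := fun t₁ t₂ =>
    G.2.congr _ _ fun d hd => by
      rw [hS, mem_insert, mem_singleton] at hd
      rcases hd with rfl | rfl
      · simp [pairSt, hab]
      · simp [pairSt, hab.symm]
  rw [rootSums, rootSums, Multiset.sum_map_sum_map]
  simp only [hG, rootSum_swap E _ h, Multiset.sum_map_neg]

lemma sum_colourings {ι M : Type*} [Fintype ι] [AddCommMonoid M] {V1 V2 : 𝓕 N}
    (hA : A ∈ V) (h₁ : V1 ⊆ V) (h₂ : V2 ⊆ V) (hA1 : A ∉ V1) (hA2 : A ∉ V2)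
    (hd : ∀ v, v ∈ V1 → v ∉ V2) (hcov : ∀ v ∈ V, v ≠ A → v ∉ V1 → v ∈ V2)
    (F : ι → (V1 → ι) → (V2 → ι) → M) :
    ∑ i : V → ι, F (i ⟨A, hA⟩) (fun v => i ⟨v.1, h₁ v.2⟩) (fun v => i ⟨v.1, h₂ v.2⟩)
      = ∑ i₁, ∑ i₂, ∑ j, F j i₁ i₂ := by
  classical
  refine Eq.trans (b := ∑ p : (V1 → ι) × (V2 → ι) × ι, F p.2.2 p.1 p.2.1) (sum_bij'
    (fun i _ => (fun v => i ⟨v.1, h₁ v.2⟩, fun v => i ⟨v.1, h₂ v.2⟩, i ⟨A, hA⟩))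
    (fun p _ v => if h : v.1 ∈ V1 then p.1 ⟨v.1, h⟩ else
      if h : v.1 ∈ V2 then p.2.1 ⟨v.1, h⟩ else p.2.2)
    (fun _ _ => mem_univ _) (fun _ _ => mem_univ _) (fun i _ => ?_) (fun p _ => ?_)
    fun _ _ => rfl) ?_
  · grind
  · refine Prod.ext ?_ (Prod.ext ?_ ?_)
    · funext v
      simp
    · grind
    · simp only [hA1, hA2, dif_neg, not_false_eq_true]
  · simp only [Fintype.sum_prod_type]

lemma monomial_root (hV : IsTree A V) (hA : A ∈ V) (hc : IsPlanar V c) (ψ : V → Q.E) :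
    monomial c V ψ A.card A = Q.node (ψ ⟨A, hA⟩)
      (monomial c (V.filter (· ⊆ (c A).1)) (fun v => ψ ⟨v.1, (mem_filter.1 v.2).1⟩)
        (c A).1.card (c A).1)
      (monomial c (V.filter (· ⊆ (c A).2)) (fun v => ψ ⟨v.1, (mem_filter.1 v.2).1⟩)
        (c A).2.card (c A).2) := by
  have hne : ∀ v ∈ V, (c v).1.Nonempty ∧ (c v).2.Nonempty := fun v hv =>
    ⟨hV.edge_nonempty (mem_inp.1 (hc.child_mem hv).1).1,
      hV.edge_nonempty (mem_inp.1 (hc.child_mem hv).2).1⟩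
  have h1 := card_lt_card (hc.child_subset hA).1
  have h2 := card_lt_card (hc.child_subset hA).2
  obtain ⟨f, hf⟩ : ∃ f, A.card = f + 1 := ⟨A.card - 1, by omega⟩
  rw [hf, monomial, dif_pos hA,
    monomial_depth hc _ f (c A).1.card _ (by omega) le_rfl (hne A hA).1 hne,
    monomial_depth hc _ f (c A).2.card _ (by omega) le_rfl (hne A hA).2 hne,
    monomial_filter hc _ (c A).1 _ _ le_rfl, monomial_filter hc _ (c A).2 _ _ le_rfl]

lemma spl_corollas (ψ : V → Q.E) (d : Block N) : spl V (corollas c V ψ) d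
    = (V.filter (· ⊆ d), corollas c (V.filter (· ⊆ d))
      fun v => ψ ⟨v.1, (mem_filter.1 v.2).1⟩) := by
  refine Prod.ext rfl ?_
  funext v
  have h : (spl V (corollas c V ψ) d).2 v = if v ⊆ d then corollas c V ψ v else 0 := rfl
  rw [h]
  change _ = corollas c (V.filter (· ⊆ d)) (fun v => ψ ⟨v.1, (mem_filter.1 v.2).1⟩) v
  by_cases h2 : v ⊆ d
  · rw [if_pos h2]
    by_cases h1 : v ∈ V
    · rw [corollas_of_mem h1, corollas_of_mem (mem_filter.2 ⟨h1, h2⟩)]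
    · rw [corollas_of_notMem h1, corollas_of_notMem fun h' => h1 (mem_filter.1 h').1]
  · have h3 : v ∉ V.filter (· ⊆ d) := fun h' => h2 (mem_filter.1 h').2
    rw [if_neg h2, corollas_of_notMem h3]

lemma rootSums_planarTrees (G : Q.MF S) (a b : Block N) (V1 V2 : 𝓕 N) :
    rootSums E G a b (planarTrees E c V1 a) (planarTrees E c V2 b)
      = ∑ i₁ : V1 → Fin E.d, ∑ i₂ : V2 → Fin E.d,
        rootSum E (G.1 (pairSt a (V1, corollas c V1 fun v => E.X (i₁ v))
          (V2, corollas c V2 fun v => E.X (i₂ v)))) a b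
          (monomial c V1 (fun v => E.Ξ (i₁ v)) a.card a)
          (monomial c V2 (fun v => E.Ξ (i₂ v)) b.card b) := by
  rw [rootSums, sum_map_planarTrees]
  exact sum_congr rfl fun i₁ _ => sum_map_planarTrees E V2 b _

/-- The sum over the colourings of a planar tree, in terms of the two trees at the root. -/
lemma evalTrees_planarTrees_root (hV : IsTree A V) (hA : A ∈ V) (hc : IsPlanar V c)
    (Φ : Q.cobar A) : evalTrees (planarTrees E c V A) Φ.1
      = sgn (shx (inp V A) fun b => eA b V) • rootSums E (splitG (hV.isPart_inp hA) Φ) (c A).1 (c A).2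
        (planarTrees E c (V.filter (· ⊆ (c A).1)) (c A).1)
        (planarTrees E c (V.filter (· ⊆ (c A).2)) (c A).2) := by
  obtain ⟨hab, hS⟩ := hc A hA
  have hP := hV.isPart_inp hA
  set a := (c A).1 with ha_def
  set b := (c A).2 with hb_def
  have ha : a ∈ inp V A := by rw [hS]; simp
  have hb : b ∈ inp V A := by rw [hS]; simp
  set V1 := V.filter (· ⊆ a) with hV1
  set V2 := V.filter (· ⊆ b) with hV2
  have hA1 : A ∉ V1 := fun h => (mem_inp.1 ha).2.1.2 (mem_filter.1 h).2
  have hA2 : A ∉ V2 := fun h => (mem_inp.1 hb).2.1.2 (mem_filter.1 h).2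
  have hd : ∀ v, v ∈ V1 → v ∉ V2 := fun u hu hu' => hab (hP.eq_of_subset ha hb
    (hV.edge_nonempty (.inl (mem_filter.1 hu).1)) (mem_filter.1 hu).2
    (mem_filter.1 hu').2)
  have hcov : ∀ v ∈ V, v ≠ A → v ∉ V1 → v ∈ V2 := fun u hu hne h1 => by
    obtain ⟨w, hw, huw⟩ := inp_cover (.inl hu) (lt_of_le_of_ne (hV.sub u hu) hne)
    rw [hS, mem_insert, mem_singleton] at hw
    rcases hw with rfl | rfl
    · exact (h1 (mem_filter.2 ⟨hu, huw⟩)).elim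
    · exact mem_filter.2 ⟨hu, huw⟩
  have h₁ : V1 ⊆ V := filter_subset _ _
  have h₂ : V2 ⊆ V := filter_subset _ _
  have hspl : ∀ i : V → Fin E.d, ∀ d ∈ inp V A, spl V (corollas c V fun v => E.X (i v)) d
      = pairSt a (V1, corollas c V1 fun v => E.X (i ⟨v.1, h₁ v.2⟩))
        (V2, corollas c V2 fun v => E.X (i ⟨v.1, h₂ v.2⟩)) d := fun i d hdS => by
    rw [spl_corollas]
    rw [hS, mem_insert, mem_singleton] at hdS
    rcases hdS with rfl | rfl
    · rw [pairSt, if_pos rfl]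
    · rw [pairSt, if_neg hab.symm]
  set G := splitG hP Φ with hG
  have hL : ∀ i : V → Fin E.d, op (Φ.1 V (corollas c V fun v => E.X (i v)))
        • monomial c V (fun v => E.Ξ (i v)) A.card A
      = sgn (shx (inp V A) fun b => eA b V) •
        op (ev (G.1 (pairSt a (V1, corollas c V1 fun v => E.X (i ⟨v.1, h₁ v.2⟩))
          (V2, corollas c V2 fun v => E.X (i ⟨v.1, h₂ v.2⟩))))
          (Q.node (E.X (i ⟨A, hA⟩)) (Q.var a) (Q.var b))) •
        Q.dual.node (E.Ξ (i ⟨A, hA⟩)) (monomial c V1 (fun v => E.Ξ (i ⟨v.1, h₁ v.2⟩)) a.card a)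
          (monomial c V2 (fun v => E.Ξ (i ⟨v.1, h₂ v.2⟩)) b.card b) := fun i => by
    have hm := corollas_valid hc fun v => E.X (i v)
    have hmA : corollas c V (fun v => E.X (i v)) A
        = Q.node (E.X (i ⟨A, hA⟩)) (Q.var a) (Q.var b) := corollas_of_mem hA _
    have hmem := hm.mem A hA
    rw [monomial_root hV hA hc, split_apply hV hA Φ hm, G.2.congr _ _ (hspl i), MulOpposite.op_smul, smul_assoc]
    rw [hmA] at hmem
    rw [ev_of_mem _ hmem]
    simp only [hmA]
    rfl
  rw [evalTrees_planarTrees, rootSums_planarTrees, sum_congr rfl fun i _ => hL i, ← smul_sum]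
  refine congrArg (fun x => sgn (shx (inp V A) fun b => eA b V) • x) ?_
  exact sum_colourings hA h₁ h₂ hA1 hA2 hd hcov fun j i₁ i₂ =>
    op (ev (G.1 (pairSt a (V1, corollas c V1 fun v => E.X (i₁ v))
        (V2, corollas c V2 fun v => E.X (i₂ v)))) (Q.node (E.X j) (Q.var a) (Q.var b))) •
      Q.dual.node (E.Ξ j) (monomial c V1 (fun v => E.Ξ (i₁ v)) a.card a)
        (monomial c V2 (fun v => E.Ξ (i₂ v)) b.card b)

end QuadraticData

namespace QuadraticData

/-! ### The canonical element over a fixed tree -/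

variable (E : Q.DualBasis)

open scoped Classical in
/-- The part of the canonical element over the tree `V`. -/
def treesOver (V : 𝓕 N) (A : Block N) : Multiset (Q.dual.Alg (Fin N) × Q.St N) :=
  ((BT E A).filter fun t => t.2.1 = V).map fun t => ((t.1 : Q.dual.Alg (Fin N)), t.2)

open scoped Classical in
lemma sum_map_treesOver {M : Type*} [AddCommMonoid M] (V : 𝓕 N) (A : Block N)
    (g : Q.dual.Alg (Fin N) × Q.St N → M) : ((treesOver E V A).map g).sum
      = bsum E A fun t => if t.2.1 = V then g (t.1, t.2) else 0 := by
  rw [treesOver, bsum, Multiset.map_map]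
  induction BT E A using Multiset.induction_on with
  | empty => rfl
  | cons t T ih =>
    rw [Multiset.map_cons, Multiset.sum_cons, ← ih]
    by_cases h : t.2.1 = V
    · rw [Multiset.filter_cons_of_pos (p := fun t : Q.Tr A => t.2.1 = V) T h, if_pos h, Multiset.map_cons, Multiset.sum_cons]
      rfl
    · rw [Multiset.filter_cons_of_neg (p := fun t : Q.Tr A => t.2.1 = V) T h, if_neg h, zero_add]

lemma eq_of_mem_splits {p p' : Block N × Block N} (hp : p ∈ splits A) (hp' : p' ∈ splits A)
    (h : ({p.1, p.2} : 𝓕 N) = {p'.1, p'.2}) : p = p' := by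
  have h1 := (mem_splits.1 hp).2.2.2.2
  have h2 := (mem_splits.1 hp').2.2.2.2
  have h3 : p.1 ∈ ({p'.1, p'.2} : 𝓕 N) := h ▸ by simp
  have h4 : p.2 ∈ ({p'.1, p'.2} : 𝓕 N) := h ▸ by simp
  rw [mem_insert, mem_singleton] at h3 h4
  rcases h3 with h3 | h3 <;> rcases h4 with h4 | h4
  · rw [h3, h4] at h1; exact absurd h1 (lt_irrefl _)
  · exact Prod.ext h3 h4
  · rw [h3, h4] at h1; exact absurd h1 (lt_asymm h2)
  · rw [h3, h4] at h1; exact absurd h1 (lt_irrefl _)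

lemma evalTrees_treesOver_node (h2 : 2 ≤ A.card) (hV : IsTree A V) {p : Block N × Block N}
    (hp : p ∈ splits A) (hP : IsPart A S) (hSp : S = {p.1, p.2}) (hSV : inp V A = S)
    (Φ : Q.cobar A) : evalTrees (treesOver E V A) Φ.1
      = rootSums E (splitG hP Φ) p.1 p.2 (treesOver E (V.filter (· ⊆ p.1)) p.1)
        (treesOver E (V.filter (· ⊆ p.2)) p.2) := by
  classical
  subst hSp
  have hne := ne_of_mem_splits hp
  have hA : A ∈ V := hV.top h2
  rw [evalTrees, rootSums, sum_map_treesOver, sum_map_treesOver, bsum_node E h2,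
    sum_eq_single_of_mem p hp, ← bsum_sum]
  · refine bsum_congr E fun t₁ ht1 => ?_
    rw [← bsum_sum]
    have h1 := (BT_spec E p.1 t₁ ht1).1
    by_cases e₁ : t₁.2.1 = V.filter (· ⊆ p.1)
    swap
    · rw [if_neg e₁]
      refine Eq.trans (bsum_congr E fun t₂ ht2 => ?_) (bsum_zero E)
      refine sum_eq_zero fun i _ => if_neg fun h => e₁ ?_
      have hg := pairSt_good hne h1 (BT_spec E p.2 t₂ ht2).1
      have h3 := glueV_filter hP (fun b hb => (hg b hb).1) (show p.1 ∈ _ by simp)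
      have h4 : (V.filter (· ⊆ p.1)) = (pairSt p.1 t₁.2 t₂.2 p.1).1 := by rw [← h3, ← h]; rfl
      rw [h4, pairSt, if_pos rfl]
    rw [if_pos e₁, sum_map_treesOver]
    refine bsum_congr E fun t₂ ht2 => ?_
    have hg := pairSt_good hne h1 (BT_spec E p.2 t₂ ht2).1
    by_cases e₂ : t₂.2.1 = V.filter (· ⊆ p.2)
    swap
    · rw [if_neg e₂]
      refine sum_eq_zero fun i _ => if_neg fun h => e₂ ?_
      have h3 := glueV_filter hP (fun b hb => (hg b hb).1) (show p.2 ∈ _ by simp)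
      have h4 : (V.filter (· ⊆ p.2)) = (pairSt p.1 t₁.2 t₂.2 p.2).1 := by rw [← h3, ← h]; rfl
      rw [h4, pairSt, if_neg hne.symm]
    rw [if_pos e₂, rootSum_apply]
    refine sum_congr rfl fun i _ => ?_
    have h3 : (graft E A p.1 p.2 i t₁ t₂).2.1 = V := by
      have h4 := hV.eq_glueV hA
      rw [hSV] at h4
      refine Eq.trans (glueV_congr fun b hb => ?_) h4
      rcases mem_insert.1 hb with rfl | hb
      · rw [pairSt, if_pos rfl, e₁]
      · rw [mem_singleton.1 hb, pairSt, if_neg hne.symm, e₂]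
    rw [if_pos h3, ev_of_mem _ (node_var_mem hne _), splitG_apply hP Φ hg, coe_graft_fst E hp,
      MulOpposite.op_smul, smul_assoc, smul_comm]
    rfl
  · intro p' hp' hpp
    refine sum_eq_zero fun i _ => (bsum_congr E fun t₁ ht1 => (bsum_congr E fun t₂ ht2 =>
      ?_).trans (bsum_zero E)).trans (bsum_zero E)
    refine if_neg fun h => hpp (eq_of_mem_splits hp' hp ?_)
    have hg := pairSt_good (ne_of_mem_splits hp') (BT_spec E p'.1 t₁ ht1).1
      (BT_spec E p'.2 t₂ ht2).1
    rw [← hSV, ← h]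
    exact (jV_inp (isPart_splits hp') hg).symm

lemma evalTrees_leaf (x : Fin N) (Φ : Q.cobar {x}) :
    evalTrees (planarTrees E c ∅ {x}) Φ.1 = evalTrees (treesOver E ∅ {x}) Φ.1 := by
  rw [evalTrees_planarTrees, evalTrees, sum_map_treesOver, bsum_leaf E (card_singleton x),
    Fintype.sum_unique]
  refine Eq.trans ?_ (if_pos rfl).symm
  have h1 : ∀ ψ : (∅ : 𝓕 N) → Q.E, corollas c ∅ ψ = 0 := fun ψ => by
    funext v
    exact corollas_of_notMem (notMem_empty v) ψ
  rw [h1, coe_leafTr_fst, card_singleton, monomial, dif_neg (notMem_empty _),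
    sum_singleton]
  rfl

lemma biadditive_zsmul {M M' M'' : Type*} [AddCommGroup M] [AddCommGroup M'] [AddCommGroup M'']
    (H : M →+ M' →+ M'') (m n : ℤ) (x : M) (y : M') : H (m • x) (n • y) = (m * n) • H x y := by
  rw [map_zsmul, mul_comm, mul_smul]
  exact congrArg (n • ·) (map_zsmul (H.flip y) m x)

/-- Over a fixed binary tree, the canonical element is the sum over the colourings of any planar
structure, with the orientation that is given by the planar structure. -/
lemma wedgeSign_smul_evalTrees [FiniteDimensional k K] [FiniteDimensional k Q.E]
    [IsSemisimpleRing K] (hV : IsTree A V) (hA : A.Nonempty)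
    (hc : IsPlanar V c) (Φ : Q.cobar A) :
    wedgeSign (childList c V.toList) • evalTrees (planarTrees E c V A) Φ.1
      = evalTrees (treesOver E V A) Φ.1 := by
  induction h : A.card using Nat.strong_induction_on generalizing A V with
  | _ n ih =>
    subst h
    rcases Nat.lt_or_ge A.card 2 with h2 | h2
    · obtain ⟨x, rfl⟩ := card_eq_one.1 (le_antisymm (by omega) (card_pos.2 hA))
      obtain rfl := hV.eq_empty (by simp)
      rw [evalTrees_leaf]
      simp [childList, wedgeSign]
    have hAV := hV.top h2
    obtain ⟨hab, hS⟩ := hc A hAV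
    have hP := hV.isPart_inp hAV
    obtain ⟨s₁, s₂⟩ := hc.child_subset hAV
    obtain ⟨m1, m2⟩ := hc.child_mem hAV
    have n₁ := hP.nonempty _ m1
    have n₂ := hP.nonempty _ m2
    have B : ∀ b : Block N, Q.Frame b := fun b => (Q.nonempty_frame b).some
    have key1 : wedgeSign (childList c V.toList) • evalTrees (planarTrees E c V A) Φ.1
        = wedgeSign [(c A).1, (c A).2] • rootSums E (splitG hP Φ) (c A).1 (c A).2
          (treesOver E (V.filter (· ⊆ (c A).1)) (c A).1)
          (treesOver E (V.filter (· ⊆ (c A).2)) (c A).2) := by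
      rw [evalTrees_planarTrees_root E hV hAV hc, hc.wedgeSign_root hV hAV, smul_smul, mul_assoc,
        sgn_mul_self, mul_one, rootSums, sum_rootSum E B hab hS, rootSums,
        sum_rootSum E B hab hS, mul_assoc, mul_smul]
      refine congrArg (fun x => wedgeSign [(c A).1, (c A).2] • x) ?_
      rw [smul_sum]
      refine sum_congr rfl fun l _ => ?_
      rw [smul_sum]
      refine sum_congr rfl fun l' _ => ?_
      rw [← ih _ (card_lt_card s₁) (hV.filter (mem_inp.1 m1).1) n₁ (hc.filter _) _ rfl,
        ← ih _ (card_lt_card s₂) (hV.filter (mem_inp.1 m2).1) n₂ (hc.filter _) _ rfl,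
        biadditive_zsmul]
    rw [key1]
    have hun : (c A).1 ∪ (c A).2 = A := by
      refine Finset.Subset.antisymm (Finset.union_subset s₁.1 s₂.1) fun x hx => ?_
      obtain ⟨b, hb, hxb⟩ := hP.cover x hx
      rw [hS, mem_insert, mem_singleton] at hb
      rcases hb with rfl | rfl
      exacts [mem_union_left _ hxb, Finset.mem_union_right _ hxb]
    have hdj := hP.disj _ m1 _ m2 hab
    rcases lt_or_gt_of_ne fun h => hab (key_injective h) with hk | hk
    · rw [evalTrees_treesOver_node E h2 hV (p := ((c A).1, (c A).2))
        (mem_splits.2 ⟨hdj, hun, n₁, n₂, hk⟩) hP hS rfl]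
      simp [wedgeSign, lt_asymm hk]
    · rw [evalTrees_treesOver_node E h2 hV (p := ((c A).2, (c A).1))
        (mem_splits.2 ⟨hdj.symm, by rw [Finset.union_comm]; exact hun, n₂, n₁, hk⟩) hP
        (hS.trans (Finset.pair_comm _ _)) rfl, rootSums_swap E _ hab hS]
      simp [wedgeSign, hk]

end QuadraticData

lemma RTree.isTree (T : RTree N) : IsTree univ T.verts :=
  ⟨fun _ _ => subset_univ _, fun _ => T.univ_mem, T.two_le_card, T.laminar⟩

/-- A tree on the set of all leaves as a reduced tree. -/
def IsTree.toRTree (hN : 2 ≤ N) (hV : IsTree univ V) : RTree N :=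
  ⟨V, hV.top (by rwa [card_fin]), hV.two, hV.lam⟩

lemma eA_univ (V : 𝓕 N) (hN : 2 ≤ N) :
    eA univ V = V.erase univ ∪ RTree.leafEdges N := by
  ext u
  rw [mem_eA, mem_union, mem_erase, mem_leafEdges]
  constructor
  · rintro ⟨h | h, h2⟩
    exacts [.inl ⟨h2.ne, h⟩, .inr h]
  · rintro (⟨h, h2⟩ | ⟨i, rfl⟩)
    · exact ⟨.inl h2, lt_of_le_of_ne (subset_univ _) h⟩
    · refine ⟨.inr ⟨i, rfl⟩, lt_of_le_of_ne (subset_univ _) fun h => ?_⟩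
      have := congrArg Finset.card h
      rw [card_singleton, card_fin] at this
      omega

namespace QuadraticData

/-! ### The complex D(P)(n) as the cobar complex of the set of all leaves -/

/-- The family of forms on the reduced trees that is given by an element of the cobar complex. -/
def restr : Q.cobar 𝕌 →+ Q.Cochain N :=
  AddMonoidHom.mk' (fun Φ T m => Φ.1 T.verts (extDec T.verts m)) fun _ _ => rfl

lemma restr_apply (Φ : Q.cobar 𝕌) (T : RTree N) (m : Q.Deco T) :
    restr Φ T m = Φ.1 T.verts (extDec T.verts m) := rfl

lemma extDec_of_mem (d : (v : V) → Q.P (inp V v.1)) (hv : v ∈ V) :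
    extDec V d v = (d ⟨v, hv⟩).1 := dif_pos hv

lemma extDec_of_notMem (d : (v : V) → Q.P (inp V v.1)) (hv : v ∉ V) :
    extDec V d v = 0 := dif_neg hv

lemma restr_update (Φ : Q.cobar 𝕌) (T : RTree N) (m : Q.Deco T) (v : T.verts)
    (x : Q.P (T.inputs v.1)) : restr Φ T (update m v x)
      = Φ.1 T.verts (update (extDec T.verts m) v.1 x.1) :=
  congrArg (Φ.1 T.verts) (extDec_update m v x)

lemma isForm_restr (Φ : Q.cobar 𝕌) (T : RTree N) :
    Q.IsForm T (restr Φ T) where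
  map_add m v x y := by
    rw [restr_update, restr_update, restr_update]
    exact (Φ.2.isFm _ T.isTree).add (extDec_valid m) v.2 x.2 y.2
  map_smul m v c x := by
    rw [restr_update, restr_update]
    exact (Φ.2.isFm _ T.isTree).smul (extDec_valid m) v.2 c x.2
  root m a := by
    have h := (Φ.2.isFm _ T.isTree).root _ (extDec_valid m) T.univ_mem a
    rw [extDec_of_mem m T.univ_mem] at h
    rw [restr_update]
    exact h
  balance m v w a hvw := by
    have h := (Φ.2.isFm _ T.isTree).bal _ (extDec_valid m) v.1 v.2 w.1 w.2 hvw a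
    rw [extDec_of_mem m v.2, extDec_of_mem m w.2] at h
    rw [restr_update, restr_update]
    exact h

lemma restr_injective (hN : 2 ≤ N) :
    Function.Injective (restr (Q := Q) (N := N)) := fun Φ Ψ h => cobar_ext fun V hV m hm => by
  rw [hm.eq_extDec]
  exact congrFun (congrFun h (hV.toRTree hN)) _

/-- The values of a decoration at the vertices. -/
def Valid.dec (hm : Q.Valid V m) (v : V) : Q.P (inp V v.1) := ⟨m v.1, hm.mem v.1 v.2⟩

lemma Valid.dec_update [DecidableEq V] (hm : Q.Valid V m) (hv : v ∈ V)
    {x : Q.Alg (Block N)} (hx : x ∈ Q.P (inp V v)) (h : Q.Valid V (update m v x)) :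
    h.dec = update hm.dec ⟨v, hv⟩ ⟨x, hx⟩ := by
  funext u
  by_cases hu : u = ⟨v, hv⟩
  · subst hu
    rw [update_self]
    exact Subtype.ext (show update m v x v = x from update_self v x m)
  · rw [update_of_ne hu]
    exact Subtype.ext (show update m v x u.1 = m u.1 from
      update_of_ne (fun h' => hu (Subtype.ext h')) x m)

lemma exists_restr_eq (hN : 2 ≤ N) {F : Q.Cochain N} (hF : ∀ T, Q.IsForm T (F T)) :
    ∃ Φ, restr Φ = F := by
  classical
  let f : Q.BF N := fun V m => if h : IsTree univ V ∧ Q.Valid V m then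
    F (h.1.toRTree hN) h.2.dec else 0
  have hf : ∀ {V} (hV : IsTree univ V) {m} (hm : Q.Valid V m),
      f V m = F (hV.toRTree hN) hm.dec := fun hV _ hm => dif_pos ⟨hV, hm⟩
  have hmem : f ∈ Q.cobar 𝕌 := by
    refine mem_cobar.2 ⟨fun V hV => ⟨fun m hm => dif_neg fun h => hm h.2,
      fun m hm v hv c x hx y hy => ?_, fun m hm hA a => ?_,
      fun m hm v hv u hu hvu a => ?_⟩, fun V hV => ?_⟩
    · have hz := Submodule.smul_mem _ c hx
      rw [hf hV (hm.set hv (Submodule.add_mem _ hz hy)), hf hV (hm.set hv hx),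
        hf hV (hm.set hv hy), hm.dec_update hv (Submodule.add_mem _ hz hy),
        hm.dec_update hv hx, hm.dec_update hv hy]
      have h := hF (hV.toRTree hN)
      exact (h.map_add hm.dec ⟨v, hv⟩ ⟨_, hz⟩ ⟨y, hy⟩).trans
        (congrArg (· + _) (h.map_smul hm.dec ⟨v, hv⟩ c ⟨x, hx⟩))
    · rw [hf hV (hm.smul hA a), hf hV hm, hm.dec_update hA (Q.smul_mem_P a (hm.mem _ hA))]
      exact (hF (hV.toRTree hN)).root hm.dec a
    · rw [hf hV (hm.ract hu v a), hf hV (hm.smul hv a),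
        hm.dec_update hu (Q.ract_mem v a (hm.mem _ hu)),
        hm.dec_update hv (Q.smul_mem_P a (hm.mem _ hv))]
      exact (hF (hV.toRTree hN)).balance hm.dec ⟨v, hv⟩ ⟨u, hu⟩ a hvu
    · funext m
      exact dif_neg fun h => hV h.1
  refine ⟨⟨f, hmem⟩, ?_⟩
  funext T m
  rw [restr_apply]
  refine (hf T.isTree (extDec_valid m)).trans ?_
  refine congrArg (F T) (funext fun v => Subtype.ext ?_)
  exact extDec_of_mem m v.2

lemma ctr_extDec (T : RTree N) (e : T.internal) (m : Q.Deco T) :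
    Q.ctr T.verts e.1 (extDec T.verts m)
      = extDec (T.contract e.1 e.2.2).verts (Q.contractDeco T e m) := by
  have hval := (extDec_valid m).ctr T.isTree e.2.1
  funext v
  by_cases hv : v ∈ T.verts.erase e.1
  · refine Eq.trans ?_ (extDec_of_mem (V := (T.contract e.1 e.2.2).verts) (Q.contractDeco T e m) hv).symm
    obtain ⟨hve, hvT⟩ := mem_erase.1 hv
    rw [contractDeco]
    by_cases h : e.1 ∈ T.inputs v
    · rw [dif_pos h, ctr_of_mem h, extDec_of_mem m e.2.1, extDec_of_mem m hvT]
    · rw [dif_neg h, ctr_of_notMem hve h, extDec_of_mem m hvT]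
  · rw [hval.zero v hv]
    exact (extDec_of_notMem (V := (T.contract e.1 e.2.2).verts) _ hv).symm

/-- The differential of D(P)(n) is the one of the cobar complex of the set of all leaves. -/
lemma δ_restr (hN : 2 ≤ N) (Φ : Q.cobar 𝕌) :
    Q.δ (restr Φ) = restr (Q.δc _ Φ) := by
  funext T m
  rw [restr_apply, δc_apply, dif_of T.isTree (extDec_valid m), eA_univ _ hN,
    Finset.sum_subtype (T.verts.erase univ) (p := fun e => e ∈ T.verts ∧ e ≠ univ)
      fun e => by rw [mem_erase, and_comm]]
  change (∑ e : T.internal, ((-1) ^ inv e.1 (T.verts.erase univ ∪ RTree.leafEdges N) : ℤ) •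
      restr Φ (T.contract e.1 e.2.2) (Q.contractDeco T e m)) = _
  refine sum_congr rfl fun e _ => ?_
  rw [ctr_extDec T e m]
  rfl

end QuadraticData

/-- A tree with the maximal number of vertices is binary. -/
lemma IsTree.card_inp_of_card (hV : IsTree A V)
    (h : V.card + 1 = A.card) (hv : v ∈ V) : (inp V v).card = 2 := by
  have h2 : 2 ≤ A.card := (hV.two v hv).trans (card_le_card (hV.sub v hv))
  have h3 := hV.card_eA h2
  rw [hV.eA_eq_biUnion, card_biUnion hV.inp_disjoint] at h3
  have h4 : ∀ v ∈ V, 2 ≤ (inp V v).card := fun v hv => (hV.isPart_inp hv).two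
  have h5 : ∑ v ∈ V, 2 = ∑ v ∈ V, (inp V v).card := by rw [sum_const, smul_eq_mul]; omega
  exact ((Finset.sum_eq_sum_iff_of_le h4).1 h5 v hv).symm

open scoped Classical in
/-- The chosen planar structure of a binary tree. -/
def RTree.children {T : RTree N} (h : T.IsBinary) (v : Block N) : Block N × Block N :=
  if hv : v ∈ T.verts then (T.child₁ h ⟨v, hv⟩, T.child₂ h ⟨v, hv⟩) else (∅, ∅)

lemma RTree.children_of_mem {T : RTree N} (h : T.IsBinary) (hv : v ∈ T.verts) :
    T.children h v = (T.child₁ h ⟨v, hv⟩, T.child₂ h ⟨v, hv⟩) := dif_pos hv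

lemma RTree.isPlanar_children {T : RTree N} (h : T.IsBinary) : IsPlanar T.verts (T.children h) :=
  fun v hv => by
    rw [T.children_of_mem h hv]
    exact ⟨T.child_ne h ⟨v, hv⟩, T.inputs_eq h ⟨v, hv⟩⟩

lemma RTree.orientation_eq {T : RTree N} (h : T.IsBinary) :
    T.orientation h = wedgeSign (childList (T.children h) T.verts.toList) := by
  have h1 : (univ.toList.flatMap fun v : T.verts => [T.child₁ h v, T.child₂ h v])
      = childList (T.children h) ((univ : Finset T.verts).toList.map Subtype.val) := by
    rw [childList, List.flatMap_map]
    refine List.flatMap_congr fun v _ => ?_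
    rw [T.children_of_mem h v.2]
  rw [RTree.orientation, h1]
  refine (T.isPlanar_children h).wedgeSign_perm T.isTree ?_ fun v hv => ?_
  · refine List.perm_of_nodup_nodup_toFinset_eq
      ((nodup_toList _).map Subtype.val_injective) (nodup_toList _) ?_
    ext v
    simp
  · obtain ⟨v, -, rfl⟩ := List.mem_map.1 hv
    exact v.2

namespace QuadraticData

lemma monomial_eq_build {T : RTree N} (h : T.IsBinary) (ψ : T.verts → Q.E) (f : ℕ) (u : Block N) :
    monomial (T.children h) T.verts ψ f u = Q.build h ψ f u := by
  induction f generalizing u with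
  | zero => rfl
  | succ f ih =>
    rw [monomial, build]
    by_cases hu : u ∈ T.verts
    · rw [dif_pos hu, dif_pos hu, ih, ih, T.children_of_mem h hu]
    · rw [dif_neg hu, dif_neg hu]

lemma corollas_eq_extDec {T : RTree N} (h : T.IsBinary) (ψ : T.verts → Q.E) :
    corollas (T.children h) T.verts ψ = extDec T.verts fun v => Q.corolla T h v (ψ v) := by
  funext v
  by_cases hv : v ∈ T.verts
  · rw [corollas_of_mem hv, T.children_of_mem h hv]
    exact (extDec_of_mem (V := T.verts) (fun v => Q.corolla T h v (ψ v)) hv).symm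
  · rw [corollas_of_notMem hv]
    exact (extDec_of_notMem (V := T.verts) (fun v => Q.corolla T h v (ψ v)) hv).symm

variable (E : Q.DualBasis)

lemma coe_γc (Φ : Q.cobar A) : (γc E A Φ : Q.dual.Alg (Fin N))
    = bsum E A fun t => op (Φ.1 t.2.1 t.2.2) • (t.1 : Q.dual.Alg (Fin N)) := by
  rw [γc_apply]
  exact map_bsum E (Q.dual.P A).subtype.toAddMonoidHom _

lemma sum_treesOver (hN : 2 ≤ N) (Φ : Q.cobar 𝕌) :
    ∑ T : {T : RTree N // T.IsBinary}, evalTrees (treesOver E T.1.verts univ) Φ.1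
      = γc E univ Φ := by
  classical
  simp only [evalTrees, sum_map_treesOver]
  rw [coe_γc, ← bsum_sum]
  refine bsum_congr E fun t ht => ?_
  obtain ⟨⟨h1, -⟩, h2⟩ := BT_spec E _ t ht
  rw [sum_eq_single_of_mem ⟨h1.toRTree hN, fun v hv => h1.card_inp_of_card h2 hv⟩
    (mem_univ _)]
  · exact if_pos rfl
  · rintro ⟨T, hT⟩ - hne
    refine if_neg fun h => hne (Subtype.ext ?_)
    cases T
    subst h
    rfl

/-- The canonical morphism on D(P)(n) is the one on the cobar complex of the set of all leaves. -/
lemma γ_restr [FiniteDimensional k K] [FiniteDimensional k Q.E] [IsSemisimpleRing K]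
    (hN : 2 ≤ N) (Φ : Q.cobar 𝕌) :
    Q.γ E (restr Φ) = γc E univ Φ := by
  refine Subtype.ext ?_
  rw [← sum_treesOver E hN]
  have hne : (𝕌).Nonempty := card_pos.1 (by rw [card_fin]; omega)
  change ((∑ T : {T : RTree N // T.IsBinary}, RTree.orientation T.2 •
    ∑ i : T.1.verts → Fin E.d,
      Q.dual.lactP _ (op (restr Φ T.1 fun v => Q.corolla T.1 T.2 v (E.X (i v))))
        (Q.dual.treeMonomial T.2 fun v => E.Ξ (i v)) : Q.dual.P 𝕌) :
    Q.dual.Alg (Fin N)) = _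
  rw [AddSubmonoidClass.coe_finsetSum]
  refine sum_congr rfl fun T _ => ?_
  rw [← wedgeSign_smul_evalTrees E T.1.isTree hne (T.1.isPlanar_children T.2),
    evalTrees_planarTrees, ← T.1.orientation_eq T.2]
  refine congrArg (fun x => T.1.orientation T.2 • x) ?_
  rw [AddSubmonoidClass.coe_finsetSum]
  refine sum_congr rfl fun i _ => ?_
  rw [corollas_eq_extDec, monomial_eq_build, card_fin]
  rfl

/-! ### The Koszul condition as the exactness of the cobar complexes -/

/-- The part of degree -j. -/
abbrev degPrj (j : ℕ) : Module.End Kᵐᵒᵖ (Q.cobar 𝕌) :=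
  Q.prj univ fun V => V.card + j + 1 = N

lemma restr_mem_D (hN : 2 ≤ N) {j : ℕ} (Φ : Q.cobar 𝕌) :
    restr Φ ∈ Q.D N j ↔ degPrj j Φ = Φ := by
  constructor
  · refine fun h => cobar_ext fun V hV m hm => ?_
    rw [prj_apply]
    by_cases hj : V.card + j + 1 = N
    · rw [if_pos hj]
    · rw [if_neg hj, hm.eq_extDec]
      exact (congrFun ((h (hV.toRTree hN)).2 hj) _).symm
  · refine fun h T => ⟨isForm_restr Φ T, fun hj => ?_⟩
    funext m
    rw [← h, restr_apply, prj_apply, if_neg hj]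
    rfl

lemma exists_of_mem_D (hN : 2 ≤ N) {j : ℕ} {F : Q.Cochain N} (hF : F ∈ Q.D N j) :
    ∃ Φ, degPrj j Φ = Φ ∧ restr Φ = F := by
  obtain ⟨Φ, rfl⟩ := exists_restr_eq hN fun T => (hF T).1
  exact ⟨Φ, (restr_mem_D hN Φ).1 hF, rfl⟩

lemma δc_degPrj (j : ℕ) (Φ : Q.cobar 𝕌) :
    Q.δc _ (degPrj (j + 1) Φ) = degPrj j (Q.δc _ Φ) :=
  LinearMap.congr_fun (δc_prj _ _ fun V _ e he _ => by
    have := card_erase_add_one he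
    omega) Φ

lemma δc_degPrj_zero (hN : 2 ≤ N) (Φ : Q.cobar 𝕌) :
    Q.δc _ (degPrj 0 Φ) = 0 := by
  have h1 : Q.δc 𝕌 * degPrj 0 = Q.prj _ (fun V => V.card = N) * Q.δc _ :=
    δc_prj _ _ fun V _ e he _ => by
      have := card_erase_add_one he
      omega
  rw [prj_false (fun V => V.card = N) fun V hV h => by
    have h2 := hV.card_le (card_pos.1 (by rw [card_fin]; omega))
    rw [card_fin] at h2
    omega, zero_mul] at h1
  exact LinearMap.congr_fun h1 Φ

lemma degPrj_degPrj (j : ℕ) (Φ : Q.cobar 𝕌) :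
    degPrj j (degPrj j Φ) = degPrj j Φ :=
  LinearMap.congr_fun (prj_mul _ _ _ fun _ _ => and_self_iff) Φ

lemma γc_degPrj_zero (Φ : Q.cobar 𝕌) :
    γc E _ (degPrj 0 Φ) = γc E _ Φ :=
  LinearMap.congr_fun (γc_prj (A := univ) E (fun V => V.card + 0 + 1 = N) fun V _ h => by
    rw [h, card_fin]) Φ

lemma γc_degPrj_succ (j : ℕ) (Φ : Q.cobar 𝕌) :
    γc E _ (degPrj (j + 1) Φ) = 0 :=
  LinearMap.congr_fun (γc_prj_of_not (A := univ) E (fun V => V.card + (j + 1) + 1 = N)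
    fun V _ h => by rw [card_fin] at h; omega) Φ

lemma sum_degPrj (hN : 2 ≤ N) (Φ : Q.cobar 𝕌) :
    ∑ j ∈ Finset.range N, degPrj j Φ = Φ := by
  classical
  refine cobar_ext fun V hV m _ => ?_
  have h2 := hV.card_le (card_pos.1 (by rw [card_fin]; omega))
  rw [card_fin] at h2
  rw [AddSubmonoidClass.coe_finsetSum, Finset.sum_apply, Finset.sum_apply,
    sum_eq_single_of_mem (N - 1 - V.card) (mem_range.2 (by omega))]
  · rw [prj_apply, if_pos (by omega)]
  · intro j _ hj
    rw [prj_apply, if_neg (by omega)]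

/-- The condition that D(P)(n) → P^!(n) is a quasi-isomorphism. -/
lemma exactAt_univ_iff_quasiIso [FiniteDimensional k K] [FiniteDimensional k Q.E]
    [IsSemisimpleRing K] (hN : 2 ≤ N) : ExactAt E 𝕌 ↔
    (∀ j : ℕ, (Q.D N (j + 2)).map Q.δ = Q.D N (j + 1) ⊓ LinearMap.ker Q.δ) ∧
    (Q.D N 1).map Q.δ = Q.D N 0 ⊓ LinearMap.ker (Q.γ E) ∧ (Q.D N 0).map (Q.γ E) = ⊤ := by
  have hinj := restr_injective (Q := Q) hN
  have hδδ : ∀ Φ : Q.cobar 𝕌, Q.δc _ (Q.δc _ Φ) = 0 :=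
    fun Φ => LinearMap.congr_fun (δc_δc _) Φ
  have hD : ∀ j (Φ : Q.cobar 𝕌), restr (degPrj j Φ) ∈ Q.D N j :=
    fun _ _ => (restr_mem_D hN _).2 (degPrj_degPrj _ _)
  constructor
  · intro h
    refine ⟨fun j => le_antisymm ?_ ?_, le_antisymm ?_ ?_, ?_⟩
    · rintro _ ⟨F, hF, rfl⟩
      obtain ⟨Φ, hΦ, rfl⟩ := exists_of_mem_D hN hF
      rw [δ_restr hN]
      exact ⟨(restr_mem_D hN _).2 (by rw [← δc_degPrj, hΦ]), LinearMap.mem_ker.2 <| by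
        rw [δ_restr hN, hδδ, map_zero]⟩
    · rintro F ⟨hF, h0⟩
      obtain ⟨Φ, hΦ, rfl⟩ := exists_of_mem_D hN hF
      replace h0 := LinearMap.mem_ker.1 h0
      rw [δ_restr hN] at h0
      obtain ⟨Ψ, hΨ⟩ := (h.exact Φ).1 ⟨hinj (h0.trans (map_zero _).symm), by
        rw [← hΦ, γc_degPrj_succ]⟩
      refine ⟨restr (degPrj (j + 2) Ψ), hD _ _, ?_⟩
      rw [δ_restr hN, δc_degPrj, hΨ, hΦ]
    · rintro _ ⟨F, hF, rfl⟩
      obtain ⟨Φ, hΦ, rfl⟩ := exists_of_mem_D hN hF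
      rw [δ_restr hN]
      exact ⟨(restr_mem_D hN _).2 (by rw [← δc_degPrj, hΦ]), LinearMap.mem_ker.2 <|
        (γ_restr E hN _).trans ((h.exact _).2 ⟨Φ, rfl⟩).2⟩
    · rintro F ⟨hF, h0⟩
      obtain ⟨Φ, hΦ, rfl⟩ := exists_of_mem_D hN hF
      replace h0 := LinearMap.mem_ker.1 h0
      rw [γ_restr E hN] at h0
      obtain ⟨Ψ, hΨ⟩ := (h.exact Φ).1 ⟨by rw [← hΦ, δc_degPrj_zero hN], h0⟩
      refine ⟨restr (degPrj 1 Ψ), hD _ _, ?_⟩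
      rw [δ_restr hN, δc_degPrj, hΨ, hΦ]
    · refine (Submodule.eq_top_iff').2 fun y => ?_
      obtain ⟨Φ, rfl⟩ := h.surj y
      refine ⟨restr (degPrj 0 Φ), hD _ _, ?_⟩
      rw [γ_restr E hN, γc_degPrj_zero]
  · rintro ⟨h1, h2, h3⟩
    refine ⟨fun Φ => ⟨?_, ?_⟩, fun y => ?_⟩
    · rintro ⟨e1, e2⟩
      have key : ∀ j, ∃ Ψ, Q.δc _ Ψ = degPrj j Φ := fun j => by
        have hmem : restr (degPrj j Φ) ∈ (Q.D N (j + 1)).map Q.δ := by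
          cases j with
          | zero =>
            rw [h2]
            exact ⟨hD _ _, LinearMap.mem_ker.2 <| by rw [γ_restr E hN, γc_degPrj_zero, e2]⟩
          | succ j =>
            rw [h1]
            exact ⟨hD _ _, LinearMap.mem_ker.2 <| by rw [δ_restr hN, δc_degPrj, e1, map_zero, map_zero]⟩
        obtain ⟨F, hF, h⟩ := hmem
        obtain ⟨Ψ, -, rfl⟩ := exists_of_mem_D hN hF
        exact ⟨Ψ, hinj (by rw [← δ_restr hN, h])⟩
      choose Ψ hΨ using key
      refine ⟨∑ j ∈ Finset.range N, Ψ j, ?_⟩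
      rw [map_sum, sum_congr rfl fun j _ => hΨ j, sum_degPrj hN]
    · rintro ⟨Ψ, rfl⟩
      refine ⟨hδδ Ψ, ?_⟩
      have h4 : Q.δ (restr (degPrj 1 Ψ)) ∈ Q.D N 0 ⊓ LinearMap.ker (Q.γ E) := h2 ▸ ⟨_, hD 1 Ψ, rfl⟩
      have h5 := LinearMap.mem_ker.1 h4.2
      rwa [δ_restr hN, γ_restr E hN, δc_degPrj, γc_degPrj_zero] at h5
    · have h4 : y ∈ (Q.D N 0).map (Q.γ E) := h3 ▸ Submodule.mem_top
      obtain ⟨F, hF, rfl⟩ := h4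
      obtain ⟨Φ, -, rfl⟩ := exists_of_mem_D hN hF
      exact ⟨Φ, (γ_restr E hN Φ).symm⟩

end QuadraticData

/-! ### Relabelling the leaves -/

lemma key_lt_key_iff {u v : Block N} :
    key u < key v ↔ ∃ a ∈ v, a ∉ u ∧ ∀ b ∈ u, b ∉ v → b < a := by
  have h : ∀ u : Block N, key u = ∑ i ∈ u.map Fin.valEmbedding, 2 ^ i := fun u => by simp [key]
  rw [h, h, Finset.geomSum_lt_geomSum_iff_toColex_lt_toColex le_rfl,
    Finset.Colex.toColex_lt_toColex_iff_exists_forall_lt]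
  simp [Fin.val_inj]

lemma image_eq_self {α : Type*} [DecidableEq α] {S : Finset α} {f : α → α} (h : ∀ x ∈ S, f x = x) :
    S.image f = S := (Finset.image_congr h).trans Finset.image_id

/-- An increasing bijection of `A` onto `A'`, and its inverse. -/
structure Relabel {N' : ℕ} (A : Block N) (A' : Block N') where
  g : Fin N → Fin N'
  g' : Fin N' → Fin N
  image : A.image g = A'
  left : ∀ x ∈ A, g' (g x) = x
  mono : ∀ x ∈ A, ∀ y ∈ A, x < y → g x < g y

namespace Relabel

variable {N' : ℕ} {A : Block N} {A' : Block N'} (r : Relabel A A')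

/-- The inverse bijection. -/
def symm : Relabel A' A where
  g := r.g'
  g' := r.g
  image := (congrArg (Finset.image r.g') r.image.symm).trans
    (image_image.trans (image_eq_self r.left))
  left y hy := by
    rw [← r.image] at hy
    obtain ⟨x, hx, rfl⟩ := mem_image.1 hy
    rw [r.left x hx]
  mono y hy z hz h := by
    rw [← r.image] at hy hz
    obtain ⟨a, ha, rfl⟩ := mem_image.1 hy
    obtain ⟨b, hb, rfl⟩ := mem_image.1 hz
    rw [r.left a ha, r.left b hb]
    refine lt_of_not_ge fun h' => ?_
    rcases h'.lt_or_eq with h' | rfl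
    exacts [lt_asymm h (r.mono _ hb _ ha h'), lt_irrefl _ h]

/-- The restriction to a subset. -/
def sub (hb : b ⊆ A) : Relabel b (b.image r.g) :=
  ⟨r.g, r.g', rfl, fun x hx => r.left x (hb hx), fun x hx y hy => r.mono x (hb hx) y (hb hy)⟩

/-- The image of a subset. -/
def G (u : Block N) : Block N' := u.image r.g

variable {u v : Block N} (hu : u ⊆ A) (hv : v ⊆ A)

lemma injOn : Set.InjOn r.g A := fun x hx y hy h => by rw [← r.left x hx, h, r.left y hy]

lemma G_top : r.G A = A' := r.image

lemma G_subset (h : u ⊆ v) : r.G u ⊆ r.G v := Finset.image_subset_image h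

include hu in
lemma symm_G : r.symm.G (r.G u) = u :=
  image_image.trans (image_eq_self fun x hx => r.left x (hu hx))

include hu in
lemma G_sub_top : r.G u ⊆ A' := (r.G_subset hu).trans_eq r.image

include hu hv in
lemma G_inj (h : r.G u = r.G v) : u = v := by rw [← r.symm_G hu, h, r.symm_G hv]

lemma injOn_G (hS : ∀ u ∈ S, u ⊆ A) : Set.InjOn r.G S :=
  fun u hu v hv h => r.G_inj (hS u hu) (hS v hv) h

include hu in
lemma card_G : (r.G u).card = u.card :=
  Finset.card_image_of_injOn (r.injOn.mono (Finset.coe_subset.2 hu))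

include hu hv in
lemma G_subset_iff : r.G u ⊆ r.G v ↔ u ⊆ v :=
  ⟨fun h => by rw [← r.symm_G hu, ← r.symm_G hv]; exact r.symm.G_subset h, r.G_subset⟩

include hu hv in
lemma G_ssubset_iff : r.G u ⊂ r.G v ↔ u ⊂ v := by
  rw [ssubset_def, ssubset_def, r.G_subset_iff hu hv, r.G_subset_iff hv hu]

include hu hv in
lemma key_G_lt (h : key u < key v) : key (r.G u) < key (r.G v) := by
  obtain ⟨a, ha, hau, h⟩ := key_lt_key_iff.1 h
  refine key_lt_key_iff.2 ⟨r.g a, mem_image_of_mem _ ha, fun h' => ?_, fun b hb hbv => ?_⟩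
  · obtain ⟨x, hx, hxa⟩ := mem_image.1 h'
    exact hau (r.injOn (hu hx) (hv ha) hxa ▸ hx)
  · obtain ⟨x, hx, rfl⟩ := mem_image.1 hb
    exact r.mono x (hu hx) a (hv ha) (h x hx fun h' => hbv (mem_image_of_mem _ h'))

include hu hv in
lemma key_G_lt_iff : key (r.G u) < key (r.G v) ↔ key u < key v := by
  refine ⟨fun h => ?_, r.key_G_lt hu hv⟩
  have := r.symm.key_G_lt (r.G_sub_top hu) (r.G_sub_top hv) h
  rwa [r.symm_G hu, r.symm_G hv] at this

lemma exists_G_eq {u' : Block N'} (h : u' ⊆ A') : ∃ u ⊆ A, r.G u = u' :=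
  ⟨r.symm.G u', r.symm.G_sub_top h, r.symm.symm_G h⟩

variable (hV : ∀ u ∈ V, u ⊆ A)
include hV

include hu in
lemma G_mem_image : r.G u ∈ V.image r.G ↔ u ∈ V :=
  ⟨fun h => by
    obtain ⟨w, hw, h⟩ := mem_image.1 h
    exact r.G_inj (hV w hw) hu h ▸ hw, mem_image_of_mem _⟩

lemma symm_image : (V.image r.G).image r.symm.G = V :=
  image_image.trans (image_eq_self fun u hu => r.symm_G (hV u hu))

include hu in
lemma edge_G : (r.G u ∈ V.image r.G ∨ ∃ i, {i} = r.G u) ↔ (u ∈ V ∨ ∃ i, {i} = u) := by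
  have h : ∀ {n : ℕ} (u : Block n), (∃ i, {i} = u) ↔ u.card = 1 := fun u => by
    rw [card_eq_one]
    exact exists_congr fun i => eq_comm
  rw [r.G_mem_image hu hV, h, h, r.card_G hu]

include hv in
lemma eA_G : eA (r.G v) (V.image r.G) = (eA v V).image r.G := by
  ext u'
  rw [mem_eA]
  constructor
  · rintro ⟨h1, h2⟩
    obtain ⟨u, hu, rfl⟩ := r.exists_G_eq (h2.1.trans (r.G_sub_top hv))
    exact mem_image.2 ⟨u, mem_eA.2 ⟨(r.edge_G hu hV).1 h1, (r.G_ssubset_iff hu hv).1 h2⟩, rfl⟩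
  · intro h'
    obtain ⟨u, h, rfl⟩ := mem_image.1 h'
    obtain ⟨h1, h2⟩ := mem_eA.1 h
    have hu := h2.1.trans hv
    exact ⟨(r.edge_G hu hV).2 h1, (r.G_ssubset_iff hu hv).2 h2⟩

include hv in
lemma inp_G : inp (V.image r.G) (r.G v) = (inp V v).image r.G := by
  ext u'
  rw [mem_inp]
  constructor
  · rintro ⟨h1, h2, h3⟩
    obtain ⟨u, hu, rfl⟩ := r.exists_G_eq (h2.1.trans (r.G_sub_top hv))
    exact mem_image.2 ⟨u, mem_inp.2 ⟨(r.edge_G hu hV).1 h1, (r.G_ssubset_iff hu hv).1 h2, fun w hw hwv huw =>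
      h3 _ (mem_image_of_mem _ hw) ((r.G_ssubset_iff (hV w hw) hv).2 hwv)
        ((r.G_ssubset_iff hu (hV w hw)).2 huw)⟩, rfl⟩
  · intro h'
    obtain ⟨u, h, rfl⟩ := mem_image.1 h'
    obtain ⟨h1, h2, h3⟩ := mem_inp.1 h
    have hu := h2.1.trans hv
    refine ⟨(r.edge_G hu hV).2 h1, (r.G_ssubset_iff hu hv).2 h2, fun w' hw' hwv huw => ?_⟩
    obtain ⟨w, hw, rfl⟩ := mem_image.1 hw'
    exact h3 w hw ((r.G_ssubset_iff (hV w hw) hv).1 hwv) ((r.G_ssubset_iff hu (hV w hw)).1 huw)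

lemma image_erase_G {e : Block N} (he : e ∈ V) :
    (V.image r.G).erase (r.G e) = (V.erase e).image r.G := by
  ext u'
  rw [mem_erase, mem_image, mem_image]
  constructor
  · grind
  · rintro ⟨u, hu, rfl⟩
    obtain ⟨h1, h2⟩ := mem_erase.1 hu
    exact ⟨fun h => h1 (r.G_inj (hV u h2) (hV e he) h), u, h2, rfl⟩

lemma nlt_G (hS : ∀ u ∈ S, u ⊆ A) :
    nlt (S.image r.G) (V.image r.G) = nlt S V := by
  rw [nlt, nlt, sum_image (r.injOn_G hS)]
  refine sum_congr rfl fun u hu => ?_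
  rw [sum_image (r.injOn_G hV)]
  exact sum_congr rfl fun w hw => if_congr (r.key_G_lt_iff (hV w hw) (hS u hu)) rfl rfl

lemma shx_G {E : Block N → 𝓕 N} {E' : Block N' → Finset (Block N')}
    (h : ∀ b ∈ V, E' (r.G b) = (E b).image r.G) (hE : ∀ b ∈ V, ∀ u ∈ E b, u ⊆ A) :
    shx (V.image r.G) E' = shx V E := by
  have hi := r.injOn_G hV
  rw [shx, shx, sum_image hi, sum_image hi]
  congr 1
  · refine sum_congr rfl fun b hb => ?_
    rw [sum_image hi]
    refine sum_congr rfl fun b' hb' => ?_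
    rw [h b hb, h b' hb', r.nlt_G (hE b' hb') (hE b hb)]
    exact if_congr (r.key_G_lt_iff (hV b hb) (hV b' hb')) rfl rfl
  · refine sum_congr rfl fun b hb => ?_
    rw [h b hb, r.nlt_G hV (hE b hb)]

omit hV in
lemma isTree_G (hT : IsTree A V) : IsTree A' (V.image r.G) where
  sub v' hv' := by
    obtain ⟨v, hv, rfl⟩ := mem_image.1 hv'
    exact r.G_sub_top (hT.sub v hv)
  top h := by
    rw [← r.G_top, r.card_G le_rfl] at h
    exact mem_image.2 ⟨A, hT.top h, r.G_top⟩
  two v' hv' := by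
    obtain ⟨v, hv, rfl⟩ := mem_image.1 hv'
    rw [r.card_G (hT.sub v hv)]
    exact hT.two v hv
  lam u' hu' v' hv' := by
    obtain ⟨u, hu, rfl⟩ := mem_image.1 hu'
    obtain ⟨v, hv, rfl⟩ := mem_image.1 hv'
    refine (hT.lam u hu v hv).imp r.G_subset (Or.imp r.G_subset fun h => ?_)
    refine disjoint_left.2 fun x hx hx' => ?_
    obtain ⟨a, ha, rfl⟩ := mem_image.1 hx
    obtain ⟨b, hb, hab⟩ := mem_image.1 hx'
    exact disjoint_left.1 h ha (r.injOn (hT.sub v hv hb) (hT.sub u hu ha) hab ▸ hb)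

end Relabel

namespace QuadraticData

variable {N' : ℕ} {A' : Block N'} (r : Relabel A A')

/-- The relabelling of the operations on the blocks. -/
def relOp : Q.Alg (Block N) →ₗ[k] Q.Alg (Block N') := Q.subst fun u => Q.var (r.G u)

/-- The relabelling of the operations on the leaves. -/
def relLeaf : Q.Alg (Fin N) →ₗ[k] Q.Alg (Fin N') := Q.subst fun x => Q.var (r.g x)

lemma subst_var_mem {α β : Type*} [DecidableEq β] {f : α → β} {S : Finset α} {x : Q.Alg α}
    (hx : x ∈ Q.P S) (hf : Set.InjOn f S) : Q.subst (fun a => Q.var (f a)) x ∈ Q.P (S.image f) := by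
  have h := Q.subst_mem (fun a => Q.var (f a)) (fun a => {f a}) hx fun a _ => Q.var_mem (f a)
  rwa [Multiset.bind_singleton, ← Finset.image_val_of_injOn hf] at h

lemma subst_var_subst_var {α β : Type*} {f : α → β} {f' : β → α} {S : Finset α} {x : Q.Alg α}
    (hx : x ∈ Q.P S) (h : ∀ a ∈ S, f' (f a) = a) :
    Q.subst (fun b => Q.var (f' b)) (Q.subst (fun a => Q.var (f a)) x) = x := by
  rw [subst_subst]
  exact Q.subst_eq_self hx fun a ha => by rw [subst_var, h a ha]

lemma relOp_mem (hS : ∀ u ∈ S, u ⊆ A) {x : Q.Alg (Block N)} (hx : x ∈ Q.P S) :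
    relOp r x ∈ Q.P (S.image r.G) := subst_var_mem hx (r.injOn_G hS)

lemma relOp_symm (hS : ∀ u ∈ S, u ⊆ A) {x : Q.Alg (Block N)} (hx : x ∈ Q.P S) :
    relOp r.symm (relOp r x) = x := subst_var_subst_var hx fun u hu => r.symm_G (hS u hu)

lemma relOp_smul (a : K) (x : Q.Alg (Block N)) : relOp r (a • x) = a • relOp r x :=
  Q.subst_smulK _ a x

lemma relOp_ract (hS : ∀ u ∈ S, u ⊆ A) {x : Q.Alg (Block N)} (hx : x ∈ Q.P S)
    (hv : v ⊆ A) (a : K) : relOp r (Q.ract v a x) = Q.ract (r.G v) a (relOp r x) := by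
  rw [ract_eq, ract_eq, relOp, ractm, ractm, subst_subst, subst_subst]
  refine Q.subst_congr hx fun u hu => ?_
  rw [subst_smulK, subst_var, subst_var]
  by_cases h : u = v
  · rw [h, update_self, update_self]
  · rw [update_of_ne h, update_of_ne fun h' => h (r.G_inj (hS u hu) hv h')]
    rfl

lemma relOp_plug (hS : ∀ u ∈ S, u ⊆ A) {x : Q.Alg (Block N)} (hx : x ∈ Q.P S) {e : Block N}
    (he : e ⊆ A) (y : Q.Alg (Block N)) :
    relOp r (Q.plug e y x) = Q.plug (r.G e) (relOp r y) (relOp r x) := by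
  rw [plug_eq, plug_eq, relOp, subst_subst, subst_subst]
  refine Q.subst_congr hx fun u hu => ?_
  rw [subst_var]
  by_cases h : u = e
  · rw [h, update_self, update_self]
  · rw [update_of_ne h, update_of_ne fun h' => h (r.G_inj (hS u hu) he h'),
      subst_var]

open scoped Classical in
/-- The relabelling of a decoration of the vertices of `V`. -/
def relDec (V : 𝓕 N) (m : Q.Dec N) : Q.Dec N' := fun v' =>
  if v' ∈ V.image r.G then relOp r (m (r.symm.G v')) else 0

lemma relDec_G (hv : v ∈ V) (hvA : v ⊆ A) (m : Q.Dec N) :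
    relDec r V m (r.G v) = relOp r (m v) := by
  rw [relDec, if_pos (mem_image_of_mem _ hv), r.symm_G hvA]

lemma relDec_of_notMem {v' : Block N'} (hv : v' ∉ V.image r.G) (m : Q.Dec N) :
    relDec r V m v' = 0 := if_neg hv

section

variable (hV : IsTree A V)
include hV

lemma inp_sub : ∀ u ∈ inp V v, v ∈ V → u ⊆ A := fun _ hu hv =>
  (mem_inp.1 hu).2.1.1.trans (hV.sub _ hv)

lemma relDec_valid (hm : Q.Valid V m) :
    Q.Valid (V.image r.G) (relDec r V m) where
  mem v' hv' := by
    obtain ⟨v, hv, rfl⟩ := mem_image.1 hv'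
    rw [relDec_G r hv (hV.sub v hv), r.inp_G (hV.sub v hv) hV.sub]
    exact relOp_mem r (fun u hu => inp_sub hV u hu hv) (hm.mem v hv)
  zero v' hv' := relDec_of_notMem r hv' m

lemma relDec_symm (hm : Q.Valid V m) :
    relDec r.symm (V.image r.G) (relDec r V m) = m := by
  funext v
  by_cases hv : v ∈ V
  · have h1 := relDec_G r hv (hV.sub v hv) m
    have h2 := relDec_G r.symm (mem_image_of_mem r.G hv) (r.G_sub_top (hV.sub v hv))
      (relDec r V m)
    rw [r.symm_G (hV.sub v hv), h1,
      relOp_symm r (fun u hu => inp_sub hV u hu hv) (hm.mem v hv)] at h2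
    exact h2
  · rw [relDec_of_notMem r.symm (by rwa [r.symm_image hV.sub]), hm.zero v hv]

lemma relDec_update (hv : v ∈ V) (m : Q.Dec N) (x : Q.Alg (Block N)) :
    relDec r V (update m v x)
      = update (relDec r V m) (r.G v) (relOp r x) := by
  funext v'
  by_cases hv' : v' ∈ V.image r.G
  · obtain ⟨u, hu, rfl⟩ := mem_image.1 hv'
    rw [relDec_G r hu (hV.sub u hu)]
    by_cases h : u = v
    · rw [h, update_self, update_self]
    · rw [update_of_ne h, update_of_ne fun h' =>
        h (r.G_inj (hV.sub u hu) (hV.sub v hv) h'), relDec_G r hu (hV.sub u hu)]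
  · rw [relDec_of_notMem r hv', update_of_ne, relDec_of_notMem r hv']
    rintro rfl
    exact hv' (mem_image_of_mem _ hv)

lemma relDec_ctr {e : Block N} (he : e ∈ V) (hm : Q.Valid V m) :
    relDec r (V.erase e) (Q.ctr V e m) = Q.ctr (V.image r.G) (r.G e) (relDec r V m) := by
  have hval := (relDec_valid r hV hm).ctr (r.isTree_G hV) (mem_image_of_mem r.G he)
  rw [r.image_erase_G hV.sub he] at hval
  funext v'
  by_cases hv' : v' ∈ (V.erase e).image r.G
  · obtain ⟨v, hv, rfl⟩ := mem_image.1 hv'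
    obtain ⟨hve, hvV⟩ := mem_erase.1 hv
    have hvA := hV.sub v hvV
    have heA := hV.sub e he
    have hin : r.G e ∈ inp (V.image r.G) (r.G v) ↔ e ∈ inp V v := by
      rw [r.inp_G hvA hV.sub]
      exact r.G_mem_image heA fun u hu => inp_sub hV u hu hvV
    rw [relDec_G r hv hvA]
    by_cases h : e ∈ inp V v
    · rw [ctr_of_mem h, ctr_of_mem (hin.2 h), relDec_G r hvV hvA, relDec_G r he heA,
        relOp_plug r (fun u hu => inp_sub hV u hu hvV) (hm.mem v hvV) heA]
    · rw [ctr_of_notMem hve h, ctr_of_notMem (fun h' => hve (r.G_inj hvA heA h'))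
        (fun h' => h (hin.1 h')), relDec_G r hvV hvA]
  · rw [relDec_of_notMem r hv', hval.zero v' hv']

end

open scoped Classical in
/-- The relabelling of an element of the cobar complex. -/
def pull (Φ : Q.cobar A') : Q.cobar A := ⟨fun V m => if IsTree A V ∧ Q.Valid V m then
    Φ.1 (V.image r.G) (relDec r V m) else 0, by
  refine mem_cobar.2 ⟨fun V hV => ?_, fun V hV => funext fun m => if_neg fun h => hV h.1⟩
  have hf := Φ.2.isFm _ (r.isTree_G hV)
  have hval := fun {m} (hm : Q.Valid V m) => relDec_valid r hV hm
  have hinp := fun {v : Block N} (hv : v ∈ V) => r.inp_G (hV.sub v hv) hV.sub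
  have hin := fun {v : Block N} (hv : v ∈ V) => mem_image_of_mem r.G hv
  have hmem := fun {v : Block N} (hv : v ∈ V) {x} (hx : x ∈ Q.P (inp V v)) =>
    relOp_mem r (fun u hu => inp_sub hV u hu hv) hx
  have hpos : ∀ {m}, Q.Valid V m → (if IsTree A V ∧ Q.Valid V m then
      Φ.1 (V.image r.G) (relDec r V m) else 0) = Φ.1 (V.image r.G) (relDec r V m) :=
    fun hm => if_pos ⟨hV, hm⟩
  refine ⟨fun m hm => if_neg fun h => hm h.2, fun m hm v hv c x hx y hy => ?_, fun m hm hA a => ?_, fun m hm v hv u hu hvu a => ?_⟩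
  · rw [hpos (hm.set hv (Submodule.add_mem _ (Submodule.smul_mem _ c hx) hy)),
      hpos (hm.set hv hx), hpos (hm.set hv hy), relDec_update r hV hv, relDec_update r hV hv,
      relDec_update r hV hv, map_add, map_smul]
    exact hf.lin _ (hval hm) _ (hin hv) c _ (by rw [hinp hv]; exact hmem hv hx) _
      (by rw [hinp hv]; exact hmem hv hy)
  · rw [hpos (hm.smul hA a), hpos hm, relDec_update r hV hA, relOp_smul]
    have h1 := hin hA
    have h2 := relDec_G r hA le_rfl m
    rw [r.G_top] at h1 h2 ⊢
    rw [← h2]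
    exact hf.root _ (hval hm) h1 a
  · rw [hpos (hm.ract hu v a), hpos (hm.smul hv a), relDec_update r hV hu, relDec_update r hV hv,
      relOp_ract r (fun w hw => inp_sub hV w hw hu) (hm.mem u hu) (hV.sub v hv)]
    have h := hf.bal _ (hval hm) _ (hin hv) _ (hin hu) (by
      rw [hinp hu]; exact mem_image_of_mem _ hvu) a
    rw [relDec_G r hu (hV.sub u hu), relDec_G r hv (hV.sub v hv)] at h
    rw [h, relOp_smul]⟩

lemma pull_apply (Φ : Q.cobar A') (hV : IsTree A V) (hm : Q.Valid V m) :
    (pull r Φ).1 V m = Φ.1 (V.image r.G) (relDec r V m) := if_pos ⟨hV, hm⟩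

lemma pull_pull (Φ : Q.cobar A) : pull r (pull r.symm Φ) = Φ := cobar_ext fun V hV m hm => by
  rw [pull_apply r _ hV hm, pull_apply r.symm Φ (r.isTree_G hV) (relDec_valid r hV hm),
    relDec_symm r hV hm, r.symm_image hV.sub]

lemma δc_pull (Φ : Q.cobar A') : Q.δc A (pull r Φ) = pull r (Q.δc A' Φ) :=
  cobar_ext fun V hV m hm => by
    have hV' := r.isTree_G hV
    rw [pull_apply r _ hV hm, δc_apply, δc_apply, dif_of hV hm, dif_of hV' (relDec_valid r hV hm)]
    by_cases hA : A ∈ V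
    swap
    · have h : V = ∅ := eq_empty_of_forall_notMem fun v hv => hA (hV.top
        ((hV.two v hv).trans (card_le_card (hV.sub v hv))))
      subst h
      rfl
    have h1 : (V.image r.G).erase A' = (V.erase A).image r.G := by
      rw [← r.image_erase_G hV.sub hA, r.G_top]
    rw [h1, sum_image (r.injOn_G fun u hu => hV.sub u (mem_of_mem_erase hu))]
    refine sum_congr rfl fun e he => ?_
    have heV := mem_of_mem_erase he
    have heA := ne_of_mem_erase he
    rw [pull_apply r Φ (hV.erase heA) (hm.ctr hV heV), relDec_ctr r hV heV hm,
      r.image_erase_G hV.sub heV]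
    have h2 : eA A' (V.image r.G) = (eA A V).image r.G := by rw [← r.eA_G le_rfl hV.sub, r.G_top]
    have h3 : ∀ u ∈ eA A V, u ⊆ A := fun u hu => (mem_eA.1 hu).2.1
    have h4 : nlt {r.G e} ((eA A V).image r.G) = nlt {e} (eA A V) := by
      rw [← r.nlt_G h3 (S := {e}) (by simpa using hV.sub e heV), image_singleton]
    rw [h2, ← sgn_natCast, ← sgn_natCast, cast_inv, cast_inv, h4]

end QuadraticData

namespace QuadraticData

variable {N' : ℕ} {A' : Block N'} (r : Relabel A A')

/-- The relabelling of a decorated tree. -/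
def relSt (t : Q.St N) : Q.St N' := (t.1.image r.G, relDec r t.1 t.2)

/-- The relabelling of a decorated tree with an element of P^!. -/
def relTr (t : Q.dual.Alg (Fin N) × Q.St N) : Q.dual.Alg (Fin N') × Q.St N' :=
  (relLeaf r t.1, relSt r t.2)

variable (E : Q.DualBasis)

/-- The grafting of two trees. -/
def graftAlg (A c1 c2 : Block N) (i : Fin E.d) (t₁ t₂ : Q.dual.Alg (Fin N) × Q.St N) :
    Q.dual.Alg (Fin N) × Q.St N :=
  (sgn (shx {c1, c2} (edg (pairSt c1 t₁.2 t₂.2))) • Q.dual.node (E.Ξ i) t₁.1 t₂.1,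
    jV A {c1, c2} (pairSt c1 t₁.2 t₂.2),
    jm A {c1, c2} (pairSt c1 t₁.2 t₂.2) (Q.node (E.X i) (Q.var c1) (Q.var c2)))

lemma relTr_graftAlg {p : Block N × Block N} (hp : p ∈ splits A) (i : Fin E.d)
    {t₁ t₂ : Q.dual.Alg (Fin N) × Q.St N} (h₁ : IsTree p.1 t₁.2.1 ∧ Q.Valid t₁.2.1 t₁.2.2)
    (h₂ : IsTree p.2 t₂.2.1 ∧ Q.Valid t₂.2.1 t₂.2.2) (hp' : (r.G p.1, r.G p.2) ∈ splits A') :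
    graftAlg E A' (r.G p.1) (r.G p.2) i (relTr r t₁) (relTr r t₂)
      = relTr r (graftAlg E A p.1 p.2 i t₁ t₂) := by
  have hne := ne_of_mem_splits hp
  have hP := isPart_splits hp
  have hne' : r.G p.1 ≠ r.G p.2 := ne_of_mem_splits hp'
  have hP' : IsPart A' {r.G p.1, r.G p.2} := isPart_splits hp'
  have hg := pairSt_good hne h₁ h₂
  have s₁ : p.1 ⊆ A := hP.sub _ (by simp)
  have s₂ : p.2 ⊆ A := hP.sub _ (by simp)
  have rel_good : ∀ {b : Block N} (hb : b ⊆ A) {t : Q.St N}, (IsTree b t.1 ∧ Q.Valid t.1 t.2) →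
      IsTree (r.G b) (relSt r t).1 ∧ Q.Valid (relSt r t).1 (relSt r t).2 := fun hb _ h =>
    ⟨(r.sub hb).isTree_G h.1, relDec_valid (r.sub hb) h.1 h.2⟩
  have hg' := pairSt_good hne' (rel_good s₁ h₁) (rel_good s₂ h₂)
  have hS : ({r.G p.1, r.G p.2} : Finset (Block N')) = ({p.1, p.2} : 𝓕 N).image r.G := by
    rw [image_insert, image_singleton]
  have hst : ∀ b ∈ ({p.1, p.2} : 𝓕 N),
      pairSt (r.G p.1) (relSt r t₁.2) (relSt r t₂.2) (r.G b) = relSt r (pairSt p.1 t₁.2 t₂.2 b) := by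
    intro b hb
    rcases mem_insert.1 hb with rfl | hb
    · rw [pairSt, if_pos rfl, pairSt, if_pos rfl]
    · rw [mem_singleton.1 hb, pairSt, if_neg hne'.symm, pairSt, if_neg hne.symm]
  have hsub : ∀ b ∈ ({p.1, p.2} : 𝓕 N), ∀ u ∈ (pairSt p.1 t₁.2 t₂.2 b).1, u ⊆ A :=
    fun b hb u hu => ((hg b hb).1.sub u hu).trans (hP.sub b hb)
  have hV : jV A' {r.G p.1, r.G p.2} (pairSt (r.G p.1) (relSt r t₁.2) (relSt r t₂.2))
      = (jV A {p.1, p.2} (pairSt p.1 t₁.2 t₂.2)).image r.G := by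
    rw [jV, jV, glueV, glueV, image_insert, r.G_top, Finset.biUnion_image, hS,
      Finset.image_biUnion]
    exact congrArg (insert A') (biUnion_congr rfl fun b hb => congrArg Prod.fst (hst b hb))
  have hT := jV_isTree hP hg
  have hval := jm_valid hP hg (node_var_mem hne (E.X i))
  have hval' := jm_valid hP' hg' (node_var_mem hne' (E.X i))
  refine Prod.ext ?_ (Prod.ext hV ?_)
  · have h1 : shx {r.G p.1, r.G p.2} (edg (pairSt (r.G p.1) (relSt r t₁.2) (relSt r t₂.2)))
        = shx {p.1, p.2} (edg (pairSt p.1 t₁.2 t₂.2)) := by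
      rw [hS]
      refine r.shx_G hP.sub (fun b hb => ?_) fun b hb u hu =>
        (mem_eA.1 hu).2.1.trans (hP.sub b hb)
      rw [edg, edg, hst b hb]
      exact r.eA_G (hP.sub b hb) (hsub b hb)
    change sgn _ • Q.dual.node (E.Ξ i) (relLeaf r t₁.1) (relLeaf r t₂.1)
      = relLeaf r (sgn _ • Q.dual.node (E.Ξ i) t₁.1 t₂.1)
    rw [map_zsmul, relLeaf, subst_node]
    exact congrArg (fun z => sgn z • _) h1
  · change jm A' {r.G p.1, r.G p.2} (pairSt (r.G p.1) (relSt r t₁.2) (relSt r t₂.2))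
      (Q.node (E.X i) (Q.var (r.G p.1)) (Q.var (r.G p.2)))
      = relDec r (jV A {p.1, p.2} (pairSt p.1 t₁.2 t₂.2)) (jm A {p.1, p.2} (pairSt p.1 t₁.2 t₂.2)
        (Q.node (E.X i) (Q.var p.1) (Q.var p.2)))
    funext v'
    by_cases hv' : v' ∈ (jV A {p.1, p.2} (pairSt p.1 t₁.2 t₂.2)).image r.G
    · obtain ⟨v, hv, rfl⟩ := mem_image.1 hv'
      rw [relDec_G r hv (hT.sub v hv)]
      rcases mem_glueV.1 hv with rfl | ⟨b, hb, hvb⟩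
      · rw [jm_top, r.G_top, jm_top, relOp, subst_node, subst_var, subst_var]
      · have hb' : r.G b ∈ ({r.G p.1, r.G p.2} : Finset (Block N')) :=
          hS ▸ mem_image_of_mem _ hb
        have hvb' : r.G v ∈ (pairSt (r.G p.1) (relSt r t₁.2) (relSt r t₂.2) (r.G b)).1 := by
          rw [hst b hb]; exact mem_image_of_mem _ hvb
        rw [jm_of_mem hP' hg' hb' hvb', jm_of_mem hP hg hb hvb, hst b hb]
        exact relDec_G r hvb (hT.sub v hv) _
    · rw [relDec_of_notMem r hv']
      exact jm_off hP' hg' (by rwa [hV]) _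

lemma G_mem_splits {p : Block N × Block N} (hp : p ∈ splits A) :
    (r.G p.1, r.G p.2) ∈ splits A' := by
  obtain ⟨h1, h2, h3, h4, h5⟩ := mem_splits.1 hp
  have s₁ : p.1 ⊆ A := h2 ▸ subset_union_left
  have s₂ : p.2 ⊆ A := h2 ▸ subset_union_right
  refine mem_splits.2 ⟨disjoint_left.2 fun x hx hx' => ?_, ?_, h3.image _, h4.image _,
    r.key_G_lt s₁ s₂ h5⟩
  · obtain ⟨a, ha, rfl⟩ := mem_image.1 hx
    obtain ⟨b, hb, hab⟩ := mem_image.1 hx'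
    exact disjoint_left.1 h1 ha (r.injOn (s₂ hb) (s₁ ha) hab ▸ hb)
  · exact (Finset.image_union _ _).symm.trans ((congrArg r.G h2).trans r.G_top)

/-- Relabelling commutes with the sum over the coloured binary trees on a block. -/
lemma bsum_relabel {M : Type*} [AddCommMonoid M] (hA : A.Nonempty)
    (F : Q.dual.Alg (Fin N') × Q.St N' → M) :
    (bsum E A' fun t => F (t.1, t.2)) = bsum E A fun t => F (relTr r (t.1, t.2)) := by
  induction h : A.card using Nat.strong_induction_on generalizing A A' F with
  | _ n ih =>
    subst h
    have hcard : A'.card = A.card := by rw [← r.G_top]; exact r.card_G le_rfl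
    rcases Nat.lt_or_ge A.card 2 with h2 | h2
    · obtain ⟨x, rfl⟩ := card_eq_one.1 (le_antisymm (by omega) (card_pos.2 hA))
      obtain ⟨x', rfl⟩ := card_eq_one.1 (hcard.trans (card_singleton x))
      have hx : r.g x = x' := by simpa using r.image
      rw [bsum_leaf E (card_singleton _), bsum_leaf E (card_singleton _),
        coe_leafTr_fst, coe_leafTr_fst]
      refine congrArg F (Prod.ext ?_ (Prod.ext rfl ?_))
      · have h3 : relLeaf r (Q.dual.var x) = Q.dual.var x' := by rw [relLeaf, subst_var, hx]
        exact h3.symm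
      · funext v'
        exact (relDec_of_notMem r (V := ∅) (notMem_empty v') (0 : Q.Dec N)).symm
    · rw [bsum_node E h2, bsum_node E (by omega)]
      symm
      refine sum_bij' (fun p _ => (r.G p.1, r.G p.2)) (fun p _ => (r.symm.G p.1, r.symm.G p.2))
        (fun p hp => G_mem_splits r hp) (fun p hp => G_mem_splits r.symm hp) (fun p hp => ?_)
        (fun p hp => ?_) fun p hp => sum_congr rfl fun i _ => ?_
      · have hP := isPart_splits hp
        exact Prod.ext (r.symm_G (hP.sub _ (by simp))) (r.symm_G (hP.sub _ (by simp)))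
      · have hP := isPart_splits hp
        exact Prod.ext (r.symm.symm_G (hP.sub _ (by simp))) (r.symm.symm_G (hP.sub _ (by simp)))
      · have hP := isPart_splits hp
        have hp' := G_mem_splits r hp
        obtain ⟨c1, c2, -⟩ := card_of_mem_splits hp
        have s₁ : p.1 ⊆ A := hP.sub _ (by simp)
        have s₂ : p.2 ⊆ A := hP.sub _ (by simp)
        obtain ⟨-, -, n₁, n₂, -⟩ := mem_splits.1 hp
        have e₁ : ∀ {n : ℕ} {A : Block n} {p : Block n × Block n} (_ : p ∈ splits A) (t₁ : Q.Tr p.1)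
            (t₂ : Q.Tr p.2), (((graft E A p.1 p.2 i t₁ t₂).1 : Q.dual.Alg (Fin n)),
              (graft E A p.1 p.2 i t₁ t₂).2) = graftAlg E A p.1 p.2 i (t₁.1, t₁.2) (t₂.1, t₂.2) :=
          fun hp t₁ t₂ => Prod.ext (coe_graft_fst E hp i t₁ t₂) rfl
        have key := (ih _ c1 (r.sub s₁) n₁ (fun t₁ => bsum E (r.G p.2) fun t₂ =>
          F (graftAlg E A' (r.G p.1) (r.G p.2) i t₁ (t₂.1, t₂.2))) rfl)
        refine Eq.trans ?_ (Eq.trans key.symm ?_)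
        · refine bsum_congr E fun t₁ ht1 => ?_
          refine Eq.trans ?_ (ih _ c2 (r.sub s₂) n₂ (fun t₂ =>
            F (graftAlg E A' (r.G p.1) (r.G p.2) i (relTr r (t₁.1, t₁.2)) t₂)) rfl).symm
          refine bsum_congr E fun t₂ ht2 => ?_
          rw [e₁ hp]
          exact congrArg F (relTr_graftAlg r E hp i (t₁ := (t₁.1, t₁.2)) (t₂ := (t₂.1, t₂.2))
            (BT_spec E _ t₁ ht1).1 (BT_spec E _ t₂ ht2).1 hp').symm
        · refine bsum_congr E fun t₁ _ => bsum_congr E fun t₂ _ => ?_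
          exact congrArg F (e₁ hp' t₁ t₂).symm

lemma coe_γc_pull (hA : A.Nonempty) (Φ : Q.cobar A') :
    (γc E A' Φ : Q.dual.Alg (Fin N')) = relLeaf r (γc E A (pull r Φ)) := by
  rw [coe_γc, coe_γc, bsum_relabel r E hA fun t => op (Φ.1 t.2.1 t.2.2) • t.1]
  refine Eq.trans (bsum_congr E fun t ht => ?_)
    (map_bsum E (relLeaf r : Q.dual.Alg (Fin N) →ₗ[k] _).toAddMonoidHom _).symm
  obtain ⟨⟨h1, h2⟩, -⟩ := BT_spec E A t ht
  rw [pull_apply r Φ h1 h2]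
  exact (Q.dual.subst_smulK _ _ _).symm

include r in
/-- Exactness only depends on the number of leaves. -/
lemma ExactAt.relabel (hA : A.Nonempty) (h : ExactAt E A') : ExactAt E A := by
  have hA' : A'.Nonempty := r.image ▸ hA.image _
  have hback : ∀ y : Q.dual.P A, relLeaf r.symm (relLeaf r y.1) = y.1 := fun y =>
    subst_var_subst_var y.2 r.left
  have pull_zero : ∀ {n n' : ℕ} {A : Block n} {A' : Block n'} (r : Relabel A A'),
      pull r (0 : Q.cobar A') = 0 := fun r => cobar_ext fun V hV m hm => pull_apply r 0 hV hm
  refine ⟨fun Φ => ⟨?_, ?_⟩, fun y => ?_⟩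
  · rintro ⟨h1, h2⟩
    obtain ⟨Ψ, hΨ⟩ := (h.exact (pull r.symm Φ)).1 ⟨by rw [δc_pull, h1, pull_zero], Subtype.ext (by
      rw [coe_γc_pull r E hA, pull_pull, h2]
      exact map_zero (relLeaf r))⟩
    exact ⟨pull r Ψ, by rw [δc_pull, hΨ, pull_pull]⟩
  · rintro ⟨Ψ, rfl⟩
    obtain ⟨h1, h2⟩ := (h.exact (pull r.symm (Q.δc A Ψ))).2 ⟨pull r.symm Ψ, δc_pull r.symm Ψ⟩
    refine ⟨?_, Subtype.ext ?_⟩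
    · rw [← pull_pull r (Q.δc A Ψ), δc_pull, h1, pull_zero]
    · rw [coe_γc_pull r.symm E hA', h2]
      exact map_zero (relLeaf r.symm)
  · have hy : relLeaf r y.1 ∈ Q.dual.P A' := by
      have := subst_var_mem y.2 r.injOn
      rwa [r.image] at this
    obtain ⟨Φ, hΦ⟩ := h.surj ⟨_, hy⟩
    refine ⟨pull r Φ, Subtype.ext ?_⟩
    rw [← hback, ← coe_γc_pull r E hA, hΦ, hback]

/-- The increasing bijection of {0, …, m-1} onto a set with m elements. -/
def Relabel.ofCard {m : ℕ} (b : Block N) (hm : b.card = m) (h : 0 < m) :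
    Relabel b (univ : Block m) :=
  haveI : Nonempty (Fin m) := ⟨⟨0, h⟩⟩
  Relabel.symm
    { g := b.orderEmbOfFin hm
      g' := Function.invFun (b.orderEmbOfFin hm)
      image := b.image_orderEmbOfFin_univ hm
      left := fun x _ => Function.leftInverse_invFun (b.orderEmbOfFin hm).injective x
      mono := fun _ _ _ _ h => (b.orderEmbOfFin hm).strictMono h }

lemma exactAt_of_card_eq_one (hb : b.card = 1) : ExactAt E b := by
  obtain ⟨x, rfl⟩ := card_eq_one.1 hb
  have htree : ∀ {V}, IsTree {x} V → V = ∅ := fun hV => hV.eq_empty (by simp)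
  have hγ : ∀ Φ : Q.cobar {x}, (γc E {x} Φ : Q.dual.Alg (Fin N)) = op (Φ.1 ∅ 0) • Q.dual.var x := by
    intro Φ
    rw [coe_γc, bsum_leaf E hb, coe_leafTr_fst]
    rfl
  have hδ : ∀ Ψ : Q.cobar {x}, Q.δc {x} Ψ = 0 := fun Ψ => cobar_ext fun V hV m hm => by
    rw [δc_apply, dif_of hV hm]
    exact sum_eq_zero fun e he => absurd (mem_of_mem_erase he) (by rw [htree hV]; simp)
  refine ⟨fun Φ => ⟨fun h => ⟨0, ?_⟩, ?_⟩, fun y => ?_⟩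
  · rw [hδ]
    refine cobar_ext fun V hV m hm => ?_
    obtain rfl := htree hV
    have hm0 : m = 0 := funext fun v => hm.zero v (notMem_empty v)
    have h1 := congrArg Subtype.val h.2
    rw [hγ] at h1
    have h2 := Q.dual.coef_smul_var (op (Φ.1 ∅ 0)) x
    rw [h1] at h2
    rw [hm0]
    exact congrArg unop ((map_zero _).symm.trans h2)
  · grind
  · obtain ⟨c, hc⟩ := Q.dual.mem_P_singleton.1 y.2
    classical
    have hmem : (fun V m => if V = ∅ ∧ m = 0 then unop c else 0 : Q.BF N) ∈ Q.cobar {x} := by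
      refine mem_cobar.2 ⟨fun V hV => ?_, fun V hV => funext fun m => if_neg ?_⟩
      · obtain rfl := htree hV
        refine ⟨fun m hm => if_neg fun h => hm ?_, by simp, by simp, by simp⟩
        rw [h.2]
        exact ⟨by simp, fun _ _ => rfl⟩
      · rintro ⟨rfl, -⟩
        exact hV ⟨by simp, fun h => by simp at h, by simp, by simp⟩
    refine ⟨⟨_, hmem⟩, Subtype.ext ?_⟩
    rw [hγ, hc]
    exact congrArg (fun a => op a • Q.dual.var x) (if_pos ⟨rfl, rfl⟩)

lemma isKoszul_iff [FiniteDimensional k K] [IsSemisimpleRing K] [FiniteDimensional k Q.E] :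
    Q.IsKoszul ↔ ∀ n : ℕ, 2 ≤ n → ExactAt Q.dualBasis (univ : Block n) :=
  forall₂_congr fun _ hn => (exactAt_univ_iff_quasiIso Q.dualBasis hn).symm

/-- Exactness for the blocks with fewer elements makes the two conditions for n equivalent. -/
lemma exactAt_univ_iff_koszulComplexExact [CharZero k] [FiniteDimensional k K] [IsSemisimpleRing K]
    [FiniteDimensional k Q.E] {n : ℕ} (hn : 2 ≤ n)
    (h : ∀ m, 2 ≤ m → m < n → ExactAt Q.dualBasis (univ : Block m)) :
    ExactAt Q.dualBasis (univ : Block n) ↔ Q.KoszulComplexExact n := by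
  have hC : ∀ b : Block n, b.Nonempty → b ≠ univ →
      Nonempty (Contraction Q.dualBasis b) := fun b hb hne => by
    have h0 := card_pos.2 hb
    have h1 : b.card < n := by
      have := card_lt_card (Finset.ssubset_univ_iff.2 hne)
      rwa [card_fin] at this
    refine ExactAt.nonempty_contraction Q.dualBasis hb ?_
    rcases Nat.lt_or_ge b.card 2 with h2 | h2
    · exact exactAt_of_card_eq_one Q.dualBasis (by omega)
    · exact (h _ h2 h1).relabel (Relabel.ofCard b rfl h0) Q.dualBasis hb
  rw [exactAt_univ_iff Q.dualBasis (by omega), exact_cone_iff Q.dualBasis hC hn,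
    exact_kD_iff Q.dualBasis (by omega)]
  rfl

end QuadraticData

end QuadOp

end

theorem theorem4p1p13 {k : Type*} {K : Type*} [Field k] [CharZero k] [Ring K] [Algebra k K]
    [FiniteDimensional k K] [IsSemisimpleRing K] (Q : QuadOp.QuadraticData k K)
    [FiniteDimensional k Q.E] :
    Q.IsKoszul ↔ ∀ n : ℕ, 2 ≤ n → Q.KoszulComplexExact n := by
  open QuadOp.QuadraticData in
  rw [isKoszul_iff]
  constructor
  · exact fun h n hn => (exactAt_univ_iff_koszulComplexExact hn fun m hm _ => h m hm).1 (h n hn)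
  · intro h n
    induction n using Nat.strong_induction_on with
    | _ n ih => exact fun hn => (exactAt_univ_iff_koszulComplexExact hn fun m hm hmn => ih m hmn hm).2 (h n hn)
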